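/- Let $\mathfrak g=\mathfrak g_{\bar 0}\oplus\mathfrak g_{\bar 1}$ be a finite-dimensional Lie superalgebra over $\mathbb C$ with an even non-degenerate supersymmetric invariant bilinear form $(\cdot,\cdot)$ (for example a basic classical Lie superalgebra, or $\mathfrak{gl}(m|n)$), and let $\{e,h,f\}\subset\mathfrak g_{\bar 0}$ be an $\mathfrak{sl}_2$-triple (all three zero if $e=0$). Put $\chi=(e,\cdot)$, $\mathfrak g(i)=\{x:[h,x]=ix\}$ (the natural grading), $\mathfrak g_e=\ker(\operatorname{ad}e)$, and let $r=\dim\mathfrak g(-1)_{\bar 1}$ be the judging number. Choose a basis $u_1,\dots,u_{2s}$ of $\mathfrak g(-1)_{\bar 0}$ with $\chi([u_i,u_j])=i^*\delta_{i+j,2s+1}$, where $i^*=-1$ for $i\le s$ and $i^*=1$ for $i>s$, and a basis $v_1,\dots,v_r$ of $\mathfrak g(-1)_{\bar 1}$ with $\chi([v_i,v_j])=\delta_{i+j,r+1}$. Let $\mathfrak m$ be the sum of $\bigoplus_{i\le -2}\mathfrak g(i)$ and the span of $u_{s+1},\dots,u_{2s}$ and of the last $\lfloor r/2\rfloor$ of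 the $v_i$; let $\mathfrak m'=\mathfrak m$ if $r$ is even and $\mathfrak m'=\mathfrak m\oplus\mathbb C v_{(r+1)/2}$ if $r$ is odd. Let $Q_\chi=U(\mathfrak g)/I_\chi$ with $I_\chi=\sum_{x\in\mathfrak m}U(\mathfrak g)(x-\chi(x))$, let $1_\chi$ be the image of $1$, and let $W_\chi=(\operatorname{End}_{\mathfrak g}Q_\chi)^{\mathrm{op}}$, regarded as a subspace of $Q_\chi$ via $\Theta\mapsto\Theta(1_\chi)$. The refined finite $W$-superalgebra is its subalgebra $W'_\chi=Q_\chi^{\operatorname{ad}\mathfrak m'}$. The space $Q_\chi$ is spanned by the images of the monomials $x_1\cdots x_a\,u_1^{c_1}\cdots u_s^{c_s}\,v_1^{d_1}\cdots v_{\lceil r/2\rceil}^{d_{\lceil r/2\rceil}}$ with $x_i\in\mathfrak g(k_i)$, $k_i\ge 0$, $c_j\in\mathbb Z_{\ge0}$, $d_j\in\{0,1\}$; such a monomial has weight $\sum k_i-|c|-|d|$, Kazhdan degree $\sum(k_i+2)+|c|+|d|$ and length $a+|c|+|d|$. The natural filtration of $Q_\chi$, and by restriction of $W_\chi$ and $W'_\chi$,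 has as its $n$-th term the span of the monomials of weight at most $n$; $\operatorname{gr}_\natural$ denotes the associated graded object. For $Y\in\mathfrak g_e\cap\mathfrak g(m)$ of parity $p$, a PBW generator for $Y$ is an element $\Theta$ of the $W$-superalgebra of parity $p$ such that $\Theta(1_\chi)-Y1_\chi$ is a linear combination of monomials that have either Kazhdan degree $m+2$ and length at least $2$, or Kazhdan degree less than $m+2$. Then the natural filtration makes $W'_\chi$ a filtered algebra (increasing, multiplicative, exhaustive, separated), and there is an isomorphism of algebras $$\Phi:\operatorname{gr}_\natural W'_\chi\ \xrightarrow{\ \sim\ }\ U(\mathfrak g_e)$$ such that for every basis $Y_1,\dots,Y_N$ of $\mathfrak g_e$ with $Y_i\in\mathfrak g(m_i)$ of parity $p_i$ there are PBW generators $\Theta_i\in W'_\chi$ for $Y_i$ with $\Phi(\operatorname{gr}_\natural\Theta_i)=Y_i$ for all $i$, where $\operatorname{gr}_\natural\Theta_i$ is the class of $\Theta_i$ in degree $m_i$. Moreover, for arbitrary PBW generators $\Theta_i\in W'_\chi$ for the $Y_i$ one has $\Phi(\operatorname{gr}_\natural\Theta_i)=Y_i+c_i$ with constants $c_i\in\mathbb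 C$, and $c_i=0$ unless $Y_i$ is even and $m_i=0$. If $r$ is even, the same holds with $W_\chi$ in place of $W'_\chi$. For $\mathfrak g=\mathfrak{gl}(m|n)$ the number $r$ is always even, so the same holds for $W_\chi$ there; in particular $\operatorname{gr}_\natural W_\chi\cong U(\mathfrak g_e)$. -/

import Mathlib

open Module

/-! ## Lie superalgebras over `ℂ` -/

/-- The Koszul sign `(-1)^{ij}` of two parities. -/
def ksign (i j : ZMod 2) : ℂ := if i = 1 ∧ j = 1 then -1 else 1

theorem zmod2_cases (i : ZMod 2) : i = 0 ∨ i = 1 := by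
  revert i; decide

/-- A Lie superalgebra over `ℂ`: a `ℤ/2`-graded space with an even, super-skew-symmetric bracket
satisfying the super Jacobi identity. (`parity 0` is the even and `parity 1` the odd part.) -/
class LieSuperalgebra (g : Type*) [AddCommGroup g] [Module ℂ g] where
  parity : ZMod 2 → Submodule ℂ g
  isCompl : IsCompl (parity 0) (parity 1)
  bracket : g →ₗ[ℂ] g →ₗ[ℂ] g
  bracket_mem : ∀ {i j : ZMod 2} {x y : g}, x ∈ parity i → y ∈ parity j →
    bracket x y ∈ parity (i + j)
  skew : ∀ {i j : ZMod 2} {x y : g}, x ∈ parity i → y ∈ parity j →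
    bracket x y = -(ksign i j • bracket y x)
  jacobi : ∀ {i j : ZMod 2} {x y : g}, x ∈ parity i → y ∈ parity j → ∀ z : g,
    bracket x (bracket y z) = bracket (bracket x y) z + ksign i j • bracket y (bracket x z)

open LieSuperalgebra

section Super

variable (g : Type*) [AddCommGroup g] [Module ℂ g] [LieSuperalgebra g]

theorem exists_parity_decomp (x : g) :
    ∃ x0 ∈ parity (g := g) 0, ∃ x1 ∈ parity (g := g) 1, x0 + x1 = x := by
  have h : x ∈ (parity (g := g) 0) ⊔ (parity (g := g) 1) := by
    rw [(isCompl (g := g)).sup_eq_top]; trivial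
  exact Submodule.mem_sup.mp h

/-- The parity involution `x₀ + x₁ ↦ x₀ - x₁`. -/
noncomputable def parityInvol : g →ₗ[ℂ] g :=
  (parity (g := g) 0).subtype ∘ₗ
      Submodule.projectionOnto _ _ (isCompl (g := g)) -
    (parity (g := g) 1).subtype ∘ₗ
      Submodule.projectionOnto _ _ (isCompl (g := g)).symm

theorem parityInvol_apply {i : ZMod 2} {x : g} (hx : x ∈ parity (g := g) i) :
    parityInvol g x = ksign i 1 • x := by
  rcases zmod2_cases i with rfl | rfl
  · have h1 : Submodule.projectionOnto _ _ (isCompl (g := g)) x = ⟨x, hx⟩ :=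
      Submodule.projectionOnto_apply_left (isCompl (g := g)) ⟨x, hx⟩
    have h2 : Submodule.projectionOnto _ _ (isCompl (g := g)).symm x = 0 :=
      Submodule.projectionOnto_apply_right (isCompl (g := g)).symm ⟨x, hx⟩
    simp [parityInvol, h1, h2, ksign]
  · have h1 : Submodule.projectionOnto _ _ (isCompl (g := g)).symm x = ⟨x, hx⟩ :=
      Submodule.projectionOnto_apply_left (isCompl (g := g)).symm ⟨x, hx⟩
    have h2 : Submodule.projectionOnto _ _ (isCompl (g := g)) x = 0 :=
      Submodule.projectionOnto_apply_right (isCompl (g := g)) ⟨x, hx⟩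
    simp [parityInvol, h1, h2, ksign]

/-! ### The universal enveloping superalgebra -/

/-- The defining relations `x y = (-1)^{|x||y|} y x + [x, y]` for homogeneous `x`, `y`. -/
inductive UEA.Rel : TensorAlgebra ℂ g → TensorAlgebra ℂ g → Prop
  | of {i j : ZMod 2} {x y : g} (hx : x ∈ parity (g := g) i) (hy : y ∈ parity (g := g) j) :
      UEA.Rel (TensorAlgebra.ι ℂ x * TensorAlgebra.ι ℂ y)
        (ksign i j • (TensorAlgebra.ι ℂ y * TensorAlgebra.ι ℂ x)
          + TensorAlgebra.ι ℂ (bracket x y))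

/-- The universal enveloping superalgebra `U(g)`. -/
def UEA : Type _ := RingQuot (UEA.Rel g)

noncomputable instance : Ring (UEA g) := inferInstanceAs (Ring (RingQuot (UEA.Rel g)))

noncomputable instance : Algebra ℂ (UEA g) :=
  inferInstanceAs (Algebra ℂ (RingQuot (UEA.Rel g)))

/-- The canonical map `g → U(g)`. -/
noncomputable def UEA.ι : g →ₗ[ℂ] UEA g :=
  (RingQuot.mkAlgHom ℂ (UEA.Rel g)).toLinearMap ∘ₗ TensorAlgebra.ι ℂ

theorem UEA.ι_mul {i j : ZMod 2} {x y : g} (hx : x ∈ parity (g := g) i)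
    (hy : y ∈ parity (g := g) j) :
    UEA.ι g x * UEA.ι g y = ksign i j • (UEA.ι g y * UEA.ι g x) + UEA.ι g (bracket x y) := by
  have h := RingQuot.mkAlgHom_rel ℂ (UEA.Rel.of hx hy)
  rw [map_add, map_smul, map_mul, map_mul] at h
  exact h

/-- The parity involution of `U(g)`: the algebra endomorphism extending that of `g`. -/
noncomputable def UEA.invol : UEA g →ₐ[ℂ] UEA g :=
  RingQuot.liftAlgHom ℂ ⟨TensorAlgebra.lift ℂ (UEA.ι g ∘ₗ parityInvol g), by
    intro a b hab
    obtain ⟨hx, hy⟩ := hab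
    rename_i i j x y
    have hb := parityInvol_apply g (bracket_mem hx hy)
    have hs : ksign (i + j) 1 = ksign i 1 * ksign j 1 := by
      rcases zmod2_cases i with rfl | rfl <;> rcases zmod2_cases j with rfl | rfl <;>
        simp [ksign, show (1 : ZMod 2) + 1 = 0 from rfl]
    simp only [map_mul, map_add, map_smul, TensorAlgebra.lift_ι_apply, LinearMap.comp_apply,
      parityInvol_apply g hx, parityInvol_apply g hy, hb, hs]
    simp only [smul_mul_assoc, mul_smul_comm, UEA.ι_mul g hx hy, smul_add, smul_smul]
    congr 2 <;> ring⟩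

/-- The homogeneous part of parity `i` of `U(g)`. -/
noncomputable def UEA.parity (i : ZMod 2) : Submodule ℂ (UEA g) :=
  LinearMap.ker ((UEA.invol g).toLinearMap - ksign i 1 • LinearMap.id)

variable {g}

/-- `(ad x) u = x u - (-1)^{|x||u|} u x` for `x ∈ g` of parity `i` and any `u ∈ U(g)`. -/
noncomputable def superAd (i : ZMod 2) (x : g) (u : UEA g) : UEA g :=
  UEA.ι g x * u - (if i = 1 then UEA.invol g u else u) * UEA.ι g x

theorem superAd_mul (i : ZMod 2) (x : g) (u w : UEA g) :
    superAd i x (u * w) =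
      superAd i x u * w + (if i = 1 then UEA.invol g u else u) * superAd i x w := by
  unfold superAd
  split_ifs
  · rw [map_mul]; noncomm_ring
  · noncomm_ring

theorem superAd_add (i : ZMod 2) (x : g) (u w : UEA g) :
    superAd i x (u + w) = superAd i x u + superAd i x w := by
  unfold superAd
  split_ifs
  · rw [map_add]; noncomm_ring
  · noncomm_ring

theorem superAd_algebraMap (i : ZMod 2) (x : g) (c : ℂ) :
    superAd i x (algebraMap ℂ (UEA g) c) = 0 := by
  unfold superAd
  split_ifs
  · rw [AlgHom.commutes, Algebra.commutes, sub_self]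
  · rw [Algebra.commutes, sub_self]

/-! ### Centralizers of even elements -/

/-- The centralizer `g_e = ker (ad e)` of an even element. -/
def centralizer (e : parity (g := g) 0) : Submodule ℂ g := LinearMap.ker (bracket (e : g))

theorem ad_even (e : parity (g := g) 0) (x y : g) :
    bracket (e : g) (bracket x y) =
      bracket (bracket (e : g) x) y + bracket x (bracket (e : g) y) := by
  obtain ⟨x0, h0, x1, h1, rfl⟩ := exists_parity_decomp g x
  have a := jacobi e.2 h0 y
  have b := jacobi e.2 h1 y
  simp only [ksign, zero_ne_one, false_and, if_false, one_smul] at a b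
  simp only [map_add, LinearMap.add_apply, a, b]
  abel

/-- `g_e` is a Lie superalgebra, with the bracket and the parity of `g`. -/
noncomputable instance centralizer.lieSuperalgebra (e : parity (g := g) 0) :
    LieSuperalgebra (centralizer e) where
  parity i := (parity (g := g) i).comap (centralizer e).subtype
  isCompl := by
    constructor
    · rw [Submodule.disjoint_def]
      intro x h0 h1
      exact Subtype.ext (Submodule.disjoint_def.mp (isCompl (g := g)).disjoint x h0 h1)
    · rw [codisjoint_iff, eq_top_iff]
      rintro ⟨x, hx⟩ -
      obtain ⟨x0, h0, x1, h1, rfl⟩ := exists_parity_decomp g x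
      have hx' : bracket (e : g) x0 + bracket (e : g) x1 = 0 := by
        rw [← map_add]; exact hx
      have m0 : bracket (e : g) x0 ∈ parity (g := g) 0 := by simpa using bracket_mem e.2 h0
      have m1 : bracket (e : g) x1 ∈ parity (g := g) 1 := by simpa using bracket_mem e.2 h1
      have z0 : bracket (e : g) x0 = 0 := by
        refine Submodule.disjoint_def.mp (isCompl (g := g)).disjoint _ m0 ?_
        rw [eq_neg_of_add_eq_zero_left hx']
        exact neg_mem m1
      have z1 : bracket (e : g) x1 = 0 := by rw [z0, zero_add] at hx'; exact hx'
      exact Submodule.mem_sup.mpr ⟨⟨x0, z0⟩, h0, ⟨x1, z1⟩, h1, rfl⟩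
  bracket := LinearMap.mk₂ ℂ
    (fun x y => ⟨bracket (x : g) (y : g), by
      have hx : bracket (e : g) (x : g) = 0 := x.2
      have hy : bracket (e : g) (y : g) = 0 := y.2
      change bracket (e : g) _ = 0
      rw [ad_even, hx, hy]; simp⟩)
    (by intros; ext; simp) (by intros; ext; simp) (by intros; ext; simp) (by intros; ext; simp)
  bracket_mem hx hy := bracket_mem (g := g) hx hy
  skew hx hy := Subtype.ext (skew (g := g) hx hy)
  jacobi hx hy z := Subtype.ext (jacobi (g := g) hx hy z)

/-! ### Invariant forms, `sl₂`-triples and the natural grading -/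

variable (g)

/-- An even non-degenerate supersymmetric invariant bilinear form on `g`. -/
structure InvariantForm where
  form : g →ₗ[ℂ] g →ₗ[ℂ] ℂ
  even : ∀ {i j : ZMod 2} {x y : g}, x ∈ parity (g := g) i → y ∈ parity (g := g) j → i ≠ j →
    form x y = 0
  supersymm : ∀ {i j : ZMod 2} {x y : g}, x ∈ parity (g := g) i → y ∈ parity (g := g) j →
    form x y = ksign i j * form y x
  invariant : ∀ x y z : g, form (bracket x y) z = form x (bracket y z)
  nondegenerate : ∀ x : g, (∀ y, form x y = 0) → x = 0

/-- An `sl₂`-triple of even elements (all three are zero if `e = 0`). -/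
structure Sl2Triple where
  e : parity (g := g) 0
  h : parity (g := g) 0
  f : parity (g := g) 0
  h_e : bracket (h : g) (e : g) = (2 : ℂ) • (e : g)
  h_f : bracket (h : g) (f : g) = (-2 : ℂ) • (f : g)
  e_f : bracket (e : g) (f : g) = (h : g)

variable {g}

/-- The natural grading: `g(k)` is the `k`-eigenspace of `ad h`. -/
noncomputable def Sl2Triple.grade (t : Sl2Triple g) (k : ℤ) : Submodule ℂ g :=
  End.eigenspace (bracket (t.h : g)) (k : ℂ)

/-- The judging number `r = dim g(-1)_1`. -/
noncomputable def Sl2Triple.judgingNumber (t : Sl2Triple g) : ℕ :=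
  finrank ℂ ↥(t.grade (-1) ⊓ parity (g := g) 1)

/-- The linear form `χ = (e, ·)`. -/
noncomputable def chi (B : InvariantForm g) (t : Sl2Triple g) : g →ₗ[ℂ] ℂ := B.form (t.e : g)

/-- Bases `u_1, …, u_{2s}` of `g(-1)_0` and `v_1, …, v_r` of `g(-1)_1` in which the symplectic,
resp. symmetric, form `⟨x, y⟩' = χ([x, y])` is anti-diagonal. (Indices start at `0` here.) -/
structure WittBases (B : InvariantForm g) (t : Sl2Triple g) where
  s : ℕ
  u : Basis (Fin (2 * s)) ℂ ↥(t.grade (-1) ⊓ parity (g := g) 0)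
  v : Basis (Fin t.judgingNumber) ℂ ↥(t.grade (-1) ⊓ parity (g := g) 1)
  u_u : ∀ i j, chi B t (bracket (u i : g) (u j : g)) =
    if (i : ℕ) + j + 1 = 2 * s then (if (i : ℕ) < s then -1 else 1) else 0
  v_v : ∀ i j, chi B t (bracket (v i : g) (v j : g)) =
    if (i : ℕ) + j + 1 = t.judgingNumber then 1 else 0

/-! ### The generalized Gelfand-Graev module and the `W`-superalgebras -/

variable {B : InvariantForm g} {t : Sl2Triple g} (b : WittBases B t)

/-- `m = ⨁_{i ≤ -2} g(i) ⊕ g(-1)'`, where `g(-1)'` is spanned by the second half of the `u_i` and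
by the last `⌊r/2⌋` of the `v_i`. -/
noncomputable def mSub : Submodule ℂ g :=
  (⨆ k : {k : ℤ // k ≤ -2}, t.grade k) ⊔
    Submodule.span ℂ {x | ∃ i : Fin (2 * b.s), b.s ≤ (i : ℕ) ∧ x = (b.u i : g)} ⊔
    Submodule.span ℂ {x | ∃ i : Fin t.judgingNumber, t.judgingNumber ≤ 2 * (i : ℕ) ∧ x = (b.v i : g)}

/-- `m' = m` if `r` is even, `m' = m ⊕ ℂ v_{(r+1)/2}` if `r` is odd. -/
noncomputable def mSub' : Submodule ℂ g :=
  mSub b ⊔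
    Submodule.span ℂ {x | ∃ i : Fin t.judgingNumber, 2 * (i : ℕ) + 1 = t.judgingNumber ∧ x = (b.v i : g)}

/-- The left ideal `I_χ` of `U(g)` generated by the elements `x - χ(x)`, `x ∈ m`. -/
noncomputable def Ichi : Submodule (UEA g) (UEA g) :=
  Submodule.span (UEA g)
    {y | ∃ x ∈ mSub b, y = UEA.ι g x - algebraMap ℂ (UEA g) (chi B t x)}

/-- The generalized Gelfand-Graev module `Q_χ = U(g) ⊗_{U(m)} ℂ_χ = U(g) / I_χ`. -/
abbrev Qchi : Type _ := UEA g ⧸ Ichi b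

/-- The generator `1_χ` of `Q_χ`. -/
noncomputable def oneChi : Qchi b := (Ichi b).mkQ 1

/-- The finite `W`-superalgebra `W_χ = (End_g Q_χ)^op`. -/
abbrev FiniteW : Type _ := (Module.End (UEA g) (Qchi b))ᵐᵒᵖ

/-- The action of an element of `W_χ` on `1_χ`; `W_χ` is identified with its image. -/
noncomputable def evalOne : FiniteW b →ₗ[ℂ] Qchi b where
  toFun φ := φ.unop (oneChi b)
  map_add' _ _ := rfl
  map_smul' _ _ := rfl

/-- The refined `W`-superalgebra `W'_χ = Q_χ^{ad m'}`, as a subalgebra of `W_χ`. -/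
noncomputable def refinedW : Subalgebra ℂ (FiniteW b) where
  carrier := {φ | ∃ u : UEA g, (Ichi b).mkQ u = evalOne b φ ∧
    ∀ (i : ZMod 2) (x : g), x ∈ mSub' b → x ∈ parity (g := g) i → superAd i x u ∈ Ichi b}
  mul_mem' := by
    rintro φ ψ ⟨u, hu, hu'⟩ ⟨w, hw, hw'⟩
    have key : ∀ a : UEA g, ψ.unop ((Ichi b).mkQ a) = (Ichi b).mkQ (a * w) := by
      intro a
      have h1 : (Ichi b).mkQ a = a • oneChi b := by
        rw [oneChi, ← map_smul, smul_eq_mul, mul_one]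
      have hw2 : (Ichi b).mkQ w = ψ.unop (oneChi b) := hw
      rw [h1, map_smul, ← hw2, ← map_smul, smul_eq_mul]
    refine ⟨u * w, ?_, ?_⟩
    · rw [← key, hu]; rfl
    · intro i x hx hp
      rw [superAd_mul]
      refine add_mem ?_ ((Ichi b).smul_mem _ (hw' i x hx hp))
      have h0 : (Ichi b).mkQ (superAd i x u) = 0 := by
        rw [Submodule.mkQ_apply, Submodule.Quotient.mk_eq_zero]; exact hu' i x hx hp
      have h := key (superAd i x u)
      rw [h0, map_zero] at h
      rw [← Submodule.Quotient.mk_eq_zero]; exact h.symm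
  add_mem' := by
    rintro φ ψ ⟨u, hu, hu'⟩ ⟨w, hw, hw'⟩
    refine ⟨u + w, by rw [map_add, map_add, hu, hw], fun i x hx hp => ?_⟩
    rw [superAd_add]
    exact add_mem (hu' i x hx hp) (hw' i x hx hp)
  algebraMap_mem' c := by
    refine ⟨algebraMap ℂ _ c, ?_, fun i x _ _ => ?_⟩
    · rw [Algebra.algebraMap_eq_smul_one, Algebra.algebraMap_eq_smul_one]; rfl
    · rw [superAd_algebraMap]; exact zero_mem _

/-! ### PBW monomials of `Q_χ`, weight and Kazhdan degree -/

/-- `IsMonomial b q wt kaz len`: `q` is the image in `Q_χ` of a PBW monomial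
`x_1 ⋯ x_a u_1^{c_1} ⋯ u_s^{c_s} v_1^{d_1} ⋯ v_t^{d_t}`, with `x_i ∈ g(k_i)`, `k_i ≥ 0`,
`d_j ∈ {0, 1}` and `t = ⌈r/2⌉`, of weight `wt = ∑ k_i - |c| - |d|`, Kazhdan degree
`kaz = ∑ (k_i + 2) + |c| + |d|` and length `len = a + |c| + |d|`.
The list `xs` consists of the pairs `(k_i, x_i)`. -/
def IsMonomial (q : Qchi b) (wt kaz : ℤ) (len : ℕ) : Prop :=
  ∃ (xs : List (ℤ × g)) (c : Fin (2 * b.s) → ℕ) (d : Fin t.judgingNumber → ℕ),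
    (∀ p ∈ xs, 0 ≤ p.1 ∧ p.2 ∈ t.grade p.1) ∧
    (∀ i : Fin (2 * b.s), b.s ≤ (i : ℕ) → c i = 0) ∧
    (∀ i, d i ≤ 1) ∧ (∀ i : Fin t.judgingNumber, t.judgingNumber ≤ 2 * (i : ℕ) → d i = 0) ∧
    q = (Ichi b).mkQ ((xs.map fun p => UEA.ι g p.2).prod *
      (List.ofFn fun i => UEA.ι g (b.u i : g) ^ c i).prod *
      (List.ofFn fun i => UEA.ι g (b.v i : g) ^ d i).prod) ∧
    wt = (xs.map fun p => p.1).sum - ∑ i, (c i : ℤ) - ∑ i, (d i : ℤ) ∧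
    kaz = (xs.map fun p => p.1 + 2).sum + ∑ i, (c i : ℤ) + ∑ i, (d i : ℤ) ∧
    len = xs.length + ∑ i, c i + ∑ i, d i

/-- The natural filtration of `Q_χ`: the `n`-th term is spanned by the PBW monomials of
weight at most `n`. -/
noncomputable def natFiltrationQ (n : ℤ) : Submodule ℂ (Qchi b) :=
  Submodule.span ℂ {q | ∃ wt kaz len, IsMonomial b q wt kaz len ∧ wt ≤ n}

/-- The natural filtration of an algebra `A` mapped to `W_χ`, induced from that of `Q_χ`. -/
noncomputable def natFiltration {A : Type*} [Ring A] [Algebra ℂ A] (j : A →ₐ[ℂ] FiniteW b)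
    (n : ℤ) : Submodule ℂ A :=
  (natFiltrationQ b n).comap (evalOne b ∘ₗ j.toLinearMap)

/-- The span of the PBW monomials that are either of Kazhdan degree `m + 2` and length at
least `2`, or of Kazhdan degree less than `m + 2`. -/
noncomputable def lowerTerms (m : ℤ) : Submodule ℂ (Qchi b) :=
  Submodule.span ℂ {q | ∃ wt kaz len, IsMonomial b q wt kaz len ∧
    ((kaz = m + 2 ∧ 2 ≤ len) ∨ kaz < m + 2)}

/-- `Θ` is a PBW generator of the `W`-superalgebra attached to `y ∈ g_e`, for `y ∈ g(m)` of
parity `p`: it is homogeneous of parity `p` and `Θ(1_χ) = (y + lower terms) ⊗ 1_χ`. -/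
def IsPBWGenerator (y : g) (m : ℤ) (p : ZMod 2) (Θ : FiniteW b) : Prop :=
  evalOne b Θ ∈ (UEA.parity g p).map ((Ichi b).mkQ.restrictScalars ℂ) ∧
    evalOne b Θ - (Ichi b).mkQ (UEA.ι g y) ∈ lowerTerms b m

end Super

/-! ## Filtered algebras and associated graded algebras -/

section Filtered

variable {A : Type*} [Ring A] [Algebra ℂ A]

/-- An increasing, multiplicative, exhaustive and separated filtration of an algebra by
subspaces indexed by `ℤ`. -/
structure IsAlgFiltration (F : ℤ → Submodule ℂ A) : Prop where
  mono : Monotone F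
  one_mem : (1 : A) ∈ F 0
  mul_mem : ∀ {i j : ℤ} {a c : A}, a ∈ F i → c ∈ F j → a * c ∈ F (i + j)
  exhaustive : ∀ a, ∃ i, a ∈ F i
  separated : ∀ a, (∀ i, a ∈ F i) → a = 0

theorem coeff_mul_mem {F G H : ℤ → Submodule ℂ A}
    (h : ∀ {i j : ℤ} {a c : A}, a ∈ F i → c ∈ G j → a * c ∈ H (i + j))
    {p q : LaurentPolynomial A} (hp : ∀ n, p.coeff n ∈ F n) (hq : ∀ n, q.coeff n ∈ G n) (n : ℤ) :
    (p * q).coeff n ∈ H n := by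
  rw [AddMonoidAlgebra.coeff_mul]
  refine Submodule.sum_mem _ fun i _ => Submodule.sum_mem _ fun j _ => ?_
  beta_reduce
  split_ifs with hij
  · rw [← hij]; exact h (hp i) (hq j)
  · exact zero_mem _

/-- The Rees algebra `⨁_n F_n T^n`, a subalgebra of `A[T, T⁻¹]`. -/
noncomputable def rees {F : ℤ → Submodule ℂ A} (hF : IsAlgFiltration F) :
    Subalgebra ℂ (LaurentPolynomial A) where
  carrier := {p | ∀ n, p.coeff n ∈ F n}
  mul_mem' hp hq := coeff_mul_mem hF.mul_mem hp hq
  add_mem' hp hq n := add_mem (hp n) (hq n)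
  algebraMap_mem' c n := by
    rw [Algebra.algebraMap_eq_smul_one, AddMonoidAlgebra.coeff_smul_apply,
      AddMonoidAlgebra.one_def, AddMonoidAlgebra.coeff_single]
    by_cases h : n = 0
    · subst h; rw [Finsupp.single_eq_same]; exact Submodule.smul_mem _ _ hF.one_mem
    · rw [Finsupp.single_eq_of_ne h, smul_zero]; exact zero_mem _

/-- The two-sided ideal `⨁_n F_{n-1} T^n` of the Rees algebra. -/
noncomputable def reesIdeal {F : ℤ → Submodule ℂ A} (hF : IsAlgFiltration F) :
    Ideal (rees hF) where
  carrier := {p | ∀ n, (p : LaurentPolynomial A).coeff n ∈ F (n - 1)}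
  add_mem' hp hq n := add_mem (hp n) (hq n)
  zero_mem' n := zero_mem (F (n - 1))
  smul_mem' p _ hq n := coeff_mul_mem (H := fun n => F (n - 1))
    (fun {i j} _ _ ha hc => by rw [add_sub_assoc]; exact hF.mul_mem ha hc) p.2 hq n

instance reesIdeal.isTwoSided {F : ℤ → Submodule ℂ A} (hF : IsAlgFiltration F) :
    (reesIdeal hF).IsTwoSided where
  mul_mem_of_left {_} q hp n := coeff_mul_mem (H := fun n => F (n - 1))
    (fun {i j} _ _ ha hc => by rw [add_sub_right_comm]; exact hF.mul_mem ha hc) hp q.2 n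

/-- The associated graded algebra `gr A = ⨁_n F_n / F_{n-1}`, realized as the quotient of
`⨁_n F_n T^n` by `⨁_n F_{n-1} T^n`. -/
abbrev AssocGraded {F : ℤ → Submodule ℂ A} (hF : IsAlgFiltration F) : Type _ :=
  rees hF ⧸ reesIdeal hF

/-- The class in `F_n / F_{n-1} ⊆ gr A` of an element `a` of `F_n`. -/
noncomputable def AssocGraded.symbol {F : ℤ → Submodule ℂ A} (hF : IsAlgFiltration F) (n : ℤ)
    (a : A) (ha : a ∈ F n) : AssocGraded hF :=
  Ideal.Quotient.mk (reesIdeal hF) ⟨AddMonoidAlgebra.single n a, fun k => by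
    rw [AddMonoidAlgebra.coeff_single]
    by_cases h : k = n
    · subst h; rw [Finsupp.single_eq_same]; exact ha
    · rw [Finsupp.single_eq_of_ne h]; exact zero_mem _⟩

end Filtered

/-! ## The comparison with `U(g_e)` -/

/-- The assertion that, for an algebra `A` mapped to `W_χ` by `j`, the natural filtration of `A`
is an algebra filtration whose associated graded algebra is isomorphic to `U(g_e)`, in such a way
that `gr Θ_i ↦ Y_i`. The isomorphism does not depend on the homogeneous basis `Y` of `g_e`; for
each `Y` there are PBW generators `Θ_i` in `A` with `gr Θ_i ↦ Y_i`, and any PBW generators in `A`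
have this property up to additive constants, which vanish unless `Y_i` is even of degree `0`. -/
def NaturalGradedIso {g : Type*} [AddCommGroup g] [Module ℂ g] [LieSuperalgebra g]
    {B : InvariantForm g} {t : Sl2Triple g} (b : WittBases B t)
    {A : Type*} [Ring A] [Algebra ℂ A] (j : A →ₐ[ℂ] FiniteW b) : Prop :=
  ∃ (hF : IsAlgFiltration (natFiltration b j))
    (Φ : AssocGraded hF ≃ₐ[ℂ] UEA (centralizer t.e)),
    ∀ (n : ℕ) (Y : Basis (Fin n) ℂ (centralizer t.e)) (m : Fin n → ℤ) (p : Fin n → ZMod 2),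
      (∀ i, (Y i : g) ∈ t.grade (m i) ∧ (Y i : g) ∈ parity (g := g) (p i)) →
      (∃ Θ : Fin n → A, ∀ i, IsPBWGenerator b (Y i : g) (m i) (p i) (j (Θ i)) ∧
        ∃ h : Θ i ∈ natFiltration b j (m i),
          Φ (AssocGraded.symbol hF (m i) (Θ i) h) = UEA.ι (centralizer t.e) (Y i)) ∧
      (∀ Θ : Fin n → A, (∀ i, IsPBWGenerator b (Y i : g) (m i) (p i) (j (Θ i))) →
        ∃ c : Fin n → ℂ, ∀ i, (m i ≠ 0 ∨ p i = 1 → c i = 0) ∧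
          ∃ h : Θ i ∈ natFiltration b j (m i),
            Φ (AssocGraded.symbol hF (m i) (Θ i) h) =
              UEA.ι (centralizer t.e) (Y i) + algebraMap ℂ _ (c i))

/-! ## The general linear Lie superalgebra -/

section GeneralLinear

variable (m n : ℕ)

/-- The parity of an index of `ℂ^{m|n}`. -/
def idxParity : Fin m ⊕ Fin n → ZMod 2 := Sum.elim (fun _ => 0) (fun _ => 1)

/-- The underlying space of `gl(m|n)`: complex matrices of size `m + n`. -/
abbrev GLSuper : Type := Matrix (Fin m ⊕ Fin n) (Fin m ⊕ Fin n) ℂ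

/-- Block-diagonal matrices (`i = 0`) and block-antidiagonal matrices (`i = 1`). -/
def GLSuper.parity (i : ZMod 2) : Submodule ℂ (GLSuper m n) where
  carrier := {A | ∀ a b, idxParity m n a + idxParity m n b ≠ i → A a b = 0}
  add_mem' hA hB a b h := by rw [Matrix.add_apply, hA a b h, hB a b h, add_zero]
  zero_mem' _ _ _ := rfl
  smul_mem' c A hA a b h := by rw [Matrix.smul_apply, hA a b h, smul_zero]

/-- The projection to the part of parity `i`. -/
def GLSuper.part (i : ZMod 2) : GLSuper m n →ₗ[ℂ] GLSuper m n where
  toFun A := Matrix.of fun a b => if idxParity m n a + idxParity m n b = i then A a b else 0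
  map_add' A B := by ext a b; by_cases h : idxParity m n a + idxParity m n b = i <;> simp [h]
  map_smul' c A := by ext a b; by_cases h : idxParity m n a + idxParity m n b = i <;> simp [h]

theorem GLSuper.part_mem (i : ZMod 2) (A : GLSuper m n) :
    GLSuper.part m n i A ∈ GLSuper.parity m n i := fun a b h => by
  simp [GLSuper.part, h]

theorem GLSuper.part_same {i : ZMod 2} {A : GLSuper m n} (hA : A ∈ GLSuper.parity m n i) :
    GLSuper.part m n i A = A := by
  ext a b
  by_cases h : idxParity m n a + idxParity m n b = i
  · simp [GLSuper.part, h]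
  · simp [GLSuper.part, h, hA a b h]

theorem GLSuper.part_ne {i j : ZMod 2} (hij : i ≠ j) {A : GLSuper m n}
    (hA : A ∈ GLSuper.parity m n i) : GLSuper.part m n j A = 0 := by
  ext a b
  by_cases h : idxParity m n a + idxParity m n b = j
  · simp [GLSuper.part, h, hA a b (by rw [h]; exact hij.symm)]
  · simp [GLSuper.part, h]

theorem GLSuper.part_add (A : GLSuper m n) :
    GLSuper.part m n 0 A + GLSuper.part m n 1 A = A := by
  ext a b
  rcases zmod2_cases (idxParity m n a + idxParity m n b) with h | h <;> simp [GLSuper.part, h]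

theorem GLSuper.mul_mem {i j : ZMod 2} {A B : GLSuper m n} (hA : A ∈ GLSuper.parity m n i)
    (hB : B ∈ GLSuper.parity m n j) : A * B ∈ GLSuper.parity m n (i + j) := by
  intro a c h
  rw [Matrix.mul_apply]
  refine Finset.sum_eq_zero fun b _ => ?_
  by_cases h1 : idxParity m n a + idxParity m n b = i
  · by_cases h2 : idxParity m n b + idxParity m n c = j
    · refine absurd ?_ h
      rw [← h1, ← h2]
      generalize idxParity m n a = x
      generalize idxParity m n b = y
      generalize idxParity m n c = z
      revert x y z
      decide
    · rw [hB b c h2, mul_zero]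
  · rw [hA a b h1, zero_mul]

/-- The supercommutator: the bilinear extension of `[A, B] = A B - (-1)^{|A||B|} B A`. -/
noncomputable def GLSuper.comm : GLSuper m n →ₗ[ℂ] GLSuper m n →ₗ[ℂ] GLSuper m n :=
  LinearMap.mk₂ ℂ (fun A B => A * B - GLSuper.part m n 0 B * A
      - GLSuper.part m n 1 B * (GLSuper.part m n 0 A - GLSuper.part m n 1 A))
    (by intros; simp only [map_add]; noncomm_ring)
    (by
      intro c A B
      simp only [map_smul, smul_mul_assoc, mul_smul_comm, ← smul_sub])
    (by intros; simp only [map_add]; noncomm_ring)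
    (by
      intro c A B
      simp only [map_smul, smul_mul_assoc, mul_smul_comm, ← smul_sub])

theorem GLSuper.comm_apply {i j : ZMod 2} {A B : GLSuper m n} (hA : A ∈ GLSuper.parity m n i)
    (hB : B ∈ GLSuper.parity m n j) :
    GLSuper.comm m n A B = A * B - ksign i j • (B * A) := by
  have hA' : ∀ k, GLSuper.part m n k A = if i = k then A else 0 := fun k => by
    split_ifs with h
    · subst h; exact GLSuper.part_same m n hA
    · exact GLSuper.part_ne m n h hA
  have hB' : ∀ k, GLSuper.part m n k B = if j = k then B else 0 := fun k => by
    split_ifs with h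
    · subst h; exact GLSuper.part_same m n hB
    · exact GLSuper.part_ne m n h hB
  change A * B - GLSuper.part m n 0 B * A
      - GLSuper.part m n 1 B * (GLSuper.part m n 0 A - GLSuper.part m n 1 A) = _
  rw [hA', hA', hB', hB']
  rcases zmod2_cases i with rfl | rfl <;> rcases zmod2_cases j with rfl | rfl <;>
    simp [ksign]

/-- The Lie superalgebra `gl(m|n)`. -/
noncomputable instance GLSuper.lieSuperalgebra : LieSuperalgebra (GLSuper m n) where
  parity := GLSuper.parity m n
  isCompl := by
    constructor
    · rw [Submodule.disjoint_def]
      intro A h0 h1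
      rw [← GLSuper.part_same m n h0]
      exact GLSuper.part_ne m n (by decide) h1
    · rw [codisjoint_iff, eq_top_iff]
      intro A _
      rw [← GLSuper.part_add m n A]
      exact Submodule.add_mem_sup (GLSuper.part_mem m n 0 A) (GLSuper.part_mem m n 1 A)
  bracket := GLSuper.comm m n
  bracket_mem {i j} _ _ hA hB := by
    rw [GLSuper.comm_apply m n hA hB]
    refine sub_mem (GLSuper.mul_mem m n hA hB) (Submodule.smul_mem _ _ ?_)
    rw [add_comm]; exact GLSuper.mul_mem m n hB hA
  skew {i j} _ _ hA hB := by
    rw [GLSuper.comm_apply m n hA hB, GLSuper.comm_apply m n hB hA]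
    rcases zmod2_cases i with rfl | rfl <;> rcases zmod2_cases j with rfl | rfl <;>
      simp [ksign, add_comm]
  jacobi {i j A C} hA hC Z := by
    have key : ∀ {k : ZMod 2} {Z : GLSuper m n}, Z ∈ GLSuper.parity m n k →
        GLSuper.comm m n A (GLSuper.comm m n C Z) = GLSuper.comm m n (GLSuper.comm m n A C) Z
          + ksign i j • GLSuper.comm m n C (GLSuper.comm m n A Z) := by
      intro k Z hZ
      have mem : ∀ {i j : ZMod 2} {A B : GLSuper m n}, A ∈ GLSuper.parity m n i →
          B ∈ GLSuper.parity m n j → GLSuper.comm m n A B ∈ GLSuper.parity m n (i + j) := by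
        intro i j A B hA hB
        rw [GLSuper.comm_apply m n hA hB]
        refine sub_mem (GLSuper.mul_mem m n hA hB) (Submodule.smul_mem _ _ ?_)
        rw [add_comm]; exact GLSuper.mul_mem m n hB hA
      rw [GLSuper.comm_apply m n hA (mem hC hZ), GLSuper.comm_apply m n (mem hA hC) hZ,
        GLSuper.comm_apply m n hC (mem hA hZ), GLSuper.comm_apply m n hA hC,
        GLSuper.comm_apply m n hC hZ, GLSuper.comm_apply m n hA hZ]
      rcases zmod2_cases i with rfl | rfl <;> rcases zmod2_cases j with rfl | rfl <;>
        rcases zmod2_cases k with rfl | rfl <;>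
        simp [ksign, show (1 : ZMod 2) + 1 = 0 from rfl] <;> noncomm_ring
    rw [← GLSuper.part_add m n Z]
    simp only [map_add, smul_add, key (GLSuper.part_mem m n 0 Z),
      key (GLSuper.part_mem m n 1 Z)]
    abel

end GeneralLinear

/-! ## Signs -/

/-! The proof compares the `ad m'`-invariants of `Q_χ` with polynomials in `g_e`. The free letters
consist of a basis of `g_e` and of further letters `x_l` which the form `χ([·,·])` pairs with
vectors `z_l` of `m'`, and these `z_l` span `m'`. Besides the Kazhdan degree, every PBW monomial has
the degree `lam`, which is weight plus length. To leading order in `lam`, `z_l` acts as the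
derivative with respect to `x_l`, so the leading part of an invariant involves only letters of
`g_e`. The Euler operator `∑ x_l z_l` counts the other letters to leading order; polynomials in it
correct an element that is invariant to leading order into an invariant (`exists_invariant`). Hence
each homogeneous `Y ∈ g_e(m)` lifts to an invariant `Y + a` with `a` of Kazhdan degree at most `m +
2` and `lam` at most `m`, and the ordered products of the lifts are a basis of `W'_χ`.

The difficulty is the natural filtration. Vectors of `g(-1)` have weight `-1`, but their brackets
act by constants, of weight `0`, so `U(g)` does not act on `Q_χ` compatibly with weights. The degree
`shiftDeg` repairs this: it gives weight `0` to `g(-1)`, dominates the weight, and agrees with it on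
words in `g_e`. The bound `lam ≤ m` forces degree at most `max (m - 1) 0`. For `m > 0` the
correction `a` is therefore of lower order. For `m = 0` it is not, and the explicit lift `θ_X = X -
½ ∑ [X, b_i] b^i` is used: on the relevant vectors `X` and its quadratic part induce the same
derivation of `g(-1)`, so `θ_X` supercommutes with `g(-1)`, and `[θ_X, θ_Y] = θ_[X,Y]` holds exactly
on `1_χ` (`theta_commutator`).

So the lifts satisfy the bracket relations of `g_e` up to lower degree (`defect_mem`), and their
symbols define a homomorphism from `U(g_e)` to the graded algebra (`comparison`). It sends ordered
words in `g_e` to symbols of basis elements of `W'_χ`. Triangularity in weight and `lam`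
(`weight_le_of_sum_mem`) shows that no weight is lost by cancellation in a linear combination of
these basis elements; this gives bijectivity. Two PBW generators of the same `Y` differ by an
invariant with `lam ≤ m`; there every nonempty word has weight below `m`, so only a constant
survives in degree `m`, and only for `m = 0` and even `Y`.

Three inputs come first: the PBW basis of `Q_χ`, obtained by constructing the action of `g` on a
Fock space (`coeff_eq_zero`); the integrality of weights and the nonnegativity of weights on `ker
(ad e)`, from `sl₂`-theory; and the identity `m' = m` for even `r`, which makes `W'_χ` all of `W_χ`.
For `gl(m|n)`, left multiplication by the grading operator turns the nondegenerate form on `g(-1)_1`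
into its negative, which forces `r` to be even. -/

theorem ksign_comm (i j : ZMod 2) : ksign i j = ksign j i := by
  unfold ksign; congr 1; exact propext and_comm

theorem ksign_mul_self (i j : ZMod 2) : ksign i j * ksign i j = 1 := by
  unfold ksign; split_ifs <;> norm_num

theorem ksign_add_left (i j k : ZMod 2) : ksign (i + j) k = ksign i k * ksign j k := by
  rcases zmod2_cases i with rfl | rfl <;> rcases zmod2_cases j with rfl | rfl <;>
    rcases zmod2_cases k with rfl | rfl <;> simp [ksign, show (1 : ZMod 2) + 1 = 0 from rfl]

theorem ksign_add_right (i j k : ZMod 2) : ksign k (i + j) = ksign k i * ksign k j := by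
  rw [ksign_comm, ksign_add_left, ksign_comm k, ksign_comm k]

@[simp] theorem ksign_zero_left (i : ZMod 2) : ksign 0 i = 1 := by simp [ksign]

@[simp] theorem ksign_zero_right (i : ZMod 2) : ksign i 0 = 1 := by simp [ksign]

@[simp] theorem ksign_one_one : ksign 1 1 = -1 := by simp [ksign]

/-! ## Creation and annihilation operators on the super Fock space -/

namespace SuperFock

set_option linter.unusedSectionVars false

variable {I : Type*} [Fintype I] [DecidableEq I] (key : I → ℕ) (par : I → ZMod 2)

/-- The Fock space, with one basis vector for each multi-index. An odd letter only sees the parity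
of its exponent. -/
abbrev Space (I : Type*) : Type _ := (I → ℕ) →₀ ℂ

noncomputable instance (I : Type*) : AddCommMonoid (Space I) := Finsupp.instAddCommMonoid

noncomputable instance (I : Type*) : AddCommGroup (Space I) := Finsupp.instAddCommGroup

/-- The sign of moving a letter `i` past the letters of the multi-index `α` that precede it. -/
noncomputable def eps (i : I) (α : I → ℕ) : ℂ :=
  ∏ j, if key j < key i then ksign (par i) (par j) ^ α j else 1

/-- The number of letters `i` in a monomial with exponent `n`. -/
def occ (i : I) (n : ℕ) : ℕ := if par i = 1 then n % 2 else n

/-- The operator of multiplication by the letter `i`. -/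
noncomputable def create (i : I) : Space I →ₗ[ℂ] Space I :=
  Finsupp.linearCombination ℂ fun α => Finsupp.single (α + Pi.single i 1)
    (if par i = 1 ∧ α i % 2 = 1 then 0 else eps key par i α)

/-- The (super)derivative with respect to the letter `i`. -/
noncomputable def annih (i : I) : Space I →ₗ[ℂ] Space I :=
  Finsupp.linearCombination ℂ fun α => Finsupp.single (α - Pi.single i 1)
    (eps key par i α * occ par i (α i))

theorem create_single (i : I) (α : I → ℕ) (c : ℂ) :
    create key par i (Finsupp.single α c) = Finsupp.single (α + Pi.single i 1)
      (c * if par i = 1 ∧ α i % 2 = 1 then 0 else eps key par i α) := by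
  simp [create, Finsupp.linearCombination_single]

theorem annih_single (i : I) (α : I → ℕ) (c : ℂ) :
    annih key par i (Finsupp.single α c) = Finsupp.single (α - Pi.single i 1)
      (c * (eps key par i α * occ par i (α i))) := by
  rw [annih, Finsupp.linearCombination_single, Finsupp.smul_single, smul_eq_mul]

theorem eps_add_single (i j : I) (α : I → ℕ) :
    eps key par i (α + Pi.single j 1) =
      eps key par i α * if key j < key i then ksign (par i) (par j) else 1 := by
  have : (if key j < key i then ksign (par i) (par j) else 1) =
      ∏ k, if k = j then (if key j < key i then ksign (par i) (par j) else 1) else 1 := by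
    simp
  unfold eps
  rw [this, ← Finset.prod_mul_distrib]
  refine Finset.prod_congr rfl fun k _ => ?_
  by_cases hk : k = j
  · subst hk
    by_cases h : key k < key i <;> simp [h, pow_succ]
  · simp [hk]

theorem eps_add_self (i : I) (α : I → ℕ) :
    eps key par i (α + Pi.single i 1) = eps key par i α := by
  simp [eps_add_single]

theorem eps_mul_self (i : I) (α : I → ℕ) : eps key par i α * eps key par i α = 1 := by
  unfold eps
  rw [← Finset.prod_mul_distrib]
  refine Finset.prod_eq_one fun k _ => ?_
  split_ifs
  · rw [← mul_pow, ksign_mul_self, one_pow]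
  · norm_num

theorem exists_eq_add_single {α : I → ℕ} {i : I} (h : α i ≠ 0) :
    ∃ β : I → ℕ, α = β + Pi.single i 1 := by
  refine ⟨α - Pi.single i 1, ?_⟩
  ext k
  by_cases hk : k = i
  · subst hk; simp; omega
  · simp [hk]

theorem create_create (hkey : Function.Injective key) (i j : I) (f : Space I) :
    create key par i (create key par j f) =
      ksign (par i) (par j) • create key par j (create key par i f) := by
  suffices h : create key par i ∘ₗ create key par j =
      ksign (par i) (par j) • (create key par j ∘ₗ create key par i) from
    LinearMap.congr_fun h f
  refine Finsupp.lhom_ext fun α c => ?_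
  simp only [LinearMap.comp_apply, LinearMap.smul_apply, create_single, Finsupp.smul_single]
  rw [add_right_comm α]
  congr 1
  by_cases hij : i = j
  · subst hij
    rcases zmod2_cases (par i) with h | h
    · simp [h]
    · rcases Nat.mod_two_eq_zero_or_one (α i) with h2 | h2 <;>
        simp [h, h2, Nat.add_mod]
  · have hji : j ≠ i := fun h => hij h.symm
    simp only [eps_add_single, Pi.add_apply, Pi.single_eq_of_ne hij, Pi.single_eq_of_ne hji,
      add_zero, smul_eq_mul]
    have hk : key i ≠ key j := fun h => hij (hkey h)
    have hs := ksign_mul_self (par i) (par j)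
    rw [ksign_comm (par j) (par i)]
    rcases lt_or_gt_of_ne hk with h | h
    · simp only [h, not_lt.mpr h.le, if_true, if_false]
      split_ifs <;>
        first | ring1 | linear_combination (-c * eps key par i α * eps key par j α) * hs
    · simp only [h, not_lt.mpr h.le, if_true, if_false]
      split_ifs <;> ring1

/-- These are the canonical (anti)commutation relations. Since an odd exponent counts only modulo
`2`, they hold on all multi-indices and no truncated index set is needed. At exponent `0` the
truncated subtraction is harmless because the coefficient vanishes. -/
theorem annih_create (hkey : Function.Injective key) (i j : I) (f : Space I) :
    annih key par i (create key par j f) = (if i = j then f else 0) +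
      ksign (par i) (par j) • create key par j (annih key par i f) := by
  suffices h : annih key par i ∘ₗ create key par j = (if i = j then LinearMap.id else 0) +
      ksign (par i) (par j) • (create key par j ∘ₗ annih key par i) by
    have := LinearMap.congr_fun h f
    by_cases hij : i = j <;> simpa [hij] using this
  refine Finsupp.lhom_ext fun α c => ?_
  simp only [LinearMap.comp_apply, LinearMap.smul_apply, create_single, annih_single,
    Finsupp.smul_single, LinearMap.add_apply]
  by_cases hij : i = j
  · subst hij
    have he := eps_mul_self key par i α
    by_cases h0 : α i = 0
    · have hα : α + Pi.single i 1 - Pi.single i 1 = α := by simp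
      rw [hα]
      simp only [eps_add_self, if_true, LinearMap.id_apply]
      rcases zmod2_cases (par i) with h | h <;>
        simp [occ, mul_assoc, he, h, h0]
    · obtain ⟨β, rfl⟩ := exists_eq_add_single h0
      have he := eps_mul_self key par i β
      simp only [add_tsub_cancel_right, eps_add_self, if_true, LinearMap.id_apply]
      rw [← Finsupp.single_add]
      congr 1
      rcases zmod2_cases (par i) with h | h
      · simp [h, occ]
        linear_combination (c * (1 + (β i : ℂ) + 1) - c * (1 + β i)) * he
      · rcases Nat.mod_two_eq_zero_or_one (β i) with h2 | h2
        · simp [h, h2, occ, Nat.add_mod]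
          linear_combination c * he
        · simp [h, h2, occ, Nat.add_mod]
          linear_combination c * he
  · have hji : j ≠ i := fun h => hij h.symm
    simp only [hij, if_false, LinearMap.zero_apply, zero_add]
    by_cases h0 : α i = 0
    · simp [h0, hij, occ]
    · obtain ⟨β, rfl⟩ := exists_eq_add_single h0
      rw [add_right_comm β]
      simp only [add_tsub_cancel_right]
      congr 1
      simp only [eps_add_single, Pi.add_apply, Pi.single_eq_of_ne hij, Pi.single_eq_of_ne hji,
        add_zero, smul_eq_mul, lt_irrefl, if_false, mul_one]
      have hk : key i ≠ key j := fun h => hij (hkey h)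
      have hs := ksign_mul_self (par i) (par j)
      rw [ksign_comm (par j) (par i)]
      rcases lt_or_gt_of_ne hk with h | h
      · simp only [h, not_lt.mpr h.le, if_true, if_false]
        split_ifs <;> ring1
      · simp only [h, not_lt.mpr h.le, if_true, if_false]
        split_ifs <;> ring1

/-- The degree of a monomial. -/
def deg (α : I → ℕ) : ℕ := ∑ i, occ par i (α i)

/-- The component of degree `n`. -/
def homog (n : ℕ) : Submodule ℂ (Space I) := Finsupp.supported ℂ ℂ {α | deg par α = n}

/-- The vectors of degree at most `n`. -/
def upto (n : ℕ) : Submodule ℂ (Space I) := Finsupp.supported ℂ ℂ {α | deg par α ≤ n}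

theorem homog_le_upto {m n : ℕ} (h : m ≤ n) : homog par m ≤ upto (I := I) par n :=
  Finsupp.supported_mono fun _ hα => le_of_eq_of_le hα h

theorem upto_mono {m n : ℕ} (h : m ≤ n) : upto par m ≤ upto (I := I) par n :=
  Finsupp.supported_mono fun _ hα => le_trans hα h

theorem single_mem_homog (α : I → ℕ) (c : ℂ) : Finsupp.single α c ∈ homog par (deg par α) :=
  Finsupp.single_mem_supported ℂ c rfl

theorem homog_le {n : ℕ} {S : Submodule ℂ (Space I)}
    (h : ∀ α, deg par α = n → Finsupp.single α 1 ∈ S) : homog par n ≤ S := by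
  rw [homog, Finsupp.supported_eq_span_single, Submodule.span_le]
  rintro _ ⟨α, hα, rfl⟩
  exact h α hα

theorem upto_le {n : ℕ} {S : Submodule ℂ (Space I)}
    (h : ∀ m ≤ n, homog par m ≤ S) : upto par n ≤ S := by
  rw [upto, Finsupp.supported_eq_span_single, Submodule.span_le]
  rintro _ ⟨α, hα, rfl⟩
  exact h _ hα (single_mem_homog par α 1)

theorem occ_succ (i : I) (n : ℕ) (h : ¬ (par i = 1 ∧ n % 2 = 1)) :
    occ par i (n + 1) = occ par i n + 1 := by
  unfold occ
  split_ifs with hp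
  · have : ¬ n % 2 = 1 := fun h' => h ⟨hp, h'⟩
    omega
  · rfl

theorem deg_add_single (i : I) (α : I → ℕ) (h : ¬ (par i = 1 ∧ α i % 2 = 1)) :
    deg par (α + Pi.single i 1) = deg par α + 1 := by
  have h1 : (1 : ℕ) = ∑ j, if j = i then 1 else 0 := by simp
  unfold deg
  rw [h1, ← Finset.sum_add_distrib]
  refine Finset.sum_congr rfl fun j _ => ?_
  by_cases hj : j = i
  · subst hj; simpa using occ_succ par j (α j) h
  · simp [hj]

theorem create_mem (i : I) {n : ℕ} {f : Space I} (hf : f ∈ homog par n) :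
    create key par i f ∈ homog par (n + 1) := by
  refine homog_le (S := (homog par (n + 1)).comap (create key par i)) par (fun α hα => ?_) hf
  rw [Submodule.mem_comap, create_single]
  split_ifs with h
  · simp
  · rw [← hα, ← deg_add_single par i α h]; exact single_mem_homog _ _ _

theorem annih_mem (i : I) {n : ℕ} {f : Space I} (hf : f ∈ homog par (n + 1)) :
    annih key par i f ∈ homog par n := by
  refine homog_le (S := (homog par n).comap (annih key par i)) par (fun α hα => ?_) hf
  rw [Submodule.mem_comap, annih_single]
  by_cases h0 : occ par i (α i) = 0
  · simp [h0]
  · have h1 : α i ≠ 0 := fun h => h0 (by simp [occ, h])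
    obtain ⟨β, rfl⟩ := exists_eq_add_single h1
    have h2 : ¬ (par i = 1 ∧ β i % 2 = 1) := by
      rintro ⟨hp, h2⟩
      apply h0
      simp [occ, hp]; omega
    rw [deg_add_single par i β h2] at hα
    rw [add_tsub_cancel_right, ← Nat.succ_injective hα]
    exact single_mem_homog _ _ _

theorem annih_zero (i : I) {f : Space I} (hf : f ∈ homog par 0) : annih key par i f = 0 := by
  refine homog_le (S := LinearMap.ker (annih key par i)) par (fun α hα => ?_) hf
  have h0 : occ par i (α i) = 0 := by
    unfold deg at hα
    exact (Finset.sum_eq_zero_iff.mp hα) i (Finset.mem_univ i)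
  rw [LinearMap.mem_ker, annih_single]
  simp [h0]

theorem euler {n : ℕ} {f : Space I} (hf : f ∈ homog par n) :
    ∑ i, create key par i (annih key par i f) = (n : ℂ) • f := by
  have : homog par n ≤ LinearMap.eqLocus (∑ i, create key par i ∘ₗ annih key par i)
      ((n : ℂ) • LinearMap.id) := by
    refine homog_le par fun α hα => ?_
    rw [LinearMap.mem_eqLocus]
    simp only [LinearMap.sum_apply, LinearMap.comp_apply, LinearMap.smul_apply,
      LinearMap.id_apply, annih_single]
    have key1 : ∀ i, create key par i (Finsupp.single (α - Pi.single i 1)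
        (1 * (eps key par i α * occ par i (α i)))) = Finsupp.single α (occ par i (α i) : ℂ) := by
      intro i
      by_cases h0 : occ par i (α i) = 0
      · simp [h0]
      · have h1 : α i ≠ 0 := fun h => h0 (by simp [occ, h])
        obtain ⟨β, rfl⟩ := exists_eq_add_single h1
        have h2 : ¬ (par i = 1 ∧ β i % 2 = 1) := by
          rintro ⟨hp, h2⟩
          apply h0
          simp [occ, hp]; omega
        rw [add_tsub_cancel_right, create_single, if_neg h2, eps_add_self]
        congr 1
        generalize (occ par i ((β + Pi.single i 1 : I → ℕ) i) : ℂ) = o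
        linear_combination o * eps_mul_self key par i β
    simp only [key1]
    have h2 : ∑ i, Finsupp.single α (occ par i (α i) : ℂ) =
        Finsupp.lsingle (R := ℂ) α (∑ i, (occ par i (α i) : ℂ)) := by rw [map_sum]; rfl
    rw [h2, Finsupp.lsingle_apply, Finsupp.smul_single, ← hα, deg]
    push_cast
    simp
  have h := this hf
  rw [LinearMap.mem_eqLocus] at h
  simpa using h

/-- The projection to the component of degree `n`. -/
noncomputable def proj (n : ℕ) : Space I →ₗ[ℂ] Space I :=
  Finsupp.linearCombination ℂ fun α => if deg par α = n then Finsupp.single α 1 else 0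

theorem proj_same {n : ℕ} {f : Space I} (hf : f ∈ homog par n) : proj par n f = f := by
  refine homog_le (S := LinearMap.eqLocus (proj par n) LinearMap.id) par (fun α hα => ?_) hf
  simp [proj, Finsupp.linearCombination_single, hα]

theorem proj_ne {m n : ℕ} (h : m ≠ n) {f : Space I} (hf : f ∈ homog par m) :
    proj par n f = 0 := by
  refine homog_le (S := LinearMap.ker (proj par n)) par (fun α hα => ?_) hf
  have : deg par α ≠ n := by rw [hα]; exact h
  simp [proj, Finsupp.linearCombination_single, this]

end SuperFock

/-! ## Induced modules of Lie superalgebras on Fock spaces -/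

/-- A homogeneous basis `x` of a complement of a subalgebra `m` of a Lie superalgebra (the common
kernel of the coordinates), and a linear form `chi` vanishing on `[m, m]` and on odd elements. -/
structure InductionData (g : Type*) [AddCommGroup g] [Module ℂ g] [LieSuperalgebra g]
    (I : Type*) [DecidableEq I] where
  key : I → ℕ
  key_inj : Function.Injective key
  par : I → ZMod 2
  x : I → g
  coord : I → g →ₗ[ℂ] ℂ
  chi : g →ₗ[ℂ] ℂ
  x_mem : ∀ i, x i ∈ parity (g := g) (par i)
  coord_x : ∀ i j, coord i (x j) = if i = j then 1 else 0
  coord_par : ∀ {p : ZMod 2} {i : I} {y : g}, y ∈ parity (g := g) p → p ≠ par i → coord i y = 0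
  chi_odd : ∀ {y : g}, y ∈ parity (g := g) 1 → chi y = 0
  coord_bracket : ∀ {y z : g}, (∀ i, coord i y = 0) → (∀ i, coord i z = 0) →
    ∀ i, coord i (bracket y z) = 0
  chi_bracket : ∀ {y z : g}, (∀ i, coord i y = 0) → (∀ i, coord i z = 0) → chi (bracket y z) = 0

namespace InductionData

open SuperFock

set_option linter.unusedSectionVars false

variable {g : Type*} [AddCommGroup g] [Module ℂ g] [LieSuperalgebra g]
  {I : Type*} [Fintype I] [DecidableEq I] (K : InductionData g I)

/-- Multiplication by the component of `y` in the complement. -/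
noncomputable def mul : g →ₗ[ℂ] End ℂ (Space I) :=
  ∑ i, (K.coord i).smulRight (create K.key K.par i)

theorem mul_apply (y : g) (f : Space I) :
    K.mul y f = ∑ i, K.coord i y • create K.key K.par i f := by
  simp [mul, LinearMap.sum_apply]

theorem mul_x (i : I) (f : Space I) : K.mul (K.x i) f = create K.key K.par i f := by
  simp [mul_apply, coord_x]

/-- The projection of `g` to the complement. -/
noncomputable def compl : g →ₗ[ℂ] g := ∑ i, (K.coord i).smulRight (K.x i)

theorem compl_apply (y : g) : K.compl y = ∑ i, K.coord i y • K.x i := by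
  simp [compl, LinearMap.sum_apply]

theorem compl_mem {p : ZMod 2} {y : g} (hy : y ∈ parity (g := g) p) :
    K.compl y ∈ parity (g := g) p := by
  rw [compl_apply]
  refine Submodule.sum_mem _ fun i _ => ?_
  by_cases h : p = K.par i
  · rw [h]; exact Submodule.smul_mem _ _ (K.x_mem i)
  · rw [K.coord_par hy h, zero_smul]; exact zero_mem _

/-- The rescaling of `m` and its complement used in degree `n + 1`. -/
noncomputable def scale (n : ℕ) : g →ₗ[ℂ] g :=
  ((n : ℂ) + 1)⁻¹ • (LinearMap.id - K.compl) + ((n : ℂ) + 2)⁻¹ • K.compl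

/-- The Koszul sign twist `y ↦ (-1)^{p|y|} y`. -/
noncomputable def twist (g : Type*) [AddCommGroup g] [Module ℂ g] [LieSuperalgebra g]
    (p : ZMod 2) : g →ₗ[ℂ] g :=
  if p = 1 then parityInvol g else LinearMap.id

theorem twist_apply {p q : ZMod 2} {y : g} (hy : y ∈ parity (g := g) q) :
    twist g p y = ksign q p • y := by
  rcases zmod2_cases p with rfl | rfl
  · simp [twist]
  · simp [twist, parityInvol_apply g hy]

/-- The next homogeneous component of the action, from the action `T` on lower degrees and its
last component `R`. -/
noncomputable def next (n : ℕ) (T R : g →ₗ[ℂ] End ℂ (Space I)) : g →ₗ[ℂ] End ℂ (Space I) :=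
  ∑ i, (LinearMap.mulRight ℂ (annih K.key K.par i : End ℂ (Space I))) ∘ₗ
    (T ∘ₗ (bracket (g := g)).flip (K.x i) - LinearMap.mulRight ℂ (R (K.x i)) ∘ₗ T +
      LinearMap.mulLeft ℂ (T (K.x i)) ∘ₗ R ∘ₗ twist g (K.par i)) ∘ₗ K.scale n

theorem next_apply (n : ℕ) (T R : g →ₗ[ℂ] End ℂ (Space I)) (y : g) (f : Space I) :
    K.next n T R y f = ∑ i, (T (bracket (K.scale n y) (K.x i)) (annih K.key K.par i f) -
      T (K.scale n y) (R (K.x i) (annih K.key K.par i f)) +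
      T (K.x i) (R (twist g (K.par i) (K.scale n y)) (annih K.key K.par i f))) := by
  simp [next, LinearMap.sum_apply]

/-- The action on degrees at most `n`, and its deviation from multiplication in degree `n`. -/
noncomputable def stage : ℕ → (g →ₗ[ℂ] End ℂ (Space I)) × (g →ₗ[ℂ] End ℂ (Space I))
  | 0 => (LinearMap.mulRight ℂ (proj K.par 0 : End ℂ (Space I)) ∘ₗ
      (K.mul + K.chi.smulRight 1), K.chi.smulRight 1)
  | n + 1 => ((stage n).1 + LinearMap.mulRight ℂ (proj K.par (n + 1) : End ℂ (Space I)) ∘ₗ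
      (K.mul + K.next n (stage n).1 (stage n).2), K.next n (stage n).1 (stage n).2)

/-- Each stage changes the action only in one new degree, because of `proj`. The values in a fixed
degree are therefore stable, and `act` is the limit. -/
theorem stage_fst_homog {m n : ℕ} (h : m ≤ n) (y : g) {f : Space I} (hf : f ∈ homog K.par m) :
    (K.stage n).1 y f = K.mul y f + (K.stage m).2 y f := by
  induction n with
  | zero =>
    obtain rfl : m = 0 := by omega
    simp [stage, proj_same _ hf]
  | succ n ih =>
    by_cases hm : m = n + 1
    · subst hm
      have h0 : (K.stage n).1 y f = 0 := by
        clear ih h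
        suffices ∀ k < n + 1, (K.stage k).1 y f = 0 from this n (by omega)
        intro k hk
        induction k with
        | zero => simp [stage, proj_ne K.par (show n + 1 ≠ 0 by omega) hf]
        | succ k ih => simp [stage, ih (by omega), proj_ne K.par (show n + 1 ≠ k + 1 by omega) hf]
      simp [stage, proj_same _ hf, h0]
    · simp [stage, ih (by omega), proj_ne K.par hm hf]

/-- The action of `g` on the Fock space. -/
noncomputable def act : g →ₗ[ℂ] End ℂ (Space I) where
  toFun y := Finsupp.linearCombination ℂ fun α =>
    (K.stage (deg K.par α)).1 y (Finsupp.single α 1)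
  map_add' y z := by
    refine Finsupp.lhom_ext fun α c => ?_
    simp [Finsupp.linearCombination_single]
  map_smul' c y := by
    refine Finsupp.lhom_ext fun α c => ?_
    simp [Finsupp.linearCombination_single, smul_comm c]

theorem act_homog {m n : ℕ} (h : m ≤ n) (y : g) {f : Space I} (hf : f ∈ homog K.par m) :
    (K.stage n).1 y f = K.act y f := by
  refine homog_le (S := LinearMap.eqLocus ((K.stage n).1 y) (K.act y)) K.par
    (fun α hα => ?_) hf
  have h1 : Finsupp.single α 1 ∈ homog (I := I) K.par m := by
    rw [← hα]; exact single_mem_homog _ _ _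
  rw [LinearMap.mem_eqLocus, K.stage_fst_homog h y h1]
  simp [act, Finsupp.linearCombination_single, hα, K.stage_fst_homog le_rfl y h1]

theorem act_upto {n : ℕ} (y : g) {f : Space I} (hf : f ∈ upto K.par n) :
    (K.stage n).1 y f = K.act y f :=
  upto_le (S := LinearMap.eqLocus ((K.stage n).1 y) (K.act y)) K.par
    (fun _ hm _ hf => K.act_homog hm y hf) hf

/-- The deviation of the action from multiplication. -/
noncomputable def corr : g →ₗ[ℂ] End ℂ (Space I) := K.act - K.mul

theorem act_eq (y : g) (f : Space I) : K.act y f = K.mul y f + K.corr y f := by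
  simp [corr]

theorem corr_homog {n : ℕ} (y : g) {f : Space I} (hf : f ∈ homog K.par n) :
    (K.stage n).2 y f = K.corr y f := by
  have := K.stage_fst_homog le_rfl y hf
  rw [K.act_homog le_rfl y hf] at this
  simp [corr, this]

theorem mul_mem (y : g) {n : ℕ} {f : Space I} (hf : f ∈ homog K.par n) :
    K.mul y f ∈ homog K.par (n + 1) := by
  rw [mul_apply]
  exact Submodule.sum_mem _ fun i _ => Submodule.smul_mem _ _ (create_mem _ _ _ hf)

/-- The recursion lowers the degree by one with `annih` and raises it by at most one with the action
already built. That the deviation does not raise degrees makes multiplication the leading term of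
the action. -/
theorem corr_mem_homog {n : ℕ} : ∀ (y : g) {f : Space I}, f ∈ homog K.par n →
    K.corr y f ∈ upto K.par n := by
  induction n using Nat.strong_induction_on with
  | _ n ih =>
    intro y f hf
    have ih' : ∀ k < n, ∀ (y : g) {f : Space I}, f ∈ upto K.par k →
        K.corr y f ∈ upto K.par k := fun k hk y f hf =>
      upto_le (S := (upto K.par k).comap (K.corr y)) K.par
        (fun m hm f hf => upto_mono K.par hm (ih m (by omega) y hf)) hf
    have act' : ∀ k < n, ∀ (y : g) {f : Space I}, f ∈ upto K.par k →
        K.act y f ∈ upto K.par n := fun k hk y f hf =>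
      upto_le (S := (upto K.par n).comap (K.act y)) K.par (fun m hm f hf => by
        rw [Submodule.mem_comap, act_eq]
        exact add_mem (homog_le_upto K.par (by omega) (K.mul_mem y hf))
          (upto_mono K.par (by omega) (ih m (by omega) y hf))) hf
    rw [← K.corr_homog y hf]
    cases n with
    | zero => simpa [stage] using Submodule.smul_mem _ _ (homog_le_upto K.par le_rfl hf)
    | succ n =>
      simp only [stage, next_apply]
      refine Submodule.sum_mem _ fun i _ => ?_
      have hd := annih_mem K.key K.par i hf
      have hc : ∀ y, (K.stage n).2 y (annih K.key K.par i f) ∈ upto K.par n := fun y => by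
        rw [K.corr_homog y hd]; exact ih n (by omega) y hd
      rw [K.act_homog le_rfl _ hd, K.act_upto _ (hc _), K.act_upto _ (hc _)]
      exact add_mem (sub_mem (act' n (by omega) _ (homog_le_upto K.par le_rfl hd))
        (act' n (by omega) _ (hc _))) (act' n (by omega) _ (hc _))

theorem corr_mem {n : ℕ} (y : g) {f : Space I} (hf : f ∈ upto K.par n) :
    K.corr y f ∈ upto K.par n :=
  upto_le (S := (upto K.par n).comap (K.corr y)) K.par
    (fun _ hm _ hf => upto_mono K.par hm (K.corr_mem_homog y hf)) hf

/-- The curvature which the deviation has to compensate, for the sign `s`. -/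
noncomputable def curv (s : ℂ) (y z : g) : End ℂ (Space I) :=
  K.act (bracket y z) - K.act y * K.corr z + s • (K.act z * K.corr y)

theorem curv_apply (s : ℂ) (y z : g) (f : Space I) : K.curv s y z f =
    K.act (bracket y z) f - K.act y (K.corr z f) + s • K.act z (K.corr y f) := by
  simp [curv]

theorem scale_mem (n : ℕ) {p : ZMod 2} {y : g} (hy : y ∈ parity (g := g) p) :
    K.scale n y ∈ parity (g := g) p := by
  simp only [scale, LinearMap.add_apply, LinearMap.smul_apply, LinearMap.sub_apply,
    LinearMap.id_apply]
  exact add_mem (Submodule.smul_mem _ _ (sub_mem hy (K.compl_mem hy)))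
    (Submodule.smul_mem _ _ (K.compl_mem hy))

theorem corr_zero (y : g) {f : Space I} (hf : f ∈ homog K.par 0) :
    K.corr y f = K.chi y • f := by
  rw [← K.corr_homog y hf]; simp [stage]

/-- The deviation is a homotopy formula: contract the curvature with the derivatives, as in the
proof of the Poincaré lemma. For `f` of degree `n` the curvature of two vectors of the complement is
then counted `n + 2` times, and `n + 1` times if one of them lies in `m`; this explains the
denominators in `scale`. -/
theorem corr_succ {n : ℕ} {p : ZMod 2} {y : g} (hy : y ∈ parity (g := g) p) {f : Space I}
    (hf : f ∈ homog K.par (n + 1)) :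
    K.corr y f = ∑ i, K.curv (ksign p (K.par i)) (K.scale n y) (K.x i)
      (annih K.key K.par i f) := by
  rw [← K.corr_homog y hf]
  simp only [stage, next_apply, curv_apply]
  refine Finset.sum_congr rfl fun i _ => ?_
  have hd := annih_mem K.key K.par i hf
  rw [K.corr_homog _ hd, K.corr_homog _ hd, K.act_homog le_rfl _ hd,
    K.act_upto _ (K.corr_mem_homog _ hd), K.act_upto _ (K.corr_mem_homog _ hd),
    twist_apply (K.scale_mem n hy), map_smul, LinearMap.smul_apply, map_smul]

/-- The action is a representation on vectors of degree `n`. -/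
def IsRep (n : ℕ) : Prop := ∀ (p q : ZMod 2) (y z : g), y ∈ parity (g := g) p →
  z ∈ parity (g := g) q → ∀ f ∈ homog K.par n,
    K.act y (K.act z f) = ksign p q • K.act z (K.act y f) + K.act (bracket y z) f

theorem IsRep.upto {K : InductionData g I} {n : ℕ} (h : ∀ m ≤ n, K.IsRep m) {p q : ZMod 2}
    {y z : g} (hy : y ∈ parity (g := g) p) (hz : z ∈ parity (g := g) q) {f : Space I}
    (hf : f ∈ upto K.par n) :
    K.act y (K.act z f) = ksign p q • K.act z (K.act y f) + K.act (bracket y z) f := by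
  have := upto_le (S := LinearMap.eqLocus (K.act y * K.act z)
    (ksign p q • (K.act z * K.act y) + K.act (bracket y z))) K.par
    (fun m hm f hf => by simpa using h m hm p q y z hy hz f hf) hf
  simpa using this

theorem mul_mul {p q : ZMod 2} {y z : g} (hy : y ∈ parity (g := g) p)
    (hz : z ∈ parity (g := g) q) (f : Space I) :
    K.mul y (K.mul z f) = ksign p q • K.mul z (K.mul y f) := by
  simp only [mul_apply, map_sum, map_smul, Finset.smul_sum]
  rw [Finset.sum_comm]
  refine Finset.sum_congr rfl fun i _ => Finset.sum_congr rfl fun j _ => ?_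
  by_cases h1 : p = K.par i
  · by_cases h2 : q = K.par j
    · rw [create_create K.key K.par K.key_inj i j, h1, h2]
      module
    · simp [K.coord_par hz h2]
  · simp [K.coord_par hy h1]

theorem annih_mul {q : ZMod 2} {z : g} (hz : z ∈ parity (g := g) q) (i : I) (f : Space I) :
    annih K.key K.par i (K.mul z f) = K.coord i z • f +
      ksign q (K.par i) • K.mul z (annih K.key K.par i f) := by
  simp only [mul_apply, map_sum, map_smul, annih_create K.key K.par K.key_inj, smul_add,
    Finset.sum_add_distrib, Finset.smul_sum]
  congr 1
  · simp
  · refine Finset.sum_congr rfl fun j _ => ?_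
    by_cases h1 : q = K.par j
    · rw [h1, ksign_comm, smul_comm]
    · simp [K.coord_par hz h1]

/-- The representation property in terms of the deviation. -/
theorem corr_mul_iff {p q : ZMod 2} {y z : g} (hy : y ∈ parity (g := g) p)
    (hz : z ∈ parity (g := g) q) (f : Space I) :
    K.act y (K.act z f) = ksign p q • K.act z (K.act y f) + K.act (bracket y z) f ↔
    K.corr y (K.mul z f) = ksign p q • K.corr z (K.mul y f) + K.curv (ksign p q) y z f := by
  have h := K.mul_mul hy hz f
  rw [curv_apply, K.act_eq z f, K.act_eq y f, map_add, map_add, K.act_eq y (K.mul z f),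
    K.act_eq z (K.mul y f)]
  constructor
  · intro h'
    linear_combination (norm := module) h' - h
  · intro h'
    linear_combination (norm := module) h' + h

theorem ksign_eq_one_or (p q : ZMod 2) : ksign p q = 1 ∨ ksign p q = -1 := by
  unfold ksign; split_ifs <;> simp

/-- The Bianchi identity for the curvature. -/
theorem bianchi {n : ℕ} (hrep : ∀ m ≤ n, K.IsRep m) {p q o : ZMod 2} {y z w : g}
    (hy : y ∈ parity (g := g) p) (hz : z ∈ parity (g := g) q) (hw : w ∈ parity (g := g) o)
    {f : Space I} (hf : f ∈ homog K.par n) :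
    K.curv (ksign p q) y z (K.mul w f) - ksign q o • K.curv (ksign p o) y w (K.mul z f) +
      (ksign p q * ksign p o) • K.curv (ksign q o) z w (K.mul y f) = 0 := by
  -- The `k` state the representation property through the deviation, acted on by the third vector;
  -- the `c` apply it to deviations, which is allowed because these do not raise degrees; the `b`
  -- treat the brackets and `j` is the Jacobi identity. Their combination leaves only curvature
  -- terms.
  have k1 := congrArg (K.act y) ((K.corr_mul_iff hz hw f).mp (hrep n le_rfl q o z w hz hw f hf))
  have k2 := congrArg (K.act z) ((K.corr_mul_iff hy hw f).mp (hrep n le_rfl p o y w hy hw f hf))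
  have k3 := congrArg (K.act w) ((K.corr_mul_iff hy hz f).mp (hrep n le_rfl p q y z hy hz f hf))
  have c1 := IsRep.upto hrep hy hz (K.corr_mem_homog w hf)
  have c2 := IsRep.upto hrep hy hw (K.corr_mem_homog z hf)
  have c3 := IsRep.upto hrep hz hw (K.corr_mem_homog y hf)
  have b1 := hrep n le_rfl _ _ _ _ (bracket_mem hy hz) hw f hf
  have b2 := hrep n le_rfl _ _ _ _ (bracket_mem hy hw) hz f hf
  have b3 := hrep n le_rfl _ _ _ _ (bracket_mem hz hw) hy f hf
  have j1 := jacobi hy hz w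
  rw [skew hy (bracket_mem hz hw), skew hz (bracket_mem hy hw)] at j1
  have j := congrArg (fun v => K.act v f) j1
  rw [ksign_add_left] at b1 b2 b3
  rw [ksign_add_right, ksign_add_right] at j
  rw [ksign_comm q p, ksign_comm o p] at b3
  rw [ksign_comm o q] at b2
  rw [ksign_comm q p] at j
  simp only [curv_apply, map_add, map_sub, map_smul, map_neg, LinearMap.add_apply,
    LinearMap.smul_apply, LinearMap.neg_apply] at k1 k2 k3 j ⊢
  rw [K.act_eq w f, map_add] at b1
  rw [K.act_eq z f, map_add] at b2
  rw [K.act_eq y f, map_add] at b3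
  rcases ksign_eq_one_or p q with hs | hs <;> rcases ksign_eq_one_or p o with ht | ht <;>
    rcases ksign_eq_one_or q o with hu | hu <;> 
    linear_combination (norm := (simp only [hs, ht, hu]; module)) (-1 : ℂ) • k1 +
      ksign p q • k2 - (ksign q o * ksign p o) • k3 + c1 - ksign q o • c2 +
      (ksign p q * ksign p o) • c3 + b1 - ksign q o • b2 + (ksign p q * ksign p o) • b3 - j

end InductionData

/-! ### Integrability of the corrected action and the PBW theorem. -/

namespace InductionData

open SuperFock

set_option linter.unusedSectionVars false

variable {g : Type*} [AddCommGroup g] [Module ℂ g] [LieSuperalgebra g]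
  {I : Type*} [Fintype I] [DecidableEq I] (K : InductionData g I)

theorem curv_smul_left (s c : ℂ) (y z : g) : K.curv s (c • y) z = c • K.curv s y z := by
  refine LinearMap.ext fun f => ?_
  simp only [curv_apply, map_smul, LinearMap.smul_apply]
  module

theorem curv_smul_right (s c : ℂ) (y z : g) : K.curv s y (c • z) = c • K.curv s y z := by
  refine LinearMap.ext fun f => ?_
  simp only [curv_apply, map_smul, LinearMap.smul_apply]
  module

theorem curv_sum_right {ι : Type*} (t : Finset ι) (s : ℂ) (y : g) (z : ι → g) :
    K.curv s y (∑ i ∈ t, z i) = ∑ i ∈ t, K.curv s y (z i) := by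
  refine LinearMap.ext fun f => ?_
  simp only [curv_apply, map_sum, LinearMap.sum_apply, Finset.sum_add_distrib,
    Finset.sum_sub_distrib, Finset.smul_sum]

theorem curv_swap {p q : ZMod 2} {y z : g} (hy : y ∈ parity (g := g) p)
    (hz : z ∈ parity (g := g) q) (f : Space I) :
    ksign p q • K.curv (ksign q p) z y f = -K.curv (ksign p q) y z f := by
  simp only [curv_apply]
  rw [skew hz hy, ksign_comm q p]
  simp only [map_neg, map_smul, LinearMap.neg_apply, LinearMap.smul_apply]
  rcases ksign_eq_one_or p q with hs | hs <;> simp only [hs] <;> module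

theorem coord_compl (i : I) (y : g) : K.coord i (K.compl y) = K.coord i y := by
  simp [compl_apply, coord_x]

theorem compl_compl (y : g) : K.compl (K.compl y) = K.compl y := by
  rw [compl_apply, K.compl_apply y]
  simp only [← K.compl_apply y, coord_compl]

theorem coord_eq_zero {y : g} (hy : K.compl y = 0) (i : I) : K.coord i y = 0 := by
  rw [← coord_compl, hy, map_zero]

theorem mul_eq_zero {y : g} (hy : K.compl y = 0) (f : Space I) : K.mul y f = 0 := by
  simp [mul_apply, K.coord_eq_zero hy]

/-- The Leibniz rule splits the derivative of `z f` into a coordinate of `z` times `f` and `z` times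
a derivative of `f`. The coordinates reassemble to the component of `z` in the complement. -/
theorem corr_mul_expand {n : ℕ} {p q : ZMod 2} {y z : g} (hy : y ∈ parity (g := g) p)
    (hz : z ∈ parity (g := g) q) {c : ℂ} (hc : c ≠ 0) (hs : K.scale n y = c⁻¹ • y)
    {f : Space I} (hf : f ∈ homog K.par n) :
    c • K.corr y (K.mul z f) = K.curv (ksign p q) y (K.compl z) f +
      ∑ i, ksign q (K.par i) • K.curv (ksign p (K.par i)) y (K.x i)
        (K.mul z (annih K.key K.par i f)) := by
  rw [K.corr_succ hy (K.mul_mem z hf), hs]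
  simp only [curv_smul_left, LinearMap.smul_apply]
  rw [← Finset.smul_sum, smul_smul, mul_inv_cancel₀ hc, one_smul, compl_apply, curv_sum_right,
    LinearMap.sum_apply, ← Finset.sum_add_distrib]
  refine Finset.sum_congr rfl fun i _ => ?_
  rw [K.annih_mul hz, map_add, map_smul, map_smul, curv_smul_right, LinearMap.smul_apply]
  congr 1
  by_cases h : q = K.par i
  · rw [h]
  · rw [K.coord_par hz h, zero_smul, zero_smul]

/-- By Euler's formula `n f` is the sum of the `x_i ∂_i f`. The Bianchi identity for `y`, `z`,
`x_i`, at `∂_i f` of degree one less, trades each term for the two curvatures with `x_i`. -/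
theorem curv_euler {n : ℕ} (hrep : ∀ m < n, K.IsRep m) {p q : ZMod 2} {y z : g}
    (hy : y ∈ parity (g := g) p) (hz : z ∈ parity (g := g) q) {f : Space I}
    (hf : f ∈ homog K.par n) :
    (n : ℂ) • K.curv (ksign p q) y z f =
      ∑ i, ksign q (K.par i) • K.curv (ksign p (K.par i)) y (K.x i)
        (K.mul z (annih K.key K.par i f)) -
      ksign p q • ∑ i, ksign p (K.par i) • K.curv (ksign q (K.par i)) z (K.x i)
        (K.mul y (annih K.key K.par i f)) := by
  cases n with
  | zero => simp [annih_zero K.key K.par _ hf]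
  | succ n =>
    rw [← map_smul, ← euler K.key K.par hf, map_sum, Finset.smul_sum, ← Finset.sum_sub_distrib]
    refine Finset.sum_congr rfl fun i _ => ?_
    have h := K.bianchi (fun m hm => hrep m (by omega)) hy hz (K.x_mem i)
      (annih_mem K.key K.par i hf)
    rw [mul_x] at h
    linear_combination (norm := module) h

theorem scale_of_compl (n : ℕ) {y : g} {v : ℂ} (hv : v = 0 ∨ v = 1) (h : K.compl y = v • y) :
    K.scale n y = ((n : ℂ) + 1 + v)⁻¹ • y := by
  simp only [scale, LinearMap.add_apply, LinearMap.smul_apply, LinearMap.sub_apply,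
    LinearMap.id_apply, h]
  rcases hv with rfl | rfl
  · simp
  · rw [one_smul, sub_self, smul_zero, zero_add, add_assoc, one_add_one_eq_two]

/-- The two expansions and Euler's formula give `(n+1+v) A - ε (n+1+w) A' = (n+v+w) Ω`, where `A`,
`A'` are the two deviations, `Ω` the curvature, and `v`, `w` are `1` on the complement and `0` on
`m`. For `v = w = 1` the coefficients agree; if exactly one is `0`, the deviation multiplied by a
vector of `m` vanishes; if both are `0`, only `n Ω = 0` remains. -/
theorem corr_mul_of_compl {n : ℕ} (hrep : ∀ m < n, K.IsRep m) {p q : ZMod 2} {y z : g}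
    (hy : y ∈ parity (g := g) p) (hz : z ∈ parity (g := g) q) {v w : ℂ} (hv : v = 0 ∨ v = 1)
    (hw : w = 0 ∨ w = 1) (hyv : K.compl y = v • y) (hzw : K.compl z = w • z) {f : Space I}
    (hf : f ∈ homog K.par n) :
    K.corr y (K.mul z f) = ksign p q • K.corr z (K.mul y f) + K.curv (ksign p q) y z f := by
  have hne : ∀ v : ℂ, v = 0 ∨ v = 1 → (n : ℂ) + 1 + v ≠ 0 := by
    rintro v (rfl | rfl)
    · rw [add_zero]; exact Nat.cast_add_one_ne_zero n
    · have := Nat.cast_add_one_ne_zero (R := ℂ) (n + 1)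
      push_cast at this; exact this
  have h1 := K.corr_mul_expand hy hz (hne v hv) (K.scale_of_compl n hv hyv) hf
  have h2 := K.corr_mul_expand hz hy (hne w hw) (K.scale_of_compl n hw hzw) hf
  have h3 := K.curv_euler hrep hy hz hf
  have h4 := K.curv_swap hy hz f
  rw [hzw, curv_smul_right, LinearMap.smul_apply] at h1
  rw [hyv, curv_smul_right, LinearMap.smul_apply] at h2
  have main : ((n : ℂ) + 1 + v) • K.corr y (K.mul z f) -
      (ksign p q * ((n : ℂ) + 1 + w)) • K.corr z (K.mul y f) =
      ((n : ℂ) + v + w) • K.curv (ksign p q) y z f := by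
    linear_combination (norm := module) h1 - ksign p q • h2 - h3 - v • h4
  have cancel : ∀ {a : ℂ} {u w : Space I}, a ≠ 0 → a • u = a • w → u = w :=
    fun ha h => smul_right_injective _ ha h
  rcases hv with rfl | rfl <;> rcases hw with rfl | rfl
  · have hy0 : K.compl y = 0 := by rw [hyv, zero_smul]
    have hz0 : K.compl z = 0 := by rw [hzw, zero_smul]
    rw [K.mul_eq_zero hy0, K.mul_eq_zero hz0] at main ⊢
    simp only [map_zero, smul_zero, sub_zero, add_zero, zero_add] at main ⊢
    -- Degree `0` is the only case in which it matters that `m` is a subalgebra and that `χ`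
    -- vanishes on `[m, m]`.
    rcases Nat.eq_zero_or_pos n with rfl | hn
    · have hb : K.compl (bracket y z) = 0 := by
        simp [compl_apply, K.coord_bracket (K.coord_eq_zero hy0) (K.coord_eq_zero hz0)]
      rw [curv_apply, act_eq, K.corr_zero _ hf, K.corr_zero _ hf, K.corr_zero _ hf,
        K.mul_eq_zero hb, K.chi_bracket (K.coord_eq_zero hy0) (K.coord_eq_zero hz0), map_smul,
        map_smul, act_eq, act_eq, K.mul_eq_zero hy0, K.mul_eq_zero hz0, K.corr_zero _ hf,
        K.corr_zero _ hf]
      rcases zmod2_cases p with rfl | rfl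
      · rw [ksign_zero_left]; module
      · rw [K.chi_odd hy]; module
    · exact (smul_eq_zero.mp main.symm).resolve_left (Nat.cast_ne_zero.mpr hn.ne') |>.symm
  · have hy0 : K.compl y = 0 := by rw [hyv, zero_smul]
    rw [K.mul_eq_zero hy0, map_zero, smul_zero] at main ⊢
    refine cancel (hne 0 (Or.inl rfl)) ?_
    linear_combination (norm := module) main
  · have hz0 : K.compl z = 0 := by rw [hzw, zero_smul]
    rw [K.mul_eq_zero hz0, map_zero, smul_zero] at main
    rw [K.mul_eq_zero hz0, map_zero]
    refine cancel (hne 0 (Or.inl rfl)) ?_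
    linear_combination (norm := module) main
  · refine cancel (hne 1 (Or.inr rfl)) ?_
    linear_combination (norm := module) main

theorem isRep (n : ℕ) : K.IsRep n := by
  induction n using Nat.strong_induction_on with
  | _ n ih =>
    intro p q y z hy hz f hf
    have base : ∀ {y z : g}, y ∈ parity (g := g) p → z ∈ parity (g := g) q →
        (K.compl y = 0 ∨ K.compl y = y) → (K.compl z = 0 ∨ K.compl z = z) →
        K.act y (K.act z f) = ksign p q • K.act z (K.act y f) + K.act (bracket y z) f := by
      intro y z hy hz h1 h2
      rw [K.corr_mul_iff hy hz]
      have key : ∀ {y : g}, (K.compl y = 0 ∨ K.compl y = y) →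
          ∃ v : ℂ, (v = 0 ∨ v = 1) ∧ K.compl y = v • y := by
        rintro y (h | h)
        · exact ⟨0, Or.inl rfl, by rw [h, zero_smul]⟩
        · exact ⟨1, Or.inr rfl, by rw [h, one_smul]⟩
      obtain ⟨v, hv, hyv⟩ := key h1
      obtain ⟨w, hw, hzw⟩ := key h2
      exact K.corr_mul_of_compl ih hy hz hv hw hyv hzw hf
    have c1 : ∀ y, K.compl (K.compl y) = 0 ∨ K.compl (K.compl y) = K.compl y :=
      fun y => Or.inr (K.compl_compl y)
    have c2 : ∀ y, K.compl (y - K.compl y) = 0 ∨ K.compl (y - K.compl y) = y - K.compl y :=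
      fun y => Or.inl (by rw [map_sub, compl_compl, sub_self])
    have e1 := base (K.compl_mem hy) (K.compl_mem hz) (c1 y) (c1 z)
    have e2 := base (K.compl_mem hy) (sub_mem hz (K.compl_mem hz)) (c1 y) (c2 z)
    have e3 := base (sub_mem hy (K.compl_mem hy)) (K.compl_mem hz) (c2 y) (c1 z)
    have e4 := base (sub_mem hy (K.compl_mem hy)) (sub_mem hz (K.compl_mem hz)) (c2 y) (c2 z)
    simp only [map_sub, LinearMap.sub_apply] at e1 e2 e3 e4
    linear_combination (norm := module) e1 + e2 + e3 + e4

theorem act_act {p q : ZMod 2} {y z : g} (hy : y ∈ parity (g := g) p)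
    (hz : z ∈ parity (g := g) q) (f : Space I) :
    K.act y (K.act z f) = ksign p q • K.act z (K.act y f) + K.act (bracket y z) f := by
  induction f using Finsupp.induction_linear with
  | zero => simp
  | add f f' h h' => simp only [map_add, h, h', smul_add]; abel
  | single α c => exact K.isRep _ p q y z hy hz _ (single_mem_homog _ _ _)

/-- The action of the enveloping algebra on the Fock space. -/
noncomputable def ueaAct : UEA g →ₐ[ℂ] End ℂ (Space I) :=
  RingQuot.liftAlgHom ℂ ⟨TensorAlgebra.lift ℂ K.act, by
    rintro _ _ ⟨hx, hy⟩
    rename_i i j x y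
    simp only [map_mul, map_add, map_smul, TensorAlgebra.lift_ι_apply]
    refine LinearMap.ext fun f => ?_
    simpa using K.act_act hx hy f⟩

theorem ueaAct_ι (y : g) : K.ueaAct (UEA.ι g y) = K.act y := by
  have : K.ueaAct (UEA.ι g y) = TensorAlgebra.lift ℂ K.act (TensorAlgebra.ι ℂ y) :=
    RingQuot.liftAlgHom_mkAlgHom_apply ℂ _ _ _
  rw [this, TensorAlgebra.lift_ι_apply]

/-- The vacuum vector. -/
noncomputable def vac : Space I := Finsupp.single 0 1

theorem vac_mem : (vac : Space I) ∈ homog K.par 0 := by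
  have : deg K.par (0 : I → ℕ) = 0 := by simp [deg, occ]
  have h := single_mem_homog K.par (0 : I → ℕ) 1
  rwa [this] at h

theorem ueaAct_vac {y : g} (hy : ∀ i, K.coord i y = 0) :
    K.ueaAct (UEA.ι g y - algebraMap ℂ (UEA g) (K.chi y)) vac = 0 := by
  rw [map_sub, ueaAct_ι, AlgHom.commutes, LinearMap.sub_apply, act_eq, mul_apply,
    K.corr_zero _ K.vac_mem]
  simp [hy, Algebra.algebraMap_eq_smul_one]

/-- The order in which letters may follow each other in a normal word. -/
def Before (key : I → ℕ) (par : I → ZMod 2) (i j : I) : Prop :=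
  key i < key j ∨ (i = j ∧ par i = 0)

/-- The word `x_{i_1} ⋯ x_{i_k}` of `U(g)`. -/
noncomputable def word {J : Type*} (x : J → g) (w : List J) : UEA g :=
  (w.map fun i => UEA.ι g (x i)).prod

/-- Read from the right, each new letter comes before all letters already present, so no sign
arises, and an odd letter is never repeated. Normal words thus produce basis vectors with
coefficient `1`. -/
theorem create_vac (w : List I) (hw : w.Pairwise (Before K.key K.par)) :
    (w.map fun i => create K.key K.par i).foldr (fun A f => A f) vac =
      Finsupp.single (fun i => w.count i) 1 ∧
    deg K.par (fun i => w.count i) = w.length := by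
  induction w with
  | nil => exact ⟨rfl, by simp [deg, occ]⟩
  | cons i w ih =>
    obtain ⟨h1, h2⟩ := List.pairwise_cons.mp hw
    obtain ⟨ih1, ih2⟩ := ih h2
    have hc : (fun j => (i :: w).count j) = (fun j => w.count j) + Pi.single i 1 := by
      ext j
      by_cases h : j = i
      · subst h; simp
      · simp [h, List.count_cons_of_ne (Ne.symm h)]
    have hodd : ¬ (K.par i = 1 ∧ w.count i % 2 = 1) := by
      rintro ⟨hp, hm⟩
      have : i ∈ w := by
        rw [← List.count_pos_iff]; omega
      rcases h1 i this with h | ⟨-, h⟩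
      · exact lt_irrefl _ h
      · rw [hp] at h; exact one_ne_zero h
    have heps : eps K.key K.par i (fun j => w.count j) = 1 := by
      unfold eps
      refine Finset.prod_eq_one fun j _ => ?_
      split_ifs with h
      · have : w.count j = 0 := by
          rw [List.count_eq_zero]
          intro hj
          rcases h1 j hj with h' | ⟨h', -⟩
          · omega
          · subst h'; exact lt_irrefl _ h
        simp only [this, pow_zero]
      · rfl
    refine ⟨?_, ?_⟩
    · rw [List.map_cons, List.foldr_cons, ih1, create_single, if_neg hodd, heps, hc, one_mul]
    · rw [hc, deg_add_single K.par i _ hodd, ih2, List.length_cons]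

/-- A letter acts as a creation operator plus a deviation that does not raise the degree. Everything
except the product of the creation operators thus has degree below the length of the word. -/
theorem ueaAct_word (w : List I) (hw : w.Pairwise (Before K.key K.par)) :
    ∃ f, (∀ α, w.length ≤ deg K.par α → f α = 0) ∧
      K.ueaAct (word K.x w) vac = Finsupp.single (fun i => w.count i) 1 + f := by
  obtain ⟨h1, h2⟩ := K.create_vac w hw
  rw [← h1]
  clear h1 h2
  suffices ∀ w : List I,
      (w.map fun i => create K.key K.par i).foldr (fun A f => A f) vac ∈ homog K.par w.length ∧
      ∃ f, (∀ α, w.length ≤ deg K.par α → f α = 0) ∧ K.ueaAct (word K.x w) vac =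
      (w.map fun i => create K.key K.par i).foldr (fun A f => A f) vac + f from (this w).2
  intro w
  induction w with
  | nil => exact ⟨K.vac_mem, 0, by simp, by simp [word]⟩
  | cons i w ih =>
    obtain ⟨ih1, f, hf, ih2⟩ := ih
    refine ⟨create_mem _ _ _ ih1, K.act (K.x i) f +
      K.corr (K.x i) ((w.map fun i => create K.key K.par i).foldr (fun A f => A f) vac),
      ?_, ?_⟩
    · have m2 := K.corr_mem_homog (K.x i) ih1
      have m1 : K.act (K.x i) f ∈ upto K.par w.length := by
        cases hl : w.length with
        | zero =>
          have : f = 0 := by ext α; exact hf α (by omega)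
          rw [this, map_zero]; exact zero_mem _
        | succ k =>
          have : f ∈ upto K.par k := by
            rw [upto, Finsupp.mem_supported]
            intro α hα
            by_contra h
            have h' : ¬ deg K.par α ≤ k := h
            exact Finsupp.mem_support_iff.mp hα (hf α (by omega))
          rw [act_eq]
          refine add_mem (upto_le (S := (upto K.par (k + 1)).comap (K.mul (K.x i))) K.par
            (fun m hm v hv => homog_le_upto K.par (by omega) (K.mul_mem _ hv)) this) ?_
          exact upto_mono K.par (by omega) (K.corr_mem _ this)
      intro α hα
      have := add_mem m1 m2
      rw [upto, Finsupp.mem_supported] at this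
      by_contra h
      have h' : deg K.par α ≤ w.length := this (Finsupp.mem_support_iff.mpr h)
      rw [List.length_cons] at hα
      omega
    · have : word K.x (i :: w) = UEA.ι g (K.x i) * word K.x w := by simp [word]
      rw [this, map_mul, ueaAct_ι]
      change K.act (K.x i) (K.ueaAct (word K.x w) vac) = _
      rw [ih2, map_add, K.act_eq (K.x i) (List.foldr _ _ _), mul_x, List.map_cons,
        List.foldr_cons]
      abel

/-- **Poincaré–Birkhoff–Witt theorem** for induced modules: the normal words in a basis of a
complement of `m` are linearly independent modulo the left ideal generated by the `y - chi y`,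
`y ∈ m`. -/
theorem coeff_eq_zero {S : Submodule (UEA g) (UEA g)}
    (hS : S ≤ Submodule.span (UEA g)
      {u | ∃ y, (∀ i, K.coord i y = 0) ∧ u = UEA.ι g y - algebraMap ℂ (UEA g) (K.chi y)})
    (c : {w : List I // w.Pairwise (Before K.key K.par)} →₀ ℂ)
    (hc : (c.sum fun w a => a • word K.x w.1) ∈ S) : c = 0 := by
  have hker : ∀ u ∈ S, K.ueaAct u vac = 0 := by
    intro u hu
    have hu' := hS hu
    clear hu
    induction hu' using Submodule.span_induction with
    | mem u h =>
      obtain ⟨y, hy, rfl⟩ := h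
      exact K.ueaAct_vac hy
    | zero => simp
    | add u v _ _ h1 h2 => rw [map_add, LinearMap.add_apply, h1, h2, add_zero]
    | smul a u _ h =>
      rw [smul_eq_mul, map_mul]
      change K.ueaAct a (K.ueaAct u vac) = 0
      rw [h, map_zero]
  have h0 := hker _ hc
  by_contra hne
  -- At the multi-index of a longest word, other words contribute neither by their remainders, whose
  -- degree is too small, nor by their leading terms, because a normal word is determined by its
  -- letter counts.
  obtain ⟨w, hw, hmax⟩ := Finset.exists_max_image c.support (fun w => w.1.length)
    (Finsupp.support_nonempty_iff.mpr hne)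
  have h1 := congrArg (fun v : Space I => v (fun i => w.1.count i)) h0
  rw [Finsupp.sum, map_sum, LinearMap.sum_apply] at h1
  simp only [Finsupp.finsetSum_apply, map_smul, LinearMap.smul_apply, Finsupp.smul_apply] at h1
  rw [Finset.sum_eq_single w] at h1
  · obtain ⟨f, hf, hfw⟩ := K.ueaAct_word w.1 w.2
    rw [hfw, Finsupp.add_apply, hf _ (K.create_vac w.1 w.2).2.ge] at h1
    simp at h1
    exact Finsupp.mem_support_iff.mp hw h1
  · intro v hv hvw
    obtain ⟨f, hf, hfv⟩ := K.ueaAct_word v.1 v.2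
    rw [hfv, Finsupp.add_apply, hf _ ((hmax v hv).trans (K.create_vac w.1 w.2).2.ge)]
    rw [Finsupp.single_apply, if_neg]
    · simp
    · intro he
      apply hvw
      have hp : v.1.Perm w.1 := List.perm_iff_count.mpr fun i => congrFun he i
      refine Subtype.ext (hp.eq_of_pairwise (le := Before K.key K.par) ?_ v.2 w.2)
      rintro i j - - (h | ⟨h, -⟩) (h' | ⟨h', -⟩)
      · omega
      · exact h'.symm
      · exact h
      · exact h
  · intro h; exact absurd hw h

end InductionData

/-! ## Representations of `sl₂` -/

section SlTwo

variable {V : Type*} [AddCommGroup V] [Module ℂ V]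

/-- Lagrange interpolation: if `Q` is the product of the other factors, `Q(H) v / Q(a_i)` is the
component of `v` for `a_i`. It stays in `S` because `S` is stable under polynomials in `H`. -/
theorem mem_iSup_inf_eigenspace (H : End ℂ V) {S : Submodule ℂ V} (hS : ∀ v ∈ S, H v ∈ S)
    {ι : Type*} (a : ι → ℂ) (ha : Function.Injective a) (s : Finset ι) {v : V} (hv : v ∈ S)
    (h : Polynomial.aeval H (∏ i ∈ s, (Polynomial.X - Polynomial.C (a i))) v = 0) :
    v ∈ ⨆ i : ι, S ⊓ End.eigenspace H (a i) := by
  classical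
  have hpol : ∀ (P : Polynomial ℂ), ∀ v ∈ S, Polynomial.aeval H P v ∈ S := by
    intro P v hv
    induction P using Polynomial.induction_on' with
    | add P Q h1 h2 => rw [map_add, LinearMap.add_apply]; exact add_mem h1 h2
    | monomial n c =>
      rw [Polynomial.aeval_monomial, Module.End.mul_apply, Module.algebraMap_end_apply]
      refine Submodule.smul_mem _ _ ?_
      induction n with
      | zero => simpa using hv
      | succ n ih => rw [pow_succ', Module.End.mul_apply]; exact hS _ ih
  induction s using Finset.induction_on generalizing v with
  | empty => simp at h; rw [h]; exact zero_mem _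
  | insert i s hi ih =>
    rw [Finset.prod_insert hi] at h
    set Q : Polynomial ℂ := ∏ i ∈ s, (Polynomial.X - Polynomial.C (a i)) with hQ
    have hQa : Q.eval (a i) ≠ 0 := by
      rw [hQ, Polynomial.eval_prod]
      refine Finset.prod_ne_zero_iff.mpr fun j hj => ?_
      rw [Polynomial.eval_sub, Polynomial.eval_X, Polynomial.eval_C, sub_ne_zero]
      intro h
      exact hi (ha h ▸ hj)
    set v1 := Polynomial.aeval H Q v with hv1
    have e1 : H v1 = a i • v1 := by
      rw [map_mul, Module.End.mul_apply, map_sub, LinearMap.sub_apply, Polynomial.aeval_X,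
        Polynomial.aeval_C, Module.algebraMap_end_apply] at h
      exact sub_eq_zero.mp h
    have e2 : Polynomial.aeval H Q v1 = Q.eval (a i) • v1 :=
      Module.End.aeval_apply_of_mem_apply_eq_smul e1
    have e3 : v - (Q.eval (a i))⁻¹ • v1 ∈ ⨆ i : ι, S ⊓ End.eigenspace H (a i) := by
      refine ih (sub_mem hv (Submodule.smul_mem _ _ (hpol Q v hv))) ?_
      rw [map_sub, map_smul, e2, smul_smul, inv_mul_cancel₀ hQa, one_smul, ← hv1, sub_self]
    have e4 : v1 ∈ ⨆ i : ι, S ⊓ End.eigenspace H (a i) :=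
      Submodule.mem_iSup_of_mem i ⟨hpol Q v hv, End.mem_eigenspace_iff.mpr e1⟩
    have := add_mem e3 (Submodule.smul_mem _ (Q.eval (a i))⁻¹ e4)
    rwa [sub_add_cancel] at this

variable {E H F : End ℂ V}

theorem commute_pow_of_lie {c : ℂ} (h : H * E = E * H + c • E) (n : ℕ) :
    H * E ^ n = E ^ n * H + (n * c) • E ^ n := by
  induction n with
  | zero => simp
  | succ n ih =>
    rw [pow_succ, ← mul_assoc, ih, add_mul, mul_assoc, h, mul_add, ← mul_assoc]
    rw [smul_mul_assoc, mul_smul_comm]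
    push_cast
    module

/-- Nonzero powers `E ^ n` would be eigenvectors of `ad H` on the finite-dimensional space of
endomorphisms, with infinitely many eigenvalues `n c`. -/
theorem exists_pow_eq_zero_of_lie [FiniteDimensional ℂ V] {c : ℂ} (hc : c ≠ 0)
    (h : H * E = E * H + c • E) : ∃ n, E ^ n = 0 := by
  by_contra! hne
  let A : End ℂ (End ℂ V) := LinearMap.mulLeft ℂ H - LinearMap.mulRight ℂ H
  have hev : ∀ n : ℕ, A.HasEigenvalue (n * c) := fun n =>
    End.hasEigenvalue_of_hasEigenvector (x := E ^ n) ⟨by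
      rw [End.mem_eigenspace_iff]
      simp only [A, LinearMap.sub_apply, LinearMap.mulLeft_apply, LinearMap.mulRight_apply,
        commute_pow_of_lie h n, add_sub_cancel_left], hne n⟩
  have hinf : (Set.range fun n : ℕ => (n * c : ℂ)).Infinite :=
    Set.infinite_range_of_injective fun m n hmn => by
      simpa using mul_right_cancel₀ hc hmn
  exact hinf (A.finite_hasEigenvalue.subset (by rintro _ ⟨n, rfl⟩; exact hev n))

variable (hE : H * E = E * H + (2 : ℂ) • E) (hF : H * F = F * H + (-2 : ℂ) • F)
  (hEF : E * F = F * E + H)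

include hF hEF in
theorem raise_lower_succ (n : ℕ) {v : V} (hv : E v = 0) :
    E ((F ^ (n + 1)) v) = ((n : ℂ) + 1) • (F ^ n) (H v - (n : ℂ) • v) := by
  have hEF' : ∀ w, E (F w) = F (E w) + H w := fun w => LinearMap.congr_fun hEF w
  have hFp : ∀ (n : ℕ) w, H ((F ^ n) w) = (F ^ n) (H w) + ((n : ℂ) * (-2)) • (F ^ n) w :=
    fun n w => LinearMap.congr_fun (commute_pow_of_lie hF n) w
  induction n with
  | zero => simp [hEF', hv]
  | succ n ih =>
    rw [pow_succ' F (n + 1), Module.End.mul_apply, hEF', ih, hFp]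
    simp only [map_smul, map_sub]
    have h1 : ∀ w, F ((F ^ n) w) = (F ^ (n + 1)) w := fun w => by
      rw [pow_succ', Module.End.mul_apply]
    rw [h1, h1]
    push_cast
    module

include hE hF hEF in
-- On `ker E`, raising once after `n + 1` lowerings costs a factor `(n + 1)(H - n)`, and `H - n`
-- preserves `ker E`. As `F` is nilpotent, this yields a polynomial with simple natural roots that
-- annihilates `H` on `ker E`.
theorem raise_lower (n : ℕ) {v : V} (hv : E v = 0) :
    (E ^ n) ((F ^ n) v) = (n.factorial : ℂ) • Polynomial.aeval H
      (∏ k ∈ Finset.range n, (Polynomial.X - Polynomial.C (k : ℂ))) v := by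
  have hE' : ∀ w, H (E w) = E (H w) + (2 : ℂ) • E w := fun w => LinearMap.congr_fun hE w
  induction n generalizing v with
  | zero => simp
  | succ n ih =>
    have hv' : E (H v - (n : ℂ) • v) = 0 := by
      have := hE' v
      rw [hv, map_zero, smul_zero, add_zero] at this
      rw [map_sub, map_smul, hv, ← this, smul_zero, sub_zero]
    have hX : Polynomial.aeval H (Polynomial.X - Polynomial.C (n : ℂ)) v = H v - (n : ℂ) • v := by
      rw [map_sub, LinearMap.sub_apply, Polynomial.aeval_X, Polynomial.aeval_C,
        Module.algebraMap_end_apply]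
    rw [Finset.prod_range_succ, map_mul, Module.End.mul_apply, hX, pow_succ E,
      Module.End.mul_apply, raise_lower_succ hF hEF n hv, map_smul, ih hv', smul_smul,
      Nat.factorial_succ]
    push_cast
    rfl

include hE hF hEF in
theorem aeval_prod_eq_zero [FiniteDimensional ℂ V] : ∃ n : ℕ, ∀ v, E v = 0 →
    Polynomial.aeval H (∏ k ∈ Finset.range n, (Polynomial.X - Polynomial.C (k : ℂ))) v = 0 := by
  obtain ⟨n, hn⟩ := exists_pow_eq_zero_of_lie (by norm_num : (-2 : ℂ) ≠ 0) hF
  refine ⟨n, fun v hv => ?_⟩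
  have := raise_lower hE hF hEF n hv
  rw [hn, LinearMap.zero_apply, map_zero] at this
  exact (smul_eq_zero.mp this.symm).resolve_left (Nat.cast_ne_zero.mpr n.factorial_ne_zero)

include hE hF hEF in
theorem weight_nonneg_of_raise_eq_zero [FiniteDimensional ℂ V] {k : ℤ} {v : V} (hv : E v = 0)
    (hk : H v = (k : ℂ) • v) (hne : v ≠ 0) : 0 ≤ k := by
  obtain ⟨n, hn⟩ := aeval_prod_eq_zero hE hF hEF
  have h1 := hn v hv
  rw [Module.End.aeval_apply_of_mem_apply_eq_smul hk] at h1
  have h2 := (smul_eq_zero.mp h1).resolve_right hne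
  rw [Polynomial.eval_prod, Finset.prod_eq_zero_iff] at h2
  obtain ⟨j, -, hj⟩ := h2
  rw [Polynomial.eval_sub, Polynomial.eval_X, Polynomial.eval_C, sub_eq_zero] at hj
  have : k = j := by exact_mod_cast hj
  omega

include hE hF hEF in
-- Complete reducibility is avoided. On a generalized eigenspace of the Casimir operator `4FE + H² +
-- 2H` for `c`, the operator `H` acts on `ker E` by one natural number `k`, determined by `k² + 2k =
-- c`. Climbing through the kernels of the powers of `E`, one finds that the product of the `H - (k
-- - 2i)` annihilates `ker (E ^ j)`; the roots are distinct integers and `E` is nilpotent.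
theorem iSup_eigenspace_int_eq_top [FiniteDimensional ℂ V] :
    ⨆ k : ℤ, End.eigenspace H (k : ℂ) = ⊤ := by
  have hE' : ∀ w, H (E w) = E (H w) + (2 : ℂ) • E w := fun w => LinearMap.congr_fun hE w
  set C : End ℂ V := (4 : ℂ) • (F * E) + H * H + (2 : ℂ) • H with hC
  have hCE : Commute C E := by
    have h1 : E * H = H * E - (2 : ℂ) • E := by rw [hE]; abel
    change C * E = E * C
    simp only [hC, mul_add, add_mul, mul_smul_comm, smul_mul_assoc]
    rw [← mul_assoc E F E, hEF, ← mul_assoc E H H, h1]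
    simp only [add_mul, sub_mul, mul_assoc, smul_mul_assoc, h1, mul_sub, mul_smul_comm]
    module
  have hCH : Commute C H := by
    have h1 : F * H = H * F + (2 : ℂ) • F := by rw [hF]; module
    have h2 : E * H = H * E - (2 : ℂ) • E := by rw [hE]; abel
    change C * H = H * C
    simp only [hC, mul_add, add_mul, mul_smul_comm, smul_mul_assoc, mul_assoc]
    rw [h2, mul_sub, ← mul_assoc F H E, h1]
    simp only [add_mul, mul_smul_comm, smul_mul_assoc, mul_assoc]
    module
  rw [eq_top_iff, ← Module.End.iSup_maxGenEigenspace_eq_top C, iSup_le_iff]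
  intro c
  set W := C.maxGenEigenspace c with hW
  have hWE : ∀ w ∈ W, E w ∈ W := fun w hw => End.mapsTo_maxGenEigenspace_of_comm hCE c hw
  have hWH : ∀ w ∈ W, H w ∈ W := fun w hw => End.mapsTo_maxGenEigenspace_of_comm hCH c hw
  obtain ⟨N, hN⟩ := aeval_prod_eq_zero hE hF hEF
  -- on `W ∩ ker E`, `H` acts by one scalar
  obtain ⟨k, hk⟩ : ∃ k : ℕ, ∀ v ∈ W, E v = 0 → H v = (k : ℂ) • v := by
    have hspan : ∀ v ∈ W, E v = 0 → v ∈ ⨆ k : ℕ, (W ⊓ LinearMap.ker E) ⊓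
        End.eigenspace H (k : ℂ) := fun v hv h0 =>
      mem_iSup_inf_eigenspace H (S := W ⊓ LinearMap.ker E) (fun w hw => Submodule.mem_inf.mpr ⟨hWH w hw.1, by
        have := hE' w
        rw [LinearMap.mem_ker.mp hw.2, map_zero, smul_zero, add_zero] at this
        exact this.symm⟩) _ Nat.cast_injective (Finset.range N) ⟨hv, h0⟩ (hN v h0)
    have hzero : ∀ (k : ℕ) (v : V), v ∈ (W ⊓ LinearMap.ker E) ⊓ End.eigenspace H (k : ℂ) →
        (k : ℂ) * k + 2 * k ≠ c → v = 0 := by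
      rintro k v ⟨⟨hvW, hvE⟩, hvH⟩ hkc
      have hvH : H v = (k : ℂ) • v := End.mem_eigenspace_iff.mp hvH
      have hvE : E v = 0 := hvE
      obtain ⟨n, hn⟩ := (End.mem_maxGenEigenspace _ _ _).mp hvW
      have hCv : (C - c • 1) v = ((k : ℂ) * k + 2 * k - c) • v := by
        simp only [hC, LinearMap.sub_apply, LinearMap.add_apply, LinearMap.smul_apply,
          Module.End.mul_apply, hvE, hvH, map_smul, map_zero, Module.End.one_apply]
        module
      have hp : ∀ n : ℕ, ((C - c • 1) ^ n) v = (((k : ℂ) * k + 2 * k - c) ^ n) • v := by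
        intro n
        induction n with
        | zero => simp
        | succ n ih => rw [pow_succ, Module.End.mul_apply, hCv, map_smul, ih, smul_smul, pow_succ']
      rw [hp] at hn
      exact (smul_eq_zero.mp hn).resolve_left (pow_ne_zero _ (sub_ne_zero.mpr hkc))
    by_cases hex : ∃ k : ℕ, (k : ℂ) * k + 2 * k = c
    · obtain ⟨k, hkc⟩ := hex
      refine ⟨k, fun v hv h0 => ?_⟩
      have : (⨆ k : ℕ, (W ⊓ LinearMap.ker E) ⊓ End.eigenspace H (k : ℂ)) ≤
          End.eigenspace H (k : ℂ) := by
        refine iSup_le fun j w hw => ?_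
        by_cases hj : (j : ℂ) * j + 2 * j = c
        · have hjk : j = k := by
            have h3 : ((j * j + 2 * j : ℕ) : ℂ) = ((k * k + 2 * k : ℕ) : ℂ) := by
              push_cast; rw [hj, hkc]
            have h4 : j * j + 2 * j = k * k + 2 * k := by exact_mod_cast h3
            nlinarith [lt_trichotomy j k]
          rw [← hjk]; exact hw.2
        · rw [hzero j w hw hj]; exact zero_mem _
      exact End.mem_eigenspace_iff.mp (this (hspan v hv h0))
    · push Not at hex
      refine ⟨0, fun v hv h0 => ?_⟩
      have : (⨆ k : ℕ, (W ⊓ LinearMap.ker E) ⊓ End.eigenspace H (k : ℂ)) ≤ ⊥ :=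
        iSup_le fun j w hw => (Submodule.mem_bot ℂ).mpr (hzero j w hw (hex j))
      rw [(Submodule.mem_bot ℂ).mp (this (hspan v hv h0))]
      simp
  obtain ⟨M, hM⟩ := exists_pow_eq_zero_of_lie (by norm_num : (2 : ℂ) ≠ 0) hE
  have hpow : ∀ (j : ℕ) (w : V), w ∈ W → (E ^ j) w = 0 → Polynomial.aeval H
      (∏ i ∈ Finset.range j,
        (Polynomial.X - Polynomial.C (((k - 2 * i : ℤ)) : ℂ))) w = 0 := by
    intro j
    induction j with
    | zero => intro w _ hw; simpa using hw
    | succ j ih =>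
      intro w hw hj
      have h1 : (E ^ j) w ∈ W := by
        clear ih hj
        induction j with
        | zero => simpa using hw
        | succ j ih => rw [pow_succ', Module.End.mul_apply]; exact hWE _ ih
      rw [pow_succ', Module.End.mul_apply] at hj
      have h2 := hk _ h1 hj
      have h3 : H ((E ^ j) w) = (E ^ j) (H w) + ((j : ℂ) * 2) • (E ^ j) w :=
        LinearMap.congr_fun (commute_pow_of_lie hE j) w
      rw [Finset.prod_range_succ, map_mul, Module.End.mul_apply, map_sub, LinearMap.sub_apply,
        Polynomial.aeval_X, Polynomial.aeval_C, Module.algebraMap_end_apply]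
      refine ih _ (sub_mem (hWH w hw) (Submodule.smul_mem _ _ hw)) ?_
      rw [map_sub, map_smul]
      push_cast
      linear_combination (norm := module) h2 - h3
  intro w hw
  have h1 := mem_iSup_inf_eigenspace H hWH (fun i : ℕ => (((k - 2 * i : ℤ)) : ℂ)) (fun i j hij => by
    have : (k : ℤ) - 2 * i = k - 2 * j := Int.cast_injective hij
    omega) (Finset.range M) hw (hpow M w hw (by rw [hM]; rfl))
  refine (iSup_le fun i => ?_ : _ ≤ ⨆ k : ℤ, End.eigenspace H (k : ℂ)) h1
  exact inf_le_right.trans (le_iSup (fun k : ℤ => End.eigenspace H (k : ℂ)) _)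

theorem eq_iSup_inf_eigenspace_int [FiniteDimensional ℂ V] {H : End ℂ V}
    (htop : ⨆ k : ℤ, End.eigenspace H (k : ℂ) = ⊤) {S : Submodule ℂ V}
    (hS : ∀ v ∈ S, H v ∈ S) : S = ⨆ k : ℤ, S ⊓ End.eigenspace H (k : ℂ) := by
  have h1 : ⨆ μ : ℂ, End.eigenspace H μ = ⊤ := by
    rw [eq_top_iff, ← htop]
    exact iSup_le fun k => le_iSup (fun μ => End.eigenspace H μ) _
  refine le_antisymm ?_ (iSup_le fun k => inf_le_left)
  rw [Submodule.eq_iSup_inf_genEigenspace 1 hS h1]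
  refine iSup_le fun μ => ?_
  by_cases hμ : ∃ k : ℤ, (k : ℂ) = μ
  · obtain ⟨k, rfl⟩ := hμ
    rw [← Submodule.eq_iSup_inf_genEigenspace 1 hS h1]
    exact le_iSup (fun k : ℤ => S ⊓ End.eigenspace H (k : ℂ)) k
  · have hbot : End.eigenspace H μ = ⊥ := by
      have hd := (Module.End.eigenspaces_iSupIndep H) μ
      rw [eq_bot_iff]
      intro v hv
      have : v ∈ ⨆ (ν : ℂ) (_ : ν ≠ μ), End.eigenspace H ν := by
        have hv' : v ∈ ⨆ k : ℤ, End.eigenspace H (k : ℂ) := by rw [htop]; trivial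
        refine (iSup_le fun k => ?_ : _ ≤ ⨆ (ν : ℂ) (_ : ν ≠ μ), End.eigenspace H ν) hv'
        exact le_iSup₂ (f := fun (ν : ℂ) (_ : ν ≠ μ) => End.eigenspace H ν) (k : ℂ)
          (fun h => hμ ⟨k, h⟩)
      exact hd.le_bot ⟨hv, this⟩
    refine le_trans inf_le_right ?_
    exact le_trans (le_of_eq hbot) bot_le

end SlTwo

/-! ## Straightening of words -/

section Straightening

open InductionData

set_option linter.unusedSectionVars false

variable {k : Type*} [AddCommGroup k] [Module ℂ k] [LieSuperalgebra k]
  {Q : Type*} [AddCommGroup Q] [Module ℂ Q] [Module (UEA k) Q] [IsScalarTower ℂ (UEA k) Q]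
  {J : Type*} {Γ : Type*} [AddCommGroup Γ] [PartialOrder Γ] [IsOrderedAddMonoid Γ]

theorem word_nil (x : J → k) : word x [] = 1 := rfl

theorem word_cons (x : J → k) (i : J) (w : List J) :
    word x (i :: w) = UEA.ι k (x i) * word x w := by simp [word]

theorem word_append (x : J → k) (w w' : List J) : word x (w ++ w') = word x w * word x w' := by
  simp [word]

/-- The span of the normal words in the letters `V`, of `δ`-degree at most `n` and length at most
`L`, applied to `v`. -/
def normalSpan (x : J → k) (key : J → ℕ) (par : J → ZMod 2) (V : J → Prop) (δ : J → Γ) (v : Q)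
    (n : Γ) (L : ℕ) : Submodule ℂ Q :=
  Submodule.span ℂ {q | ∃ w : List J, w.Pairwise (Before key par) ∧ (∀ i ∈ w, V i) ∧
    (w.map δ).sum ≤ n ∧ w.length ≤ L ∧ q = word x w • v}

theorem normalSpan_mono {x : J → k} {key : J → ℕ} {par : J → ZMod 2} {V : J → Prop} {δ : J → Γ}
    {v : Q} {n n' : Γ} {L L' : ℕ} (hn : n ≤ n') (hL : L ≤ L') :
    normalSpan x key par V δ v n L ≤ normalSpan x key par V δ v n' L' := by
  refine Submodule.span_mono ?_
  rintro q ⟨w, h1, h2, h3, h4, h5⟩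
  exact ⟨w, h1, h2, h3.trans hn, h4.trans hL, h5⟩

/-- The hypotheses under which words in the letters `A` applied to normal words can be
straightened compatibly with the degree `δ`. -/
structure Straightens (x : J → k) (key : J → ℕ) (par : J → ZMod 2) (chi : k →ₗ[ℂ] ℂ)
    (V A : J → Prop) (δ : J → Γ) (v : Q) : Prop where
  key_inj : Function.Injective key
  mem : ∀ i, x i ∈ parity (g := k) (par i)
  odd : ∀ i, par i = 1 → chi (x i) = 0
  vac : ∀ i, A i → ¬ V i → UEA.ι k (x i) • v = chi (x i) • v
  normal : ∀ i, V i → chi (x i) = 0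
  last : ∀ i j, ¬ V i → V j → key j < key i
  act : ∀ i j, A i → V j → key j < key i → A j
  bracket : ∀ i j, A i → V j → key j < key i ∨ i = j →
    bracket (x i) (x j) ∈ Submodule.span ℂ (x '' {l | A l ∧ δ l ≤ δ i + δ j})
  chi_bracket : ∀ i j, A i → V j → key j < key i ∨ i = j →
    chi (LieSuperalgebra.bracket (x i) (x j)) ≠ 0 → 0 ≤ δ i + δ j

namespace Straightens

variable {x : J → k} {key : J → ℕ} {par : J → ZMod 2} {chi : k →ₗ[ℂ] ℂ} {V A : J → Prop}
  {δ : J → Γ} {v : Q}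

theorem smul_sub_mem_of_letters {n d : Γ} {L : ℕ} {q : Q} {y : k} {P : J → Prop}
    (h : ∀ i, P i → UEA.ι k (x i) • q - chi (x i) • q ∈ normalSpan x key par V δ v (n + d) L)
    (hy : y ∈ Submodule.span ℂ (x '' {l | P l})) :
    UEA.ι k y • q - chi y • q ∈ normalSpan x key par V δ v (n + d) L := by
  induction hy using Submodule.span_induction with
  | mem y hy => obtain ⟨i, hi, rfl⟩ := hy; exact h i hi
  | zero => simp
  | add y y' _ _ h1 h2 =>
    rw [map_add, map_add, add_smul, add_smul]
    convert add_mem h1 h2 using 1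
    abel
  | smul a y _ h1 =>
    rw [map_smul, map_smul, smul_assoc, smul_assoc, ← smul_sub]
    exact Submodule.smul_mem _ _ h1

/-- Induction on the length bound, and inside it on the key of the acting letter `i`. If `i` cannot
be prepended, it is exchanged with the first letter `j`: the bracket acts on a shorter word, and `i`
acts on a shorter word before `j` does. Subtracting `χ(x_i) q` removes the one contribution whose
degree does not shift by `δ i`, which matters when `δ i` is negative. -/
theorem smul_sub_mem (h : Straightens x key par chi V A δ v) {L : ℕ} {i : J} (hi : A i) {n : Γ}
    {q : Q} (hq : q ∈ normalSpan x key par V δ v n L) :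
    UEA.ι k (x i) • q - chi (x i) • q ∈ normalSpan x key par V δ v (n + δ i) (L + 1) := by
  induction L generalizing i n q with
  | zero =>
    induction hq using Submodule.span_induction with
    | mem q hq =>
      obtain ⟨w, hw, hV, hn, hL, rfl⟩ := hq
      obtain rfl : w = [] := List.length_eq_zero_iff.mp (by omega)
      by_cases hVi : V i
      · rw [h.normal i hVi, zero_smul, sub_zero, ← mul_smul]
        refine Submodule.subset_span ⟨[i], List.pairwise_singleton _ _, by simpa using hVi, ?_,
          by simp, by rw [word_cons]⟩
        simpa using hn
      · rw [word_nil, one_smul, h.vac i hi hVi, sub_self]; exact zero_mem _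
    | zero => simp
    | add y y' _ _ h1 h2 =>
      convert add_mem h1 h2 using 1
      simp only [smul_add]; abel
    | smul a y _ h1 =>
      convert Submodule.smul_mem _ a h1 using 1
      rw [smul_sub, smul_comm a (chi (x i)), smul_algebra_smul_comm]
  | succ L ihL =>
    induction hk : key i using Nat.strong_induction_on generalizing i n q with
    | _ m ihm =>
    subst hk
    have ihm : ∀ {j : J}, key j < key i → A j → ∀ {n : Γ} {q : Q},
        q ∈ normalSpan x key par V δ v n (L + 1) →
        UEA.ι k (x j) • q - chi (x j) • q ∈ normalSpan x key par V δ v (n + δ j) (L + 1 + 1) :=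
      fun hj hA _ _ hq => ihm _ hj hA hq rfl
    induction hq using Submodule.span_induction with
    | zero => simp
    | add y y' _ _ h1 h2 =>
      convert add_mem h1 h2 using 1
      simp only [smul_add]; abel
    | smul a y _ h1 =>
      convert Submodule.smul_mem _ a h1 using 1
      rw [smul_sub, smul_comm a (chi (x i)), smul_algebra_smul_comm]
    | mem q hq =>
    obtain ⟨w, hw, hV, hn, hL, rfl⟩ := hq
    by_cases hpre : V i ∧ ∀ j ∈ w, Before key par i j
    · rw [h.normal i hpre.1, zero_smul, sub_zero, ← mul_smul]
      refine Submodule.subset_span ⟨i :: w, List.pairwise_cons.mpr ⟨hpre.2, hw⟩, ?_, ?_, ?_, ?_⟩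
      · intro j hj
        rcases List.mem_cons.mp hj with rfl | hj
        · exact hpre.1
        · exact hV j hj
      · rw [List.map_cons, List.sum_cons, add_comm]
        gcongr
      · simpa using hL
      · rw [word_cons]
    cases w with
    | nil =>
      have : ¬ V i := fun hVi => hpre ⟨hVi, by simp⟩
      rw [word_nil, one_smul, h.vac i hi this, sub_self]; exact zero_mem _
    | cons j w =>
    obtain ⟨hjw, hw'⟩ := List.pairwise_cons.mp hw
    have hVj : V j := hV j (by simp)
    have hVw : ∀ l ∈ w, V l := fun l hl => hV l (by simp [hl])
    -- If prepending fails, either `j` should come first, or `i = j` is a repeated odd letter.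
    have hcase : key j < key i ∨ (i = j ∧ par i = 1) := by
      by_cases hVi : V i
      · by_contra hcon
        push Not at hcon
        refine hpre ⟨hVi, ?_⟩
        have hij : Before key par i j := by
          rcases hcon.1.lt_or_eq with hlt | heq
          · exact Or.inl hlt
          · have := h.key_inj heq
            exact Or.inr ⟨this, (zmod2_cases _).resolve_right (hcon.2 this)⟩
        intro l hl
        rcases List.mem_cons.mp hl with rfl | hlw
        · exact hij
        · rcases hij with h1 | ⟨rfl, h1⟩
          · rcases hjw l hlw with h2 | ⟨rfl, h2⟩
            · exact Or.inl (h1.trans h2)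
            · exact Or.inl h1
          · exact hjw l hlw
      · exact Or.inl (h.last i j hVi hVj)
    have hc : key j < key i ∨ i = j := hcase.imp id And.left
    set n' := (w.map δ).sum with hn'
    have hn2 : n' + δ j ≤ n := by
      rw [add_comm]; simpa using hn
    have hw0 : word x w • v ∈ normalSpan x key par V δ v n' L :=
      Submodule.subset_span ⟨w, hw', hVw, le_rfl, by simpa using hL, rfl⟩
    -- the bracket term
    have hbr : UEA.ι k (LieSuperalgebra.bracket (x i) (x j)) • (word x w • v) ∈
        normalSpan x key par V δ v (n + δ i) (L + 1 + 1) := by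
      have h1 := smul_sub_mem_of_letters (x := x) (key := key) (par := par) (chi := chi) (V := V)
        (δ := δ) (v := v) (n := n') (d := δ i + δ j) (L := L + 1) (q := word x w • v)
        (P := fun l => A l ∧ δ l ≤ δ i + δ j)
        (fun l hl => normalSpan_mono (by gcongr; exact hl.2) le_rfl (ihL hl.1 hw0))
        (h.bracket i j hi hVj hc)
      -- The constant part of the bracket leaves the degree of the word unchanged, so it is
      -- admissible only when `δ i + δ j` is nonnegative.
      have h2 : chi (LieSuperalgebra.bracket (x i) (x j)) • (word x w • v) ∈
          normalSpan x key par V δ v (n' + (δ i + δ j)) (L + 1) := by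
        by_cases hz : chi (LieSuperalgebra.bracket (x i) (x j)) = 0
        · rw [hz, zero_smul]; exact zero_mem _
        · refine Submodule.smul_mem _ _ (normalSpan_mono ?_ (by omega) hw0)
          exact le_add_of_nonneg_right (h.chi_bracket i j hi hVj hc hz)
      have h3 := add_mem h1 h2
      rw [sub_add_cancel] at h3
      refine normalSpan_mono ?_ (by omega) h3
      calc n' + (δ i + δ j) = (n' + δ j) + δ i := by abel
        _ ≤ n + δ i := by gcongr
    rw [word_cons, mul_smul, ← mul_smul (UEA.ι k (x i)), UEA.ι_mul k (h.mem i) (h.mem j)]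
    rcases hcase with hlt | ⟨rfl, hodd⟩
    · have hA := h.act i j hi hVj hlt
      have h1 := ihm hlt hA (ihL hi hw0)
      rw [h.normal j hVj, zero_smul, sub_zero] at h1
      have h1' : UEA.ι k (x j) • (UEA.ι k (x i) • word x w • v - chi (x i) • word x w • v) ∈
          normalSpan x key par V δ v (n + δ i) (L + 1 + 1) := by
        refine normalSpan_mono ?_ le_rfl h1
        calc n' + δ i + δ j = (n' + δ j) + δ i := by abel
          _ ≤ n + δ i := by gcongr
      have h2 := add_mem (Submodule.smul_mem _ (ksign (par i) (par j)) h1') hbr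
      convert h2 using 1
      have hs : ∀ q : Q, ksign (par i) (par j) • chi (x i) • q = chi (x i) • q := by
        intro q
        rcases zmod2_cases (par i) with hp | hp
        · simp [hp, ksign]
        · rw [h.odd i hp, zero_smul, smul_zero]
      rw [add_smul, smul_assoc, mul_smul, smul_sub, smul_sub, smul_algebra_smul_comm, hs]
      abel
    · have hs : ksign (par i) (par i) = -1 := by simp [hodd, ksign]
      -- The square of an odd letter is half its bracket with itself, so a repetition shortens the
      -- word.
      have hsq : UEA.ι k (x i) * UEA.ι k (x i) =
          (2 : ℂ)⁻¹ • UEA.ι k (LieSuperalgebra.bracket (x i) (x i)) := by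
        have := UEA.ι_mul k (h.mem i) (h.mem i)
        rw [hs] at this
        have h2 : (2 : ℂ) • (UEA.ι k (x i) * UEA.ι k (x i)) =
            UEA.ι k (LieSuperalgebra.bracket (x i) (x i)) := by
          rw [two_smul]
          nth_rewrite 1 [this]
          module
        rw [← h2, smul_smul]; norm_num
      rw [← UEA.ι_mul k (h.mem i) (h.mem i), hsq, h.odd i hodd, zero_smul, sub_zero, smul_assoc]
      exact Submodule.smul_mem _ _ hbr

end Straightens

/-- The span of the normal words in the letters `V` of `δ`-degree at most `n`, applied to `v`. -/
def degSpan (x : J → k) (key : J → ℕ) (par : J → ZMod 2) (V : J → Prop) (δ : J → Γ) (v : Q)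
    (n : Γ) : Submodule ℂ Q :=
  Submodule.span ℂ {q | ∃ w : List J, w.Pairwise (Before key par) ∧ (∀ i ∈ w, V i) ∧
    (w.map δ).sum ≤ n ∧ q = word x w • v}

theorem degSpan_mono {x : J → k} {key : J → ℕ} {par : J → ZMod 2} {V : J → Prop} {δ : J → Γ}
    {v : Q} {n n' : Γ} (hn : n ≤ n') : degSpan x key par V δ v n ≤ degSpan x key par V δ v n' := by
  refine Submodule.span_mono ?_
  rintro q ⟨w, h1, h2, h3, h5⟩
  exact ⟨w, h1, h2, h3.trans hn, h5⟩

namespace Straightens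

variable {x : J → k} {key : J → ℕ} {par : J → ZMod 2} {chi : k →ₗ[ℂ] ℂ} {V A : J → Prop}
  {δ : J → Γ} {v : Q}

theorem letter_sub_mem (h : Straightens x key par chi V A δ v) {i : J} (hi : A i) {n : Γ}
    {q : Q} (hq : q ∈ degSpan x key par V δ v n) :
    UEA.ι k (x i) • q - chi (x i) • q ∈ degSpan x key par V δ v (n + δ i) := by
  induction hq using Submodule.span_induction with
  | zero => simp
  | add y y' _ _ h1 h2 =>
    convert add_mem h1 h2 using 1
    simp only [smul_add]; abel
  | smul a y _ h1 =>
    convert Submodule.smul_mem _ a h1 using 1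
    rw [smul_sub, smul_comm a (chi (x i)), smul_algebra_smul_comm]
  | mem q hq =>
    obtain ⟨w, h1, h2, h3, rfl⟩ := hq
    have := h.smul_sub_mem hi (L := w.length) (n := n)
      (Submodule.subset_span ⟨w, h1, h2, h3, le_rfl, rfl⟩)
    refine Submodule.span_mono ?_ this
    rintro q ⟨w, h1, h2, h3, -, h5⟩
    exact ⟨w, h1, h2, h3, h5⟩

theorem sub_mem_of_mem_span (h : Straightens x key par chi V A δ v) {y : k} {d n : Γ}
    (hy : y ∈ Submodule.span ℂ (x '' {l | A l ∧ δ l ≤ d})) {q : Q}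
    (hq : q ∈ degSpan x key par V δ v n) :
    UEA.ι k y • q - chi y • q ∈ degSpan x key par V δ v (n + d) := by
  induction hy using Submodule.span_induction with
  | mem y hy =>
    obtain ⟨i, hi, rfl⟩ := hy
    exact degSpan_mono (by gcongr; exact hi.2) (h.letter_sub_mem hi.1 hq)
  | zero => simp
  | add y y' _ _ h1 h2 =>
    rw [map_add, map_add, add_smul, add_smul]
    convert add_mem h1 h2 using 1
    abel
  | smul a y _ h1 =>
    rw [map_smul, map_smul, smul_assoc, smul_assoc, ← smul_sub]
    exact Submodule.smul_mem _ _ h1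

end Straightens

end Straightening

/-! ## The natural grading and the form `χ([x, y])` -/

section Grading

variable {g : Type*} [AddCommGroup g] [Module ℂ g] [LieSuperalgebra g]

theorem zmod2_add_eq_one {p q : ZMod 2} (h : p ≠ q) : p + q = 1 := by
  revert p q; decide

theorem bracket_even_swap (e : parity (g := g) 0) (x : g) :
    bracket x (e : g) = -bracket (e : g) x := by
  obtain ⟨x0, h0, x1, h1, rfl⟩ := exists_parity_decomp g x
  have a := skew h0 e.2
  have b := skew h1 e.2
  simp only [ksign, zero_ne_one, and_false, if_false, one_smul] at a b
  simp only [map_add, LinearMap.add_apply, a, b]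
  abel

theorem eq_top_of_parity_le {S : Submodule ℂ g} (h : ∀ i, parity (g := g) i ≤ S) : S = ⊤ := by
  rw [eq_top_iff, ← (isCompl (g := g)).sup_eq_top]
  exact sup_le (h 0) (h 1)

namespace Sl2Triple

variable (t : Sl2Triple g)

theorem mem_grade {k : ℤ} {x : g} :
    x ∈ t.grade k ↔ bracket (t.h : g) x = (k : ℂ) • x := End.mem_eigenspace_iff

theorem bracket_mem_grade {i j : ℤ} {x y : g} (hx : x ∈ t.grade i) (hy : y ∈ t.grade j) :
    bracket x y ∈ t.grade (i + j) := by
  rw [mem_grade] at *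
  rw [ad_even, hx, hy]
  simp only [map_smul, LinearMap.smul_apply]
  push_cast
  module

theorem e_mem_grade : (t.e : g) ∈ t.grade 2 := by
  rw [mem_grade, t.h_e]; norm_num

theorem ad_h_e : bracket (t.h : g) * bracket (t.e : g) =
    (bracket (t.e : g) * bracket (t.h : g) + (2 : ℂ) • bracket (t.e : g) : End ℂ g) := by
  refine LinearMap.ext fun x => ?_
  change bracket (t.h : g) (bracket (t.e : g) x) =
    bracket (t.e : g) (bracket (t.h : g) x) + (2 : ℂ) • bracket (t.e : g) x
  rw [ad_even, t.h_e, map_smul, LinearMap.smul_apply]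
  abel

theorem ad_h_f : bracket (t.h : g) * bracket (t.f : g) =
    (bracket (t.f : g) * bracket (t.h : g) + (-2 : ℂ) • bracket (t.f : g) : End ℂ g) := by
  refine LinearMap.ext fun x => ?_
  change bracket (t.h : g) (bracket (t.f : g) x) =
    bracket (t.f : g) (bracket (t.h : g) x) + (-2 : ℂ) • bracket (t.f : g) x
  rw [ad_even, t.h_f, map_smul, LinearMap.smul_apply]
  abel

theorem ad_e_f : bracket (t.e : g) * bracket (t.f : g) =
    (bracket (t.f : g) * bracket (t.e : g) + bracket (t.h : g) : End ℂ g) := by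
  refine LinearMap.ext fun x => ?_
  change bracket (t.e : g) (bracket (t.f : g) x) =
    bracket (t.f : g) (bracket (t.e : g) x) + bracket (t.h : g) x
  rw [ad_even, t.e_f]
  abel

variable [FiniteDimensional ℂ g]

theorem iSup_grade : ⨆ k : ℤ, t.grade k = ⊤ :=
  iSup_eigenspace_int_eq_top t.ad_h_e t.ad_h_f t.ad_e_f

theorem weight_nonneg {k : ℤ} {x : g} (hx : x ∈ t.grade k) (he : bracket (t.e : g) x = 0)
    (h0 : x ≠ 0) : 0 ≤ k :=
  weight_nonneg_of_raise_eq_zero t.ad_h_e t.ad_h_f t.ad_e_f he (t.mem_grade.mp hx) h0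

theorem le_iSup_inf_grade {S : Submodule ℂ g} (hS : ∀ x ∈ S, bracket (t.h : g) x ∈ S) :
    S = ⨆ k : ℤ, S ⊓ t.grade k :=
  eq_iSup_inf_eigenspace_int t.iSup_grade hS

/-- Subspaces stable under the parity projections and `ad h` are spanned by their bihomogeneous
elements. -/
theorem le_span_bihomogeneous {S : Submodule ℂ g} (hS : ∀ x ∈ S, bracket (t.h : g) x ∈ S)
    (hp : S ≤ (S ⊓ parity (g := g) 0) ⊔ (S ⊓ parity (g := g) 1)) :
    S ≤ Submodule.span ℂ {x | x ∈ S ∧ ∃ k p, x ∈ t.grade k ∧ x ∈ parity (g := g) p} := by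
  have key : ∀ p, S ⊓ parity (g := g) p ≤
      Submodule.span ℂ {x | x ∈ S ∧ ∃ k p, x ∈ t.grade k ∧ x ∈ parity (g := g) p} := by
    intro p
    rw [t.le_iSup_inf_grade (S := S ⊓ parity (g := g) p) (fun x hx =>
      ⟨hS x hx.1, by simpa using bracket_mem t.h.2 hx.2⟩)]
    exact iSup_le fun k x hx => Submodule.subset_span ⟨hx.1.1, k, p, hx.2, hx.1.2⟩
  exact hp.trans (sup_le (key 0) (key 1))

theorem exists_bihomogeneous_basis {S : Submodule ℂ g}
    (hS : ∀ x ∈ S, bracket (t.h : g) x ∈ S)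
    (hp : S ≤ (S ⊓ parity (g := g) 0) ⊔ (S ⊓ parity (g := g) 1)) :
    ∃ (n : ℕ) (v : Fin n → g) (w : Fin n → ℤ) (p : Fin n → ZMod 2), LinearIndependent ℂ v ∧
      Submodule.span ℂ (Set.range v) = S ∧
      ∀ i, v i ∈ t.grade (w i) ∧ v i ∈ parity (g := g) (p i) := by
  set H := {x | x ∈ S ∧ ∃ k p, x ∈ t.grade k ∧ x ∈ parity (g := g) p} with hH
  obtain ⟨c, hcH, hspan, hli⟩ := exists_linearIndependent ℂ H
  have hfin : c.Finite := hli.setFinite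
  have := hfin.fintype
  let eq := (Fintype.equivFin c).symm
  have hv : ∀ i, ((eq i : c) : g) ∈ H := fun i => hcH (eq i).2
  choose w p hw hp' using fun i => (hv i).2
  refine ⟨Fintype.card c, fun i => eq i, w, p, hli.comp _ eq.injective, ?_,
    fun i => ⟨hw i, hp' i⟩⟩
  have : Set.range (fun i => ((eq i : c) : g)) = c := by
    rw [show (fun i => ((eq i : c) : g)) = Subtype.val ∘ eq from rfl, Set.range_comp,
      eq.range_eq_univ, Set.image_univ, Subtype.range_coe]
  rw [this, hspan]
  refine le_antisymm (Submodule.span_le.mpr fun x hx => hx.1) (t.le_span_bihomogeneous hS hp)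

end Sl2Triple

variable (B : InvariantForm g) (t : Sl2Triple g)

theorem form_grade {i j : ℤ} {x y : g} (hx : x ∈ t.grade i) (hy : y ∈ t.grade j)
    (h : i + j ≠ 0) : B.form x y = 0 := by
  have h1 := B.invariant x (t.h : g) y
  rw [bracket_even_swap, t.mem_grade.mp hx, t.mem_grade.mp hy] at h1
  simp only [map_neg, map_smul, LinearMap.neg_apply, LinearMap.smul_apply, smul_eq_mul] at h1
  have h2 : ((i + j : ℤ) : ℂ) * B.form x y = 0 := by push_cast; linear_combination -h1
  exact (mul_eq_zero.mp h2).resolve_left (by exact_mod_cast h)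

theorem chi_grade {k : ℤ} {x : g} (hx : x ∈ t.grade k) (h : k ≠ -2) : chi B t x = 0 :=
  form_grade B t t.e_mem_grade hx (by omega)

theorem chi_odd {x : g} (hx : x ∈ parity (g := g) 1) : chi B t x = 0 :=
  B.even t.e.2 hx zero_ne_one

theorem chi_bracket_apply (x y : g) : chi B t (bracket x y) = B.form (bracket (t.e : g) x) y :=
  (B.invariant _ _ _).symm

theorem form_bracket_e (x y : g) :
    B.form (bracket (t.e : g) x) y = -B.form x (bracket (t.e : g) y) := by
  rw [← B.invariant, bracket_even_swap, map_neg, LinearMap.neg_apply, neg_neg]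

theorem chi_bracket_of_centralizes (x : g) {y : g} (hy : bracket (t.e : g) y = 0) :
    chi B t (bracket x y) = 0 := by
  rw [chi_bracket_apply, form_bracket_e, hy, map_zero, neg_zero]

theorem chi_bracket_skew {p q : ZMod 2} {x y : g} (hx : x ∈ parity (g := g) p)
    (hy : y ∈ parity (g := g) q) :
    chi B t (bracket x y) = -(ksign p q * chi B t (bracket y x)) := by
  rw [skew hx hy, map_neg, map_smul, smul_eq_mul]

theorem chi_bracket_parity {p q : ZMod 2} {x y : g} (hx : x ∈ parity (g := g) p)
    (hy : y ∈ parity (g := g) q) (h : p ≠ q) : chi B t (bracket x y) = 0 := by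
  exact chi_odd B t (zmod2_add_eq_one h ▸ bracket_mem hx hy)

theorem chi_bracket_grade {i j : ℤ} {x y : g} (hx : x ∈ t.grade i) (hy : y ∈ t.grade j)
    (h : i + j ≠ -2) : chi B t (bracket x y) = 0 :=
  chi_grade B t (t.bracket_mem_grade hx hy) h

variable [FiniteDimensional ℂ g]

/-- Since `χ([x, y]) = ([e, x], y)`, the vanishing of all these numbers means `[e, x] = 0` by
nondegeneracy, and `ker (ad e)` has no vectors of negative weight. -/
theorem eq_zero_of_chi_bracket {k : ℤ} (hk : k < 0) {p : ZMod 2} {x : g} (hx : x ∈ t.grade k)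
    (hxp : x ∈ parity (g := g) p)
    (h : ∀ y ∈ t.grade (-2 - k) ⊓ parity (g := g) p, chi B t (bracket x y) = 0) : x = 0 := by
  have hker : ∀ y, chi B t (bracket x y) = 0 := by
    have : LinearMap.ker (chi B t ∘ₗ bracket x) = ⊤ := by
      refine eq_top_of_parity_le fun q => ?_
      rw [t.le_iSup_inf_grade (S := parity (g := g) q)
        (fun y hy => by simpa using bracket_mem t.h.2 hy)]
      refine iSup_le fun j y hy => LinearMap.mem_ker.mpr ?_
      rw [LinearMap.comp_apply]
      by_cases hj : j = -2 - k
      · by_cases hq : q = p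
        · exact h y ⟨hj ▸ hy.2, hq ▸ hy.1⟩
        · exact chi_bracket_parity B t hxp hy.1 (Ne.symm hq)
      · exact chi_bracket_grade B t hx hy.2 (by omega)
    intro y
    have hy : y ∈ LinearMap.ker (chi B t ∘ₗ bracket x) := this ▸ Submodule.mem_top
    exact hy
  by_contra hne
  have he : bracket (t.e : g) x = 0 :=
    B.nondegenerate _ fun y => by rw [← chi_bracket_apply]; exact hker y
  have := t.weight_nonneg hx he hne
  omega

/-- A functional that vanishes on the range of the evaluation map `T` yields a combination of the `z
a` that pairs to zero with everything. It is zero by nondegeneracy, so `T` is surjective and the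
dual vectors are preimages of the unit vectors. -/
theorem exists_dual_family {ι : Type*} [Fintype ι] [DecidableEq ι] {k : ℤ} (hk : k < 0)
    {p : ZMod 2} {z : ι → g} (hz : LinearIndependent ℂ z)
    (hm : ∀ a, z a ∈ t.grade k ∧ z a ∈ parity (g := g) p) :
    ∃ y : ι → g, (∀ a, y a ∈ t.grade (-2 - k) ⊓ parity (g := g) p) ∧
      ∀ a b, chi B t (bracket (z a) (y b)) = if a = b then 1 else 0 := by
  let T : ↥(t.grade (-2 - k) ⊓ parity (g := g) p) →ₗ[ℂ] (ι → ℂ) :=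
    LinearMap.pi fun a => (chi B t ∘ₗ bracket (z a)) ∘ₗ Submodule.subtype _
  have hT : Function.Surjective T := by
    rw [← LinearMap.dualMap_injective_iff, injective_iff_map_eq_zero]
    intro φ hφ
    have hx : ∑ a, φ (Pi.single a 1) • z a = 0 := by
      refine eq_zero_of_chi_bracket B t hk (p := p)
        (Submodule.sum_mem _ fun a _ => Submodule.smul_mem _ _ (hm a).1)
        (Submodule.sum_mem _ fun a _ => Submodule.smul_mem _ _ (hm a).2) fun y hy => ?_
      have h1 := LinearMap.congr_fun hφ ⟨y, hy⟩
      rw [LinearMap.dualMap_apply, LinearMap.pi_apply_eq_sum_univ φ] at h1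
      rw [map_sum, LinearMap.sum_apply, map_sum]
      simp only [map_smul, LinearMap.smul_apply, smul_eq_mul]
      simp only [smul_eq_mul, LinearMap.zero_apply] at h1
      rw [← h1]
      refine Finset.sum_congr rfl fun a _ => ?_
      rw [mul_comm]
      congr 2
      ext j
      simp [Pi.single_apply, eq_comm]
    have hc := Fintype.linearIndependent_iff.mp hz _ hx
    refine LinearMap.ext fun w => ?_
    rw [LinearMap.pi_apply_eq_sum_univ φ w]
    refine Finset.sum_eq_zero fun a _ => ?_
    have := hc a
    rw [show (fun j => if a = j then (1 : ℂ) else 0) = Pi.single a 1 by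
      ext j; simp [Pi.single_apply, eq_comm], this, smul_zero]
  choose y hy using fun b : ι => hT (Pi.single b 1)
  refine ⟨fun b => y b, fun b => (y b).2, fun a b => ?_⟩
  have := congrFun (hy b) a
  rw [Pi.single_apply] at this
  exact this

theorem exists_dual_homogeneous_family {n : ℕ} {z : Fin n → g} (hz : LinearIndependent ℂ z)
    {k : Fin n → ℤ} (hk : ∀ a, k a < 0) {p : Fin n → ZMod 2}
    (hm : ∀ a, z a ∈ t.grade (k a) ∧ z a ∈ parity (g := g) (p a)) :
    ∃ y : Fin n → g, (∀ a, y a ∈ t.grade (-2 - k a) ∧ y a ∈ parity (g := g) (p a)) ∧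
      ∀ a b, chi B t (bracket (z a) (y b)) = if a = b then 1 else 0 := by
  have key : ∀ b, ∃ y, (y ∈ t.grade (-2 - k b) ∧ y ∈ parity (g := g) (p b)) ∧
      ∀ a, chi B t (bracket (z a) y) = if a = b then 1 else 0 := by
    intro b
    obtain ⟨y, h1, h2⟩ := exists_dual_family B t (hk b) (p := p b)
      (z := fun a : {a // k a = k b ∧ p a = p b} => z a)
      (hz.comp _ Subtype.val_injective)
      (fun a => ⟨by have := (hm a).1; rwa [a.2.1] at this, by have := (hm a).2; rwa [a.2.2] at this⟩)
    refine ⟨y ⟨b, rfl, rfl⟩, h1 _, fun a => ?_⟩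
    by_cases ha : k a = k b ∧ p a = p b
    · have := h2 ⟨a, ha⟩ ⟨b, rfl, rfl⟩
      simpa using this
    · rw [if_neg (fun h => ha (by rw [h]; exact ⟨rfl, rfl⟩))]
      by_cases hkk : k a = k b
      · exact chi_bracket_parity B t (hm a).2 (h1 _).2 (fun h => ha ⟨hkk, h⟩)
      · exact chi_bracket_grade B t (hm a).1 (h1 _).1 (by omega)
  choose y h1 h2 using key
  exact ⟨y, h1, fun a b => h2 b a⟩

end Grading

/-! ## Bases adapted to the centralizer of `e` and to `m` -/

/-- Labels of a basis of `g`: a basis of `g_e`, vectors of nonnegative weight dual to `neg`, the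
bases of `g(-1)_0` and of `g(-1)_1`, and a basis of the part of weight at most `-2`. -/
inductive Letter (N K s r : ℕ)
  | cent (i : Fin N)
  | pos (a : Fin K)
  | even (i : Fin (2 * s))
  | odd (i : Fin r)
  | neg (a : Fin K)
  deriving DecidableEq, Fintype

section Frames

variable {g : Type*} [AddCommGroup g] [Module ℂ g] [LieSuperalgebra g]
  {B : InvariantForm g} {t : Sl2Triple g}

/-- A homogeneous basis of `g_e`, a homogeneous basis of the part of `g` of weight at most `-2`,
and vectors of nonnegative weight dual to the latter with respect to `χ([x, y])`. -/
structure Frame (b : WittBases B t) where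
  N : ℕ
  K : ℕ
  Y : Basis (Fin N) ℂ (centralizer t.e)
  wtY : Fin N → ℤ
  parY : Fin N → ZMod 2
  Y_mem : ∀ i, (Y i : g) ∈ t.grade (wtY i) ∧ (Y i : g) ∈ parity (g := g) (parY i)
  pos : Fin K → g
  neg : Fin K → g
  wtN : Fin K → ℤ
  parN : Fin K → ZMod 2
  neg_mem : ∀ a, neg a ∈ t.grade (wtN a) ∧ neg a ∈ parity (g := g) (parN a)
  wtN_le : ∀ a, wtN a ≤ -2
  neg_span : Submodule.span ℂ (Set.range neg) = ⨆ k : {k : ℤ // k ≤ -2}, t.grade k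
  pos_mem : ∀ a, pos a ∈ t.grade (-2 - wtN a) ∧ pos a ∈ parity (g := g) (parN a)
  chi_neg_pos : ∀ a a', chi B t (bracket (neg a) (pos a')) = if a = a' then 1 else 0

theorem exists_frame [FiniteDimensional ℂ g] (b : WittBases B t) : Nonempty (Frame b) := by
  obtain ⟨N, Y, wY, pY, hYli, hYs, hYm⟩ := t.exists_bihomogeneous_basis (S := centralizer t.e)
    (fun x hx => by
      change bracket (t.e : g) _ = 0
      have h1 := LinearMap.congr_fun t.ad_h_e x
      have hx' : bracket (t.e : g) x = 0 := hx
      simp only [Module.End.mul_apply, LinearMap.add_apply, LinearMap.smul_apply, hx', map_zero,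
        smul_zero, add_zero] at h1
      exact h1.symm)
    (fun x hx => by
      have h := (centralizer.lieSuperalgebra t.e).isCompl.sup_eq_top
      have h2 : (⟨x, hx⟩ : centralizer t.e) ∈ parity (g := centralizer t.e) 0 ⊔
        parity (g := centralizer t.e) 1 := by rw [h]; trivial
      obtain ⟨y, hy, z, hz, hyz⟩ := Submodule.mem_sup.mp h2
      exact Submodule.mem_sup.mpr ⟨y, ⟨y.2, hy⟩, z, ⟨z.2, hz⟩, congrArg Subtype.val hyz⟩)
  have hle : ∀ S : Submodule ℂ g, (∀ k : ℤ, k ≤ -2 → t.grade k ≤ S) →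
      (⨆ k : {k : ℤ // k ≤ -2}, t.grade k) ≤ S := fun S h => iSup_le fun k => h k k.2
  have hge : ∀ k : ℤ, k ≤ -2 → t.grade k ≤ ⨆ k : {k : ℤ // k ≤ -2}, t.grade k :=
    fun k hk => le_iSup (fun k : {k : ℤ // k ≤ -2} => t.grade k) ⟨k, hk⟩
  obtain ⟨K, Z, wZ, pZ, hZli, hZs, hZm⟩ := t.exists_bihomogeneous_basis
    (S := ⨆ k : {k : ℤ // k ≤ -2}, t.grade k)
    (fun x hx => by
      refine hle (Submodule.comap (bracket (t.h : g)) (⨆ k : {k : ℤ // k ≤ -2}, t.grade k)) (fun k hk y hy => ?_) hx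
      rw [Submodule.mem_comap, t.mem_grade.mp hy]
      exact Submodule.smul_mem _ _ (hge k hk hy))
    (by
      refine hle _ fun k hk => ?_
      intro y hy
      obtain ⟨y0, h0, y1, h1, rfl⟩ := exists_parity_decomp g y
      rw [t.mem_grade, map_add, smul_add] at hy
      have hd := (isCompl (g := g)).disjoint
      have m0 : bracket (t.h : g) y0 ∈ parity (g := g) 0 := by simpa using bracket_mem t.h.2 h0
      have m1 : bracket (t.h : g) y1 ∈ parity (g := g) 1 := by simpa using bracket_mem t.h.2 h1
      have e0 : bracket (t.h : g) y0 - (k : ℂ) • y0 = (k : ℂ) • y1 - bracket (t.h : g) y1 := by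
        linear_combination (norm := module) hy
      have z0 : bracket (t.h : g) y0 - (k : ℂ) • y0 = 0 :=
        Submodule.disjoint_def.mp hd _ (sub_mem m0 (Submodule.smul_mem _ _ h0))
          (e0 ▸ sub_mem (Submodule.smul_mem _ _ h1) m1)
      have z1 := e0.symm.trans z0
      exact Submodule.mem_sup.mpr ⟨y0, ⟨hge k hk (t.mem_grade.mpr (sub_eq_zero.mp z0)), h0⟩,
        y1, ⟨hge k hk (t.mem_grade.mpr (sub_eq_zero.mp z1).symm), h1⟩, rfl⟩)
  -- A nonzero eigenvector of weight above `-2` cannot lie in the sum of eigenspaces of weight at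
  -- most `-2`, because eigenspaces are independent.
  have hw : ∀ a, wZ a ≤ -2 := by
    intro a
    by_contra hlt
    push Not at hlt
    have h1 : Z a ∈ ⨆ k : {k : ℤ // k ≤ -2}, t.grade k :=
      hZs ▸ Submodule.subset_span (Set.mem_range_self a)
    have h2 : ⨆ k : {k : ℤ // k ≤ -2}, t.grade k ≤
        ⨆ (μ : ℂ) (_ : μ ≠ (wZ a : ℂ)), End.eigenspace (bracket (t.h : g)) μ :=
      iSup_le fun k => le_iSup₂ (f := fun (μ : ℂ) (_ : μ ≠ (wZ a : ℂ)) =>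
        End.eigenspace (bracket (t.h : g)) μ) ((k : ℤ) : ℂ) (fun h => by
          have h3 : (k : ℤ) = wZ a := by exact_mod_cast h
          have := k.2
          omega)
    exact hZli.ne_zero a ((Module.End.eigenspaces_iSupIndep (bracket (t.h : g))
      (wZ a : ℂ)).le_bot ⟨(hZm a).1, h2 h1⟩)
  obtain ⟨X, hXm, hX⟩ := exists_dual_homogeneous_family B t hZli (fun a => by have := hw a; omega) hZm
  let YB : Basis (Fin N) ℂ (centralizer t.e) := (Basis.span hYli).map (LinearEquiv.ofEq _ _ hYs)
  have hYB : ∀ i, (YB i : g) = Y i := fun i => by simp [YB, Basis.span_apply]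
  exact ⟨{ N := N, K := K, Y := YB, wtY := wY, parY := pY, Y_mem := fun i => by
             rw [hYB]; exact hYm i
           pos := X, neg := Z, wtN := wZ, parN := pZ, neg_mem := hZm, wtN_le := hw
           neg_span := hZs, pos_mem := hXm, chi_neg_pos := hX }⟩

/-! ### The letters of a frame as a basis of `g`, and their duals in `m'`. -/

namespace Frame

variable {b : WittBases B t} (F : Frame b)

/-- The labels of the letters of a frame. -/
abbrev J : Type := Letter F.N F.K b.s t.judgingNumber

noncomputable def vec : F.J → g
  | .cent i => F.Y i
  | .pos a => F.pos a
  | .even i => b.u i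
  | .odd i => b.v i
  | .neg a => F.neg a

def wt : F.J → ℤ
  | .cent i => F.wtY i
  | .pos a => -2 - F.wtN a
  | .even _ => -1
  | .odd _ => -1
  | .neg a => F.wtN a

def par : F.J → ZMod 2
  | .cent i => F.parY i
  | .pos a => F.parN a
  | .even _ => 0
  | .odd _ => 1
  | .neg a => F.parN a

/-- The letters that span the complement of `m`. -/
def Free : F.J → Prop
  | .cent _ => True
  | .pos _ => True
  | .even i => (i : ℕ) < b.s
  | .odd i => 2 * (i : ℕ) < t.judgingNumber
  | .neg _ => False

noncomputable instance : DecidablePred F.Free := Classical.decPred _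

/-- The vectors of `m'` dual to the free letters outside of `g_e`. -/
noncomputable def dual : F.J → g
  | .cent _ => 0
  | .pos a => F.neg a
  | .even i => b.u i.rev
  | .odd i => b.v i.rev
  | .neg _ => 0

/-- Letters of nonnegative weight precede those of weight `-1`. This is the order of the monomials
that define the filtration, and it ensures that a letter of nonnegative weight only passes letters
of nonnegative weight. The middle odd letter, if any, is the last free one. -/
noncomputable def pos' : F.J → ℕ
  | .cent i => i
  | .pos a => F.N + a
  | .even i => F.N + F.K + i
  | .odd i => F.N + F.K + 2 * b.s + i
  | .neg a => F.N + F.K + 2 * b.s + t.judgingNumber + a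

/-- The order of the letters: the free ones come first. -/
noncomputable def key (l : F.J) : ℕ :=
  if F.Free l then F.pos' l else F.N + F.K + 2 * b.s + t.judgingNumber + F.K + F.pos' l

theorem pos'_lt (l : F.J) : F.pos' l < F.N + F.K + 2 * b.s + t.judgingNumber + F.K := by
  cases l <;> simp only [pos'] <;> omega

theorem pos'_injective : Function.Injective F.pos' := by
  intro l l' h
  cases l <;> cases l' <;> simp only [pos'] at h <;>
    first
    | (congr 1; apply Fin.ext; omega)
    | (exfalso; omega)

theorem key_injective : Function.Injective F.key := by
  intro l l' h
  have h1 := F.pos'_lt l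
  have h2 := F.pos'_lt l'
  apply F.pos'_injective
  unfold key at h
  split_ifs at h <;> omega

theorem vec_mem_grade (l : F.J) : F.vec l ∈ t.grade (F.wt l) := by
  cases l with
  | cent i => exact (F.Y_mem i).1
  | pos a => exact (F.pos_mem a).1
  | even i => simpa [vec, wt] using (b.u i).2.1
  | odd i => simpa [vec, wt] using (b.v i).2.1
  | neg a => exact (F.neg_mem a).1

theorem vec_mem_parity (l : F.J) : F.vec l ∈ parity (g := g) (F.par l) := by
  cases l with
  | cent i => exact (F.Y_mem i).2
  | pos a => exact (F.pos_mem a).2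
  | even i => exact (b.u i).2.2
  | odd i => exact (b.v i).2.2
  | neg a => exact (F.neg_mem a).2

theorem dual_mem_grade (l : F.J) : F.dual l ∈ t.grade (-2 - F.wt l) := by
  cases l with
  | cent i => exact zero_mem _
  | pos a => simpa [dual, wt] using (F.neg_mem a).1
  | even i => simpa [dual, wt] using (b.u i.rev).2.1
  | odd i => simpa [dual, wt] using (b.v i.rev).2.1
  | neg a => exact zero_mem _

theorem dual_mem_parity (l : F.J) : F.dual l ∈ parity (g := g) (F.par l) := by
  cases l with
  | cent i => exact zero_mem _
  | pos a => exact (F.neg_mem a).2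
  | even i => exact (b.u i.rev).2.2
  | odd i => exact (b.v i.rev).2.2
  | neg a => exact zero_mem _

theorem wtY_nonneg [FiniteDimensional ℂ g] (i : Fin F.N) : 0 ≤ F.wtY i :=
  t.weight_nonneg (F.Y_mem i).1 (F.Y i).2 fun h => F.Y.ne_zero i (Subtype.ext h)

theorem chi_neg_centralizer (x : g) (i : Fin F.N) : chi B t (bracket x (F.Y i : g)) = 0 :=
  chi_bracket_of_centralizes B t x (F.Y i).2

/-- The reversed index of a free even letter lies in the second half, where the antidiagonal entry
is `1`; a middle odd letter is its own dual. Weights and parities exclude the remaining nonzero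
pairings. -/
theorem chi_dual_vec [FiniteDimensional ℂ g] {l l' : F.J} (hl : F.Free l) (hl' : F.Free l') :
    chi B t (bracket (F.dual l) (F.vec l')) = if l = l' ∧ ∀ i, l ≠ .cent i then 1 else 0 := by
  by_cases hw : F.wt l = F.wt l'
  swap
  · rw [chi_bracket_grade B t (F.dual_mem_grade l) (F.vec_mem_grade l') (by omega), if_neg]
    rintro ⟨rfl, -⟩; exact hw rfl
  by_cases hp : F.par l = F.par l'
  swap
  · rw [chi_bracket_parity B t (F.dual_mem_parity l) (F.vec_mem_parity l') hp, if_neg]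
    rintro ⟨rfl, -⟩; exact hp rfl
  cases l' with
  | cent j =>
    rw [vec, F.chi_neg_centralizer, if_neg]
    rintro ⟨rfl, h⟩; exact h j rfl
  | pos a' =>
    cases l with
    | cent i => simp [dual]
    | pos a => simp [dual, vec, F.chi_neg_pos]
    | even i => have := F.wtN_le a'; simp only [wt] at hw; omega
    | odd i => have := F.wtN_le a'; simp only [wt] at hw; omega
    | neg a => exact hl.elim
  | even j =>
    cases l with
    | cent i => simp [dual]
    | pos a => have := F.wtN_le a; simp only [wt] at hw; omega
    | even i =>
      have hi : (i : ℕ) < b.s := hl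
      simp only [dual, vec, b.u_u, Fin.val_rev]
      by_cases hij : i = j
      · subst hij
        rw [if_pos (by omega), if_neg (by omega), if_pos (by simp)]
      · rw [if_neg (fun h => hij (Fin.ext (by omega))), if_neg (by simp [hij])]
    | odd i => simp [par] at hp
    | neg a => exact hl.elim
  | odd j =>
    cases l with
    | cent i => simp [dual]
    | pos a => have := F.wtN_le a; simp only [wt] at hw; omega
    | even i => simp [par] at hp
    | odd i =>
      simp only [dual, vec, b.v_v, Fin.val_rev]
      by_cases hij : i = j
      · subst hij
        rw [if_pos (by omega), if_pos (by simp)]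
      · rw [if_neg (fun h => hij (Fin.ext (by omega))), if_neg (by simp [hij])]
    | neg a => exact hl.elim
  | neg a => exact hl'.elim

/-- Coefficients are removed by pairing through `χ([·,·])`: first with the `neg`, then with the
`pos`, then with the two antidiagonal bases of `g(-1)`. The order matters, since `pos` letters may
pair with each other. All pairings ignore `g_e`, whose basis remains. -/
theorem linearIndependent_vec : LinearIndependent ℂ F.vec := by
  rw [Fintype.linearIndependent_iff]
  intro c hc
  have key : ∀ (y : g) (l₀ : F.J), (∀ l ≠ l₀, c l = 0 ∨ chi B t (bracket y (F.vec l)) = 0) →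
      chi B t (bracket y (F.vec l₀)) ≠ 0 → c l₀ = 0 := by
    intro y l₀ h h₀
    have h1 := congrArg (chi B t ∘ₗ bracket y) hc
    simp only [map_sum, map_smul, LinearMap.comp_apply, map_zero, smul_eq_mul] at h1
    rw [Finset.sum_eq_single l₀ (fun l _ hl => by rcases h l hl with h | h <;> simp [h])
      (fun h => absurd (Finset.mem_univ _) h)] at h1
    exact (mul_eq_zero.mp h1).resolve_right h₀
  have hpos : ∀ a, c (.pos a) = 0 := by
    intro a
    refine key (F.neg a) _ (fun l hl => Or.inr ?_) ?_
    · by_cases hw : F.wt l = -2 - F.wtN a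
      · cases l with
        | cent i => exact F.chi_neg_centralizer _ i
        | pos a' => rw [vec, F.chi_neg_pos, if_neg (by rintro rfl; exact hl rfl)]
        | even i => have := F.wtN_le a; simp only [wt] at hw; omega
        | odd i => have := F.wtN_le a; simp only [wt] at hw; omega
        | neg a' => have := F.wtN_le a; have := F.wtN_le a'; simp only [wt] at hw; omega
      · exact chi_bracket_grade B t (F.neg_mem a).1 (F.vec_mem_grade l) (by omega)
    · rw [vec, F.chi_neg_pos, if_pos rfl]; exact one_ne_zero
  have hneg : ∀ a, c (.neg a) = 0 := by
    have hsk : ∀ a a', chi B t (bracket (F.pos a) (F.neg a')) =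
        -(ksign (F.parN a) (F.parN a') * if a' = a then 1 else 0) := by
      intro a a'
      rw [chi_bracket_skew B t (F.pos_mem a).2 (F.neg_mem a').2, F.chi_neg_pos]
    intro a
    refine key (F.pos a) _ (fun l hl => ?_) ?_
    · by_cases hw : F.wt l = F.wtN a
      · cases l with
        | cent i => exact Or.inr (F.chi_neg_centralizer _ i)
        | pos a' => exact Or.inl (hpos a')
        | even i => have := F.wtN_le a; simp only [wt] at hw; omega
        | odd i => have := F.wtN_le a; simp only [wt] at hw; omega
        | neg a' =>
          right
          rw [vec, hsk, if_neg (by rintro rfl; exact hl rfl), mul_zero, neg_zero]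
      · exact Or.inr (chi_bracket_grade B t (F.pos_mem a).1 (F.vec_mem_grade l) (by omega))
    · rw [vec, hsk, if_pos rfl]
      rcases InductionData.ksign_eq_one_or (F.parN a) (F.parN a) with h | h <;> simp [h]
  have heven : ∀ i, c (.even i) = 0 := by
    intro i
    refine key (b.u i.rev) _ (fun l hl => ?_) ?_
    · cases l with
      | cent i => exact Or.inr (F.chi_neg_centralizer _ i)
      | pos a' => exact Or.inl (hpos a')
      | even j =>
        right
        rw [vec, b.u_u, if_neg]
        rw [Fin.val_rev]
        exact fun h => hl (congrArg _ (Fin.ext (by omega)))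
      | odd j => exact Or.inr (chi_bracket_parity B t (b.u i.rev).2.2 (b.v j).2.2 zero_ne_one)
      | neg a' => exact Or.inl (hneg a')
    · rw [vec, b.u_u, Fin.val_rev, if_pos (by omega)]
      split_ifs <;> simp
  have hodd : ∀ i, c (.odd i) = 0 := by
    intro i
    refine key (b.v i.rev) _ (fun l hl => ?_) ?_
    · cases l with
      | cent i => exact Or.inr (F.chi_neg_centralizer _ i)
      | pos a' => exact Or.inl (hpos a')
      | even j => exact Or.inl (heven j)
      | odd j =>
        right
        rw [vec, b.v_v, if_neg]
        rw [Fin.val_rev]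
        exact fun h => hl (congrArg _ (Fin.ext (by omega)))
      | neg a' => exact Or.inl (hneg a')
    · rw [vec, b.v_v, Fin.val_rev, if_pos (by omega)]
      simp
  have hcent : ∑ i, c (.cent i) • F.Y i = 0 := by
    apply Subtype.ext
    rw [Submodule.coe_zero, ← hc, AddSubmonoidClass.coe_finsetSum]
    refine Fintype.sum_of_injective (fun i => (.cent i : F.J)) (fun i j h => by simpa using h)
      _ _ (fun l hl => ?_) (fun i => rfl)
    cases l with
    | cent i => exact absurd ⟨i, rfl⟩ hl
    | pos a => rw [hpos, zero_smul]
    | even i => rw [heven, zero_smul]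
    | odd i => rw [hodd, zero_smul]
    | neg a => rw [hneg, zero_smul]
  have hY := Fintype.linearIndependent_iff.mp F.Y.linearIndependent _ hcent
  intro l
  cases l with
  | cent i => exact hY i
  | pos a => exact hpos a
  | even i => exact heven i
  | odd i => exact hodd i
  | neg a => exact hneg a

/-- For a vector of nonnegative weight, subtract the combination of `pos` letters with the same
pairings against the `neg` letters. The rest `y` satisfies `([e, y], z) = 0` for `z` of weight at
most `-2` by duality and for other `z` by weight, so it lies in `g_e`. -/
theorem span_vec [FiniteDimensional ℂ g] : ⊤ ≤ Submodule.span ℂ (Set.range F.vec) := by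
  have hmem : ∀ l, F.vec l ∈ Submodule.span ℂ (Set.range F.vec) :=
    fun l => Submodule.subset_span (Set.mem_range_self l)
  have hY : ∀ x, bracket (t.e : g) x = 0 → x ∈ Submodule.span ℂ (Set.range F.vec) := by
    intro x hx
    have h1 := congrArg Subtype.val (F.Y.sum_repr ⟨x, hx⟩)
    rw [AddSubmonoidClass.coe_finsetSum] at h1
    have h2 : ∑ i, ((F.Y.repr ⟨x, hx⟩ i • F.Y i : centralizer t.e) : g) = x := h1
    rw [← h2]
    exact Submodule.sum_mem _ fun i _ => Submodule.smul_mem _ _ (hmem (.cent i))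
  have hN : ∀ k ≤ -2, t.grade k ≤ Submodule.span ℂ (Set.range F.neg) := fun k hk => by
    rw [F.neg_span]
    exact le_iSup (fun k : {k : ℤ // k ≤ -2} => t.grade k) ⟨k, hk⟩
  refine (eq_top_of_parity_le fun q => ?_).ge
  rw [t.le_iSup_inf_grade (S := parity (g := g) q)
    (fun y hy => by simpa using bracket_mem t.h.2 hy)]
  refine iSup_le fun k x hx => ?_
  obtain ⟨hxq, hxk⟩ := hx
  rcases lt_trichotomy k (-1) with hk | rfl | hk
  · refine Submodule.span_le.mpr ?_ (hN k (by omega) hxk)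
    rintro _ ⟨a, rfl⟩
    exact hmem (.neg a)
  · rcases zmod2_cases q with rfl | rfl
    · have h1 := congrArg Subtype.val (b.u.sum_repr ⟨x, hxk, hxq⟩)
      rw [AddSubmonoidClass.coe_finsetSum] at h1
      have h2 : ∑ i, ((b.u.repr ⟨x, hxk, hxq⟩ i • b.u i : ↥(t.grade (-1) ⊓ parity (g := g) 0)) : g) =
          x := h1
      rw [← h2]
      exact Submodule.sum_mem _ fun i _ => Submodule.smul_mem _ _ (hmem (.even i))
    · have h1 := congrArg Subtype.val (b.v.sum_repr ⟨x, hxk, hxq⟩)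
      rw [AddSubmonoidClass.coe_finsetSum] at h1
      have h2 : ∑ i, ((b.v.repr ⟨x, hxk, hxq⟩ i • b.v i : ↥(t.grade (-1) ⊓ parity (g := g) 1)) : g) =
          x := h1
      rw [← h2]
      exact Submodule.sum_mem _ fun i _ => Submodule.smul_mem _ _ (hmem (.odd i))
  · set y := x - ∑ a, chi B t (bracket (F.neg a) x) • F.pos a with hy
    have hyk : y ∈ t.grade k := by
      refine sub_mem hxk (Submodule.sum_mem _ fun a _ => ?_)
      by_cases hka : F.wtN a + k = -2
      · rw [show k = -2 - F.wtN a by omega]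
        exact Submodule.smul_mem _ _ (F.pos_mem a).1
      · rw [chi_bracket_grade B t (F.neg_mem a).1 hxk hka, zero_smul]; exact zero_mem _
    have hyq : y ∈ parity (g := g) q := by
      refine sub_mem hxq (Submodule.sum_mem _ fun a _ => ?_)
      by_cases hka : F.parN a = q
      · rw [← hka]
        exact Submodule.smul_mem _ _ (F.pos_mem a).2
      · rw [chi_bracket_parity B t (F.neg_mem a).2 hxq hka, zero_smul]; exact zero_mem _
    have hya : ∀ a, chi B t (bracket (F.neg a) y) = 0 := by
      intro a
      rw [hy]
      simp only [map_sub, map_sum, map_smul, F.chi_neg_pos, smul_eq_mul]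
      simp
    have hey : bracket (t.e : g) y = 0 := by
      refine B.nondegenerate _ ?_
      have htop : LinearMap.ker (B.form (bracket (t.e : g) y)) = ⊤ := by
        rw [eq_top_iff, ← t.iSup_grade]
        refine iSup_le fun j z hz => LinearMap.mem_ker.mpr ?_
        rcases le_or_gt j (-2) with hj | hj
        · have h1 := hN j hj hz
          refine LinearMap.mem_ker.mp (Submodule.span_le.mpr ?_ h1)
          rintro _ ⟨a, rfl⟩
          rw [SetLike.mem_coe, LinearMap.mem_ker, form_bracket_e, B.supersymm hyq
            (bracket_mem t.e.2 (F.neg_mem a).2), ← chi_bracket_apply, hya, mul_zero, neg_zero]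
        · exact form_grade B t (t.bracket_mem_grade t.e_mem_grade hyk) hz (by omega)
      intro z
      have : z ∈ LinearMap.ker (B.form (bracket (t.e : g) y)) := htop ▸ Submodule.mem_top
      exact this
    have h2 := add_mem (hY y hey) (Submodule.sum_mem (t := Finset.univ) _ fun a _ =>
      Submodule.smul_mem _ (chi B t (bracket (F.neg a) x)) (hmem (.pos a)))
    simpa [hy, vec] using h2

variable [FiniteDimensional ℂ g]

/-- The basis of `g` given by the letters. -/
noncomputable def basis : Basis F.J ℂ g := Basis.mk F.linearIndependent_vec F.span_vec

theorem basis_apply (l : F.J) : F.basis l = F.vec l := by simp [basis]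

theorem repr_vec (l l' : F.J) : F.basis.repr (F.vec l) l' = if l = l' then 1 else 0 := by
  rw [← basis_apply, Basis.repr_self, Finsupp.single_apply]

theorem repr_grade {k : ℤ} {x : g} (hx : x ∈ t.grade k) {l : F.J} (h : F.wt l ≠ k) :
    F.basis.repr x l = 0 := by
  have h1 : ∑ l, (((F.wt l : ℂ) - k) * F.basis.repr x l) • F.vec l = 0 := by
    have h2 := t.mem_grade.mp hx
    rw [← F.basis.sum_repr x, map_sum, Finset.smul_sum, ← sub_eq_zero,
      ← Finset.sum_sub_distrib] at h2
    rw [← h2]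
    refine Finset.sum_congr rfl fun l _ => ?_
    rw [map_smul, basis_apply, t.mem_grade.mp (F.vec_mem_grade l)]
    module
  have h3 := Fintype.linearIndependent_iff.mp F.linearIndependent_vec _ h1 l
  refine (mul_eq_zero.mp h3).resolve_left (sub_ne_zero.mpr ?_)
  exact_mod_cast h

theorem repr_parity {p : ZMod 2} {x : g} (hx : x ∈ parity (g := g) p) {l : F.J}
    (h : F.par l ≠ p) : F.basis.repr x l = 0 := by
  have h1 : ∑ l, ((ksign (F.par l) 1 - ksign p 1) * F.basis.repr x l) • F.vec l = 0 := by
    have h2 := parityInvol_apply g hx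
    rw [← F.basis.sum_repr x, map_sum, Finset.smul_sum, ← sub_eq_zero,
      ← Finset.sum_sub_distrib] at h2
    rw [← h2]
    refine Finset.sum_congr rfl fun l _ => ?_
    rw [map_smul, basis_apply, parityInvol_apply g (F.vec_mem_parity l)]
    module
  have h3 := Fintype.linearIndependent_iff.mp F.linearIndependent_vec _ h1 l
  refine (mul_eq_zero.mp h3).resolve_left (sub_ne_zero.mpr ?_)
  rcases zmod2_cases (F.par l) with h4 | h4 <;> rcases zmod2_cases p with h5 | h5 <;>
    rw [h4, h5] at h ⊢ <;> simp_all [ksign] <;> norm_num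

theorem mem_span_vec {P : F.J → Prop} {x : g} (h : ∀ l, ¬ P l → F.basis.repr x l = 0) :
    x ∈ Submodule.span ℂ (F.vec '' {l | P l}) := by
  rw [← F.basis.sum_repr x]
  refine Submodule.sum_mem _ fun l _ => ?_
  by_cases hl : P l
  · rw [basis_apply]
    exact Submodule.smul_mem _ _ (Submodule.subset_span ⟨l, hl, rfl⟩)
  · rw [h l hl, zero_smul]; exact zero_mem _

theorem grade_le_span (k : ℤ) : t.grade k ≤ Submodule.span ℂ (F.vec '' {l | F.wt l = k}) :=
  fun _ hx => F.mem_span_vec fun _ hl => F.repr_grade hx hl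

theorem grade_parity_le_span (k : ℤ) (p : ZMod 2) : t.grade k ⊓ parity (g := g) p ≤
    Submodule.span ℂ (F.vec '' {l | F.wt l = k ∧ F.par l = p}) := fun _ hx =>
  F.mem_span_vec fun l hl => by
    by_cases h : F.wt l = k
    · exact F.repr_parity hx.2 fun hp => hl ⟨h, hp⟩
    · exact F.repr_grade hx.1 h

end Frame

end Frames

/-! ## The PBW basis of `Q_χ` -/

theorem UEA.adjoin_range_ι (g : Type*) [AddCommGroup g] [Module ℂ g] [LieSuperalgebra g] :
    Algebra.adjoin ℂ (Set.range (UEA.ι g)) = ⊤ := by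
  rw [eq_top_iff]
  intro u _
  obtain ⟨a, rfl⟩ := RingQuot.mkAlgHom_surjective ℂ (UEA.Rel g) u
  have ha : a ∈ Algebra.adjoin ℂ (Set.range (TensorAlgebra.ι ℂ (M := g))) := by
    rw [TensorAlgebra.adjoin_range_ι]; trivial
  have h1 := (Subalgebra.map_mono (f := RingQuot.mkAlgHom ℂ (UEA.Rel g)) le_rfl :
    (Algebra.adjoin ℂ (Set.range (TensorAlgebra.ι ℂ (M := g)))).map _ ≤ _)
    (Subalgebra.mem_map.mpr ⟨a, ha, rfl⟩)
  rw [AlgHom.map_adjoin, ← Set.range_comp] at h1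
  exact h1

theorem UEA.induction_mul {g : Type*} [AddCommGroup g] [Module ℂ g] [LieSuperalgebra g]
    {P : UEA g → Prop} (h1 : P 1) (hadd : ∀ u v, P u → P v → P (u + v))
    (hsmul : ∀ (c : ℂ) u, P u → P (c • u)) (hmul : ∀ x u, P u → P (UEA.ι g x * u)) (u : UEA g) :
    P u := by
  have h0 : P 0 := by simpa using hsmul 0 1 h1
  let S : Submodule ℂ (UEA g) := ⟨⟨⟨{u | P u}, fun {u v} => hadd u v⟩, h0⟩, fun c u => hsmul c u⟩
  have hu : u ∈ Algebra.adjoin ℂ (Set.range (UEA.ι g)) := by rw [UEA.adjoin_range_ι]; trivial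
  have key : ∀ v ∈ Algebra.adjoin ℂ (Set.range (UEA.ι g)), ∀ w, P w → P (v * w) := by
    intro v hv
    induction hv using Algebra.adjoin_induction with
    | mem v h => obtain ⟨x, rfl⟩ := h; exact fun w => hmul x w
    | algebraMap c => intro w hw; rw [← Algebra.smul_def]; exact hsmul c w hw
    | add v v' _ _ h h' => intro w hw; rw [add_mul]; exact hadd _ _ (h w hw) (h' w hw)
    | mul v v' _ _ h h' => intro w hw; rw [mul_assoc]; exact h _ (h' w hw)
  simpa using key u hu 1 h1

open InductionData

set_option linter.unusedSectionVars false

section Frames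

variable {g : Type*} [AddCommGroup g] [Module ℂ g] [LieSuperalgebra g]
  {B : InvariantForm g} {t : Sl2Triple g} {b : WittBases B t}

theorem mkQ_eq_smul (u : UEA g) : (Ichi b).mkQ u = u • oneChi b := by
  rw [oneChi, ← map_smul, smul_eq_mul, mul_one]

theorem smul_oneChi {x : g} (hx : x ∈ mSub b) : UEA.ι g x • oneChi b = chi B t x • oneChi b := by
  rw [← sub_eq_zero, ← mkQ_eq_smul, ← algebraMap_smul (UEA g) (chi B t x) (oneChi b),
    ← mkQ_eq_smul, ← map_sub, Submodule.mkQ_apply, Submodule.Quotient.mk_eq_zero]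
  exact Submodule.subset_span ⟨x, hx, rfl⟩

namespace Frame

variable (F : Frame b)

theorem vec_mem_mSub {l : F.J} (hl : ¬ F.Free l) : F.vec l ∈ mSub b := by
  cases l with
  | cent i => exact absurd trivial hl
  | pos a => exact absurd trivial hl
  | even i =>
    refine Submodule.mem_sup_left (Submodule.mem_sup_right (Submodule.subset_span ⟨i, ?_, rfl⟩))
    simpa [Free] using hl
  | odd i =>
    refine Submodule.mem_sup_right (Submodule.subset_span ⟨i, ?_, rfl⟩)
    simpa [Free] using hl
  | neg a =>
    refine Submodule.mem_sup_left (Submodule.mem_sup_left ?_)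
    rw [← F.neg_span]
    exact Submodule.subset_span (Set.mem_range_self a)

theorem mSub_le_span : mSub b ≤ Submodule.span ℂ (F.vec '' {l | ¬ F.Free l}) := by
  refine sup_le (sup_le ?_ ?_) ?_
  · rw [← F.neg_span, Submodule.span_le]
    rintro _ ⟨a, rfl⟩
    exact Submodule.subset_span ⟨.neg a, id, rfl⟩
  · rw [Submodule.span_le]
    rintro _ ⟨i, hi, rfl⟩
    exact Submodule.subset_span ⟨.even i, by simpa [Free] using hi, rfl⟩
  · rw [Submodule.span_le]
    rintro _ ⟨i, hi, rfl⟩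
    exact Submodule.subset_span ⟨.odd i, by simpa [Free] using hi, rfl⟩

theorem dual_mem_mSub' {l : F.J} (hl : F.Free l) : F.dual l ∈ mSub' b := by
  cases l with
  | cent i => exact zero_mem _
  | pos a => exact Submodule.mem_sup_left (F.vec_mem_mSub (l := .neg a) id)
  | even i =>
    refine Submodule.mem_sup_left (F.vec_mem_mSub (l := .even i.rev) ?_)
    have hi : (i : ℕ) < b.s := hl
    simp only [Free, Fin.val_rev]; omega
  | odd i =>
    have hi : 2 * (i : ℕ) < t.judgingNumber := hl
    -- The middle odd vector is the only dual that lies outside `m`; it is the reason for passing to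
    -- `m'`.
    by_cases h : 2 * (i : ℕ) + 1 = t.judgingNumber
    · exact Submodule.mem_sup_right (Submodule.subset_span
        ⟨i.rev, by simp only [Fin.val_rev]; omega, rfl⟩)
    · refine Submodule.mem_sup_left (F.vec_mem_mSub (l := .odd i.rev) ?_)
      simp only [Free, Fin.val_rev]; omega
  | neg a => exact hl.elim

theorem mSub'_le_span : mSub' b ≤ Submodule.span ℂ (F.dual '' {l | F.Free l}) := by
  refine sup_le (F.mSub_le_span.trans ?_) ?_
  · rw [Submodule.span_le]
    rintro _ ⟨l, hl, rfl⟩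
    cases l with
    | cent i => exact absurd trivial hl
    | pos a => exact absurd trivial hl
    | even i =>
      have hi : ¬ (i : ℕ) < b.s := hl
      refine Submodule.subset_span ⟨.even i.rev, ?_, by simp [dual, vec]⟩
      simp only [Set.mem_ofPred_eq, Free, Fin.val_rev]; omega
    | odd i =>
      have hi : ¬ 2 * (i : ℕ) < t.judgingNumber := hl
      refine Submodule.subset_span ⟨.odd i.rev, ?_, by simp [dual, vec]⟩
      simp only [Set.mem_ofPred_eq, Free, Fin.val_rev]; omega
    | neg a => exact Submodule.subset_span ⟨.pos a, trivial, rfl⟩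
  · rw [Submodule.span_le]
    rintro _ ⟨i, hi, rfl⟩
    refine Submodule.subset_span ⟨.odd i.rev, ?_, by simp [dual]⟩
    simp only [Set.mem_ofPred_eq, Free, Fin.val_rev]; omega

theorem mem_span_dual {p : ZMod 2} {x : g} (hx : x ∈ mSub' b) (hp : x ∈ parity (g := g) p) :
    x ∈ Submodule.span ℂ (F.dual '' {l | F.Free l ∧ F.par l = p}) := by
  have hmem : ∀ q, Submodule.span ℂ (F.dual '' {l | F.Free l ∧ F.par l = q}) ≤
      parity (g := g) q := fun q => by
    rw [Submodule.span_le]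
    rintro _ ⟨l, hl, rfl⟩
    exact hl.2 ▸ F.dual_mem_parity l
  have h1 : mSub' b ≤ Submodule.span ℂ (F.dual '' {l | F.Free l ∧ F.par l = p}) ⊔
      Submodule.span ℂ (F.dual '' {l | F.Free l ∧ F.par l = p + 1}) := by
    refine F.mSub'_le_span.trans ?_
    rw [← Submodule.span_union]
    refine Submodule.span_mono ?_
    rintro _ ⟨l, hl, rfl⟩
    by_cases h : F.par l = p
    · exact Or.inl ⟨l, ⟨hl, h⟩, rfl⟩
    · refine Or.inr ⟨l, ⟨hl, ?_⟩, rfl⟩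
      have h2 := zmod2_add_eq_one h
      have h3 : p + p = 0 := by
        rcases zmod2_cases p with rfl | rfl <;> rfl
      rw [← h2, add_left_comm, h3, add_zero]
  obtain ⟨y, hy, z, hz, rfl⟩ := Submodule.mem_sup.mp (h1 hx)
  have hyp := hmem _ hy
  have hzp : z ∈ parity (g := g) p := by
    have := sub_mem hp hyp
    rwa [add_sub_cancel_left] at this
  have hz1 := hmem _ hz
  have hd := Submodule.disjoint_def.mp (isCompl (g := g)).disjoint
  have hz0 : z = 0 := by
    rcases zmod2_cases p with rfl | rfl
    · exact hd z hzp (by simpa using hz1)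
    · exact hd z hz1 hzp
  rw [hz0, add_zero]
  exact hy

theorem wt_neg_of_not_free {l : F.J} (hl : ¬ F.Free l) : F.wt l ≤ -1 := by
  cases l with
  | cent i => exact absurd trivial hl
  | pos a => exact absurd trivial hl
  | even i => simp [wt]
  | odd i => simp [wt]
  | neg a => have := F.wtN_le a; simp only [wt]; omega

theorem not_free_of_wt {l : F.J} [FiniteDimensional ℂ g] (hl : F.wt l ≤ -2) : ¬ F.Free l := by
  cases l with
  | cent i => have := F.wtY_nonneg i; simp only [wt] at hl; omega
  | pos a => have := F.wtN_le a; simp only [wt] at hl; omega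
  | even i => simp [wt] at hl
  | odd i => simp [wt] at hl
  | neg a => exact id

theorem wt_free [FiniteDimensional ℂ g] {l : F.J} (hl : F.Free l) : -1 ≤ F.wt l := by
  by_contra h
  exact F.not_free_of_wt (by omega) hl

variable [FiniteDimensional ℂ g]

/-- This is `χ([m', m]) = 0`, which lets `ad m'` descend to `Q_χ`. By weight only `g(-1)` matters;
there, the reversal of a free index and an index that is not free never lie on the antidiagonal. -/
theorem chi_bracket_dual {l l' : F.J} (hl : F.Free l) (hl' : ¬ F.Free l') :
    chi B t (bracket (F.dual l) (F.vec l')) = 0 := by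
  have h1 := F.wt_free hl
  have h2 := F.wt_neg_of_not_free hl'
  by_cases hw : F.wt l = F.wt l'
  swap
  · exact chi_bracket_grade B t (F.dual_mem_grade l) (F.vec_mem_grade l') (by omega)
  by_cases hp : F.par l = F.par l'
  swap
  · exact chi_bracket_parity B t (F.dual_mem_parity l) (F.vec_mem_parity l') hp
  cases l' with
  | cent j => exact absurd trivial hl'
  | pos a => exact absurd trivial hl'
  | neg a => have := F.wtN_le a; simp only [wt] at hw h1; omega
  | even j =>
    cases l with
    | cent i => simp [dual]
    | pos a => have := F.wtN_le a; simp only [wt] at hw; omega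
    | even i =>
      have hi : (i : ℕ) < b.s := hl
      have hj : ¬ (j : ℕ) < b.s := hl'
      rw [dual, vec, b.u_u, if_neg]
      rw [Fin.val_rev]; omega
    | odd i => simp [par] at hp
    | neg a => exact hl.elim
  | odd j =>
    cases l with
    | cent i => simp [dual]
    | pos a => have := F.wtN_le a; simp only [wt] at hw; omega
    | even i => simp [par] at hp
    | odd i =>
      have hi : 2 * (i : ℕ) < t.judgingNumber := hl
      have hj : ¬ 2 * (j : ℕ) < t.judgingNumber := hl'
      rw [dual, vec, b.v_v, if_neg]
      rw [Fin.val_rev]; omega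
    | neg a => exact hl.elim

theorem chi_bracket_not_free {l l' : F.J} (hl : ¬ F.Free l) (hl' : ¬ F.Free l') :
    chi B t (bracket (F.vec l) (F.vec l')) = 0 := by
  have h1 := F.wt_neg_of_not_free hl
  have h2 := F.wt_neg_of_not_free hl'
  by_cases hw : F.wt l + F.wt l' = -2
  swap
  · exact chi_bracket_grade B t (F.vec_mem_grade l) (F.vec_mem_grade l') hw
  cases l with
  | cent i => exact absurd trivial hl
  | pos a => exact absurd trivial hl
  | neg a => have := F.wtN_le a; simp only [wt] at hw h2; omega
  | even i =>
    have hi : ¬ (i : ℕ) < b.s := hl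
    cases l' with
    | cent i => exact absurd trivial hl'
    | pos a => exact absurd trivial hl'
    | neg a => have := F.wtN_le a; simp only [wt] at hw; omega
    | even j =>
      have hj : ¬ (j : ℕ) < b.s := hl'
      rw [vec, vec, b.u_u, if_neg (by omega)]
    | odd j => exact chi_bracket_parity B t (b.u i).2.2 (b.v j).2.2 zero_ne_one
  | odd i =>
    have hi : ¬ 2 * (i : ℕ) < t.judgingNumber := hl
    cases l' with
    | cent i => exact absurd trivial hl'
    | pos a => exact absurd trivial hl'
    | neg a => have := F.wtN_le a; simp only [wt] at hw; omega
    | even j => exact chi_bracket_parity B t (b.v i).2.2 (b.u j).2.2 one_ne_zero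
    | odd j =>
      have hj : ¬ 2 * (j : ℕ) < t.judgingNumber := hl'
      rw [vec, vec, b.v_v, if_neg (by omega)]

theorem repr_eq_zero_of_grade {k : ℤ} (hk : k ≤ -2) {x : g} (hx : x ∈ t.grade k) {l : F.J}
    (hl : F.Free l) : F.basis.repr x l = 0 :=
  F.repr_grade hx fun h => F.not_free_of_wt (by omega) hl

theorem mem_span_of_repr {x : g} (hx : ∀ l, F.Free l → F.basis.repr x l = 0) :
    x ∈ Submodule.span ℂ (F.vec '' {l | ¬ F.Free l}) :=
  F.mem_span_vec fun l hl => hx l (not_not.mp hl)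

theorem bracket_induction {P : g → g → Prop}
    (h0 : ∀ l l', ¬ F.Free l → ¬ F.Free l' → P (F.vec l) (F.vec l'))
    (hl : ∀ z, P 0 z) (hr : ∀ y, P y 0) (hal : ∀ y y' z, P y z → P y' z → P (y + y') z)
    (har : ∀ y z z', P y z → P y z' → P y (z + z')) (hsl : ∀ (c : ℂ) y z, P y z → P (c • y) z)
    (hsr : ∀ (c : ℂ) y z, P y z → P y (c • z)) {y z : g}
    (hy : y ∈ Submodule.span ℂ (F.vec '' {l | ¬ F.Free l}))
    (hz : z ∈ Submodule.span ℂ (F.vec '' {l | ¬ F.Free l})) : P y z := by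
  induction hy using Submodule.span_induction with
  | mem y hy =>
    obtain ⟨l, hl, rfl⟩ := hy
    induction hz using Submodule.span_induction with
    | mem z hz => obtain ⟨l', hl', rfl⟩ := hz; exact h0 l l' hl hl'
    | zero => exact hr _
    | add z z' _ _ h h' => exact har _ _ _ h h'
    | smul c z _ h => exact hsr _ _ _ h
  | zero => exact hl z
  | add y y' _ _ h h' => exact hal _ _ _ h h'
  | smul c y _ h => exact hsl _ _ _ h

/-- The data describing `Q_χ` as an induced module. -/
noncomputable def inductionData : InductionData g {l : F.J // F.Free l} where
  key l := F.key l
  key_inj := F.key_injective.comp Subtype.val_injective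
  par l := F.par l
  x l := F.vec l
  coord l := F.basis.coord l
  chi := chi B t
  x_mem l := F.vec_mem_parity l
  coord_x i j := by rw [Basis.coord_apply, F.repr_vec]; simp [Subtype.ext_iff, eq_comm]
  coord_par hy h := F.repr_parity hy (Ne.symm h)
  chi_odd := chi_odd B t
  coord_bracket {y z} hy hz i := by
    have h1 := F.mem_span_of_repr (x := y) fun l hl => hy ⟨l, hl⟩
    have h2 := F.mem_span_of_repr (x := z) fun l hl => hz ⟨l, hl⟩
    refine F.bracket_induction (P := fun y z => F.basis.coord i (LieSuperalgebra.bracket y z) = 0)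
      ?_ ?_ ?_ ?_ ?_ ?_ ?_ h1 h2
    · intro l l' hl hl'
      have h1 := F.wt_neg_of_not_free hl
      have h2 := F.wt_neg_of_not_free hl'
      exact F.repr_eq_zero_of_grade (by omega)
        (t.bracket_mem_grade (F.vec_mem_grade l) (F.vec_mem_grade l')) i.2
    all_goals intros; simp_all
  chi_bracket {y z} hy hz := by
    have h1 := F.mem_span_of_repr (x := y) fun l hl => hy ⟨l, hl⟩
    have h2 := F.mem_span_of_repr (x := z) fun l hl => hz ⟨l, hl⟩
    refine F.bracket_induction (P := fun y z => chi B t (LieSuperalgebra.bracket y z) = 0)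
      ?_ ?_ ?_ ?_ ?_ ?_ ?_ h1 h2
    · exact fun l l' => F.chi_bracket_not_free
    all_goals intros; simp_all

/-- The normal words in the free letters. -/
abbrev NormalWord : Type := {w : List F.J // w.Pairwise (Before F.key F.par) ∧ ∀ l ∈ w, F.Free l}

/-- The PBW monomial of a word. -/
noncomputable def monomial (w : List F.J) : Qchi b := word F.vec w • oneChi b

theorem monomial_nil : F.monomial [] = oneChi b := one_smul _ _

theorem monomial_cons (l : F.J) (w : List F.J) :
    F.monomial (l :: w) = UEA.ι g (F.vec l) • F.monomial w := by
  rw [monomial, word_cons, mul_smul, monomial]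

/-- Two properties make all letters act compatibly with a degree: subadditivity, for the brackets,
and nonnegativity on weights with sum `-2`, for the constants produced by `χ`. The weight violates
the second one. -/
theorem straightens {Γ : Type*} [AddCommGroup Γ] [PartialOrder Γ] [IsOrderedAddMonoid Γ]
    (d : ℤ → Γ) (h1 : ∀ i j, d (i + j) ≤ d i + d j) (h2 : ∀ i j, i + j = -2 → 0 ≤ d i + d j) :
    Straightens F.vec F.key F.par (chi B t) F.Free (fun _ => True) (fun l => d (F.wt l))
      (oneChi b) where
  key_inj := F.key_injective
  mem := F.vec_mem_parity
  odd l hl := chi_odd B t (hl ▸ F.vec_mem_parity l)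
  vac l _ hl := smul_oneChi (F.vec_mem_mSub hl)
  normal l hl := chi_grade B t (F.vec_mem_grade l) (by have := F.wt_free hl; omega)
  last i j hi hj := by
    have := F.pos'_lt j
    rw [key, key, if_pos hj, if_neg hi]
    omega
  act _ _ _ _ _ := trivial
  bracket i j _ _ _ := by
    refine Submodule.span_mono (Set.image_mono ?_) (F.grade_le_span _
      (t.bracket_mem_grade (F.vec_mem_grade i) (F.vec_mem_grade j)))
    intro l hl
    refine ⟨trivial, ?_⟩
    have hl : F.wt l = F.wt i + F.wt j := hl
    rw [hl]
    exact h1 _ _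
  chi_bracket i j _ _ _ h := by
    refine h2 _ _ ?_
    by_contra hij
    exact h (chi_bracket_grade B t (F.vec_mem_grade i) (F.vec_mem_grade j) hij)

theorem wt_nonneg_of_key_lt {i j : F.J} (hi : 0 ≤ F.wt i) (hj : F.Free j)
    (hij : F.key j < F.key i) : 0 ≤ F.wt j := by
  have hfi : F.Free i := by
    by_contra h
    have := F.wt_neg_of_not_free h
    omega
  rw [key, key, if_pos hfi, if_pos hj] at hij
  cases j with
  | cent j => exact F.wtY_nonneg j
  | pos a => have := F.wtN_le a; simp only [wt]; omega
  | neg a => exact hj.elim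
  | even j =>
    cases i <;> simp only [pos', wt] at hij hi ⊢ <;> first | omega | exact hfi.elim
  | odd j =>
    cases i <;> simp only [pos', wt] at hij hi ⊢ <;> first | omega | exact hfi.elim

/-- For the weight itself, only letters of nonnegative weight may act. In the chosen order they pass
only such letters, so no pair of weights with sum `-2` occurs. -/
theorem straightens_weight : Straightens F.vec F.key F.par (chi B t) F.Free
    (fun l => 0 ≤ F.wt l) F.wt (oneChi b) where
  key_inj := F.key_injective
  mem := F.vec_mem_parity
  odd l hl := chi_odd B t (hl ▸ F.vec_mem_parity l)
  vac l _ hl := smul_oneChi (F.vec_mem_mSub hl)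
  normal l hl := chi_grade B t (F.vec_mem_grade l) (by have := F.wt_free hl; omega)
  last i j hi hj := by
    have := F.pos'_lt j
    rw [key, key, if_pos hj, if_neg hi]
    omega
  act i j hi hj hij := F.wt_nonneg_of_key_lt hi hj hij
  bracket i j hi hj hij := by
    have hj0 : 0 ≤ F.wt j := by
      rcases hij with h | rfl
      · exact F.wt_nonneg_of_key_lt hi hj h
      · exact hi
    refine Submodule.span_mono (Set.image_mono ?_) (F.grade_le_span _
      (t.bracket_mem_grade (F.vec_mem_grade i) (F.vec_mem_grade j)))
    intro l hl
    have hl : F.wt l = F.wt i + F.wt j := hl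
    exact ⟨by rw [hl]; exact add_nonneg hi hj0, hl.le⟩
  chi_bracket i j hi hj hij h := by
    have hj0 : 0 ≤ F.wt j := by
      rcases hij with h | rfl
      · exact F.wt_nonneg_of_key_lt hi hj h
      · exact hi
    exact add_nonneg hi hj0

/-- The span of the normal monomials with a given property. -/
noncomputable def spanMon (P : List F.J → Prop) : Submodule ℂ (Qchi b) :=
  Submodule.span ℂ {q | ∃ w : F.NormalWord, P w.1 ∧ q = F.monomial w.1}

theorem degSpan_eq {Γ : Type*} [AddCommGroup Γ] [PartialOrder Γ] (δ : F.J → Γ) (n : Γ) :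
    degSpan F.vec F.key F.par F.Free δ (oneChi b) n =
      F.spanMon fun w => (w.map δ).sum ≤ n := by
  refine congrArg _ (Set.ext fun q => ⟨?_, ?_⟩)
  · rintro ⟨w, h1, h2, h3, h4⟩; exact ⟨⟨w, h1, h2⟩, h3, h4⟩
  · rintro ⟨w, h3, h4⟩; exact ⟨w.1, w.2.1, w.2.2, h3, h4⟩

/-- With the zero degree, straightening becomes a pure spanning statement. -/
theorem spanMon_true : F.spanMon (fun _ => True) = ⊤ := by
  have h := F.straightens (fun _ => (0 : ℤ)) (by simp) (by simp)
  have h1 : F.spanMon (fun _ => True) =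
      degSpan F.vec F.key F.par F.Free (fun _ => (0 : ℤ)) (oneChi b) 0 := by
    rw [degSpan_eq]; congr 1; ext w; simp
  rw [h1, eq_top_iff]
  rintro q -
  obtain ⟨u, rfl⟩ := (Ichi b).mkQ_surjective q
  rw [mkQ_eq_smul]
  induction u using UEA.induction_mul with
  | h1 =>
    rw [one_smul, ← F.monomial_nil]
    exact Submodule.subset_span ⟨[], List.Pairwise.nil, by simp, by simp, by
      rw [monomial_nil, word_nil, one_smul]⟩
  | hadd u v hu hv => rw [add_smul]; exact add_mem hu hv
  | hsmul c u hu => rw [smul_assoc]; exact Submodule.smul_mem _ _ hu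
  | hmul x u hu =>
    rw [mul_smul]
    have h2 := h.sub_mem_of_mem_span (y := x) (d := 0) (n := 0) (by
      refine Submodule.span_mono (Set.image_mono ?_) (F.mem_span_vec (P := fun _ => True)
        fun l hl => absurd trivial hl)
      exact fun l _ => ⟨trivial, le_rfl⟩) hu
    have h3 := add_mem h2 (Submodule.smul_mem _ (chi B t x) hu)
    simpa using h3

/-- The induced-module PBW theorem applies because `I_χ` is generated by elements `x - χ(x)` for
which `x` has no coordinate along a free letter. The rest only moves words to the subtype of free
letters. -/
theorem linearIndependent_monomial :
    LinearIndependent ℂ fun w : F.NormalWord => F.monomial w.1 := by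
  let K := F.inductionData
  have h1 : LinearIndependent ℂ
      fun w : {w : List {l : F.J // F.Free l} // w.Pairwise (Before K.key K.par)} =>
        word K.x w.1 • oneChi b := by
    rw [linearIndependent_iff]
    intro c hc
    refine K.coeff_eq_zero (S := Ichi b) ?_ c ?_
    · refine Submodule.span_mono ?_
      rintro _ ⟨x, hx, rfl⟩
      refine ⟨x, fun l => ?_, rfl⟩
      have h2 := F.mSub_le_span hx
      change F.basis.coord l x = 0
      refine LinearMap.mem_ker.mp (Submodule.span_le.mpr ?_ h2)
      rintro _ ⟨l', hl', rfl⟩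
      rw [SetLike.mem_coe, LinearMap.mem_ker, Basis.coord_apply, F.repr_vec, if_neg]
      rintro rfl
      exact hl' l.2
    · rw [← Submodule.Quotient.mk_eq_zero, ← Submodule.mkQ_apply, mkQ_eq_smul, ← hc,
        Finsupp.linearCombination_apply, Finsupp.sum, Finset.sum_smul]
      exact Finset.sum_congr rfl fun w _ => smul_assoc _ _ _
  let φ : F.NormalWord → {w : List {l : F.J // F.Free l} // w.Pairwise (Before K.key K.par)} :=
    fun w => ⟨w.1.attachWith F.Free w.2.2, by
      have h2 : ((w.1.attachWith F.Free w.2.2).map Subtype.val).Pairwise (Before F.key F.par) := by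
        rw [List.attachWith_map_subtype_val]; exact w.2.1
      rw [List.pairwise_map] at h2
      refine h2.imp fun h => h.imp id fun h => ⟨Subtype.ext h.1, h.2⟩⟩
  have hφ : ∀ w, (φ w).1.map Subtype.val = w.1 := fun w => List.attachWith_map_subtype_val _
  have h2 := h1.comp φ fun w w' h => Subtype.ext (by rw [← hφ w, ← hφ w', h])
  convert h2 using 2 with w
  change _ = word K.x (φ w).1 • oneChi b
  rw [monomial, ← hφ w, word, word, List.map_map]
  rfl

theorem span_range_monomial :
    ⊤ ≤ Submodule.span ℂ (Set.range fun w : F.NormalWord => F.monomial w.1) := by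
  refine F.spanMon_true.symm.le.trans (Submodule.span_mono ?_)
  rintro q ⟨w, -, rfl⟩
  exact ⟨w, rfl⟩

/-- The PBW basis of `Q_χ`. -/
noncomputable def pbw : Basis F.NormalWord ℂ (Qchi b) :=
  Basis.mk F.linearIndependent_monomial F.span_range_monomial

theorem pbw_apply (w : F.NormalWord) : F.pbw w = F.monomial w.1 := by simp [pbw]

theorem mem_spanMon {P : List F.J → Prop} {q : Qchi b} :
    q ∈ F.spanMon P ↔ ∀ w, F.pbw.repr q w ≠ 0 → P w.1 := by
  have hset : {q | ∃ w : F.NormalWord, P w.1 ∧ q = F.monomial w.1} =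
      F.pbw '' {w | P w.1} := by
    ext q
    constructor
    · rintro ⟨w, h, rfl⟩; exact ⟨w, h, F.pbw_apply w⟩
    · rintro ⟨w, h, rfl⟩; exact ⟨w, h, F.pbw_apply w⟩
  rw [spanMon, hset, Basis.mem_span_image]
  constructor
  · exact fun h w hw => h (Finsupp.mem_support_iff.mpr hw)
  · exact fun h w hw => h w (Finsupp.mem_support_iff.mp hw)

end Frame

end Frames

/-! ## Monomials and filtrations of `Q_χ` -/

theorem List.mul_prod_ofFn {M : Type*} [Monoid M] {n : ℕ} (a : Fin n → M) (i : Fin n) (x : M)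
    (h : ∀ j < i, a j = 1) :
    x * (List.ofFn a).prod = (List.ofFn fun j => if j = i then x * a j else a j).prod := by
  induction n with
  | zero => exact i.elim0
  | succ n ih =>
    rw [List.ofFn_succ, List.ofFn_succ, List.prod_cons, List.prod_cons]
    refine Fin.cases (motive := fun i => (∀ j < i, a j = 1) → x * (a 0 * (List.ofFn fun i => a i.succ).prod) =
      (if 0 = i then x * a 0 else a 0) * (List.ofFn fun j : Fin n => if j.succ = i then x * a j.succ else a j.succ).prod) ?_ ?_ i h
    · intro _
      simp [Fin.succ_ne_zero, mul_assoc]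
    · intro i h
      rw [if_neg (Fin.succ_ne_zero i).symm, h 0 (Fin.succ_pos i), one_mul, one_mul,
        ih (fun j => a j.succ) i fun j hj => h _ (Fin.succ_lt_succ_iff.mpr hj)]
      simp [Fin.succ_inj]

theorem List.prod_ofFn_one {M : Type*} [Monoid M] {n : ℕ} (a : Fin n → M) (h : ∀ j, a j = 1) :
    (List.ofFn a).prod = 1 := by
  rw [funext h, List.prod_eq_one]
  intro x hx
  obtain ⟨i, rfl⟩ := (List.mem_ofFn' _ _).mp hx
  rfl

section Frames

variable {g : Type*} [AddCommGroup g] [Module ℂ g] [LieSuperalgebra g]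
  {B : InvariantForm g} {t : Sl2Triple g} {b : WittBases B t} (F : Frame b)

namespace Frame

/-- The weight of a word. -/
def weight (w : List F.J) : ℤ := (w.map F.wt).sum

/-- The Kazhdan degree of a word. -/
def kaz (w : List F.J) : ℤ := (w.map fun l => F.wt l + 2).sum

/-- The Kazhdan degree of a word minus its length. -/
def lam (w : List F.J) : ℤ := (w.map fun l => F.wt l + 1).sum

theorem kaz_eq (w : List F.J) : F.kaz w = F.weight w + 2 * w.length := by
  induction w with
  | nil => rfl
  | cons l w ih =>
    simp only [kaz, weight, List.map_cons, List.sum_cons, List.length_cons] at *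
    rw [ih]; push_cast; ring

theorem lam_eq (w : List F.J) : F.lam w = F.weight w + w.length := by
  induction w with
  | nil => rfl
  | cons l w ih =>
    simp only [lam, weight, List.map_cons, List.sum_cons, List.length_cons] at *
    rw [ih]; push_cast; ring

theorem weight_cons (l : F.J) (w : List F.J) : F.weight (l :: w) = F.wt l + F.weight w := by
  simp [weight]

theorem weight_append (w w' : List F.J) : F.weight (w ++ w') = F.weight w + F.weight w' := by
  simp [weight]

theorem sum_bideg (w : List F.J) :
    (w.map fun l => ((F.wt l + 2, F.wt l + 1) : ℤ × ℤ)).sum = (F.kaz w, F.lam w) := by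
  induction w with
  | nil => rfl
  | cons l w ih => simp [ih, kaz, lam]

/-- The normal monomials of Kazhdan degree at most `d` and of `lam` at most `c`. -/
noncomputable def bi (d c : ℤ) : Submodule ℂ (Qchi b) :=
  F.spanMon fun w => F.kaz w ≤ d ∧ F.lam w ≤ c

theorem spanMon_mono {P P' : List F.J → Prop} (h : ∀ w, P w → P' w) :
    F.spanMon P ≤ F.spanMon P' :=
  Submodule.span_mono fun _ ⟨w, h1, h2⟩ => ⟨w, h _ h1, h2⟩

theorem bi_mono {d d' c c' : ℤ} (hd : d ≤ d') (hc : c ≤ c') : F.bi d c ≤ F.bi d' c' :=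
  F.spanMon_mono fun _ h => ⟨h.1.trans hd, h.2.trans hc⟩

variable [FiniteDimensional ℂ g]

theorem bi_eq (d c : ℤ) : F.bi d c = degSpan F.vec F.key F.par F.Free
    (fun l => ((F.wt l + 2, F.wt l + 1) : ℤ × ℤ)) (oneChi b) (d, c) := by
  rw [degSpan_eq, bi]
  congr 1
  ext w
  rw [sum_bideg, Prod.mk_le_mk]

theorem monomial_mem_bi (w : F.NormalWord) : F.monomial w.1 ∈ F.bi (F.kaz w.1) (F.lam w.1) :=
  Submodule.subset_span ⟨w, ⟨le_rfl, le_rfl⟩, rfl⟩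

theorem straightens_bi : Straightens F.vec F.key F.par (chi B t) F.Free (fun _ => True)
    (fun l => ((F.wt l + 2, F.wt l + 1) : ℤ × ℤ)) (oneChi b) :=
  F.straightens (fun k => ((k + 2, k + 1) : ℤ × ℤ))
    (fun i j => by rw [Prod.mk_add_mk, Prod.mk_le_mk]; constructor <;> omega)
    (fun i j h => by
      rw [Prod.mk_add_mk, ← Prod.mk_zero_zero, Prod.mk_le_mk]; constructor <;> omega)

theorem smul_sub_mem_bi {k : ℤ} {y : g} (hy : y ∈ t.grade k) {d c : ℤ} {q : Qchi b}
    (hq : q ∈ F.bi d c) :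
    UEA.ι g y • q - chi B t y • q ∈ F.bi (d + (k + 2)) (c + (k + 1)) := by
  rw [bi_eq] at hq
  have hs : y ∈ Submodule.span ℂ (F.vec '' {l | True ∧
      ((F.wt l + 2, F.wt l + 1) : ℤ × ℤ) ≤ ((k + 2, k + 1) : ℤ × ℤ)}) := by
    refine Submodule.span_mono (Set.image_mono ?_) (F.grade_le_span k hy)
    intro l hl
    have hl : F.wt l = k := hl
    exact ⟨trivial, by rw [hl]⟩
  have h := F.straightens_bi.sub_mem_of_mem_span hs hq
  rw [Prod.mk_add_mk, ← bi_eq] at h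
  exact h

theorem smul_mem_bi {k : ℤ} {y : g} (hy : y ∈ t.grade k) (hk : k ≠ -2) {d c : ℤ} {q : Qchi b}
    (hq : q ∈ F.bi d c) : UEA.ι g y • q ∈ F.bi (d + (k + 2)) (c + (k + 1)) := by
  simpa [chi_grade B t hy hk] using F.smul_sub_mem_bi hy hq

theorem smul_mem_weight {k : ℤ} (hk : 0 ≤ k) {y : g} (hy : y ∈ t.grade k) {n : ℤ} {q : Qchi b}
    (hq : q ∈ F.spanMon fun w => F.weight w ≤ n) :
    UEA.ι g y • q ∈ F.spanMon fun w => F.weight w ≤ n + k := by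
  have h := F.degSpan_eq F.wt
  simp only [weight] at *
  rw [← h] at *
  have h1 := F.straightens_weight.sub_mem_of_mem_span (d := k) (y := y) (by
    refine Submodule.span_mono (Set.image_mono ?_) (F.grade_le_span k hy)
    intro l hl
    have hl : F.wt l = k := hl
    exact ⟨hl ▸ hk, hl.le⟩) hq
  simpa [chi_grade B t hy (by omega)] using h1

omit [FiniteDimensional ℂ g] in
theorem sum_count_even (w : List F.J) (l : F.J) :
    (∑ i, ((l :: w).count (.even i) : ℕ)) =
      (∑ i, w.count (.even i : F.J)) + if ∃ i, l = .even i then 1 else 0 := by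
  simp only [List.count_cons, Finset.sum_add_distrib]
  congr 1
  cases l <;> simp

omit [FiniteDimensional ℂ g] in
theorem sum_count_odd (w : List F.J) (l : F.J) :
    (∑ i, ((l :: w).count (.odd i) : ℕ)) =
      (∑ i, w.count (.odd i : F.J)) + if ∃ i, l = .odd i then 1 else 0 := by
  simp only [List.count_cons, Finset.sum_add_distrib]
  congr 1
  cases l <;> simp

theorem wt_cent_nonneg (i : Fin F.N) : 0 ≤ F.wt (.cent i) := F.wtY_nonneg i

theorem wt_pos_nonneg (a : Fin F.K) : 0 ≤ F.wt (.pos a) := by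
  have := F.wtN_le a
  simp only [wt]; omega

theorem filter_cons {l : F.J} (h : 0 ≤ F.wt l) (w : List F.J) :
    ((l :: w).filter fun l => 0 ≤ F.wt l) = l :: w.filter fun l => 0 ≤ F.wt l :=
  List.filter_cons_of_pos (by simpa using h)

theorem filter_cons' {l : F.J} (h : F.wt l = -1) (w : List F.J) :
    ((l :: w).filter fun l => 0 ≤ F.wt l) = w.filter fun l => 0 ≤ F.wt l :=
  List.filter_cons_of_neg (by simp [h])

/-- A normal word already lists its letters in the order of `IsMonomial`, so it remains to collect
equal letters of weight `-1` into powers. -/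
theorem word_eq_prod {w : List F.J} (hw : w.Pairwise (Before F.key F.par))
    (hf : ∀ l ∈ w, F.Free l) :
    word F.vec w = (((w.filter fun l => 0 ≤ F.wt l).map fun l => (F.wt l, F.vec l)).map
        fun p => UEA.ι g p.2).prod *
      (List.ofFn fun i => UEA.ι g (b.u i : g) ^ w.count (.even i : F.J)).prod *
      (List.ofFn fun i => UEA.ι g (b.v i : g) ^ w.count (.odd i : F.J)).prod := by
  induction w with
  | nil => simp [word_nil]
  | cons l w ih =>
    obtain ⟨h1, h2⟩ := List.pairwise_cons.mp hw
    have hfw : ∀ l ∈ w, F.Free l := fun l hl => hf l (by simp [hl])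
    have hfl : F.Free l := hf l (by simp)
    rw [word_cons, ih h2 hfw]
    have hkey : ∀ l' ∈ w, F.pos' l ≤ F.pos' l' := by
      intro l' hl'
      rcases h1 l' hl' with h | ⟨rfl, -⟩
      · rw [key, key, if_pos hfl, if_pos (hfw l' hl')] at h
        exact h.le
      · exact le_rfl
    -- Positions do not decrease along a normal word, so no letter of nonnegative weight follows one
    -- of weight `-1`.
    have hlow : F.wt l = -1 → (w.filter fun l => 0 ≤ F.wt l) = [] := by
      intro hl
      rw [List.filter_eq_nil_iff]
      intro l' hl' h0
      have h0 : 0 ≤ F.wt l' := by simpa using h0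
      have := hkey l' hl'
      have hfl' := hfw l' hl'
      have hY := F.wtY_nonneg
      have hN := F.wtN_le
      cases l' with
      | neg a => exact hfl'.elim
      | even i => simp [wt] at h0
      | odd i => simp [wt] at h0
      | cent i =>
        cases l with
        | neg a => exact hfl.elim
        | cent j => have := hY j; simp only [wt] at hl; omega
        | pos a => have := hN a; simp only [wt] at hl; omega
        | _ => simp only [pos'] at this; omega
      | pos i =>
        cases l with
        | neg a => exact hfl.elim
        | cent j => have := hY j; simp only [wt] at hl; omega
        | pos a => have := hN a; simp only [wt] at hl; omega
        | _ => simp only [pos'] at this; omega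
    cases l with
    | neg a => exact hfl.elim
    | cent i =>
      rw [F.filter_cons (F.wt_cent_nonneg i)]
      simp [mul_assoc]
    | pos a =>
      rw [F.filter_cons (F.wt_pos_nonneg a)]
      simp [mul_assoc]
    | even i =>
      rw [F.filter_cons' rfl, hlow rfl]
      simp only [List.map_nil, List.prod_nil, one_mul, ← mul_assoc]
      have hc : ∀ j < i, w.count (.even j : F.J) = 0 := fun j hj => by
        rw [List.count_eq_zero]
        intro hm
        have := hkey _ hm
        simp only [pos'] at this
        have hj : (j : ℕ) < i := hj
        omega
      rw [List.mul_prod_ofFn _ i _ fun j hj => by rw [hc j hj, pow_zero]]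
      congr 1
      · congr 2
        ext j
        by_cases hj : j = i
        · subst hj
          rw [if_pos rfl, List.count_cons_self, pow_succ', vec]
        · rw [if_neg hj, List.count_cons_of_ne (by simpa using Ne.symm hj)]
    | odd i =>
      rw [F.filter_cons' rfl, hlow rfl]
      have he : ∀ j, w.count (.even j : F.J) = 0 := fun j => by
        rw [List.count_eq_zero]
        intro hm
        have := hkey _ hm
        simp only [pos'] at this
        omega
      have hc : ∀ j < i, w.count (.odd j : F.J) = 0 := fun j hj => by
        rw [List.count_eq_zero]
        intro hm
        have := hkey _ hm
        simp only [pos'] at this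
        have hj : (j : ℕ) < i := hj
        omega
      simp only [List.map_nil, List.prod_nil, one_mul]
      have he' : ∀ j, (Letter.odd i :: w).count (.even j : F.J) = 0 := fun j => by
        rw [List.count_cons_of_ne (by simp), he]
      rw [List.prod_ofFn_one (fun j => UEA.ι g (b.u j : g) ^ w.count (.even j : F.J))
          fun j => by rw [he, pow_zero], one_mul,
        List.prod_ofFn_one (fun j => UEA.ι g (b.u j : g) ^
          (Letter.odd i :: w).count (.even j : F.J)) fun j => by rw [he', pow_zero], one_mul,
        List.mul_prod_ofFn _ i _ fun j hj => by rw [hc j hj, pow_zero]]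
      congr 2
      ext j
      by_cases hj : j = i
      · subst hj
        rw [if_pos rfl, List.count_cons_self, pow_succ', vec]
      · rw [if_neg hj, List.count_cons_of_ne (by simpa using Ne.symm hj)]

theorem isMonomial_monomial (w : F.NormalWord) :
    IsMonomial b (F.monomial w.1) (F.weight w.1) (F.kaz w.1) w.1.length := by
  refine ⟨(w.1.filter fun l => 0 ≤ F.wt l).map fun l => (F.wt l, F.vec l),
    fun i => w.1.count (.even i), fun i => w.1.count (.odd i), ?_, ?_, ?_, ?_, ?_, ?_⟩
  · intro p hp
    obtain ⟨l, hl, rfl⟩ := List.mem_map.mp hp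
    exact ⟨by simpa using (List.mem_filter.mp hl).2, F.vec_mem_grade l⟩
  · intro i hi
    rw [List.count_eq_zero]
    exact fun h => absurd (w.2.2 _ h) (not_lt.mpr hi)
  · intro i
    by_contra hc
    have h1 := List.duplicate_iff_sublist.mp
      (List.duplicate_iff_two_le_count.mpr (not_le.mp hc : 1 < w.1.count (.odd i)))
    have h2 := w.2.1.sublist h1
    have h3 := (List.pairwise_cons.mp h2).1 (.odd i) (by simp)
    rcases h3 with h3 | ⟨-, h3⟩
    · exact lt_irrefl _ h3
    · exact one_ne_zero h3
  · intro i hi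
    rw [List.count_eq_zero]
    exact fun h => absurd (w.2.2 _ h) (not_lt.mpr hi)
  · rw [← F.word_eq_prod w.2.1 w.2.2, mkQ_eq_smul, monomial]
  · have hstat : ∀ v : List F.J, (∀ l ∈ v, F.Free l) →
        F.weight v = ((v.filter fun l => 0 ≤ F.wt l).map F.wt).sum -
          ((∑ i, v.count (.even i : F.J) : ℕ) : ℤ) - ((∑ i, v.count (.odd i : F.J) : ℕ) : ℤ) ∧
        v.length = (v.filter fun l => 0 ≤ F.wt l).length + (∑ i, v.count (.even i : F.J)) +
          ∑ i, v.count (.odd i : F.J) := by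
      intro v hv
      induction v with
      | nil => simp [weight]
      | cons l v ih =>
        obtain ⟨i1, i2⟩ := ih fun l hl => hv l (by simp [hl])
        have hfl := hv l (by simp)
        rw [weight_cons, List.length_cons, F.sum_count_even, F.sum_count_odd, i1, i2]
        have hY := F.wtY_nonneg
        have hN := F.wtN_le
        cases l with
        | neg a => exact hfl.elim
        | cent i =>
          rw [F.filter_cons (F.wt_cent_nonneg i)]
          simp; constructor <;> ring
        | pos a =>
          rw [F.filter_cons (F.wt_pos_nonneg a)]
          simp; constructor <;> ring
        | even i =>
          rw [F.filter_cons' rfl]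
          simp [wt]; constructor <;> ring
        | odd i =>
          rw [F.filter_cons' rfl]
          simp [wt]; constructor <;> ring
    obtain ⟨h1, h2⟩ := hstat w.1 w.2.2
    have h3 : ∀ v : List F.J, (v.map fun l => F.wt l + 2).sum = (v.map F.wt).sum + 2 * v.length := F.kaz_eq
    simp only [List.map_map, List.length_map, Function.comp_def]
    rw [h3, F.kaz_eq]
    push_cast at h1
    refine ⟨h1, ?_, h2⟩
    rw [h1]
    have h2' := congrArg (Nat.cast : ℕ → ℤ) h2
    push_cast at h2'
    rw [h2']
    ring

/-- The word `u₁^{c₁} ⋯ v₁^{d₁} ⋯`. -/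
noncomputable def tail (c : Fin (2 * b.s) → ℕ) (d : Fin t.judgingNumber → ℕ) : List F.J :=
  (List.ofFn fun i => List.replicate (c i) (Letter.even i)).flatten ++
    (List.ofFn fun i => List.replicate (d i) (Letter.odd i)).flatten

omit [FiniteDimensional ℂ g] in
theorem word_flatten_replicate {n : ℕ} (l : Fin n → F.J) (c : Fin n → ℕ) :
    word F.vec (List.ofFn fun i => List.replicate (c i) (l i)).flatten =
      (List.ofFn fun i => UEA.ι g (F.vec (l i)) ^ c i).prod := by
  have h1 : ∀ L : List (List F.J), word F.vec L.flatten = (L.map (word F.vec)).prod := by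
    intro L
    induction L with
    | nil => rfl
    | cons w L ih => rw [List.flatten_cons, word_append, ih, List.map_cons, List.prod_cons]
  rw [h1, List.map_ofFn]
  congr 2
  ext i
  simp [word]

omit [FiniteDimensional ℂ g] in
theorem weight_flatten_replicate {n : ℕ} (l : Fin n → F.J) (c : Fin n → ℕ) :
    F.weight (List.ofFn fun i => List.replicate (c i) (l i)).flatten =
      ∑ i, c i * F.wt (l i) := by
  simp only [weight, List.map_flatten, List.sum_flatten, List.map_ofFn, List.sum_ofFn]
  simp

omit [FiniteDimensional ℂ g] in
theorem length_flatten_replicate {n : ℕ} (l : Fin n → F.J) (c : Fin n → ℕ) :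
    (List.ofFn fun i => List.replicate (c i) (l i)).flatten.length = ∑ i, c i := by
  simp only [List.length_flatten, List.map_ofFn, List.sum_ofFn]
  simp

omit [FiniteDimensional ℂ g] in
theorem mem_flatten_replicate {n : ℕ} {l : Fin n → F.J} {c : Fin n → ℕ} {x : F.J}
    (h : x ∈ (List.ofFn fun i => List.replicate (c i) (l i)).flatten) :
    ∃ i, x = l i ∧ c i ≠ 0 := by
  obtain ⟨L, hL, hx⟩ := List.mem_flatten.mp h
  obtain ⟨i, rfl⟩ := (List.mem_ofFn' _ _).mp hL
  exact ⟨i, (List.mem_replicate.mp hx).2, (List.mem_replicate.mp hx).1⟩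

omit [FiniteDimensional ℂ g] in
theorem normal_tail {c : Fin (2 * b.s) → ℕ} {d : Fin t.judgingNumber → ℕ}
    (hc : ∀ i : Fin (2 * b.s), b.s ≤ (i : ℕ) → c i = 0) (hd1 : ∀ i, d i ≤ 1)
    (hd : ∀ i : Fin t.judgingNumber, t.judgingNumber ≤ 2 * (i : ℕ) → d i = 0) :
    (F.tail c d).Pairwise (Before F.key F.par) ∧ ∀ l ∈ F.tail c d, F.Free l := by
  have hce : ∀ i, c i ≠ 0 → F.Free (.even i) := fun i h => by
    by_contra hi
    exact h (hc i (not_lt.mp hi))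
  have hdo : ∀ i, d i ≠ 0 → F.Free (.odd i) := fun i h => by
    by_contra hi
    exact h (hd i (not_lt.mp hi))
  refine ⟨List.pairwise_append.mpr ⟨List.pairwise_flatten.mpr ⟨?_, ?_⟩,
    List.pairwise_flatten.mpr ⟨?_, ?_⟩, ?_⟩, ?_⟩
  · intro L hL
    obtain ⟨i, rfl⟩ := (List.mem_ofFn' _ _).mp hL
    exact List.pairwise_replicate.mpr (Or.inr (Or.inr ⟨rfl, rfl⟩))
  · rw [List.pairwise_ofFn]
    intro i j hij x hx y hy
    obtain ⟨h1, rfl⟩ := List.mem_replicate.mp hx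
    obtain ⟨h2, rfl⟩ := List.mem_replicate.mp hy
    left
    rw [key, key, if_pos (hce i h1), if_pos (hce j h2)]
    simpa [pos'] using hij
  · intro L hL
    obtain ⟨i, rfl⟩ := (List.mem_ofFn' _ _).mp hL
    exact List.pairwise_replicate.mpr (Or.inl (hd1 i))
  · rw [List.pairwise_ofFn]
    intro i j hij x hx y hy
    obtain ⟨h1, rfl⟩ := List.mem_replicate.mp hx
    obtain ⟨h2, rfl⟩ := List.mem_replicate.mp hy
    left
    rw [key, key, if_pos (hdo i h1), if_pos (hdo j h2)]
    simpa [pos'] using hij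
  · intro x hx y hy
    obtain ⟨i, rfl, h1⟩ := F.mem_flatten_replicate hx
    obtain ⟨j, rfl, h2⟩ := F.mem_flatten_replicate hy
    left
    rw [key, key, if_pos (hce i h1), if_pos (hdo j h2)]
    simp only [pos']
    omega
  · intro l hl
    rcases List.mem_append.mp hl with h | h
    · obtain ⟨i, rfl, h1⟩ := F.mem_flatten_replicate h
      exact hce i h1
    · obtain ⟨i, rfl, h1⟩ := F.mem_flatten_replicate h
      exact hdo i h1

/-- The factors `x_i` are arbitrary homogeneous vectors in any order, but the tail in the `u` and
`v` is normal. The `x_i` are applied to it one at a time; since `k_i ≥ 0`, both the weight estimate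
and the estimate by Kazhdan degree and `lam` apply. -/
theorem mem_of_isMonomial {q : Qchi b} {n k : ℤ} {L : ℕ} (h : IsMonomial b q n k L) :
    q ∈ F.spanMon (fun w => F.weight w ≤ n) ∧ q ∈ F.bi k (k - L) := by
  obtain ⟨xs, c, d, h1, h2, h3, h4, rfl, rfl, rfl, rfl⟩ := h
  obtain ⟨hn, hf⟩ := F.normal_tail h2 h3 h4
  have hw : word F.vec (F.tail c d) = (List.ofFn fun i => UEA.ι g (b.u i : g) ^ c i).prod *
      (List.ofFn fun i => UEA.ι g (b.v i : g) ^ d i).prod := by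
    rw [tail, word_append, F.word_flatten_replicate, F.word_flatten_replicate]
    rfl
  have hwt : F.weight (F.tail c d) = -∑ i, (c i : ℤ) - ∑ i, (d i : ℤ) := by
    rw [tail, weight_append, weight_flatten_replicate, weight_flatten_replicate]
    simp [wt, sub_eq_add_neg]
  have hlen : ((F.tail c d).length : ℤ) = ∑ i, (c i : ℤ) + ∑ i, (d i : ℤ) := by
    rw [tail, List.length_append, length_flatten_replicate, length_flatten_replicate]
    push_cast; rfl
  rw [mkQ_eq_smul, mul_assoc, mul_smul, ← hw]
  push_cast
  rw [add_assoc (xs.length : ℤ), ← hlen]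
  have e1 : (xs.map fun p => p.1).sum - ∑ i, (c i : ℤ) - ∑ i, (d i : ℤ) =
      F.weight (F.tail c d) + (xs.map fun p => p.1).sum := by rw [hwt]; ring
  have e2 : (xs.map fun p => p.1 + 2).sum + ∑ i, (c i : ℤ) + ∑ i, (d i : ℤ) =
      F.kaz (F.tail c d) + (xs.map fun p => p.1 + 2).sum := by rw [F.kaz_eq, hwt, hlen]; ring
  rw [e1, e2]
  clear e1 e2 hwt hlen
  have e3 : F.kaz (F.tail c d) - (F.tail c d).length = F.lam (F.tail c d) := by
    rw [F.kaz_eq, F.lam_eq]; ring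
  rw [add_sub_right_comm, sub_add_eq_sub_sub_swap, e3]
  clear e3 hw
  generalize F.tail c d = w at *
  induction xs with
  | nil =>
    simp only [List.map_nil, List.prod_nil, one_smul, List.sum_nil, add_zero, List.length_nil,
      Nat.cast_zero, sub_zero]
    exact ⟨Submodule.subset_span ⟨⟨w, hn, hf⟩, le_rfl, rfl⟩, F.monomial_mem_bi ⟨w, hn, hf⟩⟩
  | cons p xs ih =>
    obtain ⟨i1, i2⟩ := ih fun p hp => h1 p (by simp [hp])
    obtain ⟨hp0, hp⟩ := h1 p (by simp)
    simp only [List.map_cons, List.prod_cons, List.sum_cons, List.length_cons, mul_smul]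
    have j1 := F.smul_mem_weight hp0 hp i1
    have j2 := F.smul_mem_bi hp (by omega) i2
    refine ⟨?_, F.bi_mono ?_ ?_ j2⟩
    · rwa [add_assoc, add_comm _ p.1] at j1
    · linarith
    · push_cast; linarith

theorem natFiltrationQ_eq (n : ℤ) : natFiltrationQ b n = F.spanMon fun w => F.weight w ≤ n := by
  refine le_antisymm (Submodule.span_le.mpr ?_) (Submodule.span_le.mpr ?_)
  · rintro q ⟨k, d, L, h, hk⟩
    exact F.spanMon_mono (fun w hw => hw.trans hk) (F.mem_of_isMonomial h).1
  · rintro q ⟨w, hw, rfl⟩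
    exact Submodule.subset_span ⟨_, _, _, F.isMonomial_monomial w, hw⟩

/-- Since `lam` is the Kazhdan degree minus the length, length at least `2` in Kazhdan degree `m +
2` means `lam ≤ m`. -/
theorem lowerTerms_eq (m : ℤ) : lowerTerms b m =
    F.spanMon fun w => (F.kaz w ≤ m + 2 ∧ F.lam w ≤ m) ∨ F.kaz w ≤ m + 1 := by
  refine le_antisymm (Submodule.span_le.mpr ?_) (Submodule.span_le.mpr ?_)
  · rintro q ⟨k, d, L, h, hk⟩
    refine F.spanMon_mono (fun w hw => ?_) (F.mem_of_isMonomial h).2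
    rcases hk with ⟨h1, h2⟩ | h1
    · left
      constructor <;> omega
    · right; omega
  · rintro q ⟨w, hw, rfl⟩
    refine Submodule.subset_span ⟨_, _, _, F.isMonomial_monomial w, ?_⟩
    have h1 := F.kaz_eq w.1
    have h2 := F.lam_eq w.1
    omega

end Frame

end Frames

/-! ## The action of `ad m'` on `Q_χ` -/

section Adjoint

variable {g : Type*} [AddCommGroup g] [Module ℂ g] [LieSuperalgebra g]

theorem UEA.invol_ι {i : ZMod 2} {x : g} (hx : x ∈ LieSuperalgebra.parity (g := g) i) :
    UEA.invol g (UEA.ι g x) = ksign i 1 • UEA.ι g x := by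
  have h : ∀ x, UEA.invol g (UEA.ι g x) = UEA.ι g (parityInvol g x) := fun x => by
    change RingQuot.liftAlgHom ℂ _ (RingQuot.mkAlgHom ℂ (UEA.Rel g) (TensorAlgebra.ι ℂ x)) = _
    rw [RingQuot.liftAlgHom_mkAlgHom_apply]
    simp
  rw [h, parityInvol_apply g hx, map_smul]

theorem UEA.mem_parity {i : ZMod 2} {u : UEA g} :
    u ∈ UEA.parity g i ↔ UEA.invol g u = ksign i 1 • u := by
  rw [UEA.parity, LinearMap.mem_ker, LinearMap.sub_apply, sub_eq_zero]
  rfl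

theorem UEA.ι_mem_parity {i : ZMod 2} {x : g} (hx : x ∈ LieSuperalgebra.parity (g := g) i) :
    UEA.ι g x ∈ UEA.parity g i := UEA.mem_parity.mpr (UEA.invol_ι hx)

theorem UEA.mul_mem_parity {i j : ZMod 2} {u v : UEA g} (hu : u ∈ UEA.parity g i)
    (hv : v ∈ UEA.parity g j) : u * v ∈ UEA.parity g (i + j) := by
  rw [UEA.mem_parity] at *
  rw [map_mul, hu, hv, ksign_add_left, smul_mul_smul_comm]

theorem UEA.one_mem_parity : (1 : UEA g) ∈ UEA.parity g 0 := by
  rw [UEA.mem_parity, map_one]; simp [ksign]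

theorem superAd_of_mem {i j : ZMod 2} (x : g) {u : UEA g} (hu : u ∈ UEA.parity g j) :
    superAd i x u = UEA.ι g x * u - ksign i j • (u * UEA.ι g x) := by
  rw [superAd]
  rcases zmod2_cases i with rfl | rfl
  · simp [ksign]
  · rw [if_pos rfl, UEA.mem_parity.mp hu, ksign_comm, smul_mul_assoc]

theorem superAd_ι {i j : ZMod 2} {x y : g} (hx : x ∈ LieSuperalgebra.parity (g := g) i)
    (hy : y ∈ LieSuperalgebra.parity (g := g) j) : superAd i x (UEA.ι g y) = UEA.ι g (bracket x y) := by
  rw [superAd_of_mem x (UEA.ι_mem_parity hy), UEA.ι_mul g hx hy]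
  abel

theorem superAd_mem_parity {i j : ZMod 2} {x : g} (hx : x ∈ LieSuperalgebra.parity (g := g) i) {u : UEA g}
    (hu : u ∈ UEA.parity g j) : superAd i x u ∈ UEA.parity g (i + j) := by
  rw [superAd_of_mem x hu]
  refine sub_mem (UEA.mul_mem_parity (UEA.ι_mem_parity hx) hu) (Submodule.smul_mem _ _ ?_)
  rw [add_comm]
  exact UEA.mul_mem_parity hu (UEA.ι_mem_parity hx)

/-- `superAd` as a linear map. -/
noncomputable def superAdₗ (i : ZMod 2) (x : g) : UEA g →ₗ[ℂ] UEA g where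
  toFun := superAd i x
  map_add' := superAd_add i x
  map_smul' c u := by
    simp only [superAd, RingHom.id_apply]
    split_ifs <;> simp only [map_smul, mul_smul_comm, smul_mul_assoc, smul_sub]

theorem superAdₗ_apply (i : ZMod 2) (x : g) (u : UEA g) : superAdₗ i x u = superAd i x u := rfl

theorem superAd_ι_mul {i j : ZMod 2} {x y : g} (hx : x ∈ LieSuperalgebra.parity (g := g) i)
    (hy : y ∈ LieSuperalgebra.parity (g := g) j) (u : UEA g) :
    superAd i x (UEA.ι g y * u) =
      UEA.ι g (bracket x y) * u + ksign i j • (UEA.ι g y * superAd i x u) := by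
  rw [superAd_mul, superAd_ι hx hy]
  congr 1
  rcases zmod2_cases i with rfl | rfl
  · simp [ksign]
  · rw [if_pos rfl, UEA.invol_ι hy, ksign_comm, smul_mul_assoc]

/-- Both sides follow the same Leibniz rule, so the Jacobi identity on generators suffices. -/
theorem superAd_superAd {i j : ZMod 2} {x y : g} (hx : x ∈ LieSuperalgebra.parity (g := g) i)
    (hy : y ∈ LieSuperalgebra.parity (g := g) j) (u : UEA g) :
    superAd i x (superAd j y u) =
      superAd (i + j) (bracket x y) u + ksign i j • superAd j y (superAd i x u) := by
  induction u using UEA.induction_mul with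
  | h1 =>
    have h : ∀ i (x : g), superAd i x 1 = 0 := fun i x => by
      rw [← map_one (algebraMap ℂ (UEA g)), superAd_algebraMap]
    have h0 : ∀ i (x : g), superAd i x 0 = 0 := fun i x => map_zero (superAdₗ i x)
    simp [h, h0]
  | hadd u v hu hv => simp only [superAd_add, hu, hv, smul_add]; abel
  | hsmul c u hu =>
    simp only [← superAdₗ_apply, map_smul] at *
    rw [hu, smul_add, smul_comm c]
  | hmul z u hu =>
    obtain ⟨z0, h0, z1, h1, rfl⟩ := exists_parity_decomp g z
    have key : ∀ {k : ZMod 2} {z : g}, z ∈ LieSuperalgebra.parity (g := g) k →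
        superAd i x (superAd j y (UEA.ι g z * u)) =
        superAd (i + j) (bracket x y) (UEA.ι g z * u) +
          ksign i j • superAd j y (superAd i x (UEA.ι g z * u)) := by
      intro k z hz
      rw [superAd_ι_mul hy hz, superAd_ι_mul hx hz, superAd_ι_mul (bracket_mem hx hy) hz]
      simp only [← superAdₗ_apply, map_add, map_smul] at *
      simp only [superAdₗ_apply] at *
      rw [superAd_ι_mul hx (bracket_mem hy hz), superAd_ι_mul hy (bracket_mem hx hz),
        superAd_ι_mul hx hz, superAd_ι_mul hy hz, hu, jacobi hx hy z]
      simp only [map_add, map_smul, add_mul, mul_add, smul_add, smul_mul_assoc, mul_smul_comm,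
        ksign_add_left, ksign_add_right, smul_smul]
      have s1 := ksign_mul_self i j
      have s2 := ksign_comm j i
      rcases ksign_eq_one_or i j with h | h <;> rw [s2, h] <;> module
    rw [map_add, add_mul]
    simp only [superAd_add, key h0, key h1, smul_add]
    abel

variable {B : InvariantForm g} {t : Sl2Triple g} {b : WittBases B t}

open Classical in
/-- The operator induced by `superAd i x` on `Q_χ`, if it exists. -/
noncomputable def adQ (b : WittBases B t) (i : ZMod 2) (x : g) : Qchi b →ₗ[ℂ] Qchi b :=
  if h : (Ichi b).restrictScalars ℂ ≤ ((Ichi b).restrictScalars ℂ).comap (superAdₗ i x) then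
    (Submodule.Quotient.restrictScalarsEquiv ℂ (Ichi b)).toLinearMap ∘ₗ
      Submodule.mapQ _ _ (superAdₗ i x) h ∘ₗ
      (Submodule.Quotient.restrictScalarsEquiv ℂ (Ichi b)).symm.toLinearMap
  else 0

theorem adQ_mkQ {i : ZMod 2} {x : g} (h : ∀ u ∈ Ichi b, superAd i x u ∈ Ichi b) (u : UEA g) :
    adQ b i x ((Ichi b).mkQ u) = (Ichi b).mkQ (superAd i x u) := by
  have h' : (Ichi b).restrictScalars ℂ ≤ ((Ichi b).restrictScalars ℂ).comap (superAdₗ i x) := h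
  rw [adQ, dif_pos h']
  rfl

namespace Frame

variable (F : Frame b) [FiniteDimensional ℂ g]

/-- Both vectors have weight at most `-1`, so the bracket has weight at most `-2` and lies in `m`.
-/
theorem bracket_dual_mem_mSub {l : F.J} (hl : F.Free l) {y : g} (hy : y ∈ mSub b) :
    bracket (F.dual l) y ∈ mSub b ∧ chi B t (bracket (F.dual l) y) = 0 := by
  replace hy := F.mSub_le_span hy
  induction hy using Submodule.span_induction with
  | mem y hy =>
    obtain ⟨l', hl', rfl⟩ := hy
    refine ⟨?_, F.chi_bracket_dual hl hl'⟩
    have h1 := F.wt_free hl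
    have h2 := F.wt_neg_of_not_free hl'
    have h3 := t.bracket_mem_grade (F.dual_mem_grade l) (F.vec_mem_grade l')
    refine Submodule.mem_sup_left (Submodule.mem_sup_left ?_)
    exact le_iSup (fun k : {k : ℤ // k ≤ -2} => t.grade k) ⟨_, by omega⟩ h3
  | zero => simp
  | add y y' _ _ h h' => simpa [h.2, h'.2] using add_mem h.1 h'.1
  | smul c y _ h => simpa [h.2] using Submodule.smul_mem _ c h.1

/-- For `z ∈ m'`, a generator `x - χ(x)` goes to `[z, x]`, which equals `[z, x] - χ([z, x])`. The
Leibniz rule extends this to the left ideal. -/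
theorem superAd_dual_mem {l : F.J} (hl : F.Free l) {u : UEA g} (hu : u ∈ Ichi b) :
    superAd (F.par l) (F.dual l) u ∈ Ichi b := by
  induction hu using Submodule.span_induction with
  | mem u hu =>
    obtain ⟨y, hy, rfl⟩ := hu
    have key : superAd (F.par l) (F.dual l) (UEA.ι g y - algebraMap ℂ (UEA g) (chi B t y)) =
        UEA.ι g (bracket (F.dual l) y) := by
      rw [← superAdₗ_apply, map_sub, superAdₗ_apply, superAdₗ_apply, superAd_algebraMap, sub_zero]
      obtain ⟨y0, h0, y1, h1, rfl⟩ := exists_parity_decomp g y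
      rw [map_add, superAd_add, superAd_ι (F.dual_mem_parity l) h0,
        superAd_ι (F.dual_mem_parity l) h1, map_add, map_add]
    obtain ⟨h1, h2⟩ := F.bracket_dual_mem_mSub hl hy
    rw [key]
    refine Submodule.subset_span ⟨_, h1, ?_⟩
    rw [h2, map_zero, sub_zero]
  | zero => rw [← superAdₗ_apply, map_zero]; exact zero_mem _
  | add u v _ _ hu hv => rw [superAd_add]; exact add_mem hu hv
  | smul a u hu h =>
    rw [smul_eq_mul, superAd_mul]
    exact add_mem ((Ichi b).smul_mem _ hu) ((Ichi b).smul_mem _ h)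

/-- The action on `Q_χ` of the element of `m'` dual to the letter `l`. -/
noncomputable def lower (l : F.J) : Qchi b →ₗ[ℂ] Qchi b :=
  if F.Free l then adQ b (F.par l) (F.dual l) else 0

theorem lower_mkQ {l : F.J} (hl : F.Free l) (u : UEA g) :
    F.lower l ((Ichi b).mkQ u) = (Ichi b).mkQ (superAd (F.par l) (F.dual l) u) := by
  rw [lower, if_pos hl, adQ_mkQ fun u hu => F.superAd_dual_mem hl hu]

theorem lower_of_not_free {l : F.J} (hl : ¬ F.Free l) : F.lower l = 0 := by
  rw [lower, if_neg hl]

theorem lower_cent (i : Fin F.N) : F.lower (.cent i) = 0 := by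
  refine LinearMap.ext fun q => ?_
  obtain ⟨u, rfl⟩ := (Ichi b).mkQ_surjective q
  rw [F.lower_mkQ (l := .cent i) trivial]
  simp [dual, superAd]

theorem lower_oneChi (l : F.J) : F.lower l (oneChi b) = 0 := by
  by_cases hl : F.Free l
  · rw [oneChi, F.lower_mkQ hl, ← map_one (algebraMap ℂ (UEA g)), superAd_algebraMap, map_zero]
  · rw [F.lower_of_not_free hl, LinearMap.zero_apply]

theorem lower_smul {l : F.J} (hl : F.Free l) {j : ZMod 2} {x : g} (hx : x ∈ parity (g := g) j)
    (q : Qchi b) : F.lower l (UEA.ι g x • q) = UEA.ι g (bracket (F.dual l) x) • q +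
      ksign (F.par l) j • UEA.ι g x • F.lower l q := by
  obtain ⟨u, rfl⟩ := (Ichi b).mkQ_surjective q
  rw [← map_smul, smul_eq_mul, F.lower_mkQ hl, superAd_ι_mul (F.dual_mem_parity l) hx, map_add,
    F.lower_mkQ hl, ← smul_eq_mul, map_smul]
  congr 1

theorem mem_span_dual_of_grade {k : ℤ} (hk : k ≤ -2) {p : ZMod 2} {x : g} (hx : x ∈ t.grade k)
    (hp : x ∈ parity (g := g) p) : x ∈ Submodule.span ℂ
      (F.dual '' {j | F.Free j ∧ F.wt j = -2 - k ∧ F.par j = p}) := by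
  refine Submodule.span_mono ?_ (F.grade_parity_le_span k p ⟨hx, hp⟩)
  rintro _ ⟨l, ⟨h1, h2⟩, rfl⟩
  cases l with
  | neg a => exact ⟨.pos a, ⟨trivial, by simp only [wt] at *; omega, h2⟩, rfl⟩
  | cent i => have := F.wt_cent_nonneg i; omega
  | pos i => have := F.wt_pos_nonneg i; omega
  | even i => simp only [wt] at h1; omega
  | odd i => simp only [wt] at h1; omega

theorem mkQ_superAd_of_mem_span {P : F.J → Prop} {p : ZMod 2} {x : g}
    (hx : x ∈ Submodule.span ℂ (F.dual '' {j | F.Free j ∧ P j ∧ F.par j = p})) :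
    ∃ c : F.J → ℂ, (∀ j, c j ≠ 0 → F.Free j ∧ P j) ∧
      ∀ u, (Ichi b).mkQ (superAd p x u) = ∑ j, c j • F.lower j ((Ichi b).mkQ u) := by
  have hadd : ∀ (x y : g) u, superAd p (x + y) u = superAd p x u + superAd p y u := by
    intro x y u
    simp only [superAd, map_add, add_mul, mul_add]
    abel
  have hsmul : ∀ (a : ℂ) (x : g) u, superAd p (a • x) u = a • superAd p x u := by
    intro a x u
    simp only [superAd, map_smul, smul_mul_assoc, mul_smul_comm, smul_sub]
  have hmk : ∀ (a : ℂ) (u : UEA g), (Ichi b).mkQ (a • u) = a • (Ichi b).mkQ u :=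
    fun a u => ((Ichi b).mkQ.restrictScalars ℂ).map_smul a u
  induction hx using Submodule.span_induction with
  | mem x hx =>
    obtain ⟨l, ⟨h1, h2, h3⟩, rfl⟩ := hx
    refine ⟨Pi.single l 1, fun j hj => ?_, fun u => ?_⟩
    · by_cases hjl : j = l
      · rw [hjl]; exact ⟨h1, h2⟩
      · exact absurd (Pi.single_eq_of_ne hjl _) hj
    · rw [Finset.sum_eq_single l, Pi.single_eq_same, one_smul, F.lower_mkQ h1, h3]
      · intro j _ hj
        rw [Pi.single_eq_of_ne hj, zero_smul]
      · exact fun h => absurd (Finset.mem_univ _) h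
  | zero =>
    refine ⟨0, fun j hj => absurd rfl hj, fun u => ?_⟩
    simp [superAd]
  | add x y _ _ hx hy =>
    obtain ⟨c, hc, hcu⟩ := hx
    obtain ⟨d, hd, hdu⟩ := hy
    refine ⟨c + d, fun j hj => ?_, fun u => ?_⟩
    · by_cases h : c j = 0
      · exact hd j (by simpa [h] using hj)
      · exact hc j h
    · rw [hadd, map_add, hcu, hdu, ← Finset.sum_add_distrib]
      simp only [Pi.add_apply, add_smul]
  | smul a x _ hx =>
    obtain ⟨c, hc, hcu⟩ := hx
    refine ⟨a • c, fun j hj => hc j (right_ne_zero_of_mul hj), fun u => ?_⟩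
    rw [hsmul, hmk, hcu, Finset.smul_sum]
    simp only [Pi.smul_apply, smul_assoc]

/-- The bracket of two duals has weight at most `-2`, so it is a combination of duals of `pos`
letters, whose weight is found by counting. -/
theorem lower_lower {l l' : F.J} (hl : F.Free l) (hl' : F.Free l') (q : Qchi b) :
    ∃ c : F.J → ℂ, (∀ j, c j ≠ 0 → F.Free j ∧ F.wt j = F.wt l + F.wt l' + 2) ∧
      F.lower l (F.lower l' q) = ∑ j, c j • F.lower j q +
        ksign (F.par l) (F.par l') • F.lower l' (F.lower l q) := by
  obtain ⟨u, rfl⟩ := (Ichi b).mkQ_surjective q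
  have h1 := F.wt_free hl
  have h2 := F.wt_free hl'
  obtain ⟨c, hc, hcu⟩ := F.mkQ_superAd_of_mem_span
    (P := fun j => F.wt j = -2 - (-2 - F.wt l + (-2 - F.wt l')))
    (F.mem_span_dual_of_grade (by omega)
      (t.bracket_mem_grade (F.dual_mem_grade l) (F.dual_mem_grade l'))
      (bracket_mem (F.dual_mem_parity l) (F.dual_mem_parity l')))
  refine ⟨c, fun j hj => ⟨(hc j hj).1, by rw [(hc j hj).2]; ring⟩, ?_⟩
  rw [F.lower_mkQ hl', F.lower_mkQ hl, superAd_superAd (F.dual_mem_parity l) (F.dual_mem_parity l'),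
    map_add, hcu, F.lower_mkQ hl, F.lower_mkQ hl']
  congr 1

end Frame

end Adjoint

/-! ## The Euler operator of the Koszul complex -/

section Euler

variable {g : Type*} [AddCommGroup g] [Module ℂ g] [LieSuperalgebra g]
  {B : InvariantForm g} {t : Sl2Triple g} {b : WittBases B t}

namespace Frame

variable (F : Frame b) [FiniteDimensional ℂ g]

theorem normal_tail_of_cons {l : F.J} {w : List F.J}
    (h : (l :: w).Pairwise (Before F.key F.par) ∧ ∀ j ∈ l :: w, F.Free j) :
    w.Pairwise (Before F.key F.par) ∧ ∀ j ∈ w, F.Free j :=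
  ⟨(List.pairwise_cons.mp h.1).2, fun j hj => h.2 j (by simp [hj])⟩

theorem kaz_cons (l : F.J) (w : List F.J) : F.kaz (l :: w) = F.wt l + 2 + F.kaz w := by
  simp [kaz]

theorem lam_cons (l : F.J) (w : List F.J) : F.lam (l :: w) = F.wt l + 1 + F.lam w := by
  simp [lam]

theorem smul_monomial_mem_bi {w : List F.J} (hf : ∀ l ∈ w, F.Free l) {d c : ℤ} {q : Qchi b}
    (hq : q ∈ F.bi d c) : word F.vec w • q ∈ F.bi (d + F.kaz w) (c + F.lam w) := by
  induction w with
  | nil => simpa [word_nil, kaz, lam] using hq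
  | cons l w ih =>
    rw [word_cons, mul_smul]
    have hl := F.wt_free (hf l (by simp))
    have h1 := F.smul_mem_bi (F.vec_mem_grade l) (by omega) (ih fun j hj => hf j (by simp [hj]))
    refine F.bi_mono ?_ ?_ h1
    · rw [kaz_cons]; linarith
    · rw [lam_cons]; linarith

/-- The dual of `l` has weight `-2 - wt l`, which gives both shifts. When it passes a letter `a`,
the constant `χ([z_l, x_a])` attains the bound for `lam`, while the rest of the bracket falls one
below: to leading order `z_l` is a derivative. -/
theorem lower_mem_bi {l : F.J} (hl : F.Free l) {d c : ℤ} {q : Qchi b} (hq : q ∈ F.bi d c) :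
    F.lower l q ∈ F.bi (d - 2 - F.wt l) (c - 1 - F.wt l) := by
  induction hq using Submodule.span_induction with
  | zero => rw [map_zero]; exact zero_mem _
  | add q q' _ _ h h' => rw [map_add]; exact add_mem h h'
  | smul a q _ h => rw [map_smul]; exact Submodule.smul_mem _ _ h
  | mem q hq =>
    obtain ⟨⟨w, hw⟩, ⟨hd, hc⟩, rfl⟩ := hq
    refine F.bi_mono (d := F.kaz w - 2 - F.wt l) (c := F.lam w - 1 - F.wt l) (by linarith)
      (by linarith) ?_
    clear hd hc
    induction w with
    | nil => rw [monomial_nil, lower_oneChi]; exact zero_mem _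
    | cons a w ih =>
      have hw' := F.normal_tail_of_cons hw
      have ih := ih hw'
      have hm := F.monomial_mem_bi ⟨w, hw'⟩
      have ha := F.wt_free (hw.2 a (by simp))
      rw [monomial_cons, F.lower_smul hl (F.vec_mem_parity a), kaz_cons, lam_cons]
      refine add_mem ?_ (Submodule.smul_mem _ _ ?_)
      · have h1 := F.smul_sub_mem_bi (t.bracket_mem_grade (F.dual_mem_grade l)
          (F.vec_mem_grade a)) hm
        have h2 : chi B t (bracket (F.dual l) (F.vec a)) • F.monomial w ∈
            F.bi (F.wt a + 2 + F.kaz w - 2 - F.wt l) (F.wt a + 1 + F.lam w - 1 - F.wt l) := by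
          by_cases h : F.wt a = F.wt l
          · exact Submodule.smul_mem _ _ (F.bi_mono (by dsimp only; linarith) (by dsimp only; linarith) hm)
          · rw [chi_bracket_grade B t (F.dual_mem_grade l) (F.vec_mem_grade a) (by omega), zero_smul]
            exact zero_mem _
        rw [← sub_add_cancel (UEA.ι g (bracket (F.dual l) (F.vec a)) • F.monomial w)]
        refine add_mem (F.bi_mono ?_ ?_ h1) h2
        · simp only; linarith
        · simp only; linarith
      · refine F.bi_mono ?_ ?_ (F.smul_mem_bi (F.vec_mem_grade a) (by omega) ih)
        · linarith
        · linarith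

/-- The operator `∑ x_l z_l` on `Q_χ`, over the free letters `x_l` outside of `g_e` and the dual
elements `z_l` of `m'`. -/
noncomputable def euler : Qchi b →ₗ[ℂ] Qchi b where
  toFun q := ∑ l, UEA.ι g (F.vec l) • F.lower l q
  map_add' q q' := by simp only [map_add, smul_add, Finset.sum_add_distrib]
  map_smul' c q := by
    simp only [map_smul, RingHom.id_apply, Finset.smul_sum, smul_algebra_smul_comm]

theorem euler_apply (q : Qchi b) : F.euler q = ∑ l, UEA.ι g (F.vec l) • F.lower l q := rfl

theorem euler_mem {d c : ℤ} {q : Qchi b}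
    (hq : ∀ l, F.Free l → F.lower l q ∈ F.bi (d - 2 - F.wt l) (c - 1 - F.wt l)) :
    F.euler q ∈ F.bi d c := by
  rw [euler_apply]
  refine Submodule.sum_mem _ fun l _ => ?_
  by_cases hl : F.Free l
  · have := F.wt_free hl
    refine F.bi_mono ?_ ?_ (F.smul_mem_bi (F.vec_mem_grade l) (by omega) (hq l hl)) <;> linarith
  · rw [F.lower_of_not_free hl, LinearMap.zero_apply, smul_zero]; exact zero_mem _

theorem euler_mem_bi {d c : ℤ} {q : Qchi b} (hq : q ∈ F.bi d c) : F.euler q ∈ F.bi d c :=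
  F.euler_mem fun _ hl => F.lower_mem_bi hl hq

/-- `0` for the letters in `g_e` and `1` for the others. -/
def extra : F.J → ℕ
  | .cent _ => 0
  | _ => 1

/-- The number of letters outside of `g_e`. -/
def num (w : List F.J) : ℕ := (w.map F.extra).sum

theorem num_cons (l : F.J) (w : List F.J) : F.num (l :: w) = F.extra l + F.num w := by
  simp [num]

theorem num_le_kaz {w : List F.J} (hw : ∀ l ∈ w, F.Free l) : (F.num w : ℤ) ≤ F.kaz w := by
  induction w with
  | nil => simp [num, kaz]
  | cons l w ih =>
    have h1 := ih fun j hj => hw j (by simp [hj])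
    have h2 := F.wt_free (hw l (by simp))
    have h3 : F.extra l ≤ 1 := by cases l <;> simp [extra]
    rw [num_cons, kaz_cons]; push_cast; omega

theorem lam_nonneg {w : List F.J} (hw : ∀ l ∈ w, F.Free l) : 0 ≤ F.lam w := by
  induction w with
  | nil => simp [lam]
  | cons l w ih =>
    have h1 := ih fun j hj => hw j (by simp [hj])
    have h2 := F.wt_free (hw l (by simp))
    rw [lam_cons]; omega

/-- Free letters have weight at least `-1`, so `lam` is never negative; descents on `lam` therefore
end. -/
theorem bi_eq_bot {d c : ℤ} (hc : c < 0) : F.bi d c = ⊥ := by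
  rw [eq_bot_iff, bi, spanMon, Submodule.span_le]
  rintro q ⟨w, h, rfl⟩
  have := F.lam_nonneg w.2.2
  omega

/-- The free part of `g(-1)` is isotropic apart from a middle odd vector. Only that vector can make
the exchange of two free letters produce a constant. -/
theorem eq_odd_of_chi_bracket {l l' : F.J} (hl : F.Free l) (hl' : F.Free l')
    (h : chi B t (bracket (F.vec l) (F.vec l')) ≠ 0) :
    ∃ i : Fin t.judgingNumber, l' = .odd i ∧ 2 * (i : ℕ) + 1 = t.judgingNumber := by
  have h1 := F.wt_free hl
  have h2 := F.wt_free hl'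
  have hw : F.wt l + F.wt l' = -2 := by
    by_contra hne
    exact h (chi_bracket_grade B t (F.vec_mem_grade l) (F.vec_mem_grade l') hne)
  cases l with
  | cent i => have := F.wt_cent_nonneg i; omega
  | pos a => have := F.wt_pos_nonneg a; omega
  | neg a => exact hl.elim
  | even i =>
    have hi : (i : ℕ) < b.s := hl
    cases l' with
    | cent i => have := F.wt_cent_nonneg i; omega
    | pos a => have := F.wt_pos_nonneg a; omega
    | neg a => exact hl'.elim
    | even j =>
      have hj : (j : ℕ) < b.s := hl'
      rw [vec, vec, b.u_u, if_neg (by omega)] at h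
      exact absurd rfl h
    | odd j => exact absurd (chi_bracket_parity B t (b.u i).2.2 (b.v j).2.2 zero_ne_one) h
  | odd i =>
    have hi : 2 * (i : ℕ) < t.judgingNumber := hl
    cases l' with
    | cent i => have := F.wt_cent_nonneg i; omega
    | pos a => have := F.wt_pos_nonneg a; omega
    | neg a => exact hl'.elim
    | even j => exact absurd (chi_bracket_parity B t (b.v i).2.2 (b.u j).2.2 one_ne_zero) h
    | odd j =>
      have hj : 2 * (j : ℕ) < t.judgingNumber := hl'
      rw [vec, vec, b.v_v] at h
      split_ifs at h with hij
      · exact ⟨j, rfl, by omega⟩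
      · exact absurd rfl h

theorem eq_nil_of_middle {i : Fin t.judgingNumber} (hi : 2 * (i : ℕ) + 1 = t.judgingNumber)
    {w : List F.J} (hw : (Letter.odd i :: w).Pairwise (Before F.key F.par))
    (hf : ∀ j ∈ Letter.odd i :: w, F.Free j) : w = [] := by
  rw [List.eq_nil_iff_forall_not_mem]
  intro l hl
  have hfl := hf l (by simp [hl])
  rcases (List.pairwise_cons.mp hw).1 l hl with h | ⟨rfl, h⟩
  · rw [key, key, if_pos (hf _ (by simp)), if_pos hfl] at h
    cases l with
    | neg a => exact hfl.elim
    | odd j =>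
      have hj : 2 * (j : ℕ) < t.judgingNumber := hfl
      simp only [pos'] at h
      omega
    | _ => simp only [pos'] at h; omega
  · exact one_ne_zero h

theorem sum_chi_dual_smul {M : Type*} [AddCommGroup M] [Module ℂ M] {l : F.J} (hl : F.Free l)
    (r : F.J → M) :
    ∑ j, (if F.Free j then chi B t (bracket (F.dual j) (F.vec l)) else 0) • r j =
      (F.extra l : ℂ) • r l := by
  rw [Finset.sum_eq_single l]
  · rw [if_pos hl, F.chi_dual_vec hl hl]
    cases l <;> simp [extra]
  · intro j _ hj
    by_cases h : F.Free j
    · rw [if_pos h, F.chi_dual_vec h hl, if_neg (fun h => hj h.1), zero_smul]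
    · rw [if_neg h, zero_smul]
  · exact fun h => absurd (Finset.mem_univ _) h

/-- To leading order the operator is a derivation. When `z_j` meets the first letter, its constant
reproduces that letter once if it lies outside `g_e`, and exchanging `x_j` with the first letter
costs a bracket, of lower `lam`. -/
theorem euler_monomial (w : F.NormalWord) :
    F.euler (F.monomial w.1) - (F.num w.1 : ℂ) • F.monomial w.1 ∈
      F.bi (F.kaz w.1) (F.lam w.1 - 1) := by
  obtain ⟨w, hw⟩ := w
  induction w with
  | nil =>
    have : F.euler (F.monomial []) = 0 := by
      rw [euler_apply]
      exact Finset.sum_eq_zero fun l _ => by rw [monomial_nil, lower_oneChi, smul_zero]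
    rw [this]
    simp [num]
  | cons a w ih =>
    have hw' := F.normal_tail_of_cons hw
    have ih := ih hw'
    have hfa := hw.2 a (by simp)
    have ha := F.wt_free hfa
    have hm := F.monomial_mem_bi ⟨w, hw'⟩
    simp only at ih hm ⊢
    set q := F.monomial w with hq
    let x : F.J → UEA g := fun l => UEA.ι g (F.vec l)
    let br : F.J → g := fun j => bracket (F.dual j) (F.vec a)
    let χ : F.J → ℂ := fun j => if F.Free j then chi B t (br j) else 0
    let T : F.J → Qchi b := fun j =>
      if F.Free j then x j • (UEA.ι g (br j) • q - chi B t (br j) • q) +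
        ksign (F.par j) (F.par a) • UEA.ι g (bracket (F.vec j) (F.vec a)) • F.lower j q else 0
    have hterm : ∀ j, x j • F.lower j (x a • q) =
        χ j • (x j • q) + x a • (x j • F.lower j q) + T j := by
      intro j
      by_cases hj : F.Free j
      · simp only [χ, T, x, br, if_pos hj]
        rw [F.lower_smul hj (F.vec_mem_parity a), smul_add, smul_sub, smul_algebra_smul_comm,
          smul_algebra_smul_comm, ← mul_smul (UEA.ι g (F.vec j)) (UEA.ι g (F.vec a)),
          UEA.ι_mul g (F.vec_mem_parity j) (F.vec_mem_parity a), add_smul, smul_assoc, smul_add,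
          smul_smul (ksign _ _) (ksign _ _), ksign_mul_self, one_smul, mul_smul (UEA.ι g (F.vec a))]
        abel
      · simp [χ, T, hj, F.lower_of_not_free hj]
    have hsum : F.euler (F.monomial (a :: w)) - (F.num (a :: w) : ℂ) • F.monomial (a :: w) =
        x a • (F.euler q - (F.num w : ℂ) • q) + ∑ j, T j := by
      rw [monomial_cons, euler_apply, Finset.sum_congr rfl fun j _ => hterm j,
        Finset.sum_add_distrib, Finset.sum_add_distrib, F.sum_chi_dual_smul hfa, ← Finset.smul_sum,
        ← euler_apply, num_cons, smul_sub, smul_algebra_smul_comm]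
      simp only [x]
      push_cast
      rw [add_smul]
      abel
    rw [hsum, kaz_cons, lam_cons]
    refine add_mem ?_ (Submodule.sum_mem _ fun j _ => ?_)
    · refine F.bi_mono ?_ ?_ (F.smul_mem_bi (F.vec_mem_grade a) (by omega) ih) <;> linarith
    · by_cases hj : F.Free j
      · have hwj := F.wt_free hj
        simp only [T, if_pos hj]
        refine add_mem ?_ (Submodule.smul_mem _ _ ?_)
        · have h1 := F.smul_sub_mem_bi (t.bracket_mem_grade (F.dual_mem_grade j)
            (F.vec_mem_grade a)) hm
          refine F.bi_mono ?_ ?_ (F.smul_mem_bi (F.vec_mem_grade j) (by omega) h1) <;> linarith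
        · have h1 := F.smul_sub_mem_bi (t.bracket_mem_grade (F.vec_mem_grade j)
            (F.vec_mem_grade a)) (F.lower_mem_bi hj hm)
          have h2 : chi B t (bracket (F.vec j) (F.vec a)) • F.lower j q = 0 := by
            -- A nonzero constant here would not lower `lam`. It requires the first letter to be the
            -- middle odd one, after which the word is empty, and `lower` kills `1_χ`.
            by_cases hz : chi B t (bracket (F.vec j) (F.vec a)) = 0
            · rw [hz, zero_smul]
            · obtain ⟨i, rfl, hi⟩ := F.eq_odd_of_chi_bracket hj hfa hz
              have := F.eq_nil_of_middle hi hw.1 hw.2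
              rw [hq, this, monomial_nil, lower_oneChi, smul_zero]
          rw [h2, sub_zero] at h1
          refine F.bi_mono ?_ ?_ h1 <;> linarith
      · simp only [T, if_neg hj]; exact zero_mem _

/-- The elements of `Q_χ` on which `m'` acts with values of low degree. -/
noncomputable def adm (d c : ℤ) : Submodule ℂ (Qchi b) :=
  ⨅ l : {l : F.J // F.Free l}, (F.bi (d - 2 - F.wt l) (c - 1 - F.wt l)).comap (F.lower l)

theorem mem_adm {d c : ℤ} {q : Qchi b} : q ∈ F.adm d c ↔
    ∀ l, F.Free l → F.lower l q ∈ F.bi (d - 2 - F.wt l) (c - 1 - F.wt l) := by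
  simp [adm, Submodule.mem_iInf]

/-- To leading order `[z_l, E] = z_l`: the constants `χ([z_l, x_j])` select `j = l`, while the
brackets `[z_l, z_j]` and the nonconstant parts of `[z_l, x_j]` lose one in `lam`. Only bounds on
the images under `lower` enter, not on `q` itself. -/
theorem lower_euler {d c : ℤ} {q : Qchi b} (hq : q ∈ F.adm d c) {l : F.J} (hl : F.Free l) :
    F.lower l (F.euler q) - (F.euler (F.lower l q) + F.lower l q) ∈
      F.bi (d - 2 - F.wt l) (c - 1 - F.wt l - 1) := by
  rw [mem_adm] at hq
  by_cases hlc : ∃ i, l = .cent i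
  · obtain ⟨i, rfl⟩ := hlc
    rw [lower_cent]
    simp
  have hwl := F.wt_free hl
  have hex : ∀ j : F.J, ∃ c : F.J → ℂ,
      (∀ i, c i ≠ 0 → F.Free i ∧ F.wt i = F.wt l + F.wt j + 2) ∧
      (F.Free j → F.lower l (F.lower j q) = ∑ i, c i • F.lower i q +
        ksign (F.par l) (F.par j) • F.lower j (F.lower l q)) := by
    intro j
    by_cases hj : F.Free j
    · obtain ⟨c, h1, h2⟩ := F.lower_lower hl hj q
      exact ⟨c, h1, fun _ => h2⟩
    · exact ⟨0, by simp, fun h => absurd h hj⟩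
  choose k hk1 hk2 using hex
  let br : F.J → g := fun j => bracket (F.dual l) (F.vec j)
  let T : F.J → Qchi b := fun j => if F.Free j then
      (UEA.ι g (br j) • F.lower j q - chi B t (br j) • F.lower j q) +
        ksign (F.par l) (F.par j) • UEA.ι g (F.vec j) • ∑ i, k j i • F.lower i q else 0
  have hterm : ∀ j, F.lower l (UEA.ι g (F.vec j) • F.lower j q) =
      (if j = l then F.lower l q else 0) + UEA.ι g (F.vec j) • F.lower j (F.lower l q) + T j := by
    intro j
    by_cases hj : F.Free j
    · simp only [T, br, if_pos hj]
      have h1 : (if j = l then F.lower l q else 0) =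
          chi B t (bracket (F.dual l) (F.vec j)) • F.lower j q := by
        rw [F.chi_dual_vec hl hj]
        by_cases h : j = l
        · subst h
          rw [if_pos rfl, if_pos ⟨rfl, fun i hi => hlc ⟨i, hi⟩⟩, one_smul]
        · rw [if_neg h, if_neg (fun h' => h h'.1.symm), zero_smul]
      rw [h1, F.lower_smul hl (F.vec_mem_parity j), hk2 j hj, smul_add, smul_add,
        smul_algebra_smul_comm, smul_smul (ksign _ _) (ksign _ _),
        ksign_mul_self, one_smul]
      abel
    · have hjl : j ≠ l := fun h => hj (h ▸ hl)
      simp [T, hj, hjl, F.lower_of_not_free hj]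
  have hsum : F.lower l (F.euler q) - (F.euler (F.lower l q) + F.lower l q) = ∑ j, T j := by
    rw [euler_apply, map_sum, Finset.sum_congr rfl fun j _ => hterm j,
      Finset.sum_add_distrib, Finset.sum_add_distrib, ← euler_apply, Finset.sum_ite_eq',
      if_pos (Finset.mem_univ _)]
    abel
  rw [hsum]
  refine Submodule.sum_mem _ fun j _ => ?_
  by_cases hj : F.Free j
  · have hwj := F.wt_free hj
    simp only [T, if_pos hj]
    refine add_mem ?_ (Submodule.smul_mem _ _ ?_)
    · have h1 := F.smul_sub_mem_bi (t.bracket_mem_grade (F.dual_mem_grade l)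
        (F.vec_mem_grade j)) (hq j hj)
      refine F.bi_mono ?_ ?_ h1 <;> linarith
    · have h1 : ∑ i, k j i • F.lower i q ∈
          F.bi (d - 4 - F.wt l - F.wt j) (c - 3 - F.wt l - F.wt j) := by
        refine Submodule.sum_mem _ fun i _ => ?_
        by_cases hi : k j i = 0
        · rw [hi, zero_smul]; exact zero_mem _
        · obtain ⟨hi1, hi2⟩ := hk1 j i hi
          refine Submodule.smul_mem _ _ (F.bi_mono ?_ ?_ (hq i hi1)) <;> linarith
      refine F.bi_mono ?_ ?_ (F.smul_mem_bi (F.vec_mem_grade j) (by omega) h1) <;> linarith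
  · simp only [T, if_neg hj]; exact zero_mem _

theorem euler_mem_adm {d c : ℤ} {q : Qchi b} (hq : q ∈ F.adm d c) : F.euler q ∈ F.adm d c := by
  rw [mem_adm]
  intro l hl
  have h1 := F.lower_euler hq hl
  have h2 := (F.mem_adm.mp hq) l hl
  have h3 := add_mem (F.bi_mono le_rfl (by omega) h1) (add_mem (F.euler_mem_bi h2) h2)
  rwa [sub_add_cancel] at h3

/-- The operator `∏_{i < n} (1 - E / (i + 1))`. -/
noncomputable def corrector : ℕ → Qchi b → Qchi b
  | 0, q => q
  | n + 1, q => corrector n q - ((n : ℂ) + 1)⁻¹ • F.euler (corrector n q)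

/-- The operator `∏_{i < n} (1 - (E + 1) / (i + 1))`. -/
noncomputable def annihilator : ℕ → Qchi b →ₗ[ℂ] Qchi b
  | 0 => LinearMap.id
  | n + 1 => annihilator n -
      ((n : ℂ) + 1)⁻¹ • (F.euler ∘ₗ annihilator n + annihilator n)

/-- Modulo lower terms `z_l E` is `(E + 1) z_l`, so passing `z_l` through the corrector turns it
into the annihilator. Being polynomial in `E`, the corrector preserves every `E`-stable subspace;
this keeps parities under control. -/
theorem corrector_spec {d c : ℤ} {q : Qchi b} (hq : q ∈ F.adm d c) (n : ℕ) :
    F.corrector n q ∈ F.adm d c ∧ F.corrector n q - q ∈ F.bi d c ∧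
      (∀ S : Submodule ℂ (Qchi b), (∀ v ∈ S, F.euler v ∈ S) → q ∈ S → F.corrector n q ∈ S) ∧
      ∀ l, F.Free l → F.lower l (F.corrector n q) - F.annihilator n (F.lower l q) ∈
        F.bi (d - 2 - F.wt l) (c - 1 - F.wt l - 1) := by
  induction n with
  | zero => exact ⟨hq, by simp [corrector], fun _ _ h => h, fun l _ => by simp [corrector, annihilator]⟩
  | succ n ih =>
    obtain ⟨h1, h2, h3, h4⟩ := ih
    refine ⟨sub_mem h1 (Submodule.smul_mem _ _ (F.euler_mem_adm h1)), ?_, ?_, ?_⟩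
    · have := sub_mem h2 (Submodule.smul_mem _ ((n : ℂ) + 1)⁻¹ (F.euler_mem (F.mem_adm.mp h1)))
      rw [corrector]
      convert this using 1
      abel
    · exact fun S hS hqS => sub_mem (h3 S hS hqS) (Submodule.smul_mem _ _ (hS _ (h3 S hS hqS)))
    · intro l hl
      have e1 := F.lower_euler h1 hl
      have e2 := h4 l hl
      have e3 := F.euler_mem_bi e2
      have e4 := sub_mem e2 (Submodule.smul_mem _ ((n : ℂ) + 1)⁻¹ (add_mem e1 (add_mem e3 e2)))
      convert e4 using 1
      simp only [corrector, annihilator, map_sub, map_smul, LinearMap.sub_apply,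
        LinearMap.smul_apply, LinearMap.add_apply, LinearMap.comp_apply]
      module

theorem annihilator_monomial (w : F.NormalWord) (n : ℕ) :
    F.annihilator n (F.monomial w.1) -
      (∏ i ∈ Finset.range n, (1 - ((i : ℂ) + 1)⁻¹ * (F.num w.1 + 1))) • F.monomial w.1 ∈
      F.bi (F.kaz w.1) (F.lam w.1 - 1) := by
  induction n with
  | zero => simp [annihilator]
  | succ n ih =>
    set P := ∏ i ∈ Finset.range n, (1 - ((i : ℂ) + 1)⁻¹ * ((F.num w.1 : ℂ) + 1)) with hP
    have e1 := F.euler_mem_bi ih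
    have e2 := Submodule.smul_mem _ P (F.euler_monomial w)
    have e4 := sub_mem ih (Submodule.smul_mem _ ((n : ℂ) + 1)⁻¹ (add_mem (add_mem e1 e2) ih))
    rw [Finset.prod_range_succ, ← hP]
    convert e4 using 1
    simp only [annihilator, map_sub, map_smul, LinearMap.sub_apply,
      LinearMap.smul_apply, LinearMap.add_apply, LinearMap.comp_apply]
    module

/-- On the leading term of a monomial with `k` letters outside `g_e`, the factor with index `k`
vanishes. It occurs in the product because `k` is at most the Kazhdan degree, hence below `n`. -/
theorem annihilator_mem {d c : ℤ} {q : Qchi b} (hq : q ∈ F.bi d c) {n : ℕ} (hn : d < n) :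
    F.annihilator n q ∈ F.bi d (c - 1) := by
  induction hq using Submodule.span_induction with
  | zero => rw [map_zero]; exact zero_mem _
  | add q q' _ _ h h' => rw [map_add]; exact add_mem h h'
  | smul a q _ h => rw [map_smul]; exact Submodule.smul_mem _ _ h
  | mem q hq =>
    obtain ⟨w, ⟨hd, hc⟩, rfl⟩ := hq
    have h1 := F.annihilator_monomial w n
    have h2 := F.num_le_kaz w.2.2
    rw [Finset.prod_eq_zero (i := F.num w.1) (Finset.mem_range.mpr (by omega)), zero_smul,
      sub_zero] at h1
    · exact F.bi_mono hd (by omega) h1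
    · rw [inv_mul_cancel₀ (Nat.cast_add_one_ne_zero _), sub_self]

/-- Elements of `Q_χ` that are invariant to leading order can be corrected to invariants. -/
theorem exists_invariant {d c : ℤ} {q : Qchi b} (hq : q ∈ F.adm d c) :
    ∃ q', (∀ l, F.lower l q' = 0) ∧ q' - q ∈ F.bi d c ∧
      ∀ S : Submodule ℂ (Qchi b), (∀ v ∈ S, F.euler v ∈ S) → q ∈ S → q' ∈ S := by
  -- Each round lowers the bound `c`. Once `c < 0`, the images under `lower` lie in spaces of
  -- negative `lam`, so they vanish.
  induction hN : (c + 1).toNat generalizing c q with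
  | zero =>
    refine ⟨q, fun l => ?_, by simp, fun _ _ h => h⟩
    by_cases hl : F.Free l
    · have h1 := F.mem_adm.mp hq l hl
      have h2 := F.wt_free hl
      rw [F.bi_eq_bot (by omega)] at h1
      exact (Submodule.mem_bot ℂ).mp h1
    · rw [F.lower_of_not_free hl, LinearMap.zero_apply]
  | succ N ih =>
    -- The images under `lower` have Kazhdan degree at most `d - 1`, so `d.toNat + 1` factors
    -- suffice.
    obtain ⟨h1, h2, h3, h4⟩ := F.corrector_spec hq (d.toNat + 1)
    have h5 : F.corrector (d.toNat + 1) q ∈ F.adm d (c - 1) := by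
      rw [mem_adm]
      intro l hl
      have h6 := F.wt_free hl
      have h7 := add_mem (h4 l hl)
        (F.annihilator_mem (n := d.toNat + 1) (F.mem_adm.mp hq l hl) (by push_cast; omega))
      rw [sub_add_cancel] at h7
      refine F.bi_mono le_rfl (by omega) h7
    obtain ⟨q', e1, e2, e3⟩ := ih h5 (by omega)
    refine ⟨q', e1, ?_, fun S hS hqS => e3 S hS (h3 S hS hqS)⟩
    have := add_mem (F.bi_mono le_rfl (by omega) e2) h2
    rwa [sub_add_sub_cancel] at this

theorem repr_euler {d c : ℤ} {q : Qchi b} (hq : q ∈ F.bi d c) {w : F.NormalWord}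
    (hw : F.lam w.1 = c) : F.pbw.repr (F.euler q) w = F.num w.1 * F.pbw.repr q w := by
  induction hq using Submodule.span_induction with
  | zero => simp
  | add q q' _ _ h h' => simp only [map_add, Finsupp.add_apply, h, h']; ring
  | smul a q _ h => simp only [map_smul, Finsupp.smul_apply, h, smul_eq_mul]; ring
  | mem q hq =>
    obtain ⟨v, ⟨hd, hc⟩, rfl⟩ := hq
    have h1 := F.mem_spanMon.mp (F.euler_monomial v) w
    have h2 : F.pbw.repr (F.euler (F.monomial v.1) - (F.num v.1 : ℂ) • F.monomial v.1) w = 0 := by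
      by_contra h
      have := (h1 h).2
      omega
    rw [map_sub, map_smul, Finsupp.sub_apply, Finsupp.smul_apply, sub_eq_zero, smul_eq_mul] at h2
    rw [h2, ← F.pbw_apply, Basis.repr_self, Finsupp.single_apply]
    by_cases h : v = w
    · rw [h]
    · rw [if_neg h, mul_zero, mul_zero]

/-- The Euler operator annihilates invariants, but it multiplies each coefficient of top `lam` by
the number of letters outside `g_e`. -/
theorem num_eq_zero_of_invariant {d c : ℤ} {q : Qchi b} (hq : q ∈ F.bi d c)
    (h0 : ∀ l, F.lower l q = 0) {w : F.NormalWord} (hw : F.lam w.1 = c)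
    (hne : F.pbw.repr q w ≠ 0) : F.num w.1 = 0 := by
  have h1 := F.repr_euler hq hw
  have h2 : F.euler q = 0 := by
    rw [euler_apply]
    exact Finset.sum_eq_zero fun l _ => by rw [h0, smul_zero]
  rw [h2, map_zero, Finsupp.zero_apply] at h1
  exact_mod_cast (mul_eq_zero.mp h1.symm).resolve_right hne

end Frame

end Euler

/-! ## Invariants of `Q_χ` and elements of the `W`-superalgebras -/

section Invariants

variable {g : Type*} [AddCommGroup g] [Module ℂ g] [LieSuperalgebra g]
  {B : InvariantForm g} {t : Sl2Triple g} {b : WittBases B t}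

/-- The part of parity `p` of `Q_χ`. -/
noncomputable def parityQ (b : WittBases B t) (p : ZMod 2) : Submodule ℂ (Qchi b) :=
  (UEA.parity g p).map ((Ichi b).mkQ.restrictScalars ℂ)

theorem mkQ_mem_parityQ {p : ZMod 2} {u : UEA g} (hu : u ∈ UEA.parity g p) :
    (Ichi b).mkQ u ∈ parityQ b p := ⟨u, hu, rfl⟩

theorem smul_mem_parityQ {p p' : ZMod 2} {u : UEA g} (hu : u ∈ UEA.parity g p) {q : Qchi b}
    (hq : q ∈ parityQ b p') : u • q ∈ parityQ b (p + p') := by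
  obtain ⟨v, hv, rfl⟩ := hq
  exact ⟨u * v, UEA.mul_mem_parity hu hv, (Ichi b).mkQ.map_smul u v⟩

theorem oneChi_mem_parityQ : oneChi b ∈ parityQ b 0 := mkQ_mem_parityQ UEA.one_mem_parity

theorem evalOne_injective : Function.Injective (evalOne b) := by
  rw [← LinearMap.ker_eq_bot, LinearMap.ker_eq_bot']
  intro φ hφ
  have hφ : φ.unop (oneChi b) = 0 := hφ
  refine MulOpposite.unop_injective (LinearMap.ext fun q => ?_)
  obtain ⟨u, rfl⟩ := (Ichi b).mkQ_surjective q
  rw [mkQ_eq_smul, map_smul, hφ, smul_zero]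
  rfl

theorem evalOne_one : evalOne b 1 = oneChi b := rfl

theorem evalOne_mul {φ ψ : FiniteW b} {u : UEA g} (hu : (Ichi b).mkQ u = evalOne b φ) :
    evalOne b (φ * ψ) = u • evalOne b ψ := by
  change ψ.unop (evalOne b φ) = u • ψ.unop (oneChi b)
  rw [← hu, mkQ_eq_smul, map_smul]

theorem smul_evalOne {x : g} (hx : x ∈ mSub b) (φ : FiniteW b) :
    UEA.ι g x • evalOne b φ = chi B t x • evalOne b φ := by
  change UEA.ι g x • φ.unop (oneChi b) = chi B t x • φ.unop (oneChi b)
  rw [← map_smul, smul_oneChi hx, ← algebraMap_smul (UEA g) (chi B t x) (oneChi b), map_smul,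
    algebraMap_smul]

theorem mkQ_superAd {i : ZMod 2} {x : g} (hx : x ∈ mSub b) (hp : x ∈ parity (g := g) i)
    (u : UEA g) : (Ichi b).mkQ (superAd i x u) =
      UEA.ι g x • (Ichi b).mkQ u - chi B t x • (Ichi b).mkQ u := by
  rw [superAd, map_sub, ← smul_eq_mul, map_smul]
  congr 1
  rw [mkQ_eq_smul, mul_smul, smul_oneChi hx, smul_algebra_smul_comm, ← mkQ_eq_smul]
  split_ifs with h
  · subst h
    rw [chi_odd B t hp, zero_smul, zero_smul]
  · rfl

theorem mSub'_eq (hr : Even t.judgingNumber) : mSub' b = mSub b := by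
  rw [mSub', sup_eq_left, Submodule.span_le]
  rintro x ⟨i, hi, -⟩
  exact absurd hi (by obtain ⟨k, hk⟩ := hr; omega)

/-- For even `r` one has `m' = m`, and `m` acts on the image of `1_χ` under an endomorphism by `χ`,
just as on `1_χ`. -/
theorem mem_refinedW_of_even (hr : Even t.judgingNumber) (φ : FiniteW b) : φ ∈ refinedW b := by
  obtain ⟨u, hu⟩ := (Ichi b).mkQ_surjective (evalOne b φ)
  refine ⟨u, hu, fun i x hx hp => ?_⟩
  rw [mSub'_eq hr] at hx
  rw [← Submodule.Quotient.mk_eq_zero, ← Submodule.mkQ_apply, mkQ_superAd hx hp, hu,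
    smul_evalOne hx, sub_self]

namespace Frame

variable (F : Frame b) [FiniteDimensional ℂ g]

theorem invol_mem_Ichi (F : Frame b) {u : UEA g} (hu : u ∈ Ichi b) : UEA.invol g u ∈ Ichi b := by
  induction hu using Submodule.span_induction with
  | mem u hu =>
    obtain ⟨x, hx, rfl⟩ := hu
    replace hx := F.mSub_le_span hx
    induction hx using Submodule.span_induction with
    | mem x hx =>
      obtain ⟨l, hl, rfl⟩ := hx
      have h1 : UEA.ι g (F.vec l) - algebraMap ℂ (UEA g) (chi B t (F.vec l)) ∈ Ichi b :=
        Submodule.subset_span ⟨_, F.vec_mem_mSub hl, rfl⟩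
      rw [map_sub, UEA.invol_ι (F.vec_mem_parity l), AlgHom.commutes]
      rcases zmod2_cases (F.par l) with h | h
      · simpa [h, ksign] using h1
      · rw [chi_odd B t (h ▸ F.vec_mem_parity l), map_zero, sub_zero] at h1 ⊢
        simpa [h, ksign] using h1
    | zero => simp
    | add x y _ _ hx hy =>
      convert add_mem hx hy using 1
      simp only [map_add, map_sub]
      abel
    | smul a x _ h =>
      convert Submodule.smul_of_tower_mem _ a h using 1
      simp only [map_smul, map_sub, mul_sub, smul_eq_mul, map_mul, AlgHom.commutes,
        Algebra.smul_def]
  | zero => simp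
  | add u v _ _ hu hv => rw [map_add]; exact add_mem hu hv
  | smul a u _ h =>
    rw [smul_eq_mul, map_mul]
    exact (Ichi b).smul_mem _ h

/-- Because `χ` vanishes on odd elements, `I_χ` is stable under the parity involution, and averaging
isolates the even representative. -/
theorem eq_zero_of_mem_parityQ (F : Frame b) {q : Qchi b} (h0 : q ∈ parityQ b 0) (h1 : q ∈ parityQ b 1) :
    q = 0 := by
  obtain ⟨u, hu, rfl⟩ := h0
  obtain ⟨v, hv, huv⟩ := h1
  have huv : (Ichi b).mkQ v = (Ichi b).mkQ u := huv
  have h2 : u - v ∈ Ichi b := by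
    rw [← Submodule.Quotient.mk_eq_zero, ← Submodule.mkQ_apply, map_sub, huv, sub_self]
  have h3 := F.invol_mem_Ichi h2
  have hu' : UEA.invol g u = u := by simpa [ksign] using UEA.mem_parity.mp hu
  have hv' : UEA.invol g v = -v := by simpa [ksign] using UEA.mem_parity.mp hv
  rw [map_sub, hu', hv'] at h3
  have h4 := Submodule.smul_of_tower_mem (Ichi b) (2⁻¹ : ℂ) (add_mem h2 h3)
  have h5 : (2⁻¹ : ℂ) • (u - v + (u - -v)) = u := by module
  rw [h5] at h4
  exact (Submodule.Quotient.mk_eq_zero _).mpr h4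

theorem lower_mem_parityQ {p : ZMod 2} {q : Qchi b} (hq : q ∈ parityQ b p) (l : F.J) :
    F.lower l q ∈ parityQ b (F.par l + p) := by
  by_cases hl : F.Free l
  · obtain ⟨u, hu, rfl⟩ := hq
    change F.lower l ((Ichi b).mkQ u) ∈ _
    rw [F.lower_mkQ hl]
    exact mkQ_mem_parityQ (superAd_mem_parity (F.dual_mem_parity l) hu)
  · rw [F.lower_of_not_free hl]; exact zero_mem _

theorem euler_mem_parityQ {p : ZMod 2} {q : Qchi b} (hq : q ∈ parityQ b p) :
    F.euler q ∈ parityQ b p := by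
  rw [euler_apply]
  refine Submodule.sum_mem _ fun l _ => ?_
  have h := smul_mem_parityQ (UEA.ι_mem_parity (F.vec_mem_parity l)) (F.lower_mem_parityQ hq l)
  have h2 : F.par l + (F.par l + p) = p := by
    generalize F.par l = i
    clear hq h; revert i p; decide
  rwa [h2] at h

/-- The elements of `Q_χ` killed by `ad m'`. -/
noncomputable def invariants : Submodule ℂ (Qchi b) := ⨅ l, LinearMap.ker (F.lower l)

theorem mem_invariants {q : Qchi b} : q ∈ F.invariants ↔ ∀ l, F.lower l q = 0 := by
  simp [invariants]

theorem exists_dual_eq {l : F.J} (hl : ¬ F.Free l) : ∃ l', F.Free l' ∧ F.dual l' = F.vec l := by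
  cases l with
  | cent i => exact absurd trivial hl
  | pos a => exact absurd trivial hl
  | even i =>
    refine ⟨.even i.rev, ?_, by simp [dual, vec]⟩
    have hi : ¬ (i : ℕ) < b.s := hl
    simp only [Free, Fin.val_rev]; omega
  | odd i =>
    refine ⟨.odd i.rev, ?_, by simp [dual, vec]⟩
    have hi : ¬ 2 * (i : ℕ) < t.judgingNumber := hl
    simp only [Free, Fin.val_rev]; omega
  | neg a => exact ⟨.pos a, trivial, rfl⟩

theorem smul_invariant {q : Qchi b} (hq : q ∈ F.invariants) {x : g} (hx : x ∈ mSub b) :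
    UEA.ι g x • q = chi B t x • q := by
  replace hx := F.mSub_le_span hx
  induction hx using Submodule.span_induction with
  | mem x hx =>
    obtain ⟨l, hl, rfl⟩ := hx
    obtain ⟨l', hl', h⟩ := F.exists_dual_eq hl
    obtain ⟨u, rfl⟩ := (Ichi b).mkQ_surjective q
    have h1 := F.mem_invariants.mp hq l'
    rw [F.lower_mkQ hl', mkQ_superAd (h ▸ F.vec_mem_mSub hl) (F.dual_mem_parity l'), h] at h1
    exact sub_eq_zero.mp h1
  | zero => simp
  | add x y _ _ hx hy => rw [map_add, map_add, add_smul, add_smul, hx, hy]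
  | smul a x _ h => rw [map_smul, map_smul, smul_assoc, smul_assoc, h]

/-- An invariant is killed by the generators of `I_χ`, since every letter that is not free is a dual
of a free one. The assignment `1_χ ↦ q` therefore extends to an endomorphism. -/
theorem exists_evalOne_eq {q : Qchi b} (hq : q ∈ F.invariants) :
    ∃ φ ∈ refinedW b, evalOne b φ = q := by
  have hle : Ichi b ≤ LinearMap.ker (LinearMap.toSpanSingleton (UEA g) (Qchi b) q) := by
    refine Submodule.span_le.mpr ?_
    rintro _ ⟨x, hx, rfl⟩
    rw [SetLike.mem_coe, LinearMap.mem_ker, LinearMap.toSpanSingleton_apply, sub_smul,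
      F.smul_invariant hq hx, algebraMap_smul, sub_self]
  have h1 : evalOne b (MulOpposite.op ((Ichi b).liftQ _ hle)) = q := by
    change (Ichi b).liftQ _ hle ((Ichi b).mkQ 1) = q
    rw [Submodule.mkQ_apply, Submodule.liftQ_apply, LinearMap.toSpanSingleton_apply, one_smul]
  refine ⟨_, ?_, h1⟩
  obtain ⟨u, hu⟩ := (Ichi b).mkQ_surjective q
  refine ⟨u, hu.trans h1.symm, fun i x hx hp => ?_⟩
  obtain ⟨c, -, hc⟩ := F.mkQ_superAd_of_mem_span (P := fun _ => True) (p := i) (x := x) (by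
    simpa using F.mem_span_dual hx hp)
  rw [← Submodule.Quotient.mk_eq_zero, ← Submodule.mkQ_apply, hc, hu]
  exact Finset.sum_eq_zero fun j _ => by rw [F.mem_invariants.mp hq, smul_zero]

theorem evalOne_mem_invariants {φ : FiniteW b} (hφ : φ ∈ refinedW b) :
    evalOne b φ ∈ F.invariants := by
  obtain ⟨u, hu, h⟩ := hφ
  refine F.mem_invariants.mpr fun l => ?_
  by_cases hl : F.Free l
  · rw [← hu, F.lower_mkQ hl, Submodule.mkQ_apply, Submodule.Quotient.mk_eq_zero]
    exact h _ _ (F.dual_mem_mSub' hl) (F.dual_mem_parity l)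
  · rw [F.lower_of_not_free hl, LinearMap.zero_apply]

/-- For `m ≥ 0` the alternative of smaller Kazhdan degree is absorbed: a nonempty word loses at
least one from its length, and the empty word has `lam = 0`. -/
theorem lowerTerms_eq_bi {m : ℤ} (hm : 0 ≤ m) : lowerTerms b m = F.bi (m + 2) m := by
  rw [lowerTerms_eq]
  refine le_antisymm (F.spanMon_mono fun w hw => ?_) (F.spanMon_mono fun w hw => Or.inl hw)
  rcases hw with hw | hw
  · exact hw
  · refine ⟨by omega, ?_⟩
    have h1 := F.kaz_eq w
    have h2 := F.lam_eq w
    by_cases h : w = []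
    · subst h; simpa [lam] using hm
    · have := List.length_pos_iff.mpr h
      omega

end Frame

end Invariants

/-! ## A degree on `Q_χ` refining the natural filtration -/

section Degree

variable {g : Type*} [AddCommGroup g] [Module ℂ g] [LieSuperalgebra g]
  {B : InvariantForm g} {t : Sl2Triple g} {b : WittBases B t}

/-- The degree of a vector of weight `k`: its weight, if nonnegative, and `0` for `k = -1`. -/
def shiftDeg (k : ℤ) : ℤ := if 0 ≤ k then k else if k = -1 then 0 else k + 2

theorem shiftDeg_nonneg {k : ℤ} (hk : -1 ≤ k) : 0 ≤ shiftDeg k := by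
  unfold shiftDeg; split_ifs <;> omega

theorem shiftDeg_of_nonneg {k : ℤ} (hk : 0 ≤ k) : shiftDeg k = k := if_pos hk

/-- The value `k + 2` for `k ≤ -2` is the smallest one compatible with the constants that arise from
weights `k` and `-2 - k`. With it both requirements of `straightens` hold. -/
theorem shiftDeg_add (i j : ℤ) : shiftDeg (i + j) ≤ shiftDeg i + shiftDeg j := by
  unfold shiftDeg; split_ifs <;> omega

namespace Frame

variable (F : Frame b) [FiniteDimensional ℂ g]

/-- The degree of a word. -/
def deg (w : List F.J) : ℤ := (w.map fun l => shiftDeg (F.wt l)).sum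

theorem deg_cons (l : F.J) (w : List F.J) : F.deg (l :: w) = shiftDeg (F.wt l) + F.deg w := by
  simp [deg]

theorem weight_le_deg (w : List F.J) : F.weight w ≤ F.deg w := by
  induction w with
  | nil => simp [weight, deg]
  | cons l w ih =>
    rw [weight_cons, deg_cons]
    have : F.wt l ≤ shiftDeg (F.wt l) := by unfold shiftDeg; split_ifs <;> omega
    omega

theorem deg_nonneg {w : List F.J} (hw : ∀ l ∈ w, F.Free l) : 0 ≤ F.deg w := by
  induction w with
  | nil => simp [deg]
  | cons l w ih =>
    have h1 := ih fun j hj => hw j (by simp [hj])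
    have h2 := shiftDeg_nonneg (F.wt_free (hw l (by simp)))
    rw [deg_cons]; omega

/-- A letter of weight `k ≥ 0` adds `k + 1` to `lam` but only `k` to the degree; letters of weight
`-1` add nothing to either. Hence the degree is smaller than `lam` unless all letters have weight
`-1`, and then it is `0`. -/
theorem deg_le_of_lam {w : List F.J} (hw : ∀ l ∈ w, F.Free l) {m : ℤ} (hm : F.lam w ≤ m) :
    F.deg w ≤ max (m - 1) 0 := by
  have key : F.deg w = 0 ∨ F.deg w ≤ F.lam w - 1 := by
    clear hm
    induction w with
    | nil => simp [deg]
    | cons l w ih =>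
      have hw' : ∀ l ∈ w, F.Free l := fun j hj => hw j (by simp [hj])
      have h1 := ih hw'
      have h2 := F.wt_free (hw l (by simp))
      have h3 := F.lam_nonneg hw'
      rw [deg_cons, lam_cons]
      unfold shiftDeg
      split_ifs <;> omega
  omega

/-- The span of the monomials of degree at most `n`. -/
noncomputable def degQ (n : ℤ) : Submodule ℂ (Qchi b) := F.spanMon fun w => F.deg w ≤ n

theorem degQ_mono {n n' : ℤ} (h : n ≤ n') : F.degQ n ≤ F.degQ n' :=
  F.spanMon_mono fun _ hw => hw.trans h

theorem degQ_le (n : ℤ) : F.degQ n ≤ natFiltrationQ b n := by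
  rw [natFiltrationQ_eq]
  exact F.spanMon_mono fun w hw => (F.weight_le_deg w).trans hw

theorem oneChi_mem_degQ : oneChi b ∈ F.degQ 0 :=
  Submodule.subset_span ⟨⟨[], List.Pairwise.nil, by simp⟩, by simp [deg], F.monomial_nil.symm⟩

theorem oneChi_mem_bi : oneChi b ∈ F.bi 0 0 :=
  Submodule.subset_span ⟨⟨[], List.Pairwise.nil, by simp⟩, by simp [kaz, lam], F.monomial_nil.symm⟩

theorem smul_mem_degQ {k : ℤ} {y : g} (hy : y ∈ t.grade k) (hk : k ≠ -2) {n : ℤ} {q : Qchi b}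
    (hq : q ∈ F.degQ n) : UEA.ι g y • q ∈ F.degQ (n + shiftDeg k) := by
  have h := F.degSpan_eq fun l => shiftDeg (F.wt l)
  have hs := F.straightens shiftDeg shiftDeg_add
    (fun i j hij => by unfold shiftDeg; split_ifs <;> omega)
  simp only [degQ, deg, ← h] at *
  have h1 := hs.sub_mem_of_mem_span (d := shiftDeg k) (y := y) (by
    refine Submodule.span_mono (Set.image_mono ?_) (F.grade_le_span k hy)
    intro l hl
    have hl : F.wt l = k := hl
    exact ⟨trivial, by rw [hl]⟩) hq
  simpa [chi_grade B t hy hk] using h1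

theorem word_smul_mem_degQ {w : List F.J} (hf : ∀ l ∈ w, F.Free l) {n : ℤ} {q : Qchi b}
    (hq : q ∈ F.degQ n) : word F.vec w • q ∈ F.degQ (n + F.deg w) := by
  induction w with
  | nil => simpa [word_nil, deg] using hq
  | cons l w ih =>
    rw [word_cons, mul_smul]
    have hl := F.wt_free (hf l (by simp))
    have h1 := F.smul_mem_degQ (F.vec_mem_grade l) (by omega) (ih fun j hj => hf j (by simp [hj]))
    rw [deg_cons]
    exact F.degQ_mono (by omega) h1

end Frame

/-! ## The elements `θ_X` -/

/-- The basis of `g(-1)` formed by the `u_i` and the `v_i`. -/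
noncomputable def wittVec (b : WittBases B t) : Fin (2 * b.s) ⊕ Fin t.judgingNumber → g :=
  Sum.elim (fun i => b.u i) (fun i => b.v i)

/-- The parities of the `u_i` and the `v_i`. -/
def wittPar (b : WittBases B t) : Fin (2 * b.s) ⊕ Fin t.judgingNumber → ZMod 2 :=
  Sum.elim (fun _ => 0) (fun _ => 1)

/-- The basis of `g(-1)` dual to the `u_i` and `v_i`. -/
noncomputable def wittDual (b : WittBases B t) : Fin (2 * b.s) ⊕ Fin t.judgingNumber → g :=
  Sum.elim (fun i => (if (i.rev : ℕ) < b.s then (-1 : ℂ) else 1) • (b.u i.rev : g))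
    (fun i => b.v i.rev)

theorem wittVec_mem_grade (i) : wittVec b i ∈ t.grade (-1) := by
  rcases i with i | i
  · exact (b.u i).2.1
  · exact (b.v i).2.1

theorem wittVec_mem_parity (i) : wittVec b i ∈ parity (g := g) (wittPar b i) := by
  rcases i with i | i
  · exact (b.u i).2.2
  · exact (b.v i).2.2

theorem wittDual_mem_grade (i) : wittDual b i ∈ t.grade (-1) := by
  rcases i with i | i
  · exact Submodule.smul_mem _ _ (b.u i.rev).2.1
  · exact (b.v i.rev).2.1

theorem wittDual_mem_parity (i) : wittDual b i ∈ parity (g := g) (wittPar b i) := by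
  rcases i with i | i
  · exact Submodule.smul_mem _ _ (b.u i.rev).2.2
  · exact (b.v i.rev).2.2

theorem chi_wittDual_wittVec (i j) :
    chi B t (bracket (wittDual b i) (wittVec b j)) = if i = j then 1 else 0 := by
  rcases i with i | i <;> rcases j with j | j
  · simp only [wittDual, wittVec, Sum.elim_inl, map_smul, LinearMap.smul_apply, b.u_u, smul_eq_mul,
      Sum.inl.injEq]
    have h : (i.rev : ℕ) + j + 1 = 2 * b.s ↔ i = j := by
      rw [Fin.val_rev, Fin.ext_iff]; omega
    simp only [h]
    split_ifs <;> norm_num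
  · exact (chi_bracket_parity B t (wittDual_mem_parity (b := b) (.inl i)) (wittVec_mem_parity (b := b) (.inr j))
      zero_ne_one).trans (by simp)
  · exact (chi_bracket_parity B t (wittDual_mem_parity (b := b) (.inr i)) (wittVec_mem_parity (b := b) (.inl j))
      one_ne_zero).trans (by simp)
  · simp only [wittDual, wittVec, Sum.elim_inr, b.v_v, Sum.inr.injEq]
    by_cases h : i = j
    · subst h
      rw [if_pos (by rw [Fin.val_rev]; omega), if_pos rfl]
    · rw [if_neg (fun h' => h (Fin.ext (by rw [Fin.val_rev] at h'; omega))), if_neg h]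

/-! ### Expansion of vectors of `g(-1)` in the dual bases. -/

section Dual

variable [FiniteDimensional ℂ g]

theorem grade_le_span_wittVec (b : WittBases B t) :
    t.grade (-1) ≤ Submodule.span ℂ (Set.range (wittVec b)) := by
  obtain ⟨F⟩ := exists_frame b
  refine (F.grade_le_span (-1)).trans (Submodule.span_le.mpr ?_)
  rintro _ ⟨l, hl, rfl⟩
  have hl : F.wt l = -1 := hl
  cases l with
  | cent i => have := F.wt_cent_nonneg i; omega
  | pos i => have := F.wt_pos_nonneg i; omega
  | even i => exact Submodule.subset_span ⟨.inl i, rfl⟩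
  | odd i => exact Submodule.subset_span ⟨.inr i, rfl⟩
  | neg a => have := F.wtN_le a; simp only [Frame.wt] at hl; omega

theorem grade_le_span_wittDual (b : WittBases B t) :
    t.grade (-1) ≤ Submodule.span ℂ (Set.range (wittDual b)) := by
  refine (grade_le_span_wittVec b).trans (Submodule.span_le.mpr ?_)
  rintro _ ⟨i | i, rfl⟩
  · have h : wittVec b (.inl i) =
        (if (i : ℕ) < b.s then (-1 : ℂ) else 1) • wittDual b (.inl i.rev) := by
      simp only [wittVec, wittDual, Sum.elim_inl, Fin.rev_rev]
      split_ifs <;> simp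
    rw [h]
    exact Submodule.smul_mem _ _ (Submodule.subset_span ⟨_, rfl⟩)
  · exact Submodule.subset_span ⟨.inr i.rev, by simp [wittVec, wittDual]⟩

theorem sum_chi_wittDual (b : WittBases B t) {v : g} (hv : v ∈ t.grade (-1)) :
    ∑ i, chi B t (bracket (wittDual b i) v) • wittVec b i = v := by
  replace hv := grade_le_span_wittVec b hv
  induction hv using Submodule.span_induction with
  | mem v hv => obtain ⟨j, rfl⟩ := hv; simp [chi_wittDual_wittVec]
  | zero => simp
  | add v w _ _ hv hw =>
    simp only [map_add, add_smul, Finset.sum_add_distrib, hv, hw]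
  | smul a v _ h => simp only [map_smul, smul_assoc, ← Finset.smul_sum, h]

theorem sum_chi_wittVec (b : WittBases B t) {v : g} (hv : v ∈ t.grade (-1)) :
    ∑ i, chi B t (bracket v (wittVec b i)) • wittDual b i = v := by
  replace hv := grade_le_span_wittDual b hv
  induction hv using Submodule.span_induction with
  | mem v hv => obtain ⟨j, rfl⟩ := hv; simp [chi_wittDual_wittVec]
  | zero => simp
  | add v w _ _ hv hw =>
    simp only [map_add, LinearMap.add_apply, add_smul, Finset.sum_add_distrib, hv, hw]
  | smul a v _ h => simp only [map_smul, LinearMap.smul_apply, smul_assoc, ← Finset.smul_sum, h]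

end Dual

theorem chi_bracket_left {X : g} (hX : bracket (t.e : g) X = 0) (y : g) :
    chi B t (bracket X y) = 0 := by
  rw [chi_bracket_apply, hX, map_zero, LinearMap.zero_apply]

theorem chi_bracket_bracket {X : g} (hX : bracket (t.e : g) X = 0) {x p : ZMod 2}
    (hx : X ∈ parity (g := g) x) {v : g} (hv : v ∈ parity (g := g) p) (w : g) :
    chi B t (bracket (bracket X v) w) = -(ksign x p * chi B t (bracket v (bracket X w))) := by
  have h1 := congrArg (chi B t) (jacobi hx hv w)
  rw [chi_bracket_left hX, map_add, map_smul, smul_eq_mul] at h1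
  linear_combination -h1

/-- For `X ∈ g_e(0)` the functional `χ([X, ·])` vanishes, so `ad X` preserves the form `χ([·,·])` on
`g(-1)`. Its canonical tensor `∑ b_i ⊗ b^i` is therefore invariant. -/
theorem sum_bracket_witt [FiniteDimensional ℂ g] {M : Type*} [AddCommGroup M] [Module ℂ M]
    (f : g →ₗ[ℂ] g →ₗ[ℂ] M) {X : g} (h0 : X ∈ t.grade 0) (hX : bracket (t.e : g) X = 0)
    {x : ZMod 2} (hx : X ∈ parity (g := g) x) :
    ∑ i, (f (bracket X (wittVec b i)) (wittDual b i) +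
      ksign x (wittPar b i) • f (wittVec b i) (bracket X (wittDual b i))) = 0 := by
  have hm : ∀ {v}, v ∈ t.grade (-1) → bracket X v ∈ t.grade (-1) := fun hv => by
    simpa using t.bracket_mem_grade h0 hv
  have h1 : ∀ i, f (bracket X (wittVec b i)) (wittDual b i) =
      ∑ j, chi B t (bracket (wittDual b j) (bracket X (wittVec b i))) •
        f (wittVec b j) (wittDual b i) := fun i => by
    conv_lhs => rw [← sum_chi_wittDual b (hm (wittVec_mem_grade i))]
    simp only [map_sum, LinearMap.sum_apply, map_smul, LinearMap.smul_apply]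
  have h2 : ∀ i, f (wittVec b i) (bracket X (wittDual b i)) =
      ∑ j, chi B t (bracket (bracket X (wittDual b i)) (wittVec b j)) •
        f (wittVec b i) (wittDual b j) := fun i => by
    conv_lhs => rw [← sum_chi_wittVec b (hm (wittDual_mem_grade i))]
    simp only [map_sum, map_smul]
  simp only [h1, h2, Finset.smul_sum, Finset.sum_add_distrib]
  rw [Finset.sum_comm, ← Finset.sum_add_distrib]
  refine Finset.sum_eq_zero fun i _ => ?_
  rw [← Finset.sum_add_distrib]
  refine Finset.sum_eq_zero fun j _ => ?_
  rw [chi_bracket_bracket hX hx (wittDual_mem_parity i), smul_smul, ← add_smul]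
  have := ksign_mul_self x (wittPar b i)
  rw [show ∀ c : ℂ, c + ksign x (wittPar b i) * -(ksign x (wittPar b i) * c) =
    (1 - ksign x (wittPar b i) * ksign x (wittPar b i)) * c from fun c => by ring, this, sub_self,
    zero_mul, zero_smul]

/-- The quadratic element `q_X = ½ ∑ [X, b_i] b^i` of `U(g)`. -/
noncomputable def quad (b : WittBases B t) : g →ₗ[ℂ] UEA g :=
  (1 / 2 : ℂ) • ∑ i, LinearMap.mulRight ℂ (UEA.ι g (wittDual b i)) ∘ₗ UEA.ι g ∘ₗ
    bracket.flip (wittVec b i)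

theorem quad_apply (X : g) : quad b X =
    (1 / 2 : ℂ) • ∑ i, UEA.ι g (bracket X (wittVec b i)) * UEA.ι g (wittDual b i) := by
  simp [quad]

theorem quad_mem_parity {x : ZMod 2} {X : g} (hx : X ∈ parity (g := g) x) :
    quad b X ∈ UEA.parity g x := by
  rw [quad_apply]
  refine Submodule.smul_mem _ _ (Submodule.sum_mem _ fun i _ => ?_)
  have h := UEA.mul_mem_parity (UEA.ι_mem_parity (bracket_mem hx (wittVec_mem_parity (b := b) i)))
    (UEA.ι_mem_parity (wittDual_mem_parity (b := b) i))
  have h2 : ∀ i p : ZMod 2, i + p + p = i := by decide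
  rwa [h2] at h

theorem superAd_quad {x y : ZMod 2} {X Y : g} (hx : X ∈ parity (g := g) x)
    (hy : Y ∈ parity (g := g) y) : superAd y Y (quad b X) = (1 / 2 : ℂ) • ∑ i,
      (UEA.ι g (bracket Y (bracket X (wittVec b i))) * UEA.ι g (wittDual b i) +
        ksign y (x + wittPar b i) •
          (UEA.ι g (bracket X (wittVec b i)) * UEA.ι g (bracket Y (wittDual b i)))) := by
  rw [quad_apply, ← superAdₗ_apply, map_smul, map_sum]
  congr 1
  refine Finset.sum_congr rfl fun i _ => ?_
  rw [superAdₗ_apply, superAd_ι_mul hy (bracket_mem hx (wittVec_mem_parity i)),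
    superAd_ι hy (wittDual_mem_parity i)]

/-- Equivariance of `X ↦ q_X`: by the invariance of the canonical tensor, the action of `Y` on the
two factors condenses into `[Y, X]`. -/
theorem superAd_quad_eq [FiniteDimensional ℂ g] {x y : ZMod 2} {X Y : g}
    (hx : X ∈ parity (g := g) x) (hy : Y ∈ parity (g := g) y) (hY0 : Y ∈ t.grade 0)
    (hYe : bracket (t.e : g) Y = 0) : superAd y Y (quad b X) = quad b (bracket Y X) := by
  rw [superAd_quad hx hy, quad_apply]
  congr 1
  have h := sum_bracket_witt (b := b) ((LinearMap.mul ℂ (UEA g)).compl₁₂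
    (UEA.ι g ∘ₗ bracket X) (UEA.ι g)) hY0 hYe hy
  simp only [LinearMap.compl₁₂_apply, LinearMap.comp_apply, LinearMap.mul_apply'] at h
  rw [← sub_eq_zero, ← Finset.sum_sub_distrib, ← smul_zero (ksign y x), ← h, Finset.smul_sum]
  refine Finset.sum_congr rfl fun i _ => ?_
  rw [jacobi hy hx, map_add, map_smul, add_mul, smul_mul_assoc, ksign_add_right, smul_add, smul_smul]
  abel

/-! ### Vectors on which `g(k)`, `k ≤ -2`, acts by `χ` -/

/-- The vectors of `Q_χ` on which the `g(k)` with `k ≤ -2` act by `χ`. -/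
noncomputable def whittaker (b : WittBases B t) : Submodule ℂ (Qchi b) where
  carrier := {q | ∀ (k : ℤ) (p : ZMod 2) (z : g), k ≤ -2 → z ∈ t.grade k →
    z ∈ parity (g := g) p → UEA.ι g z • q = chi B t z • q}
  add_mem' h h' k p z hk hz hp := by rw [smul_add, smul_add, h k p z hk hz hp, h' k p z hk hz hp]
  zero_mem' _ _ _ _ _ _ := by rw [smul_zero, smul_zero]
  smul_mem' c q h k p z hk hz hp := by
    rw [smul_algebra_smul_comm, h k p z hk hz hp, smul_comm]

theorem smul_swap {p p' : ZMod 2} {x y : g} (hx : x ∈ parity (g := g) p)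
    (hy : y ∈ parity (g := g) p') (q : Qchi b) : UEA.ι g x • UEA.ι g y • q =
      ksign p p' • UEA.ι g y • UEA.ι g x • q + UEA.ι g (bracket x y) • q := by
  rw [← mul_smul, UEA.ι_mul g hx hy, add_smul, smul_assoc, mul_smul]

theorem oneChi_mem_whittaker : oneChi b ∈ whittaker b := fun k _ _ hk hz _ =>
  smul_oneChi (Submodule.mem_sup_left (Submodule.mem_sup_left
    (le_iSup (fun k : {k : ℤ // k ≤ -2} => t.grade k) ⟨k, hk⟩ hz)))

theorem smul_mem_whittaker {j : ℤ} (hj : j ≤ 0) {p : ZMod 2} {y : g} (hy : y ∈ t.grade j)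
    (hp : y ∈ parity (g := g) p)
    (h : ∀ k ≤ -2, ∀ z ∈ t.grade k, chi B t (bracket z y) = 0)
    {q : Qchi b} (hq : q ∈ whittaker b) : UEA.ι g y • q ∈ whittaker b := by
  intro k p' z hk hz hp'
  rw [smul_swap hp' hp, hq k p' z hk hz hp', hq (k + j) (p' + p) _ (by omega)
    (t.bracket_mem_grade hz hy) (bracket_mem hp' hp), h k hk z hz, zero_smul, add_zero,
    smul_algebra_smul_comm, smul_smul]
  rcases zmod2_cases p' with rfl | rfl
  · simp [ksign]
  · simp [chi_odd B t hp']

theorem smul_mem_whittaker_of_neg_one {p : ZMod 2} {y : g} (hy : y ∈ t.grade (-1))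
    (hp : y ∈ parity (g := g) p) {q : Qchi b} (hq : q ∈ whittaker b) :
    UEA.ι g y • q ∈ whittaker b :=
  smul_mem_whittaker (by omega) hy hp
    (fun _ hk _ hz => chi_bracket_grade B t hz hy (by omega)) hq

theorem smul_mem_whittaker_of_centralizes {p : ZMod 2} {y : g} (hy : y ∈ t.grade 0)
    (he : bracket (t.e : g) y = 0) (hp : y ∈ parity (g := g) p) {q : Qchi b}
    (hq : q ∈ whittaker b) : UEA.ι g y • q ∈ whittaker b :=
  smul_mem_whittaker le_rfl hy hp (fun _ _ z _ => chi_bracket_of_centralizes B t z he) hq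

/-- On such vectors brackets of `g(-1)` act by scalars, so `g(-1)` satisfies Weyl and Clifford
relations. -/
theorem smul_swap_whittaker {p p' : ZMod 2} {x y : g} (hx : x ∈ parity (g := g) p)
    (hy : y ∈ parity (g := g) p') (hx1 : x ∈ t.grade (-1)) (hy1 : y ∈ t.grade (-1)) {q : Qchi b}
    (hq : q ∈ whittaker b) : UEA.ι g x • UEA.ι g y • q =
      ksign p p' • UEA.ι g y • UEA.ι g x • q + chi B t (bracket x y) • q := by
  rw [smul_swap hx hy, hq (-1 + -1) _ _ (by omega) (t.bracket_mem_grade hx1 hy1) (bracket_mem hx hy)]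

/-- `θ_X = X - q_X`. -/
noncomputable def theta (b : WittBases B t) : g →ₗ[ℂ] UEA g := UEA.ι g - quad b

theorem theta_apply (X : g) : theta b X = UEA.ι g X - quad b X := rfl

theorem quad_smul_mem_whittaker {x : ZMod 2} {X : g} (h0 : X ∈ t.grade 0)
    (hx : X ∈ parity (g := g) x) {q : Qchi b} (hq : q ∈ whittaker b) :
    quad b X • q ∈ whittaker b := by
  rw [quad_apply, smul_assoc, Finset.sum_smul]
  refine Submodule.smul_mem _ _ (Submodule.sum_mem _ fun i _ => ?_)
  rw [mul_smul]
  exact smul_mem_whittaker_of_neg_one (by simpa using t.bracket_mem_grade h0 (wittVec_mem_grade i))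
    (bracket_mem hx (wittVec_mem_parity i))
    (smul_mem_whittaker_of_neg_one (wittDual_mem_grade i) (wittDual_mem_parity i) hq)

/-! ### Commutation of `θ_X` with `g(-1)` and with `θ_Y`. -/

section Theta

variable [FiniteDimensional ℂ g]

/-- Moving `u` past either factor of the quadratic element yields half of `[X, u]`, by the two
expansions in dual bases. So `q_X` induces `ad X` on `g(-1)`, as in the oscillator and spin
representations. -/
theorem quad_smul_swap {x p : ZMod 2} {X u : g} (h0 : X ∈ t.grade 0)
    (he : bracket (t.e : g) X = 0) (hx : X ∈ parity (g := g) x) (hu : u ∈ t.grade (-1))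
    (hp : u ∈ parity (g := g) p) {q : Qchi b} (hq : q ∈ whittaker b) :
    quad b X • UEA.ι g u • q =
      ksign x p • UEA.ι g u • quad b X • q + UEA.ι g (bracket X u) • q := by
  have hm : ∀ {v}, v ∈ t.grade (-1) → bracket X v ∈ t.grade (-1) := fun hv => by
    simpa using t.bracket_mem_grade h0 hv
  have hterm : ∀ i, UEA.ι g (bracket X (wittVec b i)) • UEA.ι g (wittDual b i) • UEA.ι g u • q =
      ksign x p • UEA.ι g u • UEA.ι g (bracket X (wittVec b i)) • UEA.ι g (wittDual b i) • q +
        (UEA.ι g (chi B t (bracket (bracket X u) (wittVec b i)) • wittDual b i) • q +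
        UEA.ι g (bracket X (chi B t (bracket (wittDual b i) u) • wittVec b i)) • q) := by
    intro i
    have hq' := smul_mem_whittaker_of_neg_one (wittDual_mem_grade i) (wittDual_mem_parity i) hq
    have hb := bracket_mem hx (wittVec_mem_parity (b := b) i)
    rw [smul_swap_whittaker (wittDual_mem_parity i) hp (wittDual_mem_grade i) hu hq, smul_add,
      smul_algebra_smul_comm, smul_algebra_smul_comm,
      smul_swap_whittaker hb hp (hm (wittVec_mem_grade i)) hu hq',
      chi_bracket_bracket he hx (wittVec_mem_parity i),
      chi_bracket_skew B t (wittVec_mem_parity i) (bracket_mem hx hp), ksign_add_left,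
      ksign_add_right]
    simp only [map_smul, smul_assoc]
    have s1 := ksign_comm x (wittPar b i)
    rw [s1]
    generalize UEA.ι g u • UEA.ι g (bracket X (wittVec b i)) • UEA.ι g (wittDual b i) • q = A
    generalize UEA.ι g (wittDual b i) • q = C
    generalize UEA.ι g (bracket X (wittVec b i)) • q = D
    rcases ksign_eq_one_or (wittPar b i) x with h1 | h1 <;>
      rcases ksign_eq_one_or (wittPar b i) p with h2 | h2 <;> rw [h1, h2] <;> module
  rw [quad_apply, smul_assoc, smul_assoc, Finset.sum_smul, Finset.sum_smul]
  simp only [mul_smul, hterm, Finset.sum_add_distrib, ← Finset.sum_smul, ← map_sum,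
    sum_chi_wittVec b (hm hu), sum_chi_wittDual b hu]
  rw [smul_algebra_smul_comm, ← Finset.smul_sum, ← Finset.smul_sum]
  generalize UEA.ι g u • (_ : Qchi b) = A
  generalize UEA.ι g (bracket X u) • q = D
  module

/-- `X` and `q_X` induce the same derivation of `g(-1)`, so their difference supercommutes with it.
-/
theorem theta_smul_swap {x p : ZMod 2} {X u : g} (h0 : X ∈ t.grade 0)
    (he : bracket (t.e : g) X = 0) (hx : X ∈ parity (g := g) x) (hu : u ∈ t.grade (-1))
    (hp : u ∈ parity (g := g) p) {q : Qchi b} (hq : q ∈ whittaker b) :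
    theta b X • UEA.ι g u • q = ksign x p • UEA.ι g u • theta b X • q := by
  rw [theta_apply, sub_smul, sub_smul, quad_smul_swap h0 he hx hu hp hq, smul_swap hx hp, smul_sub,
    smul_sub]
  abel

theorem theta_smul_mem_whittaker {x : ZMod 2} {X : g} (h0 : X ∈ t.grade 0)
    (he : bracket (t.e : g) X = 0) (hx : X ∈ parity (g := g) x) {q : Qchi b}
    (hq : q ∈ whittaker b) : theta b X • q ∈ whittaker b := by
  rw [theta_apply, sub_smul]
  exact sub_mem (smul_mem_whittaker_of_centralizes h0 he hx hq) (quad_smul_mem_whittaker h0 hx hq)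

theorem theta_mem_parity {x : ZMod 2} {X : g} (hx : X ∈ parity (g := g) x) :
    theta b X ∈ UEA.parity g x := sub_mem (UEA.ι_mem_parity hx) (quad_mem_parity hx)

/-- Duals of weight `-1` supercommute with `θ_X`; those of smaller weight act by `χ`, because `θ_X`
preserves Whittaker vectors. -/
theorem theta_mem_invariants (F : Frame b) {x : ZMod 2} {X : g} (h0 : X ∈ t.grade 0)
    (he : bracket (t.e : g) X = 0) (hx : X ∈ parity (g := g) x) :
    theta b X • oneChi b ∈ F.invariants := by
  refine F.mem_invariants.mpr fun l => ?_
  by_cases hl : F.Free l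
  swap
  · rw [F.lower_of_not_free hl, LinearMap.zero_apply]
  rw [← mkQ_eq_smul, F.lower_mkQ hl]
  have h1 := F.wt_free hl
  have hg := F.dual_mem_grade l
  have hp := F.dual_mem_parity l
  by_cases hw : F.wt l = -1
  · have hg' : F.dual l ∈ t.grade (-1) := by
      rw [hw] at hg; simpa using hg
    rw [superAd_of_mem _ (theta_mem_parity hx), mkQ_eq_smul, sub_smul, smul_assoc, mul_smul,
      mul_smul, theta_smul_swap h0 he hx hg' hp oneChi_mem_whittaker,
      ksign_comm (F.par l), smul_smul (ksign x (F.par l)), ksign_mul_self, one_smul, sub_self]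
  · have hk : -2 - F.wt l ≤ -2 := by omega
    have hm : F.dual l ∈ mSub b := Submodule.mem_sup_left (Submodule.mem_sup_left
      (le_iSup (fun k : {k : ℤ // k ≤ -2} => t.grade k) ⟨_, hk⟩ hg))
    rw [mkQ_superAd hm hp, mkQ_eq_smul,
      theta_smul_mem_whittaker h0 he hx oneChi_mem_whittaker _ _ _ hk hg hp, sub_self]

theorem quad_smul_theta {x y : ZMod 2} {X Y : g} (hX : X ∈ t.grade 0)
    (heX : bracket (t.e : g) X = 0) (hx : X ∈ parity (g := g) x) (hY : Y ∈ t.grade 0)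
    (hy : Y ∈ parity (g := g) y) :
    theta b X • quad b Y • oneChi b = ksign x y • quad b Y • theta b X • oneChi b := by
  rw [quad_apply, smul_assoc, smul_assoc, Finset.sum_smul, Finset.sum_smul,
    smul_algebra_smul_comm, smul_comm (ksign x y)]
  congr 1
  rw [Finset.smul_sum, Finset.smul_sum]
  refine Finset.sum_congr rfl fun i _ => ?_
  have hm : bracket Y (wittVec b i) ∈ t.grade (-1) := by
    simpa using t.bracket_mem_grade hY (wittVec_mem_grade i)
  rw [mul_smul, mul_smul, theta_smul_swap hX heX hx hm (bracket_mem hy (wittVec_mem_parity i))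
    (smul_mem_whittaker_of_neg_one (wittDual_mem_grade i) (wittDual_mem_parity i)
      oneChi_mem_whittaker), theta_smul_swap hX heX hx (wittDual_mem_grade i)
      (wittDual_mem_parity i) oneChi_mem_whittaker, smul_algebra_smul_comm, smul_smul,
      ksign_add_right, mul_assoc, ksign_mul_self, mul_one]

/-- `θ_X` supercommutes with `q_Y`, which is quadratic in `g(-1)`. So the commutator is that of
`θ_X` with `Y`, namely `[X, Y] - q_[X,Y]` by equivariance, without error terms. -/
theorem theta_commutator {x y : ZMod 2} {X Y : g} (hX : X ∈ t.grade 0)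
    (heX : bracket (t.e : g) X = 0) (hx : X ∈ parity (g := g) x) (hY : Y ∈ t.grade 0)
    (heY : bracket (t.e : g) Y = 0) (hy : Y ∈ parity (g := g) y) :
    theta b X • theta b Y • oneChi b - ksign x y • theta b Y • theta b X • oneChi b =
      theta b (bracket X Y) • oneChi b := by
  have h1 := quad_smul_theta (b := b) hX heX hx hY hy
  have h2 := superAd_quad_eq (b := b) hx hy hY heY
  rw [superAd_of_mem _ (quad_mem_parity hx)] at h2
  have h3 := congrArg (· • oneChi b) h2
  simp only [sub_smul, smul_assoc, mul_smul] at h3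
  have h4 : quad b (bracket X Y) = -(ksign x y • quad b (bracket Y X)) := by
    rw [skew hx hy, map_neg, map_smul]
  rw [theta_apply (bracket X Y), h4, sub_smul, neg_smul, smul_assoc, ← h3]
  have h5 := smul_swap hx hy (oneChi b)
  conv_lhs => rw [theta_apply Y, sub_smul, smul_sub, h1, sub_smul, theta_apply X]
  simp only [sub_smul, smul_sub]
  rw [h5, ksign_comm y x, smul_smul (ksign x y) (ksign x y), ksign_mul_self, one_smul]
  abel

end Theta

end Degree

/-! ## Generators of the `W`-superalgebra and their commutators -/

section Generators

variable {g : Type*} [AddCommGroup g] [Module ℂ g] [LieSuperalgebra g]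
  {B : InvariantForm g} {t : Sl2Triple g} {b : WittBases B t}

namespace Frame

variable (F : Frame b) [FiniteDimensional ℂ g]

theorem exists_smul_oneChi_eq {P : List F.J → Prop} {r : Qchi b} (hr : r ∈ F.spanMon P) :
    ∃ a ∈ Submodule.span ℂ {a | ∃ w : F.NormalWord, P w.1 ∧ a = word F.vec w.1},
      a • oneChi b = r := by
  induction hr using Submodule.span_induction with
  | mem r hr =>
    obtain ⟨w, hw, rfl⟩ := hr
    exact ⟨_, Submodule.subset_span ⟨w, hw, rfl⟩, rfl⟩
  | zero => exact ⟨0, zero_mem _, zero_smul _ _⟩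
  | add r s _ _ hr hs =>
    obtain ⟨a, ha, rfl⟩ := hr
    obtain ⟨c, hc, rfl⟩ := hs
    exact ⟨a + c, add_mem ha hc, add_smul _ _ _⟩
  | smul z r _ hr =>
    obtain ⟨a, ha, rfl⟩ := hr
    exact ⟨z • a, Submodule.smul_mem _ _ ha, smul_assoc _ _ _⟩

theorem smul_mem_of_mem_span_word {P : List F.J → Prop} {a : UEA g} {q : Qchi b}
    {S : Submodule ℂ (Qchi b)}
    (ha : a ∈ Submodule.span ℂ {a | ∃ w : F.NormalWord, P w.1 ∧ a = word F.vec w.1})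
    (h : ∀ w : F.NormalWord, P w.1 → word F.vec w.1 • q ∈ S) : a • q ∈ S := by
  induction ha using Submodule.span_induction with
  | mem a ha => obtain ⟨w, hw, rfl⟩ := ha; exact h w hw
  | zero => rw [zero_smul]; exact zero_mem _
  | add a c _ _ ha hc => rw [add_smul]; exact add_mem ha hc
  | smul z a _ ha => rw [smul_assoc]; exact Submodule.smul_mem _ _ ha

/-- `Y_i + a` generates an invariant, and `a` is of lower order. -/
structure IsCorrection (i : Fin F.N) (a : UEA g) : Prop where
  inv : (UEA.ι g (F.Y i : g) + a) • oneChi b ∈ F.invariants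
  par : (UEA.ι g (F.Y i : g) + a) • oneChi b ∈ parityQ b (F.parY i)
  bi : ∀ {d c : ℤ} {q : Qchi b}, q ∈ F.bi d c → a • q ∈ F.bi (d + (F.wtY i + 2)) (c + F.wtY i)
  deg : ∀ {n : ℤ} {q : Qchi b}, q ∈ F.degQ n → a • q ∈ F.degQ (n + max (F.wtY i - 1) 0)
  zero : F.wtY i = 0 → a = -quad b (F.Y i : g)

theorem Y_centralizes (i : Fin F.N) : bracket (t.e : g) (F.Y i : g) = 0 := (F.Y i).2

theorem quad_smul_mem_bi {X : g} (hX : X ∈ t.grade 0) {d c : ℤ} {q : Qchi b} (hq : q ∈ F.bi d c) :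
    quad b X • q ∈ F.bi (d + 2) c := by
  rw [quad_apply, smul_assoc, Finset.sum_smul]
  refine Submodule.smul_mem _ _ (Submodule.sum_mem _ fun i _ => ?_)
  rw [mul_smul]
  have h1 := F.smul_mem_bi (k := -1) (by simpa using t.bracket_mem_grade hX (wittVec_mem_grade i))
    (by omega) (F.smul_mem_bi (wittDual_mem_grade i) (by omega) hq)
  exact F.bi_mono (by omega) (by omega) h1

theorem quad_smul_mem_degQ {X : g} (hX : X ∈ t.grade 0) {n : ℤ} {q : Qchi b} (hq : q ∈ F.degQ n) :
    quad b X • q ∈ F.degQ n := by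
  rw [quad_apply, smul_assoc, Finset.sum_smul]
  refine Submodule.smul_mem _ _ (Submodule.sum_mem _ fun i _ => ?_)
  rw [mul_smul]
  have h1 := F.smul_mem_degQ (k := -1) (by simpa using t.bracket_mem_grade hX (wittVec_mem_grade i))
    (by omega) (F.smul_mem_degQ (wittDual_mem_grade i) (by omega) hq)
  simpa [shiftDeg] using h1

/-- `ad Y` turns one of the two factors of degree `0` into a vector of weight `m - 1`. -/
theorem superAd_quad_smul_mem_degQ {x y : ZMod 2} {X Y : g} (hX : X ∈ t.grade 0)
    (hx : X ∈ parity (g := g) x) {m : ℤ} (hm : 0 < m) (hY : Y ∈ t.grade m)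
    (hy : Y ∈ parity (g := g) y) {n : ℤ} {q : Qchi b} (hq : q ∈ F.degQ n) :
    superAd y Y (quad b X) • q ∈ F.degQ (n + (m - 1)) := by
  rw [superAd_quad hx hy, smul_assoc, Finset.sum_smul]
  refine Submodule.smul_mem _ _ (Submodule.sum_mem _ fun i _ => ?_)
  have hXb : bracket X (wittVec b i) ∈ t.grade (-1) := by
    simpa using t.bracket_mem_grade hX (wittVec_mem_grade i)
  have h0 : shiftDeg (-1) = 0 := rfl
  have h1 : shiftDeg (m + -1) = m - 1 := by rw [shiftDeg_of_nonneg (by omega)]; ring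
  rw [add_smul, smul_assoc, mul_smul, mul_smul]
  refine add_mem ?_ (Submodule.smul_mem _ _ ?_)
  · have h := F.smul_mem_degQ (t.bracket_mem_grade hY hXb) (by omega)
      (F.smul_mem_degQ (wittDual_mem_grade i) (by omega) hq)
    rwa [h0, h1, add_zero] at h
  · have h := F.smul_mem_degQ hXb (by omega)
      (F.smul_mem_degQ (t.bracket_mem_grade hY (wittDual_mem_grade i)) (by omega) hq)
    rwa [h0, h1, add_zero] at h

/-- In weight `0` a general correction could have the same degree as `Y_i`, so the explicit `-q_Y`
is taken. In positive weight the correction of the leading-order invariant `Y_i 1_χ` has `lam` at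
most the weight, hence smaller degree. -/
theorem exists_isCorrection (i : Fin F.N) : ∃ a, F.IsCorrection i a := by
  obtain ⟨hYg, hYp⟩ := F.Y_mem i
  rcases (F.wtY_nonneg i).eq_or_lt with h0 | hpos
  · rw [← h0] at hYg
    have hθ : UEA.ι g (F.Y i : g) + -quad b (F.Y i : g) = theta b (F.Y i : g) := by
      rw [theta_apply, sub_eq_add_neg]
    refine ⟨-quad b (F.Y i : g), ?_, ?_, ?_, ?_, fun _ => rfl⟩
    · rw [hθ]; exact theta_mem_invariants F hYg (F.Y_centralizes i) hYp
    · rw [hθ, ← mkQ_eq_smul]; exact mkQ_mem_parityQ (theta_mem_parity hYp)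
    · intro d c q hq
      rw [neg_smul, ← h0, zero_add, add_zero]
      exact Submodule.neg_mem _ (F.quad_smul_mem_bi hYg hq)
    · intro n q hq
      rw [neg_smul]
      exact Submodule.neg_mem _ (F.degQ_mono (by omega) (F.quad_smul_mem_degQ hYg hq))
  -- `Y_i 1_χ` is invariant to leading order because `χ([z, Y_i]) = 0` for every `z`.
  · have hadm : UEA.ι g (F.Y i : g) • oneChi b ∈ F.adm (F.wtY i + 2) (F.wtY i) := by
      refine F.mem_adm.mpr fun l hl => ?_
      rw [F.lower_smul hl hYp, F.lower_oneChi, smul_zero, smul_zero, add_zero]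
      have h := F.smul_sub_mem_bi (t.bracket_mem_grade (F.dual_mem_grade l) hYg) F.oneChi_mem_bi
      rw [F.chi_neg_centralizer, zero_smul, sub_zero] at h
      exact F.bi_mono (by omega) (by omega) h
    obtain ⟨q, hq0, hq1, hq2⟩ := F.exists_invariant hadm
    obtain ⟨a, ha, haq⟩ := F.exists_smul_oneChi_eq hq1
    have hqa : (UEA.ι g (F.Y i : g) + a) • oneChi b = q := by rw [add_smul, haq]; abel
    refine ⟨a, ?_, ?_, ?_, ?_, fun h => absurd h hpos.ne'⟩
    · rw [hqa]; exact F.mem_invariants.mpr hq0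
    · rw [hqa]
      refine hq2 _ (fun v hv => F.euler_mem_parityQ hv) ?_
      rw [← mkQ_eq_smul]
      exact mkQ_mem_parityQ (UEA.ι_mem_parity hYp)
    · intro d c q hq
      refine F.smul_mem_of_mem_span_word (P := fun w => F.kaz w ≤ F.wtY i + 2 ∧ F.lam w ≤ F.wtY i)
        (S := F.bi (d + (F.wtY i + 2)) (c + F.wtY i)) ha fun w hw => ?_
      have h1 : F.kaz w.1 ≤ F.wtY i + 2 := hw.1
      have h2 : F.lam w.1 ≤ F.wtY i := hw.2
      have h3 := F.smul_monomial_mem_bi w.2.2 hq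
      exact F.bi_mono (add_le_add le_rfl h1) (add_le_add le_rfl h2) h3
    · intro n q hq
      refine F.smul_mem_of_mem_span_word (P := fun w => F.kaz w ≤ F.wtY i + 2 ∧ F.lam w ≤ F.wtY i)
        (S := F.degQ (n + max (F.wtY i - 1) 0)) ha fun w hw => ?_
      have h1 := F.deg_le_of_lam w.2.2 hw.2
      exact F.degQ_mono (add_le_add le_rfl h1) (F.word_smul_mem_degQ w.2.2 hq)

/-- A choice of corrections. -/
noncomputable def corr (i : Fin F.N) : UEA g := (F.exists_isCorrection i).choose

theorem isCorrection_corr (i : Fin F.N) : F.IsCorrection i (F.corr i) :=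
  (F.exists_isCorrection i).choose_spec

/-- The lift of `g_e` to `U(g)` with invariant classes. -/
noncomputable def gen : centralizer t.e →ₗ[ℂ] UEA g :=
  F.Y.constr ℂ fun i => UEA.ι g (F.Y i : g) + F.corr i

theorem gen_Y (i : Fin F.N) : F.gen (F.Y i) = UEA.ι g (F.Y i : g) + F.corr i :=
  F.Y.constr_basis ℂ _ i

theorem gen_apply (y : centralizer t.e) :
    F.gen y = UEA.ι g (y : g) + ∑ i, F.Y.repr y i • F.corr i := by
  conv_lhs => rw [← F.Y.sum_repr y]
  conv_rhs => enter [1]; rw [← F.Y.sum_repr y]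
  simp only [map_sum, map_smul, gen_Y, smul_add, Finset.sum_add_distrib,
    AddSubmonoidClass.coe_finsetSum, Submodule.coe_smul]

theorem repr_Y (y : centralizer t.e) (i : Fin F.N) :
    F.basis.repr (y : g) (.cent i) = F.Y.repr y i := by
  conv_lhs => rw [← F.Y.sum_repr y]
  have h : ∀ j, F.basis.repr (F.Y j : g) (.cent i) = if j = i then 1 else 0 := fun j => by
    rw [show (F.Y j : g) = F.vec (.cent j) from rfl, F.repr_vec]
    simp
  simp only [AddSubmonoidClass.coe_finsetSum, Submodule.coe_smul, map_sum, map_smul,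
    Finsupp.coe_finsetSum, Finset.sum_apply, Finsupp.smul_apply, h]
  simp

theorem repr_Y_ne_zero {y : centralizer t.e} {k : ℤ} {p : ZMod 2} (hy : (y : g) ∈ t.grade k)
    (hp : (y : g) ∈ parity (g := g) p) {i : Fin F.N} (h : F.Y.repr y i ≠ 0) :
    F.wtY i = k ∧ F.parY i = p := by
  rw [← repr_Y] at h
  exact ⟨by_contra fun hk => h (F.repr_grade hy hk), by_contra fun hk => h (F.repr_parity hp hk)⟩

theorem gen_smul_mem_invariants (y : centralizer t.e) : F.gen y • oneChi b ∈ F.invariants := by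
  rw [← F.Y.sum_repr y, map_sum, Finset.sum_smul]
  refine Submodule.sum_mem _ fun i _ => ?_
  rw [map_smul, smul_assoc, gen_Y]
  exact Submodule.smul_mem _ _ (F.isCorrection_corr i).inv

theorem gen_smul_mem_parityQ {y : centralizer t.e} {k : ℤ} {p : ZMod 2} (hy : (y : g) ∈ t.grade k)
    (hp : (y : g) ∈ parity (g := g) p) : F.gen y • oneChi b ∈ parityQ b p := by
  rw [← F.Y.sum_repr y, map_sum, Finset.sum_smul]
  refine Submodule.sum_mem _ fun i _ => ?_
  rw [map_smul, smul_assoc, gen_Y]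
  by_cases h : F.Y.repr y i = 0
  · rw [h, zero_smul]; exact zero_mem _
  · rw [← (F.repr_Y_ne_zero hy hp h).2]
    exact Submodule.smul_mem _ _ (F.isCorrection_corr i).par

theorem gen_sub_smul_mem_bi {y : centralizer t.e} {k : ℤ} {p : ZMod 2} (hy : (y : g) ∈ t.grade k)
    (hp : (y : g) ∈ parity (g := g) p) {d c : ℤ} {q : Qchi b} (hq : q ∈ F.bi d c) :
    F.gen y • q - UEA.ι g (y : g) • q ∈ F.bi (d + (k + 2)) (c + k) := by
  rw [gen_apply, add_smul, add_sub_cancel_left, Finset.sum_smul]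
  refine Submodule.sum_mem _ fun i _ => ?_
  rw [smul_assoc]
  by_cases h : F.Y.repr y i = 0
  · rw [h, zero_smul]; exact zero_mem _
  · rw [← (F.repr_Y_ne_zero hy hp h).1]
    exact Submodule.smul_mem _ _ ((F.isCorrection_corr i).bi hq)

theorem gen_sub_smul_mem_degQ {y : centralizer t.e} {k : ℤ} {p : ZMod 2} (hy : (y : g) ∈ t.grade k)
    (hp : (y : g) ∈ parity (g := g) p) {n : ℤ} {q : Qchi b} (hq : q ∈ F.degQ n) :
    F.gen y • q - UEA.ι g (y : g) • q ∈ F.degQ (n + max (k - 1) 0) := by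
  rw [gen_apply, add_smul, add_sub_cancel_left, Finset.sum_smul]
  refine Submodule.sum_mem _ fun i _ => ?_
  rw [smul_assoc]
  by_cases h : F.Y.repr y i = 0
  · rw [h, zero_smul]; exact zero_mem _
  · rw [← (F.repr_Y_ne_zero hy hp h).1]
    exact Submodule.smul_mem _ _ ((F.isCorrection_corr i).deg hq)

theorem gen_eq_theta {y : centralizer t.e} {p : ZMod 2} (hy : (y : g) ∈ t.grade 0)
    (hp : (y : g) ∈ parity (g := g) p) : F.gen y = theta b (y : g) := by
  have h1 : F.gen y = ∑ i, F.Y.repr y i • F.gen (F.Y i) := by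
    conv_lhs => rw [← F.Y.sum_repr y]
    simp only [map_sum, map_smul]
  have h2 : theta b (y : g) = ∑ i, F.Y.repr y i • theta b (F.Y i : g) := by
    conv_lhs => rw [← F.Y.sum_repr y]
    simp only [AddSubmonoidClass.coe_finsetSum, Submodule.coe_smul, map_sum, map_smul]
  rw [h1, h2]
  refine Finset.sum_congr rfl fun i _ => ?_
  by_cases h : F.Y.repr y i = 0
  · rw [h, zero_smul, zero_smul]
  · rw [gen_Y, (F.isCorrection_corr i).zero (F.repr_Y_ne_zero hy hp h).1, theta_apply,
      sub_eq_add_neg]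

/-- The failure of `gen` to be compatible with the brackets, applied to `1_χ`. -/
noncomputable def defect (p p' : ZMod 2) (y z : centralizer t.e) : Qchi b :=
  F.gen y • F.gen z • oneChi b - ksign p p' • F.gen z • F.gen y • oneChi b -
    F.gen (bracket y z) • oneChi b

theorem defect_skew {p p' : ZMod 2} {y z : centralizer t.e} (hp : (y : g) ∈ parity (g := g) p)
    (hp' : (z : g) ∈ parity (g := g) p') :
    F.defect p p' y z = -(ksign p p' • F.defect p' p z y) := by
  have h : bracket y z = -(ksign p p' • bracket z y) :=
    skew (g := centralizer t.e) (i := p) (j := p') hp hp'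
  rw [defect, defect, h, map_neg, map_smul, neg_smul, smul_assoc, ksign_comm p' p]
  have := ksign_mul_self p p'
  rw [smul_sub, smul_sub, smul_smul (ksign p p') (ksign p p'), this, one_smul]
  abel

theorem smul_mem_degQ_of_nonneg {k : ℤ} {y : g} (hk : 0 ≤ k) (hy : y ∈ t.grade k) {n : ℤ}
    {q : Qchi b} (hq : q ∈ F.degQ n) : UEA.ι g y • q ∈ F.degQ (n + k) := by
  have h := F.smul_mem_degQ hy (by omega) hq
  rwa [shiftDeg_of_nonneg hk] at h

theorem gen_smul_mem_degQ {y : centralizer t.e} {k : ℤ} {p : ZMod 2} (hk : 0 ≤ k)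
    (hy : (y : g) ∈ t.grade k) (hp : (y : g) ∈ parity (g := g) p) {n : ℤ} {q : Qchi b}
    (hq : q ∈ F.degQ n) : F.gen y • q ∈ F.degQ (n + k) := by
  have h1 := F.degQ_mono (n' := n + k) (by omega) (F.gen_sub_smul_mem_degQ hy hp hq)
  have h2 := F.smul_mem_degQ_of_nonneg hk hy hq
  simpa using add_mem h1 h2

theorem coe_bracket (y z : centralizer t.e) :
    ((bracket y z : centralizer t.e) : g) = bracket (y : g) (z : g) := rfl

/-- In positive weights both corrections have degree smaller than the weights, so only `[Y, Z] 1_χ`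
could have top degree, and it cancels. -/
theorem defect_mem_of_pos {p p' : ZMod 2} {k k' : ℤ} {y z : centralizer t.e} (hk : 0 < k)
    (hk' : 0 < k') (hy : (y : g) ∈ t.grade k) (hp : (y : g) ∈ parity (g := g) p)
    (hz : (z : g) ∈ t.grade k') (hp' : (z : g) ∈ parity (g := g) p') :
    F.defect p p' y z ∈ F.degQ (k + k' - 1) := by
  have h1 := F.oneChi_mem_degQ
  have hy1 := F.gen_smul_mem_degQ hk.le hy hp h1
  have hz1 := F.gen_smul_mem_degQ hk'.le hz hp' h1
  have e1 := F.degQ_mono (n' := k + k' - 1) (by omega) (F.gen_sub_smul_mem_degQ hy hp hz1)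
  have e2 := F.degQ_mono (n' := k + k' - 1) (by omega) (F.gen_sub_smul_mem_degQ hz hp' hy1)
  have e3 := F.degQ_mono (n' := k + k' - 1) (by omega) (F.smul_mem_degQ_of_nonneg hk.le hy
    (F.gen_sub_smul_mem_degQ hz hp' h1))
  have e4 := F.degQ_mono (n' := k + k' - 1) (by omega) (F.smul_mem_degQ_of_nonneg hk'.le hz
    (F.gen_sub_smul_mem_degQ hy hp h1))
  have e5 := F.degQ_mono (n' := k + k' - 1) (by omega) (F.gen_sub_smul_mem_degQ
    (t.bracket_mem_grade hy hz) (bracket_mem (g := centralizer t.e) (i := p) (j := p') hp hp') h1)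
  have hs := smul_swap hp hp' (oneChi b)
  have h := sub_mem (add_mem e1 e3) (add_mem (Submodule.smul_mem _ (ksign p p')
    (add_mem e2 e4)) e5)
  convert h using 1
  rw [defect, coe_bracket]
  simp only [smul_sub, smul_add]
  rw [hs]
  abel

/-- The correction `-q_y` of a weight `0` element is not of lower degree, but its supercommutator
with `z` is; the corrections of positive weight are negligible as before. -/
theorem defect_mem_of_zero_pos {p p' : ZMod 2} {k' : ℤ} {y z : centralizer t.e}
    (hk' : 0 < k') (hy : (y : g) ∈ t.grade 0) (hp : (y : g) ∈ parity (g := g) p)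
    (hz : (z : g) ∈ t.grade k') (hp' : (z : g) ∈ parity (g := g) p') :
    F.defect p p' y z ∈ F.degQ (k' - 1) := by
  have h1 := F.oneChi_mem_degQ
  have hy1 := F.gen_smul_mem_degQ le_rfl hy hp h1
  have e1 := F.degQ_mono (n' := k' - 1) (by omega) (F.gen_smul_mem_degQ le_rfl hy hp
    (F.gen_sub_smul_mem_degQ hz hp' h1))
  have e2 := F.degQ_mono (n' := k' - 1) (by omega) (F.gen_sub_smul_mem_degQ hz hp' hy1)
  have e5 := F.degQ_mono (n' := k' - 1) (by omega) (F.gen_sub_smul_mem_degQ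
    (t.bracket_mem_grade hy hz) (bracket_mem (g := centralizer t.e) (i := p) (j := p') hp hp') h1)
  have e6 := F.degQ_mono (n' := k' - 1) (by omega)
    (F.superAd_quad_smul_mem_degQ hy hp hk' hz hp' h1)
  have hs := smul_swap hp hp' (oneChi b)
  have h := add_mem (sub_mem e1 (add_mem (Submodule.smul_mem _ (ksign p p') e2) e5))
    (Submodule.smul_mem _ (ksign p p') e6)
  convert h using 1
  rw [defect, coe_bracket, F.gen_eq_theta hy hp, theta_apply, superAd_of_mem _ (quad_mem_parity hp)]
  simp only [smul_sub, sub_smul, mul_smul, smul_assoc]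
  rw [hs, smul_smul (ksign p p') (ksign p' p), ksign_comm p' p, ksign_mul_self, one_smul]
  abel

theorem defect_mem {p p' : ZMod 2} {k k' : ℤ} {y z : centralizer t.e} (hk : 0 ≤ k) (hk' : 0 ≤ k')
    (hy : (y : g) ∈ t.grade k) (hp : (y : g) ∈ parity (g := g) p)
    (hz : (z : g) ∈ t.grade k') (hp' : (z : g) ∈ parity (g := g) p') :
    F.defect p p' y z ∈ F.degQ (k + k' - 1) := by
  rcases hk.eq_or_lt with rfl | hk <;> rcases hk'.eq_or_lt with rfl | hk'
  · have h0 : F.defect p p' y z = 0 := by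
      rw [defect, F.gen_eq_theta hy hp, F.gen_eq_theta hz hp', F.gen_eq_theta
        (y := bracket y z) (p := p + p') (by
          rw [coe_bracket]; simpa using t.bracket_mem_grade hy hz)
        (bracket_mem (g := centralizer t.e) (i := p) (j := p') hp hp'), coe_bracket,
        theta_commutator hy y.2 hp hz z.2 hp', sub_self]
    rw [h0]; exact zero_mem _
  · rw [zero_add]; exact F.defect_mem_of_zero_pos hk' hy hp hz hp'
  · rw [add_zero, F.defect_skew hp hp']
    exact Submodule.neg_mem _ (Submodule.smul_mem _ _ (F.defect_mem_of_zero_pos hk hz hp' hy hp))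
  · exact F.defect_mem_of_pos hk hk' hy hp hz hp'

end Frame

end Generators

/-! ## Symbols in associated graded algebras -/

namespace AssocGraded

variable {A : Type*} [Ring A] [Algebra ℂ A] {F : ℤ → Submodule ℂ A} (hF : IsAlgFiltration F)

theorem single_mem_rees {n : ℤ} {a : A} (ha : a ∈ F n) :
    AddMonoidAlgebra.single n a ∈ rees hF := fun k => by
  rw [AddMonoidAlgebra.coeff_single]
  by_cases h : k = n
  · subst h; rw [Finsupp.single_eq_same]; exact ha
  · rw [Finsupp.single_eq_of_ne h]; exact zero_mem _

theorem symbol_eq (n : ℤ) (a : A) (ha : a ∈ F n) :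
    symbol hF n a ha = Ideal.Quotient.mk (reesIdeal hF) ⟨_, single_mem_rees hF ha⟩ := rfl

theorem symbol_add {n : ℤ} {a c : A} (ha : a ∈ F n) (hc : c ∈ F n) :
    symbol hF n (a + c) (add_mem ha hc) = symbol hF n a ha + symbol hF n c hc := by
  rw [symbol_eq, symbol_eq, symbol_eq, ← map_add]
  exact congrArg _ (Subtype.ext (AddMonoidAlgebra.single_add n a c))

theorem symbol_smul {n : ℤ} {a : A} (z : ℂ) (ha : a ∈ F n) :
    symbol hF n (z • a) (Submodule.smul_mem _ z ha) = z • symbol hF n a ha := by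
  have h : z • symbol hF n a ha = Ideal.Quotient.mkₐ ℂ (reesIdeal hF)
      (z • ⟨_, single_mem_rees hF ha⟩) := by rw [map_smul]; rfl
  rw [h, symbol_eq]
  refine congrArg (Ideal.Quotient.mk (reesIdeal hF)) (Subtype.ext ?_)
  exact (AddMonoidAlgebra.smul_single z n a).symm

theorem symbol_mul {n m : ℤ} {a c : A} (ha : a ∈ F n) (hc : c ∈ F m) :
    symbol hF (n + m) (a * c) (hF.mul_mem ha hc) = symbol hF n a ha * symbol hF m c hc := by
  rw [symbol_eq, symbol_eq, symbol_eq, ← map_mul]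
  exact congrArg _ (Subtype.ext (AddMonoidAlgebra.single_mul_single ..).symm)

theorem symbol_one : symbol hF 0 1 hF.one_mem = 1 := by
  rw [symbol_eq, ← map_one (Ideal.Quotient.mk (reesIdeal hF))]
  rfl

theorem sum_symbol_eq_zero {ι : Type*} (s : Finset ι) (n : ι → ℤ) (a : ι → A)
    (ha : ∀ i, a i ∈ F (n i)) :
    (∑ i ∈ s, symbol hF (n i) (a i) (ha i) = 0) ↔
      ∀ k, ∑ i ∈ s with n i = k, a i ∈ F (k - 1) := by
  have h1 : ∑ i ∈ s, symbol hF (n i) (a i) (ha i) = Ideal.Quotient.mk (reesIdeal hF)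
      (∑ i ∈ s, ⟨_, single_mem_rees hF (ha i)⟩) := by
    rw [map_sum]; rfl
  rw [h1, Ideal.Quotient.eq_zero_iff_mem]
  refine forall_congr' fun k => ?_
  rw [AddSubmonoidClass.coe_finsetSum, AddMonoidAlgebra.coeff_sum, Finset.sum_filter,
    Finsupp.finsetSum_apply]
  refine iff_of_eq (congrArg (· ∈ F (k - 1)) (Finset.sum_congr rfl fun i _ => ?_))
  rw [AddMonoidAlgebra.coeff_single, Finsupp.single_apply]

theorem symbol_eq_zero {n : ℤ} {a : A} (ha : a ∈ F n) (h : a ∈ F (n - 1)) :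
    symbol hF n a ha = 0 := by
  have h1 := (sum_symbol_eq_zero hF (Finset.univ : Finset Unit) (fun _ => n) (fun _ => a)
    (fun _ => ha)).mpr fun k => by
      by_cases hk : n = k
      · subst hk; simpa using h
      · simp [hk]
  simpa using h1

theorem symbol_congr {n m : ℤ} {a c : A} (hnm : n = m) (hac : a = c) (ha : a ∈ F n) :
    symbol hF n a ha = symbol hF m c (hnm ▸ hac ▸ ha) := by
  subst hnm hac; rfl

/-- `symbol` as a linear map. -/
noncomputable def symbolₗ (n : ℤ) : F n →ₗ[ℂ] AssocGraded hF where
  toFun a := symbol hF n a a.2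
  map_add' a c := symbol_add hF a.2 c.2
  map_smul' z a := symbol_smul hF z a.2

theorem mem_of_symbol_mem (S : Submodule ℂ (AssocGraded hF))
    (h : ∀ n a ha, symbol hF n a ha ∈ S) (x : AssocGraded hF) : x ∈ S := by
  obtain ⟨⟨p, hp⟩, rfl⟩ := Ideal.Quotient.mk_surjective x
  have h1 : (⟨p, hp⟩ : rees hF) =
      ∑ n ∈ p.coeff.support, ⟨_, single_mem_rees hF (hp n)⟩ := by
    apply Subtype.ext
    rw [AddSubmonoidClass.coe_finsetSum]
    exact (AddMonoidAlgebra.sum_coeff_single p).symm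
  rw [h1, map_sum]
  exact Submodule.sum_mem _ fun n _ => h n _ (hp n)

end AssocGraded

/-! ## Algebra homomorphisms from enveloping algebras, and their spanning words -/

section Lift

variable {k : Type*} [AddCommGroup k] [Module ℂ k] [LieSuperalgebra k]

/-- The universal property of `U(k)`. -/
noncomputable def UEA.lift {R : Type*} [Ring R] [Algebra ℂ R] (σ : k →ₗ[ℂ] R)
    (h : ∀ {i j : ZMod 2} {x y : k}, x ∈ LieSuperalgebra.parity (g := k) i →
      y ∈ LieSuperalgebra.parity (g := k) j → σ x * σ y = ksign i j • (σ y * σ x) + σ (bracket x y)) :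
    UEA k →ₐ[ℂ] R :=
  RingQuot.liftAlgHom ℂ ⟨TensorAlgebra.lift ℂ σ, by
    intro a c hac
    obtain ⟨hx, hy⟩ := hac
    simpa only [map_mul, map_add, map_smul, TensorAlgebra.lift_ι_apply] using h hx hy⟩

theorem UEA.lift_ι {R : Type*} [Ring R] [Algebra ℂ R] (σ : k →ₗ[ℂ] R)
    (h : ∀ {i j : ZMod 2} {x y : k}, x ∈ LieSuperalgebra.parity (g := k) i →
      y ∈ LieSuperalgebra.parity (g := k) j → σ x * σ y = ksign i j • (σ y * σ x) + σ (bracket x y))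
    (x : k) : UEA.lift σ h (UEA.ι k x) = σ x := by
  change RingQuot.liftAlgHom ℂ _ (RingQuot.mkAlgHom ℂ (UEA.Rel k) (TensorAlgebra.ι ℂ x)) = _
  rw [RingQuot.liftAlgHom_mkAlgHom_apply]
  simp

/-- Straightening in `U(k)` as a module over itself, with `χ = 0` and all letters normal. Only this
spanning half of the PBW theorem is needed for `U(g_e)`. -/
theorem UEA.mem_span_word {n : ℕ} {Y : Fin n → k} (hspan : Submodule.span ℂ (Set.range Y) = ⊤)
    {par : Fin n → ZMod 2} (hY : ∀ i, Y i ∈ LieSuperalgebra.parity (g := k) (par i)) (u : UEA k) :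
    u ∈ Submodule.span ℂ {u | ∃ v : List (Fin n), v.Pairwise (Before (fun i : Fin n => (i : ℕ)) par) ∧
      u = word Y v} := by
  have hs : Straightens Y (fun i => (i : ℕ)) par 0 (fun _ => True) (fun _ => True)
      (fun _ => (0 : ℤ)) (1 : UEA k) :=
    { key_inj := Fin.val_injective
      mem := hY
      odd := fun _ _ => rfl
      vac := fun _ _ h => absurd trivial h
      normal := fun _ _ => rfl
      last := fun _ _ h => absurd trivial h
      act := fun _ _ _ _ _ => trivial
      bracket := fun i j _ _ _ => by
        have h : {l : Fin n | True ∧ (0 : ℤ) ≤ 0 + 0} = Set.univ := by simp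
        rw [h, Set.image_univ, hspan]; trivial
      chi_bracket := fun _ _ _ _ _ h => absurd rfl h }
  have key : u ∈ degSpan Y (fun i : Fin n => (i : ℕ)) par (fun _ => True) (fun _ => (0 : ℤ)) (1 : UEA k) 0 := by
    induction u using UEA.induction_mul with
    | h1 => exact Submodule.subset_span ⟨[], List.Pairwise.nil, by simp, by simp, by simp [word_nil]⟩
    | hadd u v hu hv => exact add_mem hu hv
    | hsmul c u hu => exact Submodule.smul_mem _ c hu
    | hmul x u hu =>
      have h := hs.sub_mem_of_mem_span (y := x) (d := 0) (by
        have h : {l : Fin n | True ∧ (0 : ℤ) ≤ 0} = Set.univ := by simp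
        rw [h, Set.image_univ, hspan]; trivial) hu
      simpa using h
  refine Submodule.span_mono ?_ key
  rintro _ ⟨v, hv, -, -, rfl⟩
  exact ⟨v, hv, by simp⟩

end Lift

/-! ## The PBW theorem for the `W`-superalgebra and its natural filtration -/

section Filtration

variable {g : Type*} [AddCommGroup g] [Module ℂ g] [LieSuperalgebra g]
  {B : InvariantForm g} {t : Sl2Triple g} {b : WittBases B t}
  {A : Type*} [Ring A] [Algebra ℂ A]

/-- `j` identifies `A` with the refined `W`-superalgebra. -/
structure IsRefinedW (j : A →ₐ[ℂ] FiniteW b) : Prop where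
  injective : Function.Injective j
  range : ∀ φ, φ ∈ refinedW b ↔ ∃ a, j a = φ

/-- The map `a ↦ a(1_χ)`. -/
noncomputable def evalVia (j : A →ₐ[ℂ] FiniteW b) : A →ₗ[ℂ] Qchi b := evalOne b ∘ₗ j.toLinearMap

theorem evalVia_apply (j : A →ₐ[ℂ] FiniteW b) (a : A) : evalVia j a = evalOne b (j a) := rfl

theorem mem_natFiltration {j : A →ₐ[ℂ] FiniteW b} {n : ℤ} {a : A} :
    a ∈ natFiltration b j n ↔ evalVia j a ∈ natFiltrationQ b n := Iff.rfl

theorem evalVia_one (j : A →ₐ[ℂ] FiniteW b) : evalVia j 1 = oneChi b := by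
  rw [evalVia_apply, map_one, evalOne_one]

theorem evalVia_mul (j : A →ₐ[ℂ] FiniteW b) {a : A} {u : UEA g} (h : evalVia j a = u • oneChi b)
    (c : A) : evalVia j (a * c) = u • evalVia j c := by
  rw [evalVia_apply, map_mul, evalOne_mul (u := u)]
  · rfl
  · rw [mkQ_eq_smul, ← h]; rfl

theorem IsRefinedW.evalVia_injective {j : A →ₐ[ℂ] FiniteW b} (hj : IsRefinedW j) :
    Function.Injective (evalVia j) :=
  evalOne_injective.comp hj.injective

namespace Frame

variable (F : Frame b) [FiniteDimensional ℂ g] {j : A →ₐ[ℂ] FiniteW b}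

theorem evalVia_mem_invariants (hj : IsRefinedW j) (a : A) : evalVia j a ∈ F.invariants :=
  F.evalOne_mem_invariants ((hj.range _).mpr ⟨a, rfl⟩)

theorem exists_evalVia_eq (hj : IsRefinedW j) {q : Qchi b} (hq : q ∈ F.invariants) :
    ∃ a, evalVia j a = q := by
  obtain ⟨φ, hφ, rfl⟩ := F.exists_evalOne_eq hq
  obtain ⟨a, rfl⟩ := (hj.range φ).mp hφ
  exact ⟨a, rfl⟩

theorem exists_generators (hj : IsRefinedW j) :
    ∃ Θ : centralizer t.e →ₗ[ℂ] A, ∀ y, evalVia j (Θ y) = F.gen y • oneChi b := by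
  choose a ha using fun i => F.exists_evalVia_eq hj (F.gen_smul_mem_invariants (F.Y i))
  refine ⟨F.Y.constr ℂ a, fun y => ?_⟩
  have h : evalVia j ∘ₗ F.Y.constr ℂ a =
      (LinearMap.toSpanSingleton (UEA g) (Qchi b) (oneChi b)).restrictScalars ℂ ∘ₗ F.gen := by
    refine F.Y.ext fun i => ?_
    rw [LinearMap.comp_apply, F.Y.constr_basis, ha]
    rfl
  exact LinearMap.congr_fun h y

/-- The normal words in the letters of `g_e`. -/
abbrev CentWord : Type := {v : List (Fin F.N) // v.Pairwise (Before (fun i : Fin F.N => (i : ℕ)) F.parY)}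

theorem key_cent (i : Fin F.N) : F.key (.cent i) = i := by
  rw [key, if_pos (show F.Free (.cent i) from trivial), pos']

/-- A normal word in the letters of `g_e` as a normal word in all letters. -/
def CentWord.toNormal {F : Frame b} (v : F.CentWord) : F.NormalWord :=
  ⟨v.1.map .cent, by
    refine ⟨List.pairwise_map.mpr (v.2.imp fun {i k} h => ?_), fun l hl => ?_⟩
    · rcases h with h | ⟨rfl, h⟩
      · exact Or.inl (by rw [key_cent, key_cent]; exact h)
      · exact Or.inr ⟨rfl, h⟩
    · obtain ⟨i, -, rfl⟩ := List.mem_map.mp hl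
      trivial⟩

theorem CentWord.toNormal_injective : Function.Injective (CentWord.toNormal (F := F)) := by
  intro v w h
  have h1 : v.1.map Letter.cent = w.1.map Letter.cent := congrArg Subtype.val h
  exact Subtype.ext (List.map_injective_iff.mpr (fun i k hik => by simpa using hik) h1)

theorem exists_toNormal_eq {w : F.NormalWord} (h : F.num w.1 = 0) :
    ∃ v : F.CentWord, v.toNormal = w := by
  obtain ⟨w, hw⟩ := w
  have h1 : ∃ v : List (Fin F.N), v.map Letter.cent = w := by
    replace h : F.num w = 0 := h
    clear hw
    induction w with
    | nil => exact ⟨[], rfl⟩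
    | cons l w ih =>
      rw [num_cons] at h
      obtain ⟨v, rfl⟩ := ih (by omega)
      cases l with
      | cent i => exact ⟨i :: v, rfl⟩
      | _ => simp [extra] at h
  obtain ⟨v, rfl⟩ := h1
  refine ⟨⟨v, (List.pairwise_map.mp hw.1).imp fun {i k} h => ?_⟩, rfl⟩
  rcases h with h | ⟨h1, h2⟩
  · exact Or.inl (by rwa [key_cent, key_cent] at h)
  · exact Or.inr ⟨by simpa using h1, h2⟩

theorem cent_free (v : List (Fin F.N)) : ∀ l ∈ v.map Letter.cent, F.Free l := fun l hl => by
  obtain ⟨i, -, rfl⟩ := List.mem_map.mp hl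
  trivial

/-- On words in `g_e` the auxiliary degree is the weight, so degree bounds control the weights of
such words. -/
theorem deg_cent (v : List (Fin F.N)) : F.deg (v.map .cent) = F.weight (v.map .cent) := by
  induction v with
  | nil => rfl
  | cons i v ih =>
    rw [List.map_cons, deg_cons, weight_cons, ih, shiftDeg_of_nonneg (F.wt_cent_nonneg i)]

theorem exists_mem_bi (q : Qchi b) : ∃ d c, q ∈ F.bi d c := by
  have hq : q ∈ F.spanMon fun _ => True := by rw [F.spanMon_true]; trivial
  induction hq using Submodule.span_induction with
  | mem q hq => obtain ⟨w, -, rfl⟩ := hq; exact ⟨_, _, F.monomial_mem_bi w⟩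
  | zero => exact ⟨0, 0, zero_mem _⟩
  | add q r _ _ hq hr =>
    obtain ⟨d, c, hq⟩ := hq
    obtain ⟨d', c', hr⟩ := hr
    exact ⟨max d d', max c c', add_mem (F.bi_mono (le_max_left _ _) (le_max_left _ _) hq)
      (F.bi_mono (le_max_right _ _) (le_max_right _ _) hr)⟩
  | smul z q _ hq =>
    obtain ⟨d, c, hq⟩ := hq
    exact ⟨d, c, Submodule.smul_mem _ z hq⟩

variable (Θ : centralizer t.e →ₗ[ℂ] A)

/-- The products of the generators. -/
noncomputable def thetaWord (v : List (Fin F.N)) : A := (v.map fun i => Θ (F.Y i)).prod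

theorem thetaWord_cons (i : Fin F.N) (v : List (Fin F.N)) :
    F.thetaWord Θ (i :: v) = Θ (F.Y i) * F.thetaWord Θ v := by simp [thetaWord]

theorem thetaWord_append (v w : List (Fin F.N)) :
    F.thetaWord Θ (v ++ w) = F.thetaWord Θ v * F.thetaWord Θ w := by simp [thetaWord]

variable {Θ}

theorem evalVia_thetaWord_cons (hΘ : ∀ y, evalVia j (Θ y) = F.gen y • oneChi b) (i : Fin F.N)
    (v : List (Fin F.N)) :
    evalVia j (F.thetaWord Θ (i :: v)) = F.gen (F.Y i) • evalVia j (F.thetaWord Θ v) := by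
  rw [thetaWord_cons, evalVia_mul j (hΘ _)]

theorem evalVia_thetaWord_mem_degQ (hΘ : ∀ y, evalVia j (Θ y) = F.gen y • oneChi b)
    (v : List (Fin F.N)) :
    evalVia j (F.thetaWord Θ v) ∈ F.degQ (F.weight (v.map .cent)) := by
  induction v with
  | nil => simpa [thetaWord, evalVia_one, weight] using F.oneChi_mem_degQ
  | cons i v ih =>
    rw [F.evalVia_thetaWord_cons hΘ, List.map_cons, weight_cons, add_comm]
    exact F.gen_smul_mem_degQ (F.wtY_nonneg i) (F.Y_mem i).1 (F.Y_mem i).2 ih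

theorem evalVia_thetaWord_sub_mem_bi (hΘ : ∀ y, evalVia j (Θ y) = F.gen y • oneChi b)
    (v : List (Fin F.N)) :
    evalVia j (F.thetaWord Θ v) - F.monomial (v.map .cent) ∈
      F.bi (F.kaz (v.map .cent)) (F.lam (v.map .cent) - 1) := by
  induction v with
  | nil => simp [thetaWord, evalVia_one, monomial_nil]
  | cons i v ih =>
    have hm : F.monomial (v.map .cent) ∈ F.bi (F.kaz (v.map .cent)) (F.lam (v.map .cent)) := by
      have h := F.smul_monomial_mem_bi (F.cent_free v) F.oneChi_mem_bi
      rwa [zero_add, zero_add] at h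
    have he : evalVia j (F.thetaWord Θ v) ∈ F.bi (F.kaz (v.map .cent)) (F.lam (v.map .cent)) := by
      simpa using add_mem (F.bi_mono le_rfl (by omega) ih) hm
    have hw := F.wtY_nonneg i
    have h1 := F.gen_sub_smul_mem_bi (F.Y_mem i).1 (F.Y_mem i).2 he
    have h2 := F.smul_mem_bi (F.Y_mem i).1 (by omega) ih
    rw [F.evalVia_thetaWord_cons hΘ, List.map_cons, kaz_cons, lam_cons, monomial_cons]
    have hwt : F.wt (.cent i) = F.wtY i := rfl
    have h3 := add_mem (F.bi_mono (d' := F.wt (.cent i) + 2 + F.kaz (v.map .cent))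
      (c' := F.wt (.cent i) + 1 + F.lam (v.map .cent) - 1) (by omega) (by omega) h1)
      (F.bi_mono (by omega) (by omega) h2)
    convert h3 using 1
    rw [smul_sub]
    change _ - UEA.ι g (F.Y i : g) • _ = _
    abel

theorem repr_evalVia_thetaWord_self (hΘ : ∀ y, evalVia j (Θ y) = F.gen y • oneChi b)
    (v : F.CentWord) : F.pbw.repr (evalVia j (F.thetaWord Θ v.1)) v.toNormal = 1 := by
  have h1 := (F.mem_spanMon.mp (F.evalVia_thetaWord_sub_mem_bi hΘ v.1)) v.toNormal
  have h2 : F.pbw.repr (F.monomial (v.1.map .cent)) = Finsupp.single v.toNormal 1 := by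
    rw [show v.1.map Letter.cent = v.toNormal.1 from rfl, ← F.pbw_apply, Basis.repr_self]
  rw [map_sub, Finsupp.sub_apply, h2, Finsupp.single_eq_same] at h1
  by_contra hne
  have h3 := (h1 (sub_ne_zero.mpr hne)).2
  change F.lam (v.1.map .cent) ≤ F.lam (v.1.map .cent) - 1 at h3
  omega

/-- The expansion of a product of lifts is triangular on words in `g_e`: degree bounds prevent the
weight from growing, and every other word in `g_e` has smaller `lam`. -/
theorem repr_evalVia_thetaWord_ne_zero (hΘ : ∀ y, evalVia j (Θ y) = F.gen y • oneChi b)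
    {v w : F.CentWord} (h : F.pbw.repr (evalVia j (F.thetaWord Θ v.1)) w.toNormal ≠ 0)
    (hvw : v ≠ w) : F.weight w.toNormal.1 ≤ F.weight v.toNormal.1 ∧
      F.lam w.toNormal.1 < F.lam v.toNormal.1 := by
  constructor
  · have h1 := (F.mem_spanMon.mp (F.evalVia_thetaWord_mem_degQ hΘ v.1)) w.toNormal h
    have h2 := F.deg_cent w.1
    change F.deg (w.1.map .cent) ≤ F.weight (v.1.map .cent) at h1
    rw [h2] at h1
    exact h1
  · have h1 := (F.mem_spanMon.mp (F.evalVia_thetaWord_sub_mem_bi hΘ v.1)) w.toNormal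
    have h2 : F.pbw.repr (F.monomial (v.1.map .cent)) = Finsupp.single v.toNormal 1 := by
      rw [show v.1.map Letter.cent = v.toNormal.1 from rfl, ← F.pbw_apply, Basis.repr_self]
    rw [map_sub, Finsupp.sub_apply, h2, Finsupp.single_eq_of_ne
      (fun h => hvw (CentWord.toNormal_injective F h).symm), sub_zero] at h1
    have h3 := (h1 h).2
    change F.lam (w.1.map .cent) ≤ F.lam (v.1.map .cent) - 1 at h3
    change F.lam (w.1.map .cent) < F.lam (v.1.map .cent)
    omega

/-- Descent on `lam`: the leading monomials of an invariant are words in `g_e`, and subtracting the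
corresponding products of lifts leaves an invariant with a smaller bound. -/
theorem exists_mem_span_thetaWord (hj : IsRefinedW j)
    (hΘ : ∀ y, evalVia j (Θ y) = F.gen y • oneChi b) {d c : ℤ} {q : Qchi b} (hq : q ∈ F.bi d c)
    (h0 : q ∈ F.invariants) :
    ∃ s ∈ Submodule.span ℂ {a | ∃ v : F.CentWord, F.kaz v.toNormal.1 ≤ d ∧
      F.lam v.toNormal.1 ≤ c ∧ a = F.thetaWord Θ v.1}, evalVia j s = q := by
  induction hN : (c + 1).toNat generalizing c q with
  | zero =>
    rw [F.bi_eq_bot (by omega)] at hq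
    exact ⟨0, zero_mem _, by rw [map_zero, (Submodule.mem_bot ℂ).mp hq]⟩
  | succ n ih =>
    have hw : ∀ w : F.NormalWord, ∃ s ∈ Submodule.span ℂ {a | ∃ v : F.CentWord,
        F.kaz v.toNormal.1 ≤ d ∧ F.lam v.toNormal.1 ≤ c ∧ a = F.thetaWord Θ v.1},
        F.pbw.repr q w ≠ 0 → F.pbw w - evalVia j s ∈ F.bi d (c - 1) := by
      intro w
      by_cases hne : F.pbw.repr q w = 0
      · exact ⟨0, zero_mem _, fun h => absurd hne h⟩
      have h1 := F.mem_spanMon.mp hq w hne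
      rcases h1.2.lt_or_eq with hlt | heq
      · refine ⟨0, zero_mem _, fun _ => ?_⟩
        rw [map_zero, sub_zero, F.pbw_apply]
        exact F.bi_mono h1.1 (by omega) (F.monomial_mem_bi w)
      · obtain ⟨v, rfl⟩ := F.exists_toNormal_eq
          (F.num_eq_zero_of_invariant hq (F.mem_invariants.mp h0) heq hne)
        refine ⟨_, Submodule.subset_span ⟨v, h1.1, h1.2, rfl⟩, fun _ => ?_⟩
        rw [F.pbw_apply, ← neg_sub (evalVia j (F.thetaWord Θ v.1))]
        exact Submodule.neg_mem _ (F.bi_mono h1.1 (sub_le_sub_right h1.2 1)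
          (F.evalVia_thetaWord_sub_mem_bi hΘ v.1))
    choose s hs hs' using hw
    have hq' : q - evalVia j (∑ w ∈ (F.pbw.repr q).support, F.pbw.repr q w • s w) ∈
        F.bi d (c - 1) := by
      have h1 : q = ∑ w ∈ (F.pbw.repr q).support, F.pbw.repr q w • F.pbw w := by
        conv_lhs => rw [← F.pbw.linearCombination_repr q]
        rfl
      have h2 : q - evalVia j (∑ w ∈ (F.pbw.repr q).support, F.pbw.repr q w • s w) =
          ∑ w ∈ (F.pbw.repr q).support, F.pbw.repr q w • (F.pbw w - evalVia j (s w)) := by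
        simp only [smul_sub, Finset.sum_sub_distrib, ← h1, map_sum, map_smul]
      rw [h2]
      exact Submodule.sum_mem _ fun w hw =>
        Submodule.smul_mem _ _ (hs' w (Finsupp.mem_support_iff.mp hw))
    obtain ⟨r, hr, hrq⟩ := ih hq' (sub_mem h0 (F.evalVia_mem_invariants hj _)) (by omega)
    refine ⟨r + ∑ w ∈ (F.pbw.repr q).support, F.pbw.repr q w • s w, add_mem ?_ ?_, ?_⟩
    · refine Submodule.span_mono ?_ hr
      rintro _ ⟨v, h1, h2, rfl⟩
      exact ⟨v, h1, by omega, rfl⟩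
    · exact Submodule.sum_mem _ fun w _ => Submodule.smul_mem _ _ (hs w)
    · rw [map_add, hrq, sub_add_cancel]

/-- Weights cannot drop by cancellation. Among the words of maximal weight take one of maximal
`lam`; by triangularity no other term reaches its monomial, so its coefficient in `Q_χ` is its
coefficient in the sum. -/
theorem weight_le_of_sum_mem (hΘ : ∀ y, evalVia j (Θ y) = F.gen y • oneChi b)
    (s : Finset F.CentWord) (c : F.CentWord → ℂ) {n : ℤ}
    (h : ∑ v ∈ s, c v • F.thetaWord Θ v.1 ∈ natFiltration b j n) {v : F.CentWord} (hv : v ∈ s)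
    (hcv : c v ≠ 0) : F.weight v.toNormal.1 ≤ n := by
  obtain ⟨m, hm, hmax⟩ := Finset.exists_max_image (s.filter fun v => c v ≠ 0)
    (fun v => F.weight v.toNormal.1) ⟨v, Finset.mem_filter.mpr ⟨hv, hcv⟩⟩
  refine (hmax v (Finset.mem_filter.mpr ⟨hv, hcv⟩)).trans ?_
  obtain ⟨w, hw, hwmax⟩ := Finset.exists_max_image
    (s.filter fun v => c v ≠ 0 ∧ F.weight v.toNormal.1 = F.weight m.toNormal.1)
    (fun v => F.lam v.toNormal.1) ⟨m, by
      rw [Finset.mem_filter] at hm ⊢; exact ⟨hm.1, hm.2, rfl⟩⟩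
  obtain ⟨hws, hcw, hwm⟩ := Finset.mem_filter.mp hw
  rw [← hwm]
  rw [mem_natFiltration, natFiltrationQ_eq F] at h
  refine F.mem_spanMon.mp h w.toNormal ?_
  rw [map_sum, map_sum, Finsupp.finsetSum_apply, Finset.sum_eq_single w]
  · rw [map_smul, map_smul, Finsupp.smul_apply, F.repr_evalVia_thetaWord_self hΘ, smul_eq_mul,
      mul_one]
    exact hcw
  · intro u hu huw
    rw [map_smul, map_smul, Finsupp.smul_apply, smul_eq_mul]
    by_contra hne
    have hcu := left_ne_zero_of_mul hne
    obtain ⟨h1, h2⟩ := F.repr_evalVia_thetaWord_ne_zero hΘ (right_ne_zero_of_mul hne) huw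
    have h3 := hmax u (Finset.mem_filter.mpr ⟨hu, hcu⟩)
    have h4 := hwmax u (Finset.mem_filter.mpr ⟨hu, hcu, le_antisymm h3 (hwm ▸ h1)⟩)
    exact absurd h2 (not_lt.mpr h4)
  · exact fun h => absurd hws h

theorem exists_sum_thetaWord (hj : IsRefinedW j) (hΘ : ∀ y, evalVia j (Θ y) = F.gen y • oneChi b)
    (a : A) : ∃ (s : Finset F.CentWord) (c : F.CentWord → ℂ),
      (∀ v ∈ s, c v ≠ 0) ∧ a = ∑ v ∈ s, c v • F.thetaWord Θ v.1 := by
  obtain ⟨d, c, hq⟩ := F.exists_mem_bi (evalVia j a)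
  obtain ⟨s, hs, hsa⟩ := F.exists_mem_span_thetaWord hj hΘ hq (F.evalVia_mem_invariants hj a)
  obtain rfl := hj.evalVia_injective hsa
  have h1 : s ∈ Submodule.span ℂ (Set.range fun v : F.CentWord => F.thetaWord Θ v.1) := by
    refine Submodule.span_mono ?_ hs
    rintro _ ⟨v, -, -, rfl⟩
    exact ⟨v, rfl⟩
  obtain ⟨c, rfl⟩ := (Finsupp.mem_span_range_iff_exists_finsupp).mp h1
  exact ⟨c.support, c, fun v hv => Finsupp.mem_support_iff.mp hv, rfl⟩

theorem thetaWord_mem_natFiltration (hΘ : ∀ y, evalVia j (Θ y) = F.gen y • oneChi b)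
    (v : List (Fin F.N)) : F.thetaWord Θ v ∈ natFiltration b j (F.weight (v.map .cent)) :=
  F.degQ_le _ (F.evalVia_thetaWord_mem_degQ hΘ v)

theorem natFiltration_mono (F : Frame b) (j : A →ₐ[ℂ] FiniteW b) : Monotone (natFiltration b j) := by
  intro m n hmn a ha
  rw [mem_natFiltration, natFiltrationQ_eq F] at ha ⊢
  exact F.spanMon_mono (fun w hw => hw.trans hmn) ha

theorem mem_natFiltration_iff (hj : IsRefinedW j)
    (hΘ : ∀ y, evalVia j (Θ y) = F.gen y • oneChi b) {n : ℤ} {a : A} :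
    a ∈ natFiltration b j n ↔ a ∈ Submodule.span ℂ {a | ∃ v : F.CentWord,
      F.weight v.toNormal.1 ≤ n ∧ a = F.thetaWord Θ v.1} := by
  constructor
  · intro ha
    obtain ⟨s, c, hc, rfl⟩ := F.exists_sum_thetaWord hj hΘ a
    exact Submodule.sum_mem _ fun v hv => Submodule.smul_mem _ _ (Submodule.subset_span
      ⟨v, F.weight_le_of_sum_mem hΘ s c ha hv (hc v hv), rfl⟩)
  · intro ha
    refine Submodule.span_le.mpr ?_ ha
    rintro _ ⟨v, hv, rfl⟩
    exact F.natFiltration_mono j hv (F.thetaWord_mem_natFiltration hΘ v.1)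

theorem isAlgFiltration (F : Frame b) (hj : IsRefinedW j) : IsAlgFiltration (natFiltration b j) := by
  obtain ⟨Θ, hΘ⟩ := F.exists_generators hj
  refine ⟨F.natFiltration_mono j, ?_, ?_, ?_, ?_⟩
  · rw [mem_natFiltration, evalVia_one]
    exact F.degQ_le _ F.oneChi_mem_degQ
  · intro m n a c ha hc
    rw [F.mem_natFiltration_iff hj hΘ] at ha hc
    induction ha using Submodule.span_induction with
    | zero => rw [zero_mul]; exact zero_mem _
    | add x y _ _ hx hy => rw [add_mul]; exact add_mem hx hy
    | smul z x _ hx => rw [smul_mul_assoc]; exact Submodule.smul_mem _ z hx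
    | mem a ha =>
      obtain ⟨v, hv, rfl⟩ := ha
      induction hc using Submodule.span_induction with
      | zero => rw [mul_zero]; exact zero_mem _
      | add x y _ _ hx hy => rw [mul_add]; exact add_mem hx hy
      | smul z x _ hx => rw [mul_smul_comm]; exact Submodule.smul_mem _ z hx
      | mem c hc =>
        obtain ⟨w, hw, rfl⟩ := hc
        -- The concatenated word need not be normal, but the degree bound holds for products of
        -- lifts in any order.
        rw [← thetaWord_append]
        refine F.natFiltration_mono j ?_ (F.thetaWord_mem_natFiltration hΘ _)
        rw [List.map_append, weight_append]
        exact add_le_add hv hw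
  · intro a
    obtain ⟨s, c, -, rfl⟩ := F.exists_sum_thetaWord hj hΘ a
    obtain ⟨n, hn⟩ := ((Finset.finite_toSet s).image fun v => F.weight v.toNormal.1).bddAbove
    refine ⟨n, Submodule.sum_mem _ fun v hv => Submodule.smul_mem _ _ ?_⟩
    exact F.natFiltration_mono j (hn ⟨v, hv, rfl⟩) (F.thetaWord_mem_natFiltration hΘ v.1)
  · intro a ha
    obtain ⟨s, c, hc, rfl⟩ := F.exists_sum_thetaWord hj hΘ a
    refine Finset.sum_eq_zero fun v hv => ?_
    have := F.weight_le_of_sum_mem hΘ s c (ha (F.weight v.toNormal.1 - 1)) hv (hc v hv)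
    omega

end Frame

end Filtration

/-! ## The isomorphism with `U(g_e)` -/

section Comparison

variable {g : Type*} [AddCommGroup g] [Module ℂ g] [LieSuperalgebra g]
  {B : InvariantForm g} {t : Sl2Triple g} {b : WittBases B t}
  {A : Type*} [Ring A] [Algebra ℂ A]

namespace Frame

variable (F : Frame b) [FiniteDimensional ℂ g] {j : A →ₐ[ℂ] FiniteW b}
  {Θ : centralizer t.e →ₗ[ℂ] A}

theorem theta_mem_natFiltration (hΘ : ∀ y, evalVia j (Θ y) = F.gen y • oneChi b) {k : ℤ}
    (hk : 0 ≤ k) {p : ZMod 2} {y : centralizer t.e} (hy : (y : g) ∈ t.grade k)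
    (hp : (y : g) ∈ parity (g := g) p) : Θ y ∈ natFiltration b j k := by
  rw [mem_natFiltration, hΘ]
  have h := F.degQ_le _ (F.gen_smul_mem_degQ hk hy hp F.oneChi_mem_degQ)
  rwa [zero_add] at h

theorem theta_Y_mem (hΘ : ∀ y, evalVia j (Θ y) = F.gen y • oneChi b) (i : Fin F.N) :
    Θ (F.Y i) ∈ natFiltration b j (F.wtY i) :=
  F.theta_mem_natFiltration hΘ (F.wtY_nonneg i) (F.Y_mem i).1 (F.Y_mem i).2

/-- The symbols of the generators. -/
noncomputable def symbolMap (hF : IsAlgFiltration (natFiltration b j))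
    (hΘ : ∀ y, evalVia j (Θ y) = F.gen y • oneChi b) :
    centralizer t.e →ₗ[ℂ] AssocGraded hF :=
  F.Y.constr ℂ fun i => AssocGraded.symbol hF (F.wtY i) (Θ (F.Y i)) (F.theta_Y_mem hΘ i)

theorem mem_span_Y_of_repr {P : Fin F.N → Prop} {y : centralizer t.e}
    (h : ∀ i, F.Y.repr y i ≠ 0 → P i) : y ∈ Submodule.span ℂ (F.Y '' {i | P i}) :=
  F.Y.mem_span_image.mpr fun i hi => h i (Finsupp.mem_support_iff.mp hi)

variable (hF : IsAlgFiltration (natFiltration b j))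
  (hΘ : ∀ y, evalVia j (Θ y) = F.gen y • oneChi b)

theorem symbolMap_Y (i : Fin F.N) : F.symbolMap hF hΘ (F.Y i) =
    AssocGraded.symbol hF (F.wtY i) (Θ (F.Y i)) (F.theta_Y_mem hΘ i) :=
  F.Y.constr_basis ℂ _ i

theorem symbolMap_apply {k : ℤ} {p : ZMod 2} {y : centralizer t.e} (hy : (y : g) ∈ t.grade k)
    (hp : (y : g) ∈ parity (g := g) p) (h : Θ y ∈ natFiltration b j k) :
    F.symbolMap hF hΘ y = AssocGraded.symbol hF k (Θ y) h := by
  have h1 := F.mem_span_Y_of_repr (P := fun i => F.wtY i = k) (y := y)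
    fun i hi => (F.repr_Y_ne_zero hy hp hi).1
  clear hy hp
  suffices hs : ∃ h, F.symbolMap hF hΘ y = AssocGraded.symbol hF k (Θ y) h from hs.2
  clear h
  induction h1 using Submodule.span_induction with
  | mem y hy =>
    obtain ⟨i, rfl, rfl⟩ := hy
    exact ⟨_, F.symbolMap_Y hF hΘ i⟩
  | zero =>
    refine ⟨by rw [map_zero]; exact zero_mem _, ?_⟩
    rw [map_zero]
    exact (AssocGraded.symbol_eq_zero hF _ (by rw [map_zero]; exact zero_mem _)).symm
  | add y z _ _ hy hz =>
    obtain ⟨h, hy⟩ := hy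
    obtain ⟨h', hz⟩ := hz
    refine ⟨by rw [map_add]; exact add_mem h h', ?_⟩
    rw [map_add, hy, hz, ← AssocGraded.symbol_add]
    exact AssocGraded.symbol_congr hF rfl (map_add Θ y z).symm _
  | smul c y _ hy =>
    obtain ⟨h, hy⟩ := hy
    refine ⟨by rw [map_smul]; exact Submodule.smul_mem _ _ h, ?_⟩
    rw [map_smul, hy, ← AssocGraded.symbol_smul]
    exact AssocGraded.symbol_congr hF rfl (map_smul Θ c y).symm _

theorem symbolMap_mul_Y (i k : Fin F.N) :
    F.symbolMap hF hΘ (F.Y i) * F.symbolMap hF hΘ (F.Y k) =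
      ksign (F.parY i) (F.parY k) • (F.symbolMap hF hΘ (F.Y k) * F.symbolMap hF hΘ (F.Y i)) +
        F.symbolMap hF hΘ (bracket (F.Y i) (F.Y k)) := by
  have hi := F.Y_mem i
  have hk := F.Y_mem k
  have hw := F.wtY_nonneg i
  have hw' := F.wtY_nonneg k
  have hbg : ((bracket (F.Y i) (F.Y k) : centralizer t.e) : g) ∈ t.grade (F.wtY i + F.wtY k) :=
    t.bracket_mem_grade hi.1 hk.1
  have hbp : ((bracket (F.Y i) (F.Y k) : centralizer t.e) : g) ∈
      parity (g := g) (F.parY i + F.parY k) := bracket_mem (g := g) hi.2 hk.2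
  have m1 := hF.mul_mem (F.theta_Y_mem hΘ i) (F.theta_Y_mem hΘ k)
  have m2 := hF.mul_mem (F.theta_Y_mem hΘ k) (F.theta_Y_mem hΘ i)
  have m2' : Θ (F.Y k) * Θ (F.Y i) ∈ natFiltration b j (F.wtY i + F.wtY k) := add_comm (F.wtY k) _ ▸ m2
  have m3 := F.theta_mem_natFiltration hΘ (by omega) hbg hbp
  rw [F.symbolMap_apply hF hΘ hbg hbp m3, symbolMap_Y, symbolMap_Y, ← AssocGraded.symbol_mul,
    ← AssocGraded.symbol_mul, AssocGraded.symbol_congr hF (add_comm (F.wtY k) _) rfl m2]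
  rw [← sub_eq_zero, ← sub_sub]
  have h0 : AssocGraded.symbolₗ hF (F.wtY i + F.wtY k) (⟨_, m1⟩ -
      ksign (F.parY i) (F.parY k) • ⟨_, m2'⟩ - ⟨_, m3⟩) = 0 := by
    refine AssocGraded.symbol_eq_zero hF (Subtype.prop _) ?_
    -- The failure of the bracket relation lies one step lower in the filtration, so it vanishes in
    -- the graded algebra.
    have hd := F.degQ_le _ (F.defect_mem hw hw' hi.1 hi.2 hk.1 hk.2)
    have he : evalVia j (Θ (F.Y i) * Θ (F.Y k) -
        ksign (F.parY i) (F.parY k) • (Θ (F.Y k) * Θ (F.Y i)) - Θ (bracket (F.Y i) (F.Y k))) =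
        F.defect (F.parY i) (F.parY k) (F.Y i) (F.Y k) := by
      rw [map_sub, map_sub, map_smul, evalVia_mul j (hΘ _), evalVia_mul j (hΘ _), hΘ, hΘ, hΘ, defect]
    rw [mem_natFiltration]
    rw [← he] at hd
    exact hd
  rw [map_sub, map_sub, map_smul] at h0
  exact h0

theorem symbolMap_mul {p p' : ZMod 2} {x y : centralizer t.e}
    (hx : x ∈ parity (g := centralizer t.e) p) (hy : y ∈ parity (g := centralizer t.e) p') :
    F.symbolMap hF hΘ x * F.symbolMap hF hΘ y =
      ksign p p' • (F.symbolMap hF hΘ y * F.symbolMap hF hΘ x) +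
        F.symbolMap hF hΘ (bracket x y) := by
  have hspan : ∀ {p : ZMod 2} {x : centralizer t.e}, x ∈ parity (g := centralizer t.e) p →
      x ∈ Submodule.span ℂ (F.Y '' {i | F.parY i = p}) := fun {p x} hx =>
    F.mem_span_Y_of_repr fun i hi => by
      rw [← repr_Y] at hi
      by_contra hp
      exact hi (F.repr_parity (l := .cent i) hx hp)
  replace hx := hspan hx
  replace hy := hspan hy
  induction hx using Submodule.span_induction with
  | zero => simp
  | add x x' _ _ h h' =>
    simp only [map_add, LinearMap.add_apply, add_mul, mul_add, h, h', smul_add]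
    abel
  | smul c x _ h =>
    simp only [map_smul, LinearMap.smul_apply, smul_mul_assoc, mul_smul_comm, h, smul_add,
      smul_comm c]
  | mem x hx =>
    obtain ⟨i, rfl, rfl⟩ := hx
    induction hy using Submodule.span_induction with
    | zero => simp
    | add x x' _ _ h h' =>
      simp only [map_add, add_mul, mul_add, h, h', smul_add]
      abel
    | smul c x _ h =>
      simp only [map_smul, smul_mul_assoc, mul_smul_comm, h, smul_add, smul_comm c]
    | mem y hy =>
      obtain ⟨k, rfl, rfl⟩ := hy
      exact F.symbolMap_mul_Y hF hΘ i k

/-- The comparison map `U(g_e) → gr W`. -/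
noncomputable def comparison : UEA (centralizer t.e) →ₐ[ℂ] AssocGraded hF :=
  UEA.lift (F.symbolMap hF hΘ) (F.symbolMap_mul hF hΘ)

theorem comparison_ι (x : centralizer t.e) :
    F.comparison hF hΘ (UEA.ι _ x) = F.symbolMap hF hΘ x := UEA.lift_ι _ _ x

theorem comparison_word (v : List (Fin F.N)) : F.comparison hF hΘ (word F.Y v) =
    AssocGraded.symbol hF (F.weight (v.map .cent)) (F.thetaWord Θ v)
      (F.thetaWord_mem_natFiltration hΘ v) := by
  induction v with
  | nil =>
    rw [word_nil, map_one, ← AssocGraded.symbol_one]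
    rfl
  | cons i v ih =>
    rw [word_cons, map_mul, ih, comparison_ι, symbolMap_Y, ← AssocGraded.symbol_mul]
    exact AssocGraded.symbol_congr hF (by rw [List.map_cons, weight_cons]; rfl)
      (F.thetaWord_cons Θ i v).symm _

theorem exists_sum_word (u : UEA (centralizer t.e)) :
    ∃ (s : Finset F.CentWord) (c : F.CentWord → ℂ), u = ∑ v ∈ s, c v • word F.Y v.1 := by
  have h := UEA.mem_span_word F.Y.span_eq (par := F.parY) (fun i => (F.Y_mem i).2) u
  have h1 : u ∈ Submodule.span ℂ (Set.range fun v : F.CentWord => word F.Y v.1) := by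
    refine Submodule.span_mono ?_ h
    rintro _ ⟨v, hv, rfl⟩
    exact ⟨⟨v, hv⟩, rfl⟩
  obtain ⟨c, rfl⟩ := (Finsupp.mem_span_range_iff_exists_finsupp).mp h1
  exact ⟨c.support, c, rfl⟩

/-- Ordered words go to symbols of products of lifts in exactly their weight. A relation among the
symbols would place a combination of words of one weight in a lower term of the filtration; hence
words in `U(g_e)` are independent as well. -/
theorem comparison_injective : Function.Injective (F.comparison hF hΘ) := by
  rw [injective_iff_map_eq_zero]
  intro u hu
  obtain ⟨s, c, rfl⟩ := F.exists_sum_word u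
  have hmem : ∀ v : F.CentWord, c v • F.thetaWord Θ v.1 ∈
      natFiltration b j (F.weight v.toNormal.1) := fun v =>
    Submodule.smul_mem _ _ (F.thetaWord_mem_natFiltration hΘ v.1)
  have h1 : ∑ v ∈ s, AssocGraded.symbol hF (F.weight v.toNormal.1) (c v • F.thetaWord Θ v.1)
      (hmem v) = 0 := by
    rw [← hu, map_sum]
    refine Finset.sum_congr rfl fun v _ => ?_
    rw [map_smul, comparison_word, ← AssocGraded.symbol_smul]
    rfl
  rw [AssocGraded.sum_symbol_eq_zero] at h1
  refine Finset.sum_eq_zero fun v hv => ?_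
  by_contra hne
  have hc : c v ≠ 0 := fun h => hne (by rw [h, zero_smul])
  have := F.weight_le_of_sum_mem hΘ _ c (h1 (F.weight v.toNormal.1))
    (Finset.mem_filter.mpr ⟨hv, rfl⟩) hc
  omega

theorem comparison_surjective (hj : IsRefinedW j) : Function.Surjective (F.comparison hF hΘ) := by
  intro x
  refine AssocGraded.mem_of_symbol_mem hF (LinearMap.range (F.comparison hF hΘ).toLinearMap) ?_ x
  intro n a ha
  have ha' := (F.mem_natFiltration_iff hj hΘ).mp ha
  suffices hs : ∃ ha, AssocGraded.symbol hF n a ha ∈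
      LinearMap.range (F.comparison hF hΘ).toLinearMap from hs.2
  clear ha
  induction ha' using Submodule.span_induction with
  | zero =>
    refine ⟨zero_mem _, ?_⟩
    rw [AssocGraded.symbol_eq_zero hF _ (zero_mem _)]
    exact zero_mem _
  | add a c _ _ ha hc =>
    obtain ⟨ha, ha'⟩ := ha
    obtain ⟨hc, hc'⟩ := hc
    exact ⟨add_mem ha hc, by rw [AssocGraded.symbol_add hF ha hc]; exact add_mem ha' hc'⟩
  | smul z a _ ha =>
    obtain ⟨ha, ha'⟩ := ha
    exact ⟨Submodule.smul_mem _ z ha, by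
      rw [AssocGraded.symbol_smul hF z ha]; exact Submodule.smul_mem _ z ha'⟩
  | mem a ha =>
    obtain ⟨v, hv, rfl⟩ := ha
    have hm := F.thetaWord_mem_natFiltration hΘ v.1
    change F.weight (v.1.map .cent) ≤ n at hv
    refine ⟨hF.mono hv hm, ?_⟩
    rcases hv.eq_or_lt with h | h
    · subst h
      exact ⟨word F.Y v.1, F.comparison_word hF hΘ v.1⟩
    · rw [AssocGraded.symbol_eq_zero hF _ (hF.mono (by omega) hm)]
      exact zero_mem _

/-- Elements of order `m` of the `W`-superalgebra are, up to a constant, of weight below `m`. -/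
theorem exists_constant (hj : IsRefinedW j) {m : ℤ} (hm : 0 ≤ m) {p : ZMod 2} {a : A}
    (ha : evalVia j a ∈ F.bi (m + 2) m) (hp : evalVia j a ∈ parityQ b p) :
    ∃ c : ℂ, (m ≠ 0 ∨ p = 1 → c = 0) ∧ a - algebraMap ℂ A c ∈ natFiltration b j (m - 1) := by
  obtain ⟨Θ, hΘ⟩ := F.exists_generators hj
  obtain ⟨s, hs, hsa⟩ := F.exists_mem_span_thetaWord hj hΘ ha (F.evalVia_mem_invariants hj a)
  obtain rfl := hj.evalVia_injective hsa
  have hmono := F.natFiltration_mono j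
  have hone : (1 : A) ∈ natFiltration b j 0 := (F.isAlgFiltration hj).one_mem
  have key : ∃ c : ℂ, s - algebraMap ℂ A c ∈ natFiltration b j (m - 1) ∧
      (m = 0 → s = algebraMap ℂ A c) := by
    clear ha hp hsa
    induction hs using Submodule.span_induction with
    | zero => exact ⟨0, by simp⟩
    | add x y _ _ hx hy =>
      obtain ⟨c, hc, hc'⟩ := hx
      obtain ⟨d, hd, hd'⟩ := hy
      refine ⟨c + d, ?_, fun h => by rw [map_add, hc' h, hd' h]⟩
      rw [map_add, add_sub_add_comm]
      exact add_mem hc hd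
    | smul z x _ hx =>
      obtain ⟨c, hc, hc'⟩ := hx
      have hz : algebraMap ℂ A (z * c) = z • algebraMap ℂ A c := by
        rw [map_mul, Algebra.smul_def]
      refine ⟨z * c, ?_, fun h => by rw [hz, ← hc' h]⟩
      rw [hz, ← smul_sub]
      exact Submodule.smul_mem _ z hc
    | mem x hx =>
      obtain ⟨v, -, hv, rfl⟩ := hx
      have hw : 0 ≤ F.weight (v.1.map .cent) := F.deg_cent v.1 ▸ F.deg_nonneg (F.cent_free v.1)
      change F.lam (v.1.map .cent) ≤ m at hv
      rw [lam_eq] at hv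
      -- Weight plus length is at most `m`, so a nonempty word has weight below `m`; only the empty
      -- word gives a constant.
      by_cases h : v.1 = []
      · exact ⟨1, by simp [h, thetaWord]⟩
      · have h1 := List.length_pos_iff.mpr h
        rw [List.length_map] at hv
        refine ⟨0, ?_, fun h => by omega⟩
        rw [map_zero, sub_zero]
        exact hmono (by omega) (F.thetaWord_mem_natFiltration hΘ v.1)
  obtain ⟨c, hc, hc'⟩ := key
  by_cases hm0 : m = 0
  · by_cases hp1 : p = 1
    -- For `m = 0` the element is a multiple of the even vector `1_χ`, which is zero if the element
    -- is odd.
    · have hs0 : s = 0 := by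
        refine hj.evalVia_injective ?_
        rw [map_zero]
        refine F.eq_zero_of_mem_parityQ ?_ (hp1 ▸ hp)
        rw [hc' hm0, Algebra.algebraMap_eq_smul_one, map_smul, evalVia_one]
        exact Submodule.smul_mem _ _ oneChi_mem_parityQ
      exact ⟨0, fun _ => rfl, by rw [hs0, map_zero, sub_zero]; exact zero_mem _⟩
    · exact ⟨c, fun h => absurd h (by simp [hm0, hp1]), hc⟩
  · refine ⟨0, fun _ => rfl, ?_⟩
    rw [map_zero, sub_zero]
    have h1 : algebraMap ℂ A c ∈ natFiltration b j (m - 1) := by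
      rw [Algebra.algebraMap_eq_smul_one]
      exact Submodule.smul_mem _ _ (hmono (by omega) hone)
    simpa using add_mem hc h1

theorem naturalGradedIso (F : Frame b) (hj : IsRefinedW j) : NaturalGradedIso b j := by
  obtain ⟨Θ, hΘ⟩ := F.exists_generators hj
  have hF := F.isAlgFiltration hj
  let Ψ := AlgEquiv.ofBijective (F.comparison hF hΘ)
    ⟨F.comparison_injective hF hΘ, F.comparison_surjective hF hΘ hj⟩
  refine ⟨hF, Ψ.symm, fun n Y m p hY => ?_⟩
  have hm : ∀ i, 0 ≤ m i := fun i =>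
    t.weight_nonneg (hY i).1 (Y i).2 fun h => Y.ne_zero i (Subtype.ext h)
  have hmem : ∀ i, Θ (Y i) ∈ natFiltration b j (m i) := fun i =>
    F.theta_mem_natFiltration hΘ (hm i) (hY i).1 (hY i).2
  have hΨ : ∀ i, Ψ (UEA.ι _ (Y i)) = AssocGraded.symbol hF (m i) (Θ (Y i)) (hmem i) := fun i =>
    (F.comparison_ι hF hΘ _).trans (F.symbolMap_apply hF hΘ (hY i).1 (hY i).2 _)
  have hgen : ∀ i, IsPBWGenerator b (Y i : g) (m i) (p i) (j (Θ (Y i))) := fun i => by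
    have h1 : evalOne b (j (Θ (Y i))) = F.gen (Y i) • oneChi b := hΘ (Y i)
    refine ⟨?_, ?_⟩
    · rw [h1]; exact F.gen_smul_mem_parityQ (hY i).1 (hY i).2
    · rw [h1, mkQ_eq_smul, F.lowerTerms_eq_bi (hm i)]
      have h2 := F.gen_sub_smul_mem_bi (hY i).1 (hY i).2 F.oneChi_mem_bi
      rwa [zero_add, zero_add] at h2
  refine ⟨⟨fun i => Θ (Y i), fun i => ⟨hgen i, hmem i, ?_⟩⟩, fun Θ' hΘ' => ?_⟩
  · rw [AlgEquiv.symm_apply_eq, hΨ]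
  -- Only the difference to the chosen generator has to be examined: it is an invariant in the span
  -- of the lower terms.
  · have hc : ∀ i, ∃ c : ℂ, (m i ≠ 0 ∨ p i = 1 → c = 0) ∧
        Θ' i - Θ (Y i) - algebraMap ℂ A c ∈ natFiltration b j (m i - 1) := fun i => by
      refine F.exists_constant hj (p := p i) (hm i) ?_ ?_
      · have h1 := sub_mem (hΘ' i).2 (hgen i).2
        rw [F.lowerTerms_eq_bi (hm i), sub_sub_sub_cancel_right] at h1
        rwa [map_sub]
      · rw [map_sub]
        exact sub_mem (hΘ' i).1 (hgen i).1
    choose c hc0 hc using hc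
    refine ⟨c, fun i => ⟨hc0 i, ?_⟩⟩
    have hone : algebraMap ℂ A (c i) ∈ natFiltration b j (m i) := by
      rw [Algebra.algebraMap_eq_smul_one]
      exact Submodule.smul_mem _ _ (hF.mono (hm i) hF.one_mem)
    have hle := hF.mono (sub_le_self (m i) zero_le_one) (hc i)
    have heq : Θ' i = Θ (Y i) + (algebraMap ℂ A (c i) +
        (Θ' i - Θ (Y i) - algebraMap ℂ A (c i))) := by abel
    have hΘm : Θ' i ∈ natFiltration b j (m i) := by
      rw [heq]; exact add_mem (hmem i) (add_mem hone hle)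
    refine ⟨hΘm, ?_⟩
    rw [AlgEquiv.symm_apply_eq, map_add, hΨ, AlgEquiv.commutes,
      AssocGraded.symbol_congr hF rfl heq hΘm, AssocGraded.symbol_add hF (hmem i)
      (add_mem hone hle), AssocGraded.symbol_add hF hone hle,
      AssocGraded.symbol_eq_zero hF hle (hc i), add_zero]
    congr 1
    by_cases h : c i = 0
    · rw [AssocGraded.symbol_congr hF rfl (show algebraMap ℂ A (c i) = 0 by rw [h, map_zero]) hone,
        AssocGraded.symbol_eq_zero hF _ (zero_mem _), h, map_zero]
    · have h0 : m i = 0 := by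
        by_contra hne
        exact h (hc0 i (Or.inl hne))
      rw [AssocGraded.symbol_congr hF h0 (Algebra.algebraMap_eq_smul_one (c i)) hone,
        AssocGraded.symbol_smul hF (c i) hF.one_mem, AssocGraded.symbol_one,
        Algebra.algebraMap_eq_smul_one]

end Frame

theorem naturalGradedIso_refinedW [FiniteDimensional ℂ g] (b : WittBases B t) :
    NaturalGradedIso (A := refinedW b) b (refinedW b).val := by
  obtain ⟨F⟩ := exists_frame b
  exact F.naturalGradedIso ⟨Subtype.val_injective, fun φ =>
    ⟨fun h => ⟨⟨φ, h⟩, rfl⟩, fun ⟨a, ha⟩ => ha ▸ a.2⟩⟩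

theorem naturalGradedIso_finiteW [FiniteDimensional ℂ g] (b : WittBases B t)
    (hr : Even t.judgingNumber) : NaturalGradedIso b (AlgHom.id ℂ (FiniteW b)) := by
  obtain ⟨F⟩ := exists_frame b
  exact F.naturalGradedIso ⟨Function.injective_id, fun φ =>
    ⟨fun _ => ⟨φ, rfl⟩, fun _ => mem_refinedW_of_even hr φ⟩⟩

end Comparison

/-! ## The judging number of `gl(m|n)` -/

section GeneralLinear

variable {m n : ℕ}

/-- The grading operator of `ℂ^{m|n}`. -/
def GLSuper.signMatrix (m n : ℕ) : GLSuper m n :=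
  Matrix.diagonal (Sum.elim (fun _ => 1) (fun _ => -1))

theorem GLSuper.signMatrix_mul_self : signMatrix m n * signMatrix m n = 1 := by
  rw [signMatrix, Matrix.diagonal_mul_diagonal, ← Matrix.diagonal_one]
  congr 1
  ext (i | i) <;> simp

theorem GLSuper.signMatrix_mem : signMatrix m n ∈ GLSuper.parity m n 0 := by
  intro a c h
  rw [signMatrix, Matrix.diagonal_apply_ne]
  rintro rfl
  exact h (by rcases zmod2_cases (idxParity m n a) with h | h <;> rw [h] <;> rfl)

theorem GLSuper.mul_signMatrix {i : ZMod 2} {X : GLSuper m n} (hX : X ∈ GLSuper.parity m n i) :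
    X * signMatrix m n = ksign i 1 • (signMatrix m n * X) := by
  ext a c
  rw [Matrix.smul_apply, signMatrix, Matrix.mul_diagonal, Matrix.diagonal_mul]
  by_cases h : idxParity m n a + idxParity m n c = i
  · subst h
    rcases a with a | a <;> rcases c with c | c <;>
      simp [idxParity, ksign, show (1 : ZMod 2) + 1 = 0 from rfl]
  · rw [hX a c h]; simp

theorem GLSuper.bracket_signMatrix_mul {i : ZMod 2} {Z X : GLSuper m n}
    (hZ : Z ∈ GLSuper.parity m n 0) (hX : X ∈ GLSuper.parity m n i) :
    bracket Z (signMatrix m n * X) = signMatrix m n * bracket Z X := by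
  have hSX : signMatrix m n * X ∈ GLSuper.parity m n i := by
    simpa using GLSuper.mul_mem m n signMatrix_mem hX
  have h1 : Z * signMatrix m n = signMatrix m n * Z := by
    rw [mul_signMatrix hZ]; simp [ksign]
  change GLSuper.comm m n _ _ = _ * GLSuper.comm m n _ _
  rw [GLSuper.comm_apply m n hZ hSX, GLSuper.comm_apply m n hZ hX, mul_sub, ← mul_assoc, h1,
    mul_smul_comm, mul_assoc, mul_assoc]

theorem GLSuper.bracket_signMatrix {X Y : GLSuper m n}
    (hX : X ∈ GLSuper.parity m n 1) (hY : Y ∈ GLSuper.parity m n 1) :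
    bracket (signMatrix m n * X) (signMatrix m n * Y) = -bracket X Y := by
  have hS : ∀ {X : GLSuper m n}, X ∈ GLSuper.parity m n 1 →
      signMatrix m n * X ∈ GLSuper.parity m n 1 := fun hX => by
    simpa using GLSuper.mul_mem m n signMatrix_mem hX
  have hm : ∀ {X : GLSuper m n} (Y : GLSuper m n), X ∈ GLSuper.parity m n 1 →
      signMatrix m n * X * (signMatrix m n * Y) = -(X * Y) := fun {X} Y hX => by
    rw [mul_assoc, ← mul_assoc X, mul_signMatrix hX]
    simp only [ksign, and_self, if_true, neg_smul, one_smul, neg_mul, mul_neg, ← mul_assoc,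
      signMatrix_mul_self, one_mul]
  change GLSuper.comm m n _ _ = -GLSuper.comm m n _ _
  rw [GLSuper.comm_apply m n (hS hX) (hS hY), GLSuper.comm_apply m n hX hY, hm Y hX, hm X hY]
  simp [ksign]
  abel

/-- The grading operator `S` commutes with even matrices, anticommutes with odd ones and satisfies
`S² = 1`. Left multiplication by `S` thus acts on `g(-1)_1` and changes the sign of `χ([·,·])`.
Comparing determinants, with `det² = 1` for the operator and a nonzero determinant for the form,
gives `(-1)^r = 1`. -/
theorem GLSuper.even_judgingNumber {B : InvariantForm (GLSuper m n)}
    {t : Sl2Triple (GLSuper m n)} (b : WittBases B t) : Even t.judgingNumber := by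
  let V := ↥(t.grade (-1) ⊓ LieSuperalgebra.parity (g := GLSuper m n) 1)
  let T : V →ₗ[ℂ] V := ((LinearMap.mulLeft ℂ (signMatrix m n)) ∘ₗ Submodule.subtype _).codRestrict _
    fun x => by
      refine ⟨?_, ?_⟩
      · refine t.mem_grade.mpr ?_
        change bracket (t.h : GLSuper m n) (signMatrix m n * (x : GLSuper m n)) = _
        rw [bracket_signMatrix_mul t.h.2 x.2.2, t.mem_grade.mp x.2.1, mul_smul_comm]
        rfl
      · have h := GLSuper.mul_mem m n signMatrix_mem x.2.2
        rwa [zero_add] at h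
  have hT : T ∘ₗ T = LinearMap.id := by
    refine LinearMap.ext fun x => Subtype.ext ?_
    change signMatrix m n * (signMatrix m n * (x : GLSuper m n)) = x
    rw [← mul_assoc, signMatrix_mul_self, one_mul]
  let β : V →ₗ[ℂ] V →ₗ[ℂ] ℂ :=
    ((bracket (g := GLSuper m n)).compr₂ (chi B t)).compl₁₂ (Submodule.subtype _)
      (Submodule.subtype _)
  have hβ : β.compl₁₂ T T = -β := by
    refine LinearMap.ext fun x => LinearMap.ext fun y => ?_
    change chi B t (bracket (signMatrix m n * (x : GLSuper m n))
      (signMatrix m n * (y : GLSuper m n))) = -chi B t (bracket (x : GLSuper m n) (y : GLSuper m n))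
    rw [bracket_signMatrix x.2.2 y.2.2, map_neg]
  have hM : ∀ i k, LinearMap.toMatrix₂ b.v b.v β i k = if k = i.rev then 1 else 0 := fun i k => by
    rw [LinearMap.toMatrix₂_apply]
    change chi B t (bracket (b.v i : GLSuper m n) (b.v k : GLSuper m n)) = _
    rw [b.v_v]
    refine if_congr ?_ rfl rfl
    rw [Fin.ext_iff, Fin.val_rev]; omega
  have hMM : LinearMap.toMatrix₂ b.v b.v β * LinearMap.toMatrix₂ b.v b.v β = 1 := by
    ext i k
    rw [Matrix.mul_apply, Finset.sum_eq_single i.rev (fun x _ hx => by rw [hM, if_neg hx, zero_mul])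
      (fun h => absurd (Finset.mem_univ _) h), hM, hM, if_pos rfl, Fin.rev_rev, one_mul,
      Matrix.one_apply]
    simp only [eq_comm]
  have hdet : (LinearMap.toMatrix₂ b.v b.v β).det ≠ 0 := fun h => by
    have := congrArg Matrix.det hMM
    rw [Matrix.det_mul, h, zero_mul, Matrix.det_one] at this
    exact zero_ne_one this
  have hTT : (LinearMap.toMatrix b.v b.v T).det * (LinearMap.toMatrix b.v b.v T).det = 1 := by
    rw [← Matrix.det_mul, ← LinearMap.toMatrix_comp, hT, LinearMap.toMatrix_id, Matrix.det_one]
  have h1 := congrArg (fun β => (LinearMap.toMatrix₂ b.v b.v β).det) hβ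
  simp only [LinearMap.toMatrix₂_compl₁₂ b.v b.v b.v b.v, map_neg, Matrix.det_mul,
    Matrix.det_transpose, Matrix.det_neg, Fintype.card_fin] at h1
  have h2 : ((-1 : ℂ) ^ t.judgingNumber - 1) * (LinearMap.toMatrix₂ b.v b.v β).det = 0 := by
    linear_combination (LinearMap.toMatrix₂ b.v b.v β).det * hTT - h1
  have h3 := sub_eq_zero.mp ((mul_eq_zero.mp h2).resolve_right hdet)
  by_contra hodd
  rw [(Nat.not_even_iff_odd.mp hodd).neg_one_pow] at h3
  norm_num at h3

end GeneralLinear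

theorem theorem2 :
    (∀ {g : Type*} [AddCommGroup g] [Module ℂ g] [FiniteDimensional ℂ g] [LieSuperalgebra g]
      (B : InvariantForm g) (t : Sl2Triple g) (b : WittBases B t),
      NaturalGradedIso (A := refinedW b) b (refinedW b).val ∧
        (Even t.judgingNumber → NaturalGradedIso b (AlgHom.id ℂ (FiniteW b)))) ∧
    (∀ (m n : ℕ) (B : InvariantForm (GLSuper m n)) (t : Sl2Triple (GLSuper m n))
      (b : WittBases B t),
      Even t.judgingNumber ∧ NaturalGradedIso b (AlgHom.id ℂ (FiniteW b))) := by
  refine ⟨fun B t b => ⟨naturalGradedIso_refinedW b, naturalGradedIso_finiteW b⟩, ?_⟩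
  intro m n B t b
  have hr := GLSuper.even_judgingNumber b
  exact ⟨hr, naturalGradedIso_finiteW b hr⟩
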